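/- Let $S$ be a real-valued $C^\infty$ function on a neighborhood of the origin in $\mathbf R^2$ with Taylor series $\sum s_{ab}x^ay^b$ at the origin, not all $s_{ab}$ zero. Let $N(S)$ be its Newton polygon, the convex hull of the quadrants $\{t_1\ge a,\ t_2\ge b\}$ over all $(a,b)$ with $s_{ab}\ne0$, and let $d=\inf\{t:(t,t)\in N(S)\}$ be the Newton distance. For an edge $e$ of $N(S)$ put $S_e(x,y)=\sum_{(a,b)\in e}s_{ab}x^ay^b$ (if $e$ is an unbounded ray this is used only for $S$ real-analytic, near the axis where it converges). The bisectrix is the line $t_1=t_2$. Assume that the coordinates are superadapted: for each compact edge $e$ meeting the bisectrix, neither $S_e(1,y)$ nor $S_e(-1,y)$ has a real zero $y\neq 0$ of order $\ge d$. Assume $d>1$ (this forces $S(0,0)=0$ and $\nabla S(0,0)=0$). For real-valued $\phi\in C_c^\infty(\mathbf R^2)$ and $\epsilon>0$ put $$I_{S,\phi}(\epsilon)=\int_{\{0<S<\epsilon\}}\phi\,dx\,dy .$$ When we speak of asymptotic expansions we mean expansions as $\epsilon\to0^+$ $$I_{S,\phi}\sim\sum_{j\ge0}\bigl(c_j(\phi)\epsilon^{r_j}+c_j'(\phi)\ln(\epsilon)\epsilon^{r_j}\bigr),\qquad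 I_{-S,\phi}\sim\sum_{j\ge0}\bigl(C_j(\phi)\epsilon^{r_j}+C_j'(\phi)\ln(\epsilon)\epsilon^{r_j}\bigr),$$ valid for all $\phi$ supported in some fixed neighborhood of the origin, where $(r_j)$ is an increasing arithmetic progression of positive rationals independent of $\phi$, normalized so that in every sufficiently small neighborhood of the origin some $\phi$ supported there has one of $c_0(\phi),c_0'(\phi),C_0(\phi),C_0'(\phi)$ nonzero. (Such expansions exist if $S$ is real-analytic; their existence is not part of the claim.) **Theorem 1.1.** The leading exponent is $1/d$. That is: for all $\phi$ supported in a sufficiently small neighborhood of the origin, $I_{S,\phi}(\epsilon)$ and $I_{-S,\phi}(\epsilon)$ are $O(\epsilon^r)$ for every $r<1/d$, while for every $r>1/d$ and every neighborhood $W$ of the origin there is a $\phi$ supported in $W$ for which they are not both $O(\epsilon^r)$; and $r_0=1/d$ whenever there are expansions as above. Moreover there is a neighborhood $U$ of the origin such that for all $\phi$ supported in $U$ the following hold (limits as $\epsilon\to0^+$; the statements on $c_0,c_0'$ hold whenever there are expansions as above that are valid for $\phi$). (a) Suppose the bisectrix meets the interior of a compact edge $e_0$ of $N(S)$, of slope $-1/m$.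 Let $S_0=S_{e_0}$, and let $S_0^+(x,y)^{-1/d}$ be $S_0(x,y)^{-1/d}$ if $S_0(x,y)>0$ and $0$ otherwise. Then $S_0^+(1,y)^{-1/d}$ and $S_0^+(-1,y)^{-1/d}$ are integrable in $y$ and $$\lim\frac{I_{S,\phi}(\epsilon)}{\epsilon^{1/d}}=(m+1)^{-1}\phi(0,0)\int_{-\infty}^\infty\bigl(S_0^+(1,y)^{-1/d}+S_0^+(-1,y)^{-1/d}\bigr)dy .$$ Moreover $c_0'(\phi)=0$ and $c_0(\phi)$ is equal to this limit. (b) Suppose the bisectrix meets $N(S)$ at a vertex $(d,d)$; then $d$ is an integer and $s_{dd}\ne0$. Let $-\infty\le s_2<s_1\le0$ be the slopes of the two edges (bounded or not) that meet at $(d,d)$. Then $$\lim\frac{I_{S,\phi}(\epsilon)}{\epsilon^{1/d}\ln\epsilon}=\frac1d\,\eta(S)\,|s_{dd}|^{-1/d}\,\phi(0,0)\Bigl(\frac1{s_1-1}-\frac1{s_2-1}\Bigr),$$ where $\frac1{s_2-1}=0$ if $s_2=-\infty$, and $\eta(S)=4$ if $d$ is even and $s_{dd}>0$, $\eta(S)=0$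 if $d$ is even and $s_{dd}<0$, $\eta(S)=2$ if $d$ is odd. Moreover $c_0'(\phi)$ is equal to this limit. (c) Suppose $S$ is real-analytic near the origin and the bisectrix meets the interior of the horizontal ray $e$ of $N(S)$. Then $d$ is an integer and $S_e(x,y)=a(x)y^d$ with $a$ real-analytic near $0$. Let $\alpha(x)$ be the one-dimensional measure of $\{y:0\le a(x)y^d\le1\}$; in particular $\alpha(x)=|a(x)|^{-1/d}$ if $d$ is odd and $a(x)\ne0$. Then $\alpha(x)\phi(x,0)$ is integrable, $$\lim\frac{I_{S,\phi}(\epsilon)}{\epsilon^{1/d}}=\int_{-\infty}^\infty\alpha(x)\phi(x,0)\,dx ,$$ and $c_0'(\phi)=0$, $c_0(\phi)=\int_{-\infty}^\infty\alpha(x)\phi(x,0)\,dx$. If the bisectrix meets the interior of the vertical ray, the same holds with the roles of $x$ and $y$ exchanged. -/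

import Mathlib

open Filter Topology MeasureTheory Asymptotics
open scoped ContDiff

noncomputable section

/-- `sublevelIntegral S φ ε` is the integral of `φ` over `{0 < S < ε}`. -/
def sublevelIntegral (S φ : ℝ × ℝ → ℝ) (ε : ℝ) : ℝ :=
  ∫ p in {p : ℝ × ℝ | 0 < S p ∧ S p < ε}, φ p

/-- Real-valued smooth functions with compact support contained in `U`. -/
def IsTestFunction (U : Set (ℝ × ℝ)) (φ : ℝ × ℝ → ℝ) : Prop :=
  ContDiff ℝ ∞ φ ∧ HasCompactSupport φ ∧ tsupport φ ⊆ U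

/-- The coefficient of `x ^ a * y ^ b` in the Taylor expansion of `S` at the origin. -/
def taylorCoeff (S : ℝ × ℝ → ℝ) (a b : ℕ) : ℝ :=
  iteratedDeriv a (fun x => iteratedDeriv b (fun y => S (x, y)) 0) 0 /
    ((a.factorial : ℝ) * (b.factorial : ℝ))

/-- The Newton polygon: convex hull of the quadrants with corner `(a, b)`, for all `(a, b)` whose
Taylor coefficient does not vanish. -/
def newtonPolygon (S : ℝ × ℝ → ℝ) : Set (ℝ × ℝ) :=
  convexHull ℝ {t : ℝ × ℝ | ∃ a b : ℕ, taylorCoeff S a b ≠ 0 ∧ (a : ℝ) ≤ t.1 ∧ (b : ℝ) ≤ t.2}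

/-- The Newton distance. -/
def newtonDist (S : ℝ × ℝ → ℝ) : ℝ :=
  sInf {t : ℝ | ((t, t) : ℝ × ℝ) ∈ newtonPolygon S}

/-- The face of the Newton polygon on which `u * t₁ + v * t₂` is minimal. -/
def newtonFace (S : ℝ × ℝ → ℝ) (u v : ℝ) : Set (ℝ × ℝ) :=
  {t | t ∈ newtonPolygon S ∧ ∀ t' ∈ newtonPolygon S, u * t.1 + v * t.2 ≤ u * t'.1 + v * t'.2}

/-- `e` is a compact edge of the Newton polygon, of slope `-1 / m`; it lies on a line
`t₁ + m * t₂ = α`. -/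
def IsCompactEdge (S : ℝ × ℝ → ℝ) (m : ℝ) (e : Set (ℝ × ℝ)) : Prop :=
  0 < m ∧ e = newtonFace S 1 m ∧ e.Nontrivial

/-- The unbounded horizontal edge of the Newton polygon. -/
def horizontalRay (S : ℝ × ℝ → ℝ) : Set (ℝ × ℝ) := newtonFace S 0 1

/-- The unbounded vertical edge of the Newton polygon. -/
def verticalRay (S : ℝ × ℝ → ℝ) : Set (ℝ × ℝ) := newtonFace S 1 0

/-- `e` is an edge, bounded or not, of slope `s`, where `s = ⊥` means that `e` is vertical. -/
def IsEdgeOfSlope (S : ℝ × ℝ → ℝ) (s : EReal) (e : Set (ℝ × ℝ)) : Prop :=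
  (s = ⊥ ∧ e = verticalRay S) ∨
  (∃ m : ℝ, s = ((-1 / m : ℝ) : EReal) ∧ IsCompactEdge S m e) ∨
  (s = 0 ∧ e = horizontalRay S)

/-- The bisectrix meets the (relative) interior of the edge `e`. -/
def BisectrixMeetsInterior (e : Set (ℝ × ℝ)) : Prop :=
  ∃ t : ℝ, ∃ p ∈ e, ∃ q ∈ e, p ≠ q ∧ ((t, t) : ℝ × ℝ) ∈ openSegment ℝ p q

/-- The term of the Taylor series of `S` with exponents `p` if `p` lies on `e`, and `0` otherwise. -/
def edgeTerm (S : ℝ × ℝ → ℝ) (e : Set (ℝ × ℝ)) (x y : ℝ) : ℕ × ℕ → ℝ :=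
  Set.indicator {p : ℕ × ℕ | (((p.1 : ℝ), (p.2 : ℝ)) : ℝ × ℝ) ∈ e}
    (fun p => taylorCoeff S p.1 p.2 * x ^ p.1 * y ^ p.2)

/-- `S_e(x, y)`: the sum of the terms of the Taylor series of `S` with exponents on `e`. For a
compact edge only finitely many terms are non-zero. -/
def edgeFun (S : ℝ × ℝ → ℝ) (e : Set (ℝ × ℝ)) (x y : ℝ) : ℝ :=
  ∑' p : ℕ × ℕ, edgeTerm S e x y p

/-- Superadapted coordinates: for each compact edge `e` meeting the bisectrix, every zero
`y ≠ 0` of `S_e(1, y)` or `S_e(-1, y)` has order less than the Newton distance. -/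
def IsSuperadapted (S : ℝ × ℝ → ℝ) : Prop :=
  ∀ (m : ℝ) (e : Set (ℝ × ℝ)), IsCompactEdge S m e → (∃ t : ℝ, ((t, t) : ℝ × ℝ) ∈ e) →
    ∀ σ : ℝ, (σ = 1 ∨ σ = -1) → ∀ y : ℝ, y ≠ 0 → ∀ k : ℕ,
      (k : ℕ∞) ≤ analyticOrderAt (fun z => edgeFun S e σ z) y → (k : ℝ) < newtonDist S

/-- `s ^ (-1 / d)` where `s > 0`, and `0` elsewhere. -/
def posPow (d s : ℝ) : ℝ := if 0 < s then s ^ (-1 / d) else 0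

/-- The factor `η`, for the vertex `(n, n)` with Taylor coefficient `s ≠ 0`. -/
def etaFactor (n : ℕ) (s : ℝ) : ℝ := if Even n then (if 0 < s then 4 else 0) else 2

/-- `ρ` is the leading exponent in the following sense, which needs no asymptotic expansion:
for test functions with small support, both `I_{S,φ}(ε)` and `I_{-S,φ}(ε)` are `O(ε ^ r)` for each
`r < ρ`, and for no `r > ρ` does this hold for all test functions with support in some
neighborhood of the origin. -/
def HasLeadingExponent (S : ℝ × ℝ → ℝ) (ρ : ℝ) : Prop :=
  (∃ U ∈ 𝓝 (0 : ℝ × ℝ), ∀ φ, IsTestFunction U φ → ∀ r < ρ,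
    sublevelIntegral S φ =O[𝓝[>] 0] (fun ε : ℝ => ε ^ r) ∧
    sublevelIntegral (-S) φ =O[𝓝[>] 0] (fun ε : ℝ => ε ^ r)) ∧
  (∀ r > ρ, ∀ U ∈ 𝓝 (0 : ℝ × ℝ), ∃ φ, IsTestFunction U φ ∧
    ¬ (sublevelIntegral S φ =O[𝓝[>] 0] (fun ε : ℝ => ε ^ r) ∧
       sublevelIntegral (-S) φ =O[𝓝[>] 0] (fun ε : ℝ => ε ^ r)))

/-- The asymptotic expansion `F(ε) ∼ ∑ j, (c j * ε ^ r j + c' j * log ε * ε ^ r j)` as `ε → 0+`. -/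
def HasLogExpansion (F : ℝ → ℝ) (r c c' : ℕ → ℝ) : Prop :=
  ∀ N : ℕ, (fun ε : ℝ => F ε - ∑ j ∈ Finset.range (N + 1),
      (c j * ε ^ r j + c' j * Real.log ε * ε ^ r j)) =o[𝓝[>] 0] (fun ε : ℝ => ε ^ r N)

/-- The expansions of `I_{S,φ}` (coefficients `c φ j`, `c' φ j`) and `I_{-S,φ}` (coefficients
`C φ j`, `C' φ j`) for all test functions `φ` supported in the neighborhood `W` of the origin. The
exponents form an increasing arithmetic progression of positive rationals independent of `φ`,
and `r 0` is really present: in every smaller neighborhood some test function has a non-zero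
coefficient of index `0`. -/
structure IsSublevelExpansion (S : ℝ × ℝ → ℝ) (W : Set (ℝ × ℝ)) (r : ℕ → ℝ)
    (c c' C C' : (ℝ × ℝ → ℝ) → ℕ → ℝ) : Prop where
  mem_nhds : W ∈ 𝓝 (0 : ℝ × ℝ)
  progression : ∃ a b : ℚ, 0 < a ∧ 0 < b ∧ ∀ j : ℕ, r j = (a : ℝ) + (b : ℝ) * (j : ℝ)
  expansion : ∀ φ, IsTestFunction W φ →
    HasLogExpansion (sublevelIntegral S φ) r (c φ) (c' φ) ∧
    HasLogExpansion (sublevelIntegral (-S) φ) r (C φ) (C' φ)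
  leading : ∀ W' ∈ 𝓝 (0 : ℝ × ℝ), W' ⊆ W → ∃ φ, IsTestFunction W' φ ∧
    (c φ 0 ≠ 0 ∨ c' φ 0 ≠ 0 ∨ C φ 0 ≠ 0 ∨ C' φ 0 ≠ 0)

/-- The coefficient in the case of a compact edge `e` of slope `-1 / m`. -/
def edgeCoeff (S : ℝ × ℝ → ℝ) (m : ℝ) (e : Set (ℝ × ℝ)) (φ : ℝ × ℝ → ℝ) : ℝ :=
  (m + 1)⁻¹ * φ (0, 0) *
    ∫ y : ℝ, (posPow (newtonDist S) (edgeFun S e 1 y) + posPow (newtonDist S) (edgeFun S e (-1) y))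

/-- The coefficient in the case of a vertex `(n, n)` at which edges of slopes `s₁` and `s₂` meet;
`1 / (s₂ - 1)` is `0` if `s₂ = -∞`. -/
def vertexCoeff (S : ℝ × ℝ → ℝ) (n : ℕ) (s₁ s₂ : EReal) (φ : ℝ × ℝ → ℝ) : ℝ :=
  (1 / (n : ℝ)) * etaFactor n (taylorCoeff S n n) * |taylorCoeff S n n| ^ (-1 / (n : ℝ)) *
    φ (0, 0) * ((s₁ - 1)⁻¹ - (s₂ - 1)⁻¹).toReal

/-- The one-dimensional measure of `{t | 0 ≤ a * t ^ n ≤ 1}`. -/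
def slabMeasure (n : ℕ) (a : ℝ) : ℝ := volume.real {t : ℝ | 0 ≤ a * t ^ n ∧ a * t ^ n ≤ 1}

end

/-! The axes and the curves |y| = |x|^κ cut the plane into eight cusps. Reflections and the exchange
of the coordinates turn each of them into {0 < y < x^κ} or {0 < y < x^(1/κ)}, up to null sets. For
an edge or a vertex, (1, κ) are the weights of a supporting line of the Newton polygon through (d,
d). For a ray κ is chosen so large that the cusp along the axis lies where a fixed y-derivative is
bounded below. Inside a cusp the sublevel set is studied on the slices x = const.

Uniform bounds. A sublevel set in one variable is small as soon as some derivative is large. For y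
between x^M and x^κ, the quantities y^k ∂_y^k S with k < K cannot all be small compared with the sum
of the monomials x^a y^b of the polygon. Otherwise the normalized monomials would converge, along a
sequence of counterexamples, to those of a single face, and the polynomial of this face would have a
positive zero of order at least K (`exists_face_of_tendsto`, `exists_newton_bounds`).
Superadaptedness excludes this when K ≥ d. On a face whose line passes strictly below (d, d) all
exponents of y are less than d, so the degree bounds the order; on a face whose line contains (d, d)
the hypothesis applies (`faceNondegenerate_of_isSuperadapted` and its swapped form, where a transfer
between the two variables is needed). Hence for every exponent (A, B) present, the part of the slice
in [a, 2 a] has measure at most a constant times a (ε / (x^A a^B))^(1/q), with an exponent q that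
may be taken less than d. Geometric series give bounds for whole slices; very close to the axis the
derivative of the order of the lowest row is used instead.

Limits. At a compact edge one substitutes x = δ u, y = δ^m w, ε = δ^(d (1 + m)). Then S / ε tends to
the edge polynomial, and the slices are dominated by an integrable power of u because q < d
(`tendsto_cuspIntegral_edge`). The eight limits add up to φ(0, 0) times the area of {0 < S_0 < 1},
which quasi-homogeneity turns into the integral in the theorem.

At a vertex (n, n) one substitutes x = ε^τ. A slice has length about ε^(1/n) / x as long as the
point (x, ε^(1/n) / x) lies where the monomial of the vertex dominates, and is negligible below that
region. Since dx / x = -log ε dτ up to orientation, the length of the interval of admissible τ gives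
the coefficient of the logarithm, and this length is a function of the two slopes
(`tendsto_cuspIntegral_vertex`).

On a ray, analyticity makes S divisible by y^n. The slices are dominated by x^(-A/n) with A < n, and
the four cusps along the other axis contribute o(ε^(1/n)) (`tendsto_sublevelIntegral_ray`).

That 1/d cannot be improved follows from weights u, v of sum close to 1/d: on the box |x| < ε^u, |y|
< ε^v one has |S| < C ε, while the zeros of S are a null set near the origin. Leading terms of an
expansion are unique, so the limits determine the coefficients. All data depend only on S near the
origin, so S may be replaced by a globally smooth function. -/

/-! ### Partial derivatives and Taylor coefficients, with their symmetries -/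

/-- The partial derivative in the second variable. -/
noncomputable def dY (f : ℝ × ℝ → ℝ) : ℝ × ℝ → ℝ := fun p => fderiv ℝ f p (0, 1)

/-- The partial derivative in the first variable. -/
noncomputable def dX (f : ℝ × ℝ → ℝ) : ℝ × ℝ → ℝ := fun p => fderiv ℝ f p (1, 0)

theorem contDiff_dY {f : ℝ × ℝ → ℝ} (hf : ContDiff ℝ ∞ f) : ContDiff ℝ ∞ (dY f) :=
  (hf.fderiv_right (m := ∞) (by simp)).clm_apply contDiff_const

theorem contDiff_dX {f : ℝ × ℝ → ℝ} (hf : ContDiff ℝ ∞ f) : ContDiff ℝ ∞ (dX f) :=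
  (hf.fderiv_right (m := ∞) (by simp)).clm_apply contDiff_const

theorem contDiff_iterate_dY {f : ℝ × ℝ → ℝ} (hf : ContDiff ℝ ∞ f) (k : ℕ) :
    ContDiff ℝ ∞ (dY^[k] f) := by
  induction k with
  | zero => exact hf
  | succ k ih => rw [Function.iterate_succ_apply']; exact contDiff_dY ih

theorem contDiff_iterate_dX {f : ℝ × ℝ → ℝ} (hf : ContDiff ℝ ∞ f) (k : ℕ) :
    ContDiff ℝ ∞ (dX^[k] f) := by
  induction k with
  | zero => exact hf
  | succ k ih => rw [Function.iterate_succ_apply']; exact contDiff_dX ih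

theorem hasDerivAt_dY {f : ℝ × ℝ → ℝ} (hf : ContDiff ℝ ∞ f) (x y : ℝ) :
    HasDerivAt (fun z => f (x, z)) (dY f (x, y)) y := by
  have h := ((hf.differentiable (by simp)) (x, y)).hasFDerivAt
  exact h.comp_hasDerivAt y ((hasDerivAt_const y x).prodMk (hasDerivAt_id y))

theorem hasDerivAt_dX {f : ℝ × ℝ → ℝ} (hf : ContDiff ℝ ∞ f) (x y : ℝ) :
    HasDerivAt (fun z => f (z, y)) (dX f (x, y)) x := by
  have h := ((hf.differentiable (by simp)) (x, y)).hasFDerivAt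
  exact h.comp_hasDerivAt x ((hasDerivAt_id x).prodMk (hasDerivAt_const x y))

theorem iteratedDeriv_snd {f : ℝ × ℝ → ℝ} (hf : ContDiff ℝ ∞ f) (k : ℕ) (x : ℝ) :
    iteratedDeriv k (fun z => f (x, z)) = fun y => (dY^[k] f) (x, y) := by
  induction k with
  | zero => simp
  | succ k ih =>
    rw [iteratedDeriv_succ, ih]
    funext y
    rw [Function.iterate_succ_apply']
    exact (hasDerivAt_dY (contDiff_iterate_dY hf k) x y).deriv

theorem iteratedDeriv_fst {f : ℝ × ℝ → ℝ} (hf : ContDiff ℝ ∞ f) (k : ℕ) (y : ℝ) :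
    iteratedDeriv k (fun z => f (z, y)) = fun x => (dX^[k] f) (x, y) := by
  induction k with
  | zero => simp
  | succ k ih =>
    rw [iteratedDeriv_succ, ih]
    funext x
    rw [Function.iterate_succ_apply']
    exact (hasDerivAt_dX (contDiff_iterate_dX hf k) x y).deriv

theorem taylorCoeff_eq {S : ℝ × ℝ → ℝ} (hS : ContDiff ℝ ∞ S) (a b : ℕ) :
    taylorCoeff S a b = (dX^[a] (dY^[b] S)) (0, 0) / ((a.factorial : ℝ) * (b.factorial : ℝ)) := by
  unfold taylorCoeff
  have h : (fun x => iteratedDeriv b (fun y => S (x, y)) 0) = fun x => (dY^[b] S) (x, 0) := by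
    funext x; rw [iteratedDeriv_snd hS]
  rw [h, iteratedDeriv_fst (contDiff_iterate_dY hS b)]

theorem dX_dY_comm {f : ℝ × ℝ → ℝ} (hf : ContDiff ℝ ∞ f) : dX (dY f) = dY (dX f) := by
  funext p
  have hd : DifferentiableAt ℝ (fderiv ℝ f) p :=
    ((hf.fderiv_right (m := ∞) (by simp)).differentiable (by simp)) p
  have hsym : IsSymmSndFDerivAt ℝ f p := ((contDiff_infty.1 hf 2).contDiffAt).isSymmSndFDerivAt (by simp)
  have e1 : dX (dY f) p = fderiv ℝ (fderiv ℝ f) p (1, 0) (0, 1) := by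
    unfold dX dY
    rw [fderiv_clm_apply hd (differentiableAt_const _)]
    simp
  have e2 : dY (dX f) p = fderiv ℝ (fderiv ℝ f) p (0, 1) (1, 0) := by
    unfold dX dY
    rw [fderiv_clm_apply hd (differentiableAt_const _)]
    simp
  rw [e1, e2, hsym.eq]

theorem dX_iterate_dY_comm {f : ℝ × ℝ → ℝ} (hf : ContDiff ℝ ∞ f) (b : ℕ) :
    dX (dY^[b] f) = dY^[b] (dX f) := by
  induction b generalizing f with
  | zero => rfl
  | succ b ih =>
    rw [Function.iterate_succ_apply, ih (contDiff_dY hf), dX_dY_comm hf,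
      Function.iterate_succ_apply]

theorem iterate_dX_iterate_dY_comm {f : ℝ × ℝ → ℝ} (hf : ContDiff ℝ ∞ f) (a b : ℕ) :
    dX^[a] (dY^[b] f) = dY^[b] (dX^[a] f) := by
  induction a generalizing f with
  | zero => rfl
  | succ a ih =>
    rw [Function.iterate_succ_apply, dX_iterate_dY_comm hf, ih (contDiff_dX hf),
      Function.iterate_succ_apply]

theorem contDiff_comp_swap {f : ℝ × ℝ → ℝ} (hf : ContDiff ℝ ∞ f) :
    ContDiff ℝ ∞ (f ∘ Prod.swap) :=
  hf.comp (contDiff_snd.prodMk contDiff_fst)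

theorem dY_comp_swap {f : ℝ × ℝ → ℝ} (hf : ContDiff ℝ ∞ f) :
    dY (f ∘ Prod.swap) = dX f ∘ Prod.swap := by
  funext ⟨x, y⟩
  exact (hasDerivAt_dY (contDiff_comp_swap hf) x y).unique (hasDerivAt_dX hf y x)

theorem dX_comp_swap {f : ℝ × ℝ → ℝ} (hf : ContDiff ℝ ∞ f) :
    dX (f ∘ Prod.swap) = dY f ∘ Prod.swap := by
  funext ⟨x, y⟩
  exact (hasDerivAt_dX (contDiff_comp_swap hf) x y).unique (hasDerivAt_dY hf y x)

theorem iterate_dY_comp_swap {f : ℝ × ℝ → ℝ} (hf : ContDiff ℝ ∞ f) (k : ℕ) :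
    dY^[k] (f ∘ Prod.swap) = dX^[k] f ∘ Prod.swap := by
  induction k generalizing f with
  | zero => rfl
  | succ k ih =>
    rw [Function.iterate_succ_apply, dY_comp_swap hf, ih (contDiff_dX hf),
      Function.iterate_succ_apply]

theorem iterate_dX_comp_swap {f : ℝ × ℝ → ℝ} (hf : ContDiff ℝ ∞ f) (k : ℕ) :
    dX^[k] (f ∘ Prod.swap) = dY^[k] f ∘ Prod.swap := by
  induction k generalizing f with
  | zero => rfl
  | succ k ih =>
    rw [Function.iterate_succ_apply, dX_comp_swap hf, ih (contDiff_dY hf),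
      Function.iterate_succ_apply]

theorem taylorCoeff_comp_swap {S : ℝ × ℝ → ℝ} (hS : ContDiff ℝ ∞ S) (a b : ℕ) :
    taylorCoeff (S ∘ Prod.swap) a b = taylorCoeff S b a := by
  rw [taylorCoeff_eq (contDiff_comp_swap hS), taylorCoeff_eq hS, iterate_dY_comp_swap hS,
    iterate_dX_comp_swap (contDiff_iterate_dX hS b), iterate_dX_iterate_dY_comm hS b a, mul_comm]
  rfl

theorem taylorCoeff_neg (S : ℝ × ℝ → ℝ) (a b : ℕ) :
    taylorCoeff (-S) a b = -taylorCoeff S a b := by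
  unfold taylorCoeff
  simp only [Pi.neg_apply, iteratedDeriv_fun_neg]
  ring

/-- Reflection (or scaling) of the coordinates. -/
def reflect (σ τ : ℝ) (S : ℝ × ℝ → ℝ) : ℝ × ℝ → ℝ := fun p => S (σ * p.1, τ * p.2)

theorem contDiff_reflect {S : ℝ × ℝ → ℝ} (hS : ContDiff ℝ ∞ S) (σ τ : ℝ) :
    ContDiff ℝ ∞ (reflect σ τ S) :=
  hS.comp ((contDiff_const.mul contDiff_fst).prodMk (contDiff_const.mul contDiff_snd))

theorem taylorCoeff_reflect {S : ℝ × ℝ → ℝ} (hS : ContDiff ℝ ∞ S) (σ τ : ℝ) (a b : ℕ) :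
    taylorCoeff (reflect σ τ S) a b = σ ^ a * τ ^ b * taylorCoeff S a b := by
  unfold taylorCoeff reflect
  have h1 (x : ℝ) : iteratedDeriv b (fun y => S (σ * x, τ * y)) 0
      = τ ^ b * (dY^[b] S) (σ * x, 0) := by
    have hc : ContDiff ℝ b (fun y => S (σ * x, y)) :=
      (hS.comp (contDiff_const.prodMk contDiff_id)).of_le (by exact_mod_cast le_top)
    have := congrFun (iteratedDeriv_comp_const_mul hc τ) 0
    rw [this, iteratedDeriv_snd hS]
    simp
  have h2 : iteratedDeriv a (fun x => (dY^[b] S) (σ * x, 0)) 0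
      = σ ^ a * (dX^[a] (dY^[b] S)) (0, 0) := by
    have hc : ContDiff ℝ a (fun x => (dY^[b] S) (x, 0)) :=
      ((contDiff_iterate_dY hS b).comp (contDiff_id.prodMk contDiff_const)).of_le
        (by exact_mod_cast le_top)
    have := congrFun (iteratedDeriv_comp_const_mul hc σ) 0
    rw [this, iteratedDeriv_fst (contDiff_iterate_dY hS b)]
    simp
  simp only [h1]
  rw [iteratedDeriv_const_mul_field, h2]
  have h3 := taylorCoeff_eq hS a b
  unfold taylorCoeff at h3
  rw [h3]
  ring

theorem taylorCoeff_congr {S T : ℝ × ℝ → ℝ} (h : S =ᶠ[𝓝 0] T) (a b : ℕ) :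
    taylorCoeff S a b = taylorCoeff T a b := by
  unfold taylorCoeff
  congr 1
  apply Filter.EventuallyEq.iteratedDeriv_eq
  have h' : ∀ᶠ p in 𝓝 ((0, 0) : ℝ × ℝ), ∀ᶠ q in 𝓝 p, S q = T q := h.eventually_nhds
  have hc : Tendsto (fun x : ℝ => ((x, 0) : ℝ × ℝ)) (𝓝 0) (𝓝 (0, 0)) :=
    (Continuous.prodMk_left (0 : ℝ)).tendsto' 0 _ rfl
  filter_upwards [hc.eventually h'] with x hx
  apply Filter.EventuallyEq.iteratedDeriv_eq
  have hc2 : Tendsto (fun y : ℝ => ((x, y) : ℝ × ℝ)) (𝓝 0) (𝓝 (x, 0)) :=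
    (Continuous.prodMk_right x).tendsto' 0 _ rfl
  exact hc2.eventually hx

/-! ### Taylor remainder bounds near the origin -/

/-- Induction on the order: the remainder of f vanishes at 0 and its derivative is the remainder of
f', so the mean value inequality on [-|y|, |y|] gains one factor |y|. The factorial is given away,
and both signs of y are treated at once. -/
theorem taylor_bound_symm (N : ℕ) {f : ℝ → ℝ} (hf : ContDiff ℝ ∞ f) {r C : ℝ}
    (hC : ∀ y, |y| ≤ r → |iteratedDeriv N f y| ≤ C) :
    ∀ y, |y| ≤ r → |f y - ∑ b ∈ Finset.range N, iteratedDeriv b f 0 / (b.factorial : ℝ) * y ^ b|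
      ≤ C * |y| ^ N := by
  induction N generalizing f with
  | zero => intro y hy; simpa using hC y hy
  | succ N ih =>
    intro y hy
    have hf' : ContDiff ℝ ∞ (deriv f) := ((contDiff_infty_iff_deriv).1 hf).2
    have ih' := ih hf' (fun z hz => by
      rw [← iteratedDeriv_succ']; exact hC z hz)
    have hCn : 0 ≤ C := (abs_nonneg _).trans (hC y hy)
    set g : ℝ → ℝ := fun y => f y - ∑ b ∈ Finset.range (N + 1),
      iteratedDeriv b f 0 / (b.factorial : ℝ) * y ^ b with hg
    have hg0 : g 0 = 0 := by
      simp [hg, Finset.sum_range_succ']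
    have hgd : ∀ z, HasDerivAt g (deriv f z - ∑ b ∈ Finset.range N,
        iteratedDeriv b (deriv f) 0 / (b.factorial : ℝ) * z ^ b) z := by
      intro z
      refine ((hf.differentiable (by simp)) z).hasDerivAt.sub ?_
      have : ∑ b ∈ Finset.range N, iteratedDeriv b (deriv f) 0 / (b.factorial : ℝ) * z ^ b
          = ∑ b ∈ Finset.range (N + 1),
            iteratedDeriv b f 0 / (b.factorial : ℝ) * ((b : ℝ) * z ^ (b - 1)) := by
        rw [Finset.sum_range_succ']
        simp only [Nat.cast_zero, zero_mul, mul_zero, add_zero]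
        refine Finset.sum_congr rfl fun b _ => ?_
        rw [iteratedDeriv_succ', Nat.factorial_succ]
        have h1 : (b.factorial : ℝ) ≠ 0 := by positivity
        have h2 : ((b : ℝ) + 1) ≠ 0 := by positivity
        push_cast
        field_simp
      rw [this]
      exact HasDerivAt.fun_sum fun b _ => (hasDerivAt_pow b z).const_mul _
    have key := (convex_Icc (-|y|) |y|).norm_image_sub_le_of_norm_hasDerivWithin_le
      (f := g) (C := C * |y| ^ N) (x := 0) (y := y)
      (fun z _ => (hgd z).hasDerivWithinAt) (fun z hz => by
        have hz' : |z| ≤ |y| := abs_le.2 hz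
        rw [Real.norm_eq_abs]
        exact (ih' z (hz'.trans hy)).trans (by gcongr))
      (by constructor <;> simp) (by exact abs_le.1 le_rfl)
    rw [hg0, sub_zero, sub_zero, Real.norm_eq_abs, Real.norm_eq_abs] at key
    calc |g y| ≤ _ := key
      _ = _ := by ring

theorem exists_bound_of_continuous {f : ℝ × ℝ → ℝ} (hf : Continuous f) (r : ℝ) :
    ∃ C, 0 ≤ C ∧ ∀ x y, |x| ≤ r → |y| ≤ r → |f (x, y)| ≤ C := by
  obtain ⟨C, hC⟩ := ((isCompact_Icc (a := -r) (b := r)).prod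
    (isCompact_Icc (a := -r) (b := r))).exists_bound_of_continuousOn hf.continuousOn
  refine ⟨max C 0, le_max_right _ _, fun x y hx hy => ?_⟩
  exact (hC (x, y) ⟨abs_le.1 hx, abs_le.1 hy⟩).trans (le_max_left _ _)

/-- Expansion in y with coefficients depending on x, then expansion of each coefficient in x.
Truncating to a square of exponents rather than a triangle keeps the two expansions independent; the
error is still of order N. -/
theorem taylor_bound_box {f : ℝ × ℝ → ℝ} (hf : ContDiff ℝ ∞ f) (N : ℕ) :
    ∃ C, 0 ≤ C ∧ ∀ x y, |x| ≤ 1 → |y| ≤ 1 →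
      |f (x, y) - ∑ a ∈ Finset.range N, ∑ b ∈ Finset.range N, taylorCoeff f a b * x ^ a * y ^ b|
        ≤ C * max |x| |y| ^ N := by
  obtain ⟨C, hC0, hC⟩ := exists_bound_of_continuous (contDiff_iterate_dY hf N).continuous 1
  have hD : ∀ b : ℕ, ∃ D, 0 ≤ D ∧ ∀ x y, |x| ≤ 1 → |y| ≤ 1 →
      |(dX^[N] (dY^[b] f)) (x, y)| ≤ D := fun b =>
    exists_bound_of_continuous (contDiff_iterate_dX (contDiff_iterate_dY hf b) N).continuous 1
  choose D hD0 hD using hD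
  refine ⟨C + ∑ b ∈ Finset.range N, D b, by
    have := Finset.sum_nonneg (s := Finset.range N) (fun b _ => hD0 b); positivity, ?_⟩
  intro x y hx hy
  have hm0 : 0 ≤ max |x| |y| := (abs_nonneg x).trans (le_max_left _ _)
  have h1 : |f (x, y) - ∑ b ∈ Finset.range N, (dY^[b] f) (x, 0) / (b.factorial : ℝ) * y ^ b|
      ≤ C * max |x| |y| ^ N := by
    have := taylor_bound_symm N (f := fun z => f (x, z)) (r := 1) (C := C)
      (hf.comp (contDiff_const.prodMk contDiff_id)) (fun z hz => by
        rw [iteratedDeriv_snd hf]; exact hC x z hx hz) y hy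
    simp only [iteratedDeriv_snd hf] at this
    exact this.trans (by gcongr; exact le_max_right _ _)
  have h2 : ∀ b, |(dY^[b] f) (x, 0) / (b.factorial : ℝ)
      - ∑ a ∈ Finset.range N, taylorCoeff f a b * x ^ a| ≤ D b * max |x| |y| ^ N := by
    intro b
    have hb := contDiff_iterate_dY hf b
    have := taylor_bound_symm N (f := fun z => (dY^[b] f) (z, 0)) (r := 1) (C := D b)
      (hb.comp (contDiff_id.prodMk contDiff_const)) (fun z hz => by
        rw [iteratedDeriv_fst hb]; exact hD b z 0 hz (by simp)) x hx
    simp only [iteratedDeriv_fst hb] at this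
    have hfac : (1 : ℝ) ≤ (b.factorial : ℝ) := by exact_mod_cast Nat.one_le_iff_ne_zero.2 (Nat.factorial_ne_zero b)
    have e : (dY^[b] f) (x, 0) / (b.factorial : ℝ) - ∑ a ∈ Finset.range N, taylorCoeff f a b * x ^ a
        = ((dY^[b] f) (x, 0) - ∑ a ∈ Finset.range N,
            (dX^[a] (dY^[b] f)) (0, 0) / (a.factorial : ℝ) * x ^ a) / (b.factorial : ℝ) := by
      rw [sub_div, Finset.sum_div]
      congr 1
      refine Finset.sum_congr rfl fun a _ => ?_
      rw [taylorCoeff_eq hf]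
      field_simp
    rw [e, abs_div, Nat.abs_cast]
    refine (div_le_self (abs_nonneg _) hfac).trans (this.trans ?_)
    have := hD0 b
    gcongr
    exact le_max_left _ _
  have e : f (x, y) - ∑ a ∈ Finset.range N, ∑ b ∈ Finset.range N, taylorCoeff f a b * x ^ a * y ^ b
      = (f (x, y) - ∑ b ∈ Finset.range N, (dY^[b] f) (x, 0) / (b.factorial : ℝ) * y ^ b)
        + ∑ b ∈ Finset.range N, ((dY^[b] f) (x, 0) / (b.factorial : ℝ)
          - ∑ a ∈ Finset.range N, taylorCoeff f a b * x ^ a) * y ^ b := by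
    rw [Finset.sum_comm]
    simp only [sub_mul, Finset.sum_sub_distrib, Finset.sum_mul]
    ring
  rw [e]
  refine (abs_add_le _ _).trans ?_
  rw [add_mul, Finset.sum_mul]
  refine add_le_add h1 ((Finset.abs_sum_le_sum_abs _ _).trans (Finset.sum_le_sum fun b _ => ?_))
  rw [abs_mul, abs_pow]
  calc _ ≤ (D b * max |x| |y| ^ N) * 1 := by
        gcongr
        · exact (abs_nonneg _).trans (h2 b)
        · exact h2 b
        · exact pow_le_one₀ (abs_nonneg _) hy
    _ = _ := mul_one _

theorem taylorCoeff_iterate_dY {S : ℝ × ℝ → ℝ} (hS : ContDiff ℝ ∞ S) (k a b : ℕ) :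
    taylorCoeff (dY^[k] S) a b = taylorCoeff S a (b + k) * ((b + k).descFactorial k : ℝ) := by
  rw [taylorCoeff_eq (contDiff_iterate_dY hS k), taylorCoeff_eq hS, ← Function.iterate_add_apply]
  have h : ((b + k).factorial : ℝ) = (b.factorial : ℝ) * ((b + k).descFactorial k : ℝ) := by
    have := Nat.factorial_mul_descFactorial (n := b + k) (k := k) (by omega)
    rw [Nat.add_sub_cancel] at this
    exact_mod_cast this.symm
  have h1 : (b.factorial : ℝ) ≠ 0 := by positivity
  have h2 : (a.factorial : ℝ) ≠ 0 := by positivity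
  have h3 : ((b + k).descFactorial k : ℝ) ≠ 0 := by
    have : ((b + k).factorial : ℝ) ≠ 0 := by positivity
    rw [h] at this
    exact right_ne_zero_of_mul this
  rw [h]
  field_simp

/-- Taylor expansion of `y ^ k * ∂_y ^ k S` at the origin. -/
theorem jet_bound {S : ℝ × ℝ → ℝ} (hS : ContDiff ℝ ∞ S) (k N : ℕ) :
    ∃ C, 0 ≤ C ∧ ∀ x y, |x| ≤ 1 → |y| ≤ 1 →
      |y ^ k * (dY^[k] S) (x, y) - ∑ p ∈ Finset.range N ×ˢ Finset.range N,
          taylorCoeff S p.1 p.2 * (p.2.descFactorial k : ℝ) * x ^ p.1 * y ^ p.2|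
        ≤ C * max |x| |y| ^ N := by
  obtain ⟨C, hC0, hC⟩ := taylor_bound_box (contDiff_iterate_dY hS k) N
  -- Multiplying the expansion of ∂_y^k S by y^k shifts its rows up by k. The rows N, …, N + k - 1
  -- leave the square and are absorbed into the error through `D`.
  set D := ∑ a ∈ Finset.range N, ∑ b ∈ Finset.range k,
    |taylorCoeff S a (N + b) * ((N + b).descFactorial k : ℝ)| with hD
  have hD0 : 0 ≤ D := Finset.sum_nonneg fun _ _ => Finset.sum_nonneg fun _ _ => abs_nonneg _
  refine ⟨C + D, by positivity, fun x y hx hy => ?_⟩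
  have hm0 : 0 ≤ max |x| |y| := (abs_nonneg x).trans (le_max_left _ _)
  have key := hC x y hx hy
  have e1 : y ^ k * ∑ a ∈ Finset.range N, ∑ b ∈ Finset.range N,
        taylorCoeff (dY^[k] S) a b * x ^ a * y ^ b
      = ∑ p ∈ Finset.range N ×ˢ Finset.range N,
          taylorCoeff S p.1 p.2 * (p.2.descFactorial k : ℝ) * x ^ p.1 * y ^ p.2
        + ∑ a ∈ Finset.range N, ∑ b ∈ Finset.range k,
          taylorCoeff S a (N + b) * ((N + b).descFactorial k : ℝ) * x ^ a * y ^ (N + b) := by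
    rw [Finset.sum_product, ← Finset.sum_add_distrib, Finset.mul_sum]
    refine Finset.sum_congr rfl fun a _ => ?_
    rw [← Finset.sum_range_add (fun b => taylorCoeff S a b * (b.descFactorial k : ℝ) * x ^ a * y ^ b),
      add_comm N k, Finset.sum_range_add
        (fun b => taylorCoeff S a b * (b.descFactorial k : ℝ) * x ^ a * y ^ b) k N, Finset.mul_sum]
    rw [Finset.sum_eq_zero (s := Finset.range k), zero_add]
    · refine Finset.sum_congr rfl fun b _ => ?_
      rw [taylorCoeff_iterate_dY hS, add_comm k b]
      ring
    · intro b hb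
      rw [Nat.descFactorial_eq_zero_iff_lt.2 (Finset.mem_range.1 hb)]
      simp
  have e2 : y ^ k * (dY^[k] S) (x, y) - ∑ p ∈ Finset.range N ×ˢ Finset.range N,
          taylorCoeff S p.1 p.2 * (p.2.descFactorial k : ℝ) * x ^ p.1 * y ^ p.2
      = y ^ k * ((dY^[k] S) (x, y) - ∑ a ∈ Finset.range N, ∑ b ∈ Finset.range N,
        taylorCoeff (dY^[k] S) a b * x ^ a * y ^ b)
        + ∑ a ∈ Finset.range N, ∑ b ∈ Finset.range k,
          taylorCoeff S a (N + b) * ((N + b).descFactorial k : ℝ) * x ^ a * y ^ (N + b) := by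
    rw [mul_sub, e1]; ring
  rw [e2]
  refine (abs_add_le _ _).trans ?_
  rw [add_mul]
  refine add_le_add ?_ ?_
  · rw [abs_mul, abs_pow]
    calc _ ≤ 1 * (C * max |x| |y| ^ N) := by
          gcongr
          exact pow_le_one₀ (abs_nonneg _) hy
      _ = _ := one_mul _
  · refine (Finset.abs_sum_le_sum_abs _ _).trans ?_
    rw [hD, Finset.sum_mul]
    refine Finset.sum_le_sum fun a _ => (Finset.abs_sum_le_sum_abs _ _).trans ?_
    rw [Finset.sum_mul]
    refine Finset.sum_le_sum fun b _ => ?_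
    rw [abs_mul, abs_mul, abs_pow, abs_pow, mul_assoc]
    gcongr
    calc |x| ^ a * |y| ^ (N + b) ≤ 1 * (|y| ^ N * 1) := by
          rw [pow_add]
          gcongr
          · exact pow_le_one₀ (abs_nonneg _) hx
          · exact pow_le_one₀ (abs_nonneg _) hy
      _ ≤ _ := by rw [one_mul, mul_one]; gcongr; exact le_max_right _ _

/-! ### Sublevel sets in one variable -/

/-- `F j` is the `j`-th derivative of `F 0`. -/
def IsDerivChain (F : ℕ → ℝ → ℝ) : Prop := ∀ j s, HasDerivAt (F j) (F (j + 1) s) s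

theorem isDerivChain_dY {S : ℝ × ℝ → ℝ} (hS : ContDiff ℝ ∞ S) (x : ℝ) :
    IsDerivChain (fun j y => (dY^[j] S) (x, y)) := fun j s => by
  change HasDerivAt (fun y => (dY^[j] S) (x, y)) ((dY^[j + 1] S) (x, s)) s
  rw [Function.iterate_succ_apply']
  exact hasDerivAt_dY (contDiff_iterate_dY hS j) x s

theorem IsDerivChain.le_abs_sub {F : ℕ → ℝ → ℝ} (hF : IsDerivChain F) {k : ℕ} {a b l : ℝ}
    (hl : ∀ s ∈ Set.Icc a b, l ≤ |F (k + 1) s|) {s t : ℝ} (hs : s ∈ Set.Icc a b)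
    (ht : t ∈ Set.Icc a b) : l * |t - s| ≤ |F k t - F k s| := by
  wlog hst : s < t generalizing s t
  · rcases eq_or_lt_of_le (not_lt.1 hst) with h | h
    · simp [h]
    · rw [abs_sub_comm t s, abs_sub_comm (F k t)]
      exact this ht hs h
  obtain ⟨c, hc, hc'⟩ := exists_hasDerivAt_eq_slope (F k) (F (k + 1)) hst
    (fun z _ => (hF k z).continuousAt.continuousWithinAt) (fun z _ => hF k z)
  have h1 : F k t - F k s = F (k + 1) c * (t - s) := by
    rw [hc', div_mul_cancel₀]; exact (sub_pos.2 hst).ne'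
  rw [h1, abs_mul]
  gcongr
  exact hl c ⟨hs.1.trans hc.1.le, hc.2.le.trans ht.2⟩

/-- Sublevel set estimate of van der Corput type. -/
theorem volume_sublevel_le_of_deriv {F : ℕ → ℝ → ℝ} (hF : IsDerivChain F) (k : ℕ) :
    ∀ {a b l θ : ℝ}, 0 < l → 0 < θ → (∀ s ∈ Set.Icc a b, l ≤ |F k s|) →
      volume {s | s ∈ Set.Icc a b ∧ |F 0 s| < l * θ ^ k} ≤ ENNReal.ofReal (4 ^ (k + 1) * θ) := by
  induction k with
  | zero =>
    intro a b l θ hl hθ h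
    have : {s | s ∈ Set.Icc a b ∧ |F 0 s| < l * θ ^ 0} = ∅ := by
      ext s
      simp only [Set.mem_ofPred_eq, Set.mem_empty_iff_false, iff_false, not_and, not_lt, pow_zero,
        mul_one]
      exact h s
    rw [this]; simp
  | succ k ih =>
    intro a b l θ hl hθ h
    have hη : 0 < l * θ := by positivity
    have e : l * θ ^ (k + 1) = l * θ * θ ^ k := by ring
    rw [e]
    by_cases hE : ∃ e ∈ Set.Icc a b, |F k e| < l * θ
    -- At `e` the function `F k` is small, and its derivative is at least `l` in modulus, so `|F k|
    -- ≥ l * θ` outside the interval of radius 2 θ about `e`. The induction hypothesis applies on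
    -- both sides and the middle costs 4 θ; the constant grows correctly because 2 · 4^(k+1) + 4 ≤
    -- 4^(k+2).
    · obtain ⟨e, he, hFe⟩ := hE
      have far : ∀ s ∈ Set.Icc a b, 2 * θ ≤ |s - e| → l * θ ≤ |F k s| := by
        intro s hs hse
        have h1 := hF.le_abs_sub h he hs
        have h2 : l * (2 * θ) ≤ l * |s - e| := by gcongr
        have h3 := abs_sub (F k s) (F k e)
        nlinarith
      have hsub : {s | s ∈ Set.Icc a b ∧ |F 0 s| < l * θ * θ ^ k} ⊆
          {s | s ∈ Set.Icc a (e - 2 * θ) ∧ |F 0 s| < l * θ * θ ^ k} ∪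
          Set.Icc (e - 2 * θ) (e + 2 * θ) ∪
          {s | s ∈ Set.Icc (e + 2 * θ) b ∧ |F 0 s| < l * θ * θ ^ k} := by
        rintro s ⟨hs, hs'⟩
        by_cases h1 : s ≤ e - 2 * θ
        · exact Or.inl (Or.inl ⟨⟨hs.1, h1⟩, hs'⟩)
        by_cases h2 : e + 2 * θ ≤ s
        · exact Or.inr ⟨⟨h2, hs.2⟩, hs'⟩
        · exact Or.inl (Or.inr ⟨(not_le.1 h1).le, (not_le.1 h2).le⟩)
      refine (measure_mono hsub).trans ((measure_union_le _ _).trans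
        (add_le_add (measure_union_le _ _) le_rfl) |>.trans ?_)
      have i1 := ih (a := a) (b := e - 2 * θ) hη hθ (fun s hs =>
        far s ⟨hs.1, hs.2.trans (by linarith [he.2])⟩ (by
          rw [abs_sub_comm]; exact (by linarith [hs.2] : 2 * θ ≤ e - s).trans (le_abs_self _)))
      have i2 := ih (a := e + 2 * θ) (b := b) hη hθ (fun s hs =>
        far s ⟨(by linarith [he.1] : a ≤ e + 2 * θ).trans hs.1, hs.2⟩
          ((by linarith [hs.1] : 2 * θ ≤ s - e).trans (le_abs_self _)))
      refine (add_le_add (add_le_add i1 (le_of_eq Real.volume_Icc)) i2).trans ?_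
      rw [← ENNReal.ofReal_add (by positivity) (by linarith), ← ENNReal.ofReal_add
        (by have : 0 ≤ 4 ^ (k + 1) * θ := by positivity
            linarith) (by positivity)]
      apply ENNReal.ofReal_le_ofReal
      have : (1 : ℝ) ≤ 4 ^ k := one_le_pow₀ (by norm_num)
      rw [pow_succ (4 : ℝ) (k + 1), pow_succ (4 : ℝ) k]
      nlinarith
    · push Not at hE
      refine (ih hη hθ hE).trans (ENNReal.ofReal_le_ofReal ?_)
      gcongr
      · norm_num
      · omega

theorem volume_sublevel_le_rpow {F : ℕ → ℝ → ℝ} (hF : IsDerivChain F) {k : ℕ} (hk : k ≠ 0)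
    {a b l δ : ℝ} (hl : 0 < l) (hδ : 0 < δ) (h : ∀ s ∈ Set.Icc a b, l ≤ |F k s|) :
    volume {s | s ∈ Set.Icc a b ∧ |F 0 s| < δ}
      ≤ ENNReal.ofReal (4 ^ (k + 1) * (δ / l) ^ (1 / (k : ℝ))) := by
  have := volume_sublevel_le_of_deriv hF k hl (θ := (δ / l) ^ (1 / (k : ℝ))) (by positivity) h
  rwa [one_div, Real.rpow_inv_natCast_pow (by positivity) hk, mul_div_cancel₀ _ hl.ne',
    ← one_div] at this

/-- The upper bounds make the derivatives uniformly Lipschitz, so a derivative that is large at one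
point stays large on an interval whose length depends on c and C only. On each of finitely many such
intervals the estimate for a fixed order applies. -/
theorem exists_volume_sublevel_le_unit (K : ℕ) {c C q : ℝ} (hc : 0 < c) (hC : 0 < C) (hq : 1 ≤ q)
    (hK : (K : ℝ) - 1 ≤ q) : ∃ D, 0 < D ∧ ∀ F : ℕ → ℝ → ℝ, IsDerivChain F →
      (∀ s ∈ Set.Icc (1 : ℝ) 2, ∃ k < K, c ≤ |F k s|) →
      (∀ k ≤ K, ∀ s ∈ Set.Icc (1 : ℝ) 2, |F k s| ≤ C) →
      ∀ δ > 0, volume {s | s ∈ Set.Icc (1 : ℝ) 2 ∧ |F 0 s| < δ}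
        ≤ ENNReal.ofReal (D * δ ^ (1 / q)) := by
  -- On an interval of length 1 / n the derivative selected at the left end changes by at most C / n
  -- ≤ c / 2, so at least l = c / 2 is left.
  obtain ⟨n, hn⟩ := exists_nat_gt (2 * C / c)
  have hn0 : (0 : ℝ) < n := lt_trans (by positivity) hn
  have hCn : C / n ≤ c / 2 := by
    rw [div_lt_iff₀ hc] at hn
    rw [div_le_div_iff₀ hn0 (by norm_num)]
    linarith
  set l := c / 2 with hl
  have hl0 : 0 < l := by positivity
  refine ⟨n * (4 ^ (K + 1) * (1 / l) ^ (1 / q)), by positivity, ?_⟩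
  intro F hF hlow hup δ hδ
  have hpos : 0 < (δ / l) ^ (1 / q) := by positivity
  set A := {s | s ∈ Set.Icc (1 : ℝ) 2 ∧ |F 0 s| < δ} with hA
  have piece : ∀ i ∈ Finset.range n,
      volume {s | s ∈ Set.Icc (1 + i / n : ℝ) (1 + (i + 1) / n) ∧ |F 0 s| < δ}
        ≤ ENNReal.ofReal (4 ^ (K + 1) * (δ / l) ^ (1 / q)) := by
    intro i hi
    have hi' : (i : ℝ) + 1 ≤ n := by exact_mod_cast Finset.mem_range.1 hi
    have hin : ((i : ℝ) + 1) / n ≤ 1 := (div_le_one hn0).2 hi'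
    have hi0 : 0 ≤ (i : ℝ) / n := by positivity
    have hstep : ((i : ℝ) + 1) / n = i / n + 1 / n := by ring
    have hn1 : 0 < 1 / (n : ℝ) := by positivity
    rcases le_or_gt l δ with hδl | hδl
    · have h1 : volume {s | s ∈ Set.Icc (1 + i / n : ℝ) (1 + (i + 1) / n) ∧ |F 0 s| < δ}
          ≤ ENNReal.ofReal 1 := by
        refine (measure_mono (fun s hs => hs.1)).trans ?_
        rw [Real.volume_Icc]
        apply ENNReal.ofReal_le_ofReal
        linarith
      refine h1.trans (ENNReal.ofReal_le_ofReal ?_)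
      have h2 : (1 : ℝ) ≤ (δ / l) ^ (1 / q) :=
        Real.one_le_rpow ((one_le_div hl0).2 hδl) (by positivity)
      have h3 : (1 : ℝ) ≤ 4 ^ (K + 1) := one_le_pow₀ (by norm_num)
      nlinarith
    · have hleft : (1 + i / n : ℝ) ∈ Set.Icc (1 : ℝ) 2 := ⟨by linarith, by linarith⟩
      obtain ⟨k, hkK, hk⟩ := hlow _ hleft
      have hlow' : ∀ s ∈ Set.Icc (1 + i / n : ℝ) (1 + (i + 1) / n), l ≤ |F k s| := by
        intro s hs
        have hmv := (convex_Icc (1 + i / n : ℝ) (1 + (i + 1) / n)).norm_image_sub_le_of_norm_hasDerivWithin_le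
          (f := F k) (f' := F (k + 1)) (C := C) (x := (1 + i / n : ℝ)) (y := s)
          (fun z _ => (hF k z).hasDerivWithinAt) (fun z hz => by
            rw [Real.norm_eq_abs]
            exact hup (k + 1) hkK z ⟨by linarith [hz.1], by linarith [hz.2]⟩)
          ⟨le_rfl, by linarith⟩ hs
        rw [Real.norm_eq_abs, Real.norm_eq_abs, abs_of_nonneg (by linarith [hs.1] : 0 ≤ s - (1 + i / n))] at hmv
        have h1 : C * (s - (1 + i / n)) ≤ C / n := by
          rw [div_eq_mul_one_div C]
          exact mul_le_mul_of_nonneg_left (by linarith [hs.2]) hC.le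
        have h2 := abs_sub_abs_le_abs_sub (F k (1 + i / n)) (F k s)
        rw [abs_sub_comm] at h2
        linarith
      rcases Nat.eq_zero_or_pos k with rfl | hk0
      · have : {s | s ∈ Set.Icc (1 + i / n : ℝ) (1 + (i + 1) / n) ∧ |F 0 s| < δ} = ∅ := by
          ext s
          simp only [Set.mem_ofPred_eq, Set.mem_empty_iff_false, iff_false, not_and, not_lt]
          exact fun hs => hδl.le.trans (hlow' s hs)
        rw [this]; simp
      · refine (volume_sublevel_le_rpow hF hk0.ne' hl0 hδ hlow').trans
          (ENNReal.ofReal_le_ofReal ?_)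
        have hk1 : (1 : ℝ) ≤ k := by exact_mod_cast hk0
        have hkq : (k : ℝ) ≤ q := by
          have : (k : ℝ) + 1 ≤ K := by exact_mod_cast hkK
          linarith
        gcongr ?_ * ?_
        · exact pow_le_pow_right₀ (by norm_num) (by omega)
        -- Here δ / l < 1 and k ≤ K - 1 ≤ q, so the exponent 1 / k may be lowered to 1 / q.
        · apply Real.rpow_le_rpow_of_exponent_ge (by positivity) ((div_le_one hl0).2 hδl.le)
          exact one_div_le_one_div_of_le (by linarith) hkq
  have hcover : A ⊆ ⋃ i ∈ Finset.range n,
      {s | s ∈ Set.Icc (1 + i / n : ℝ) (1 + (i + 1) / n) ∧ |F 0 s| < δ} := by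
    rintro s ⟨hs, hs'⟩
    simp only [Set.mem_iUnion]
    -- At the right end the floor of (s - 1) n would be n, one piece too far.
    by_cases hs2 : s = 2
    · have hn' : n ≠ 0 := by rintro rfl; simp at hn0
      refine ⟨n - 1, Finset.mem_range.2 (by omega), ⟨?_, ?_⟩, hs'⟩
      · rw [hs2]
        have : ((n - 1 : ℕ) : ℝ) / n ≤ 1 := (div_le_one hn0).2 (by exact_mod_cast Nat.sub_le n 1)
        linarith
      · rw [hs2]
        have : (((n - 1 : ℕ) : ℝ) + 1) / n = 1 := by
          rw [div_eq_one_iff_eq hn0.ne']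
          have : n - 1 + 1 = n := by omega
          exact_mod_cast this
        linarith
    · have h1 : 0 ≤ (s - 1) * n := mul_nonneg (by linarith [hs.1]) hn0.le
      have h2 : s < 2 := lt_of_le_of_ne hs.2 hs2
      refine ⟨⌊(s - 1) * n⌋₊, Finset.mem_range.2 ?_, ⟨?_, ?_⟩, hs'⟩
      · rw [Nat.floor_lt h1]; nlinarith
      · have := Nat.floor_le h1
        have := (div_le_iff₀ hn0).2 this
        linarith
      · have := (Nat.lt_floor_add_one ((s - 1) * n)).le
        have := (le_div_iff₀ hn0).2 this
        linarith
  calc volume A ≤ _ := measure_mono hcover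
    _ ≤ ∑ i ∈ Finset.range n, _ := measure_biUnion_finset_le _ _
    _ ≤ ∑ i ∈ Finset.range n, ENNReal.ofReal (4 ^ (K + 1) * (δ / l) ^ (1 / q)) :=
        Finset.sum_le_sum piece
    _ = ENNReal.ofReal (n * (4 ^ (K + 1) * (1 / l) ^ (1 / q)) * δ ^ (1 / q)) := by
        rw [Finset.sum_const, Finset.card_range, nsmul_eq_mul, ← ENNReal.ofReal_natCast n,
          ← ENNReal.ofReal_mul (by positivity)]
        congr 1
        rw [div_eq_mul_one_div δ l, Real.mul_rpow (by positivity) (by positivity)]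
        ring

/-- Sublevel set estimate on a dyadic interval, where the order of the derivative that is
bounded below may depend on the point. -/
theorem exists_volume_sublevel_le_dyadic (K : ℕ) {c C q : ℝ} (hc : 0 < c) (hC : 0 < C)
    (hq : 1 ≤ q) (hK : (K : ℝ) - 1 ≤ q) : ∃ D, 0 < D ∧ ∀ F : ℕ → ℝ → ℝ, IsDerivChain F →
      ∀ a > 0, ∀ Λ > 0,
      (∀ y ∈ Set.Icc a (2 * a), ∃ k < K, c * Λ ≤ |y ^ k * F k y|) →
      (∀ k ≤ K, ∀ y ∈ Set.Icc a (2 * a), |y ^ k * F k y| ≤ C * Λ) →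
      ∀ ε > 0, volume {y | y ∈ Set.Icc a (2 * a) ∧ |F 0 y| < ε}
        ≤ ENNReal.ofReal (D * a * (ε / Λ) ^ (1 / q)) := by
  -- Under y = a s the quantity y^k F_k becomes Λ s^k G_k with 1 ≤ s^k ≤ 2^K; this accounts for the
  -- constant c / 2^K.
  obtain ⟨D, hD, h⟩ := exists_volume_sublevel_le_unit K (c := c / 2 ^ K) (by positivity) hC hq hK
  refine ⟨D, hD, fun F hF a ha Λ hΛ hlow hup ε hε => ?_⟩
  set G : ℕ → ℝ → ℝ := fun j s => a ^ j * F j (a * s) / Λ with hG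
  have hmem : ∀ s : ℝ, s ∈ Set.Icc (1 : ℝ) 2 ↔ a * s ∈ Set.Icc a (2 * a) := by
    intro s
    constructor
    · rintro ⟨h1, h2⟩; constructor <;> nlinarith
    · rintro ⟨h1, h2⟩; constructor <;> nlinarith
  have hGc : IsDerivChain G := by
    intro j s
    have h1 : HasDerivAt (fun s => a * s) a s := by simpa using (hasDerivAt_id s).const_mul a
    have h2 := (((hF j (a * s)).comp s h1).const_mul (a ^ j)).div_const Λ
    have e : G (j + 1) s = a ^ j * (F (j + 1) (a * s) * a) / Λ := by simp only [hG]; ring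
    rw [e]
    exact h2
  have heq : ∀ k s, |(a * s) ^ k * F k (a * s)| = Λ * (|s| ^ k * |G k s|) := by
    intro k s
    simp only [hG]
    rw [abs_mul, abs_div, abs_mul, abs_pow, abs_pow, abs_mul, abs_of_pos ha, abs_of_pos hΛ, mul_pow]
    field_simp
  have key := h G hGc (fun s hs => by
    obtain ⟨k, hk, hk'⟩ := hlow _ ((hmem s).1 hs)
    refine ⟨k, hk, ?_⟩
    rw [heq, mul_comm c, mul_le_mul_iff_right₀ hΛ, abs_of_pos (by linarith [hs.1])] at hk'
    rw [div_le_iff₀ (by positivity)]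
    have h1 : s ^ k ≤ 2 ^ K := (pow_le_pow_left₀ (by linarith [hs.1]) hs.2 k).trans
      (pow_le_pow_right₀ (by norm_num) hk.le)
    nlinarith [abs_nonneg (G k s)]) (fun k hk s hs => by
    have := hup k hk _ ((hmem s).1 hs)
    rw [heq, mul_comm C, mul_le_mul_iff_right₀ hΛ, abs_of_pos (by linarith [hs.1])] at this
    have h1 : 1 ≤ s ^ k := one_le_pow₀ hs.1
    nlinarith [abs_nonneg (G k s)]) (ε / Λ) (by positivity)
  have hset : {s | s ∈ Set.Icc (1 : ℝ) 2 ∧ |G 0 s| < ε / Λ}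
      = (a * ·) ⁻¹' {y | y ∈ Set.Icc a (2 * a) ∧ |F 0 y| < ε} := by
    ext s
    simp only [Set.mem_ofPred_eq, Set.mem_preimage]
    rw [hmem]
    have : |G 0 s| < ε / Λ ↔ |F 0 (a * s)| < ε := by
      simp only [hG, pow_zero, one_mul]
      rw [abs_div, abs_of_pos hΛ, div_lt_div_iff_of_pos_right hΛ]
    rw [this]
  rw [hset, Real.volume_preimage_mul_left ha.ne', abs_of_pos (by positivity)] at key
  calc volume {y | y ∈ Set.Icc a (2 * a) ∧ |F 0 y| < ε}
      = ENNReal.ofReal a * (ENNReal.ofReal a⁻¹ * volume {y | y ∈ Set.Icc a (2 * a) ∧ |F 0 y| < ε}) := by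
        rw [← mul_assoc, ← ENNReal.ofReal_mul ha.le, mul_inv_cancel₀ ha.ne']; simp
    _ ≤ ENNReal.ofReal a * ENNReal.ofReal (D * (ε / Λ) ^ (1 / q)) := by gcongr
    _ = _ := by rw [← ENNReal.ofReal_mul ha.le]; congr 1; ring

/-- The dyadic intervals below b contribute a geometric series of ratio 2^(-γ), so the topmost one
decides. -/
theorem volume_inter_Ioc_le_of_dyadic {A : Set ℝ} {D γ b : ℝ} (hD : 0 ≤ D) (hγ : 0 < γ)
    (hb : 0 < b) (h : ∀ a, 0 < a → a ≤ b → volume (A ∩ Set.Icc a (2 * a)) ≤ ENNReal.ofReal (D * a ^ γ)) :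
    volume (A ∩ Set.Ioc 0 b) ≤ ENNReal.ofReal (D / (1 - 2⁻¹ ^ γ) * b ^ γ) := by
  set r : ℝ := 2⁻¹ ^ γ with hr
  have hr0 : 0 ≤ r := by positivity
  have hr1 : r < 1 := Real.rpow_lt_one (by norm_num) (by norm_num) hγ
  have hcover : A ∩ Set.Ioc 0 b ⊆ ⋃ i : ℕ, A ∩ Set.Icc (b * 2⁻¹ ^ (i + 1)) (2 * (b * 2⁻¹ ^ (i + 1))) := by
    rintro y ⟨hyA, hy0, hyb⟩
    have hyb' : 0 < y / b := by positivity
    obtain ⟨n, hn1, hn2⟩ := exists_nat_pow_near_of_lt_one hyb' ((div_le_one hb).2 hyb)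
      (y := (2⁻¹ : ℝ)) (by norm_num) (by norm_num)
    refine Set.mem_iUnion.2 ⟨n, hyA, ?_, ?_⟩
    · rw [lt_div_iff₀ hb] at hn1; linarith
    · rw [div_le_iff₀ hb] at hn2
      rw [pow_succ]; linarith
  have hterm : ∀ i : ℕ, volume (A ∩ Set.Icc (b * 2⁻¹ ^ (i + 1)) (2 * (b * 2⁻¹ ^ (i + 1))))
      ≤ ENNReal.ofReal (D * b ^ γ * r ^ i) := by
    intro i
    have hp : (0 : ℝ) < 2⁻¹ ^ (i + 1) := by positivity
    have hp1 : (2⁻¹ : ℝ) ^ (i + 1) ≤ 1 := pow_le_one₀ (by norm_num) (by norm_num)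
    refine (h _ (by positivity) (by nlinarith)).trans (ENNReal.ofReal_le_ofReal ?_)
    have e : ((2⁻¹ : ℝ) ^ (i + 1)) ^ γ = r ^ (i + 1) := by
      rw [hr, ← Real.rpow_natCast, ← Real.rpow_mul (by norm_num), mul_comm, Real.rpow_mul (by norm_num),
        Real.rpow_natCast]
    rw [Real.mul_rpow hb.le hp.le, e, ← mul_assoc]
    have : r ^ (i + 1) ≤ r ^ i := pow_le_pow_of_le_one hr0 hr1.le (Nat.le_succ i)
    gcongr
  calc volume (A ∩ Set.Ioc 0 b) ≤ _ := measure_mono hcover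
    _ ≤ ∑' i : ℕ, _ := measure_iUnion_le _
    _ ≤ ∑' i : ℕ, ENNReal.ofReal (D * b ^ γ * r ^ i) := ENNReal.tsum_le_tsum hterm
    _ = ENNReal.ofReal (∑' i : ℕ, D * b ^ γ * r ^ i) :=
        (ENNReal.ofReal_tsum_of_nonneg (fun i => by positivity)
          ((summable_geometric_of_lt_one hr0 hr1).mul_left _)).symm
    _ = _ := by rw [tsum_mul_left, tsum_geometric_of_lt_one hr0 hr1]; congr 1; ring

/-- For a negative power the series decreases upwards and the lowest interval decides. The cover is
intersected with [a₀, b] once more in order to discard the intervals starting beyond b, for which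
nothing is assumed. -/
theorem volume_inter_Icc_le_of_dyadic {A : Set ℝ} {D γ a₀ b : ℝ} (hD : 0 ≤ D) (hγ : γ < 0)
    (ha : 0 < a₀)
    (h : ∀ a, a₀ ≤ a → a ≤ b → volume (A ∩ Set.Icc a (2 * a)) ≤ ENNReal.ofReal (D * a ^ γ)) :
    volume (A ∩ Set.Icc a₀ b) ≤ ENNReal.ofReal (D / (1 - 2 ^ γ) * a₀ ^ γ) := by
  set r : ℝ := 2 ^ γ with hr
  have hr0 : 0 ≤ r := by positivity
  have hr1 : r < 1 := Real.rpow_lt_one_of_one_lt_of_neg (by norm_num) hγ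
  have hcover : A ∩ Set.Icc a₀ b ⊆ ⋃ i : ℕ, A ∩ Set.Icc (a₀ * 2 ^ i) (2 * (a₀ * 2 ^ i)) ∩ Set.Icc a₀ b := by
    rintro y ⟨hyA, hy⟩
    obtain ⟨n, hn1, hn2⟩ := exists_nat_pow_near ((one_le_div ha).2 hy.1) (y := (2 : ℝ)) (by norm_num)
    refine Set.mem_iUnion.2 ⟨n, ⟨hyA, ?_, ?_⟩, hy⟩
    · rw [le_div_iff₀ ha] at hn1; linarith
    · rw [div_lt_iff₀ ha, pow_succ] at hn2; linarith
  have hterm : ∀ i : ℕ, volume (A ∩ Set.Icc (a₀ * 2 ^ i) (2 * (a₀ * 2 ^ i)) ∩ Set.Icc a₀ b)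
      ≤ ENNReal.ofReal (D * a₀ ^ γ * r ^ i) := by
    intro i
    have hp : (0 : ℝ) < 2 ^ i := by positivity
    have hp1 : (1 : ℝ) ≤ 2 ^ i := one_le_pow₀ (by norm_num)
    by_cases hab : a₀ * 2 ^ i ≤ b
    · refine (measure_mono Set.inter_subset_left).trans
        ((h _ (by nlinarith) hab).trans (ENNReal.ofReal_le_ofReal (le_of_eq ?_)))
      have e : ((2 : ℝ) ^ i) ^ γ = r ^ i := by
        rw [hr, ← Real.rpow_natCast, ← Real.rpow_mul (by norm_num), mul_comm, Real.rpow_mul (by norm_num),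
          Real.rpow_natCast]
      rw [Real.mul_rpow ha.le hp.le, e, ← mul_assoc]
    · have : A ∩ Set.Icc (a₀ * 2 ^ i) (2 * (a₀ * 2 ^ i)) ∩ Set.Icc a₀ b = ∅ := by
        ext y
        simp only [Set.mem_inter_iff, Set.mem_Icc, Set.mem_empty_iff_false, iff_false]
        rintro ⟨⟨_, h1, _⟩, _, h2⟩
        exact hab (h1.trans h2)
      rw [this]; simp
  calc volume (A ∩ Set.Icc a₀ b) ≤ _ := measure_mono hcover
    _ ≤ ∑' i : ℕ, _ := measure_iUnion_le _
    _ ≤ ∑' i : ℕ, ENNReal.ofReal (D * a₀ ^ γ * r ^ i) := ENNReal.tsum_le_tsum hterm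
    _ = ENNReal.ofReal (∑' i : ℕ, D * a₀ ^ γ * r ^ i) :=
        (ENNReal.ofReal_tsum_of_nonneg (fun i => by positivity)
          ((summable_geometric_of_lt_one hr0 hr1).mul_left _)).symm
    _ = _ := by rw [tsum_mul_left, tsum_geometric_of_lt_one hr0 hr1]; congr 1; ring

/-! ### Newton bounds from nondegenerate faces -/

/-- On every face `a + μ * b = α` with `κ ≤ μ` of the Newton polygon of the coefficients `s`, the
face polynomial has no positive zero of order at least `K`. -/
def FaceNondegenerate (s : ℕ → ℕ → ℝ) (κ : ℝ) (K : ℕ) : Prop :=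
  ∀ μ ≥ κ, ∀ α : ℝ, ∀ F : Finset (ℕ × ℕ), F.Nonempty →
    (∀ p : ℕ × ℕ, p ∈ F ↔ s p.1 p.2 ≠ 0 ∧ (p.1 : ℝ) + μ * p.2 = α) →
    (∀ a b : ℕ, s a b ≠ 0 → α ≤ a + μ * b) →
    ∀ t : ℝ, 0 < t → ∃ k < K, ∑ p ∈ F, s p.1 p.2 * (p.2.descFactorial k : ℝ) * t ^ p.2 ≠ 0

/-- The exponents below `N` with non-zero coefficient. -/
noncomputable def boxSupport (s : ℕ → ℕ → ℝ) (N : ℕ) : Finset (ℕ × ℕ) :=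
  (Finset.range N ×ˢ Finset.range N).filter (fun p => s p.1 p.2 ≠ 0)

theorem mem_boxSupport {s : ℕ → ℕ → ℝ} {N : ℕ} {p : ℕ × ℕ} :
    p ∈ boxSupport s N ↔ (p.1 < N ∧ p.2 < N) ∧ s p.1 p.2 ≠ 0 := by
  simp [boxSupport]

/-- The sum of the monomials in the box support. -/
noncomputable def newtonMajorant (s : ℕ → ℕ → ℝ) (N : ℕ) (x y : ℝ) : ℝ :=
  ∑ p ∈ boxSupport s N, x ^ p.1 * y ^ p.2

theorem monomial_le_newtonMajorant {s : ℕ → ℕ → ℝ} {N A B : ℕ} {x y : ℝ} (hx : 0 ≤ x) (hy : 0 ≤ y)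
    (hA : A < N) (hB : B < N) (h : s A B ≠ 0) : x ^ A * y ^ B ≤ newtonMajorant s N x y :=
  Finset.single_le_sum (f := fun p : ℕ × ℕ => x ^ p.1 * y ^ p.2) (fun p _ => by positivity)
    (mem_boxSupport.2 ⟨⟨hA, hB⟩, h⟩ : ((A, B) : ℕ × ℕ) ∈ boxSupport s N)

/-- Makes the Taylor remainder of order N smaller than a monomial of the polygon by a factor x: in
the cusp both variables are at most 2 x^(min κ 1), while y ≥ x^M bounds the monomial from below by
x^(A + M B). -/
theorem max_pow_le_monomial {x y κ M : ℝ} {A B N : ℕ} (hx0 : 0 < x) (hx1 : x ≤ 1)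
    (hMy : x ^ M ≤ y) (hyκ : y ≤ 2 * x ^ κ) (hN : (A : ℝ) + M * B + 1 ≤ min κ 1 * N) :
    max |x| |y| ^ N ≤ 2 ^ N * x * (x ^ A * y ^ B) := by
  have hy0 : 0 < y := (Real.rpow_pos_of_pos hx0 M).trans_le hMy
  have h1 : max |x| |y| ≤ 2 * x ^ (min κ 1) := by
    rw [abs_of_pos hx0, abs_of_pos hy0]
    have hp := Real.rpow_pos_of_pos hx0 (min κ 1)
    refine max_le ?_ (hyκ.trans ?_)
    · have : x ^ (1 : ℝ) ≤ x ^ (min κ 1) :=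
        Real.rpow_le_rpow_of_exponent_ge hx0 hx1 (min_le_right _ _)
      rw [Real.rpow_one] at this
      linarith
    · gcongr 2 * ?_
      exact Real.rpow_le_rpow_of_exponent_ge hx0 hx1 (min_le_left _ _)
  calc max |x| |y| ^ N ≤ (2 * x ^ (min κ 1)) ^ N :=
        pow_le_pow_left₀ ((abs_nonneg x).trans (le_max_left _ _)) h1 N
    _ = 2 ^ N * x ^ (min κ 1 * N) := by
        rw [mul_pow, ← Real.rpow_natCast (x ^ (min κ 1)), ← Real.rpow_mul hx0.le]
    _ ≤ 2 ^ N * x ^ ((A : ℝ) + M * B + 1) := by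
        gcongr 2 ^ N * ?_
        exact Real.rpow_le_rpow_of_exponent_ge hx0 hx1 hN
    _ = 2 ^ N * x * (x ^ A * (x ^ M) ^ B) := by
        rw [Real.rpow_add hx0, Real.rpow_add hx0, Real.rpow_one, Real.rpow_natCast,
          Real.rpow_mul hx0.le, Real.rpow_natCast]
        ring
    _ ≤ _ := by gcongr

theorem sum_box_eq_sum_boxSupport (s : ℕ → ℕ → ℝ) (N k : ℕ) (x y : ℝ) :
    ∑ p ∈ Finset.range N ×ˢ Finset.range N,
      s p.1 p.2 * (p.2.descFactorial k : ℝ) * x ^ p.1 * y ^ p.2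
    = ∑ p ∈ boxSupport s N, s p.1 p.2 * (p.2.descFactorial k : ℝ) * (x ^ p.1 * y ^ p.2) := by
  rw [boxSupport, Finset.sum_filter]
  refine Finset.sum_congr rfl fun p _ => ?_
  split_ifs with h
  · ring
  · simp only [ne_eq, not_not] at h
    rw [h]; ring

/-- The limiting argument behind the lower bound: normalized monomials along an ultrafilter. -/
theorem exists_face_of_tendsto {s : ℕ → ℕ → ℝ} {N K A B : ℕ} {κ M : ℝ} (hκ : 0 < κ) (hK : 0 < K)
    (hs : FaceNondegenerate s κ K) (hA : A < N) (hB : B < N) (hAB : s A B ≠ 0)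
    (hN : (A : ℝ) + M * B + 1 ≤ min κ 1 * N) {x y : ℕ → ℝ} (hx0 : ∀ n, 0 < x n)
    (hx : Tendsto x atTop (𝓝 0)) (hMy : ∀ n, x n ^ M ≤ y n) (hyκ : ∀ n, y n ≤ 2 * x n ^ κ)
    (hlim : ∀ k < K, Tendsto (fun n => (∑ p ∈ boxSupport s N,
      s p.1 p.2 * (p.2.descFactorial k : ℝ) * (x n ^ p.1 * y n ^ p.2)) / newtonMajorant s N (x n) (y n))
      atTop (𝓝 0)) : False := by
  have hy0 : ∀ n, 0 < y n := fun n => (Real.rpow_pos_of_pos (hx0 n) M).trans_le (hMy n)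
  have hΛ : ∀ n, 0 < newtonMajorant s N (x n) (y n) := fun n =>
    (by have := hx0 n; have := hy0 n; positivity : 0 < x n ^ A * y n ^ B).trans_le
      (monomial_le_newtonMajorant (hx0 n).le (hy0 n).le hA hB hAB)
  -- Along an ultrafilter all the normalized monomials, which lie in [0, 1], converge
  -- simultaneously, without extraction of subsequences.
  let U : Ultrafilter ℕ := hyperfilter ℕ
  have hU : (U : Filter ℕ) ≤ atTop := by
    rw [← Nat.cofinite_eq_atTop]; exact hyperfilter_le_cofinite
  set w : ℕ × ℕ → ℕ → ℝ := fun p n => x n ^ p.1 * y n ^ p.2 / newtonMajorant s N (x n) (y n) with hw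
  have hwpos : ∀ p n, 0 < w p n := fun p n => by
    have := hx0 n; have := hy0 n; have := hΛ n; positivity
  have hw1 : ∀ p ∈ boxSupport s N, ∀ n, w p n ∈ Set.Icc (0 : ℝ) 1 := by
    intro p hp n
    refine ⟨(hwpos p n).le, (div_le_one (hΛ n)).2 ?_⟩
    obtain ⟨⟨h1, h2⟩, h3⟩ := mem_boxSupport.1 hp
    exact monomial_le_newtonMajorant (hx0 n).le (hy0 n).le h1 h2 h3
  have hwlim : ∀ p, ∃ l, p ∈ boxSupport s N → 0 ≤ l ∧ Tendsto (w p) U (𝓝 l) := by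
    intro p
    by_cases hp : p ∈ boxSupport s N
    · obtain ⟨l, hl, hl'⟩ := (isCompact_Icc (a := (0 : ℝ)) (b := 1)).ultrafilter_le_nhds
        (U.map (w p)) (by
          rw [le_principal_iff]
          exact Filter.mem_map.2 (Filter.univ_mem' (hw1 p hp)))
      exact ⟨l, fun _ => ⟨hl.1, hl'⟩⟩
    · exact ⟨0, fun h => (hp h).elim⟩
  choose l hl using hwlim
  have hsum1 : ∑ p ∈ boxSupport s N, l p = 1 := by
    have h1 : Tendsto (fun n => ∑ p ∈ boxSupport s N, w p n) U (𝓝 (∑ p ∈ boxSupport s N, l p)) :=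
      tendsto_finsetSum _ fun p hp => (hl p hp).2
    have h2 : (fun n => ∑ p ∈ boxSupport s N, w p n) = fun _ => 1 := by
      funext n
      simp only [hw]
      rw [← Finset.sum_div]
      exact div_self (hΛ n).ne'
    rw [h2] at h1
    exact tendsto_nhds_unique h1 tendsto_const_nhds
  have hzero : ∀ k < K, ∑ p ∈ boxSupport s N, s p.1 p.2 * (p.2.descFactorial k : ℝ) * l p = 0 := by
    intro k hk
    have h1 : Tendsto (fun n => ∑ p ∈ boxSupport s N, s p.1 p.2 * (p.2.descFactorial k : ℝ) * w p n) U
        (𝓝 (∑ p ∈ boxSupport s N, s p.1 p.2 * (p.2.descFactorial k : ℝ) * l p)) :=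
      tendsto_finsetSum _ fun p hp => (hl p hp).2.const_mul _
    refine tendsto_nhds_unique h1 (((hlim k hk).mono_left hU).congr fun n => ?_)
    rw [Finset.sum_div]
    refine Finset.sum_congr rfl fun p _ => ?_
    simp only [hw]; ring
  obtain ⟨p₀, hp₀, hlp₀⟩ : ∃ p ∈ boxSupport s N, 0 < l p := by
    by_contra! h
    have := Finset.sum_nonpos h
    rw [hsum1] at this
    linarith
  have hlog : Tendsto (fun n => Real.log (x n)) U atBot :=
    (Real.tendsto_log_nhdsGT_zero.comp (tendsto_nhdsWithin_iff.2
      ⟨hx, Eventually.of_forall hx0⟩)).mono_left hU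
  -- If only one monomial survives in the limit, the relation for k = 0 says that its coefficient
  -- vanishes, which is absurd.
  by_cases hone : ∀ p ∈ boxSupport s N, p ≠ p₀ → l p = 0
  · have h0 := hzero 0 hK
    rw [Finset.sum_eq_single p₀ (fun p hp hne => by rw [hone p hp hne, mul_zero])
      (fun h => (h hp₀).elim)] at h0
    have := (mem_boxSupport.1 hp₀).2
    simp only [Nat.descFactorial_zero, Nat.cast_one, mul_one] at h0
    rcases mul_eq_zero.1 h0 with h | h
    · exact this h
    · exact hlp₀.ne' h
  push Not at hone
  obtain ⟨p₁, hp₁, hne, hlp₁⟩ := hone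
  have hlp₁' : 0 < l p₁ := lt_of_le_of_ne (hl p₁ hp₁).1 (Ne.symm hlp₁)
  have hlogw : ∀ p n, Real.log (w p n) = p.1 * Real.log (x n) + p.2 * Real.log (y n)
      - Real.log (newtonMajorant s N (x n) (y n)) := by
    intro p n
    have hxn := (hx0 n); have hyn := hy0 n
    simp only [hw]
    rw [Real.log_div (by positivity) (hΛ n).ne', Real.log_mul (by positivity) (by positivity),
      Real.log_pow, Real.log_pow]
  -- Two surviving monomials have a quotient with a positive limit. This forces log y = μ log x + τ
  -- + o(1): the points follow a curve y ~ e^τ x^μ.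
  have hdiff : Tendsto (fun n => ((p₁.1 : ℝ) - p₀.1) * Real.log (x n)
      + ((p₁.2 : ℝ) - p₀.2) * Real.log (y n)) U (𝓝 (Real.log (l p₁) - Real.log (l p₀))) := by
    refine (((hl p₁ hp₁).2.log hlp₁'.ne').sub ((hl p₀ hp₀).2.log hlp₀.ne')).congr fun n => ?_
    rw [hlogw, hlogw]; ring
  have hb : (p₁.2 : ℝ) - p₀.2 ≠ 0 := by
    intro hb
    have ha : (p₁.1 : ℝ) - p₀.1 ≠ 0 := by
      intro ha
      apply hne
      ext
      · exact_mod_cast sub_eq_zero.1 ha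
      · exact_mod_cast sub_eq_zero.1 hb
    simp only [hb, zero_mul, add_zero] at hdiff
    rcases lt_or_gt_of_ne ha with h | h
    · exact not_tendsto_nhds_of_tendsto_atTop (hlog.const_mul_atBot_of_neg h) _ hdiff
    · exact not_tendsto_nhds_of_tendsto_atBot (hlog.const_mul_atBot h) _ hdiff
  set μ : ℝ := -((p₁.1 : ℝ) - p₀.1) / ((p₁.2 : ℝ) - p₀.2) with hμ
  set τ : ℝ := (Real.log (l p₁) - Real.log (l p₀)) / ((p₁.2 : ℝ) - p₀.2) with hτ
  have hr : Tendsto (fun n => Real.log (y n) - μ * Real.log (x n)) U (𝓝 τ) := by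
    refine (hdiff.div_const ((p₁.2 : ℝ) - p₀.2)).congr fun n => ?_
    rw [hμ]; field_simp; ring
  -- The region x^M ≤ y ≤ 2 x^κ confines the exponent of the curve to κ ≤ μ ≤ M.
  have hκμ : κ ≤ μ := by
    by_contra! h
    have h1 : Tendsto (fun n => (μ - κ) * Real.log (x n)
        + (Real.log (y n) - μ * Real.log (x n))) U atTop :=
      (hlog.const_mul_atBot_of_neg (by linarith)).atTop_add hr
    obtain ⟨n, hn⟩ := (h1.eventually_gt_atTop (Real.log 2)).exists
    have h2 : Real.log (y n) ≤ Real.log 2 + κ * Real.log (x n) := by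
      have := Real.log_le_log (hy0 n) (hyκ n)
      rwa [Real.log_mul (by norm_num) (Real.rpow_pos_of_pos (hx0 n) κ).ne',
        Real.log_rpow (hx0 n)] at this
    linarith
  have hμM : μ ≤ M := by
    by_contra! h
    have h1 : Tendsto (fun n => (μ - M) * Real.log (x n)
        + (Real.log (y n) - μ * Real.log (x n))) U atBot :=
      (hlog.const_mul_atBot (by linarith)).atBot_add hr
    obtain ⟨n, hn⟩ := (h1.eventually_lt_atBot 0).exists
    have h2 : M * Real.log (x n) ≤ Real.log (y n) := by
      have := Real.log_le_log (Real.rpow_pos_of_pos (hx0 n) M) (hMy n)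
      rwa [Real.log_rpow (hx0 n)] at this
    linarith
  set α : ℝ := p₀.1 + μ * p₀.2 with hα
  have hwexp : ∀ p n, w p n = w p₀ n * Real.exp (((p.1 : ℝ) + μ * p.2 - α) * Real.log (x n)
      + ((p.2 : ℝ) - p₀.2) * (Real.log (y n) - μ * Real.log (x n))) := by
    intro p n
    rw [← Real.exp_log (hwpos p n), ← Real.exp_log (hwpos p₀ n), ← Real.exp_add,
      hlogw, hlogw, hα]
    congr 1; ring
  -- Compared with the monomial at `p₀`, one below the line a + μ b = α would be infinitely large
  -- and one above it is infinitely small; on the line the limits are proportional to e^(τ b).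
  have hmin : ∀ p ∈ boxSupport s N, α ≤ (p.1 : ℝ) + μ * p.2 := by
    intro p hp
    by_contra! h
    have h1 : Tendsto (fun n => ((p.1 : ℝ) + μ * p.2 - α) * Real.log (x n)
        + ((p.2 : ℝ) - p₀.2) * (Real.log (y n) - μ * Real.log (x n))) U atTop :=
      (hlog.const_mul_atBot_of_neg (by linarith)).atTop_add (hr.const_mul _)
    have h2 : Tendsto (w p) U atTop :=
      ((hl p₀ hp₀).2.pos_mul_atTop hlp₀ (Real.tendsto_exp_atTop.comp h1)).congr
        fun n => (hwexp p n).symm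
    exact not_tendsto_nhds_of_tendsto_atTop h2 _ (hl p hp).2
  have hbig : ∀ p ∈ boxSupport s N, α < (p.1 : ℝ) + μ * p.2 → l p = 0 := by
    intro p hp h
    have h1 : Tendsto (fun n => ((p.1 : ℝ) + μ * p.2 - α) * Real.log (x n)
        + ((p.2 : ℝ) - p₀.2) * (Real.log (y n) - μ * Real.log (x n))) U atBot :=
      (hlog.const_mul_atBot (by linarith)).atBot_add (hr.const_mul _)
    have h2 := ((hl p₀ hp₀).2.mul (Real.tendsto_exp_atBot.comp h1)).congr
        fun n => (hwexp p n).symm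
    rw [mul_zero] at h2
    exact tendsto_nhds_unique (hl p hp).2 h2
  have heq : ∀ p ∈ boxSupport s N, (p.1 : ℝ) + μ * p.2 = α →
      l p = l p₀ * Real.exp (-(p₀.2 * τ)) * Real.exp τ ^ p.2 := by
    intro p hp h
    have h2 : Tendsto (w p) U (𝓝 (l p₀ * Real.exp (((p.2 : ℝ) - p₀.2) * τ))) := by
      refine ((hl p₀ hp₀).2.mul ((Real.continuous_exp.tendsto _).comp
        (hr.const_mul ((p.2 : ℝ) - p₀.2)))).congr fun n => ?_
      rw [hwexp p n, h]
      simp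
    rw [tendsto_nhds_unique (hl p hp).2 h2, mul_assoc, ← Real.exp_nat_mul, ← Real.exp_add]
    congr 2; ring
  have hαAB : α ≤ A + M * B := by
    have h1 := hmin (A, B) (mem_boxSupport.2 ⟨⟨hA, hB⟩, hAB⟩)
    have : μ * (B : ℝ) ≤ M * B := by gcongr
    simp only at h1
    linarith
  -- This is where the size of `N` matters: exponents outside the box lie strictly above the line,
  -- so the part of the line inside the box is an entire face.
  have hout : ∀ p : ℕ × ℕ, ¬ (p.1 < N ∧ p.2 < N) → α < (p.1 : ℝ) + μ * p.2 := by
    intro p hp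
    have h1 : min κ 1 * (N : ℝ) ≤ (p.1 : ℝ) + μ * p.2 := by
      have hμ0 : 0 ≤ μ := hκ.le.trans hκμ
      rcases not_and_or.1 hp with h | h
      · have h' : (N : ℝ) ≤ p.1 := by exact_mod_cast not_lt.1 h
        have : min κ 1 * (N : ℝ) ≤ 1 * N := by gcongr; exact min_le_right _ _
        have : 0 ≤ μ * (p.2 : ℝ) := by positivity
        linarith
      · have h' : (N : ℝ) ≤ p.2 := by exact_mod_cast not_lt.1 h
        have : min κ 1 * (N : ℝ) ≤ μ * p.2 := by
          gcongr
          exact (min_le_left _ _).trans hκμ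
        have : (0 : ℝ) ≤ p.1 := by positivity
        linarith
    linarith
  obtain ⟨k, hk, hk'⟩ := hs μ hκμ α ((boxSupport s N).filter (fun p => (p.1 : ℝ) + μ * p.2 = α))
    ⟨p₀, Finset.mem_filter.2 ⟨hp₀, rfl⟩⟩ (fun p => by
      rw [Finset.mem_filter, mem_boxSupport]
      constructor
      · rintro ⟨⟨_, h1⟩, h2⟩; exact ⟨h1, h2⟩
      · rintro ⟨h1, h2⟩
        refine ⟨⟨?_, h1⟩, h2⟩
        by_contra h
        exact (hout p h).ne' h2)
    (fun a b hab => by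
      by_cases h : a < N ∧ b < N
      · exact hmin (a, b) (mem_boxSupport.2 ⟨h, hab⟩)
      · exact (hout (a, b) h).le)
    (Real.exp τ) (Real.exp_pos τ)
  -- With t = e^τ the limit relations are, up to a positive factor, the sums of the nondegeneracy
  -- condition for this face.
  apply hk'
  have h0 := hzero k hk
  rw [← Finset.sum_filter_add_sum_filter_not (boxSupport s N) (fun p => (p.1 : ℝ) + μ * p.2 = α)] at h0
  have h1 : ∑ p ∈ (boxSupport s N).filter (fun p => ¬ (p.1 : ℝ) + μ * p.2 = α),
      s p.1 p.2 * (p.2.descFactorial k : ℝ) * l p = 0 := by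
    refine Finset.sum_eq_zero fun p hp => ?_
    obtain ⟨h1, h2⟩ := Finset.mem_filter.1 hp
    rw [hbig p h1 (lt_of_le_of_ne (hmin p h1) (Ne.symm h2)), mul_zero]
  have h2 : ∑ p ∈ (boxSupport s N).filter (fun p => (p.1 : ℝ) + μ * p.2 = α),
      s p.1 p.2 * (p.2.descFactorial k : ℝ) * l p = (l p₀ * Real.exp (-(p₀.2 * τ))) *
      ∑ p ∈ (boxSupport s N).filter (fun p => (p.1 : ℝ) + μ * p.2 = α),
        s p.1 p.2 * (p.2.descFactorial k : ℝ) * Real.exp τ ^ p.2 := by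
    rw [Finset.mul_sum]
    refine Finset.sum_congr rfl fun p hp => ?_
    obtain ⟨h1, h2⟩ := Finset.mem_filter.1 hp
    rw [heq p h1 h2]; ring
  rw [h1, add_zero, h2] at h0
  rcases mul_eq_zero.1 h0 with h | h
  · exact absurd h (by positivity)
  · exact h

/-- Away from the axes, `S` and its derivatives in `y` are controlled from both sides by the
monomials of the Newton polygon. -/
theorem exists_newton_bounds {S : ℝ × ℝ → ℝ} (hS : ContDiff ℝ ∞ S) {κ : ℝ} (hκ : 0 < κ) {K : ℕ}
    (hK : 0 < K) (hs : FaceNondegenerate (taylorCoeff S) κ K) (M : ℝ) {A B : ℕ}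
    (hAB : taylorCoeff S A B ≠ 0) :
    ∃ N c C ρ, A < N ∧ B < N ∧ 0 < c ∧ 0 < C ∧ 0 < ρ ∧ ρ ≤ 1 ∧ ∀ x y : ℝ, 0 < x → x < ρ →
      x ^ M ≤ y → y ≤ 2 * x ^ κ →
      (∃ k < K, c * newtonMajorant (taylorCoeff S) N x y ≤ |y ^ k * (dY^[k] S) (x, y)|) ∧
      ∀ k ≤ K, |y ^ k * (dY^[k] S) (x, y)| ≤ C * newtonMajorant (taylorCoeff S) N x y := by
  set s := taylorCoeff S with hsdef
  have hκ1 : 0 < min κ 1 := lt_min hκ one_pos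
  obtain ⟨N, hN⟩ : ∃ N : ℕ, A < N ∧ B < N ∧ (A : ℝ) + M * B + 1 ≤ min κ 1 * N := by
    obtain ⟨n, hn⟩ := exists_nat_ge (((A : ℝ) + M * B + 1) / min κ 1)
    refine ⟨n + A + B + 1, by omega, by omega, ?_⟩
    rw [div_le_iff₀ hκ1] at hn
    push_cast
    have : 0 ≤ min κ 1 * ((A : ℝ) + B + 1) := by positivity
    linarith
  obtain ⟨hA, hB, hN⟩ := hN
  have hjet := fun k => jet_bound hS k N
  choose C hC0 hC using hjet
  -- the region
  obtain ⟨ρ₀, hρ₀, hρ₀1, hreg⟩ : ∃ ρ₀ : ℝ, 0 < ρ₀ ∧ ρ₀ ≤ 1 ∧ ∀ x y : ℝ, 0 < x → x < ρ₀ →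
      x ^ M ≤ y → y ≤ 2 * x ^ κ → y ≤ 1 := by
    have h1 : Tendsto (fun x : ℝ => 2 * x ^ κ) (𝓝 0) (𝓝 (2 * 0 ^ κ)) :=
      ((Real.continuous_rpow_const hκ.le).tendsto 0).const_mul 2
    rw [Real.zero_rpow hκ.ne', mul_zero] at h1
    obtain ⟨r, hr, hr'⟩ := Metric.eventually_nhds_iff.1 (h1.eventually_lt_const one_pos)
    refine ⟨min r 1, by positivity, min_le_right _ _, fun x y hx0 hx _ hy => hy.trans (hr' ?_).le⟩
    rw [Real.dist_eq, sub_zero, abs_of_pos hx0]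
    exact hx.trans_le (min_le_left _ _)
  have hrem : ∀ k x y, 0 < x → x < ρ₀ → x ^ M ≤ y → y ≤ 2 * x ^ κ →
      |y ^ k * (dY^[k] S) (x, y) - ∑ p ∈ boxSupport s N,
        s p.1 p.2 * (p.2.descFactorial k : ℝ) * (x ^ p.1 * y ^ p.2)|
      ≤ C k * 2 ^ N * x * newtonMajorant s N x y := by
    intro k x y hx0 hx hMy hy
    have hy0 : 0 < y := (Real.rpow_pos_of_pos hx0 M).trans_le hMy
    have hx1 : x ≤ 1 := hx.le.trans hρ₀1
    have h1 := hC k x y (by rwa [abs_of_pos hx0]) (by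
      rw [abs_of_pos hy0]; exact hreg x y hx0 hx hMy hy)
    rw [sum_box_eq_sum_boxSupport (taylorCoeff S) N k x y] at h1
    refine h1.trans ?_
    have h2 := max_pow_le_monomial hx0 hx1 hMy hy hN
    have h3 := monomial_le_newtonMajorant hx0.le hy0.le hA hB hAB
    have := hC0 k
    calc C k * max |x| |y| ^ N ≤ C k * (2 ^ N * x * (x ^ A * y ^ B)) := by gcongr
      _ ≤ C k * (2 ^ N * x * newtonMajorant s N x y) := by gcongr
      _ = _ := by ring
  obtain ⟨c, hc, ρ, hρ, hlow⟩ : ∃ c > 0, ∃ ρ > 0, ∀ x y : ℝ, 0 < x → x < ρ → x ^ M ≤ y →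
      y ≤ 2 * x ^ κ → ∃ k < K, c * newtonMajorant s N x y ≤ |y ^ k * (dY^[k] S) (x, y)| := by
    -- Failure for c = 1 / (n + 1), arbitrarily near the origin, gives a sequence along which the
    -- quantities with k < K are o of the majorant. The Taylor remainder is o of it too, so the same
    -- holds for the polynomial parts.
    by_contra! hcon
    have hsel : ∀ n : ℕ, ∃ x y : ℝ, 0 < x ∧ x < min ρ₀ (1 / ((n : ℝ) + 1)) ∧ x ^ M ≤ y ∧
        y ≤ 2 * x ^ κ ∧ ∀ k < K, |y ^ k * (dY^[k] S) (x, y)|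
          < 1 / ((n : ℝ) + 1) * newtonMajorant s N x y := by
      intro n
      obtain ⟨x, y, h1, h2, h3, h4, h5⟩ := hcon (1 / ((n : ℝ) + 1)) (by positivity)
        (min ρ₀ (1 / ((n : ℝ) + 1))) (by positivity)
      exact ⟨x, y, h1, h2, h3, h4, h5⟩
    choose x y hx0 hx hMy hy hsmall using hsel
    have hy0 : ∀ n, 0 < y n := fun n => (Real.rpow_pos_of_pos (hx0 n) M).trans_le (hMy n)
    have hxlim : Tendsto x atTop (𝓝 0) :=
      squeeze_zero (fun n => (hx0 n).le) (fun n => ((hx n).trans_le (min_le_right _ _)).le)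
        tendsto_one_div_add_atTop_nhds_zero_nat
    refine exists_face_of_tendsto hκ hK hs hA hB hAB hN hx0 hxlim hMy hy fun k hk => ?_
    have hb : Tendsto (fun n : ℕ => 1 / ((n : ℝ) + 1) + C k * 2 ^ N * x n) atTop (𝓝 0) := by
      simpa using tendsto_one_div_add_atTop_nhds_zero_nat.add (hxlim.const_mul (C k * 2 ^ N))
    refine squeeze_zero_norm (fun n => ?_) hb
    have hΛ : 0 < newtonMajorant s N (x n) (y n) :=
      (by have := hx0 n; have := hy0 n; positivity : 0 < x n ^ A * y n ^ B).trans_le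
      (monomial_le_newtonMajorant (hx0 n).le (hy0 n).le hA hB hAB)
    rw [Real.norm_eq_abs, abs_div, abs_of_pos hΛ, div_le_iff₀ hΛ]
    have h1 := hrem k (x n) (y n) (hx0 n) ((hx n).trans_le (min_le_left _ _)) (hMy n) (hy n)
    have h2 := hsmall n k hk
    have h3 := abs_sub_abs_le_abs_sub (∑ p ∈ boxSupport s N,
        s p.1 p.2 * (p.2.descFactorial k : ℝ) * (x n ^ p.1 * y n ^ p.2))
        (y n ^ k * (dY^[k] S) (x n, y n))
    rw [abs_sub_comm] at h3
    linarith
  set D : ℕ → ℝ := fun k => ∑ p ∈ boxSupport s N, |s p.1 p.2 * (p.2.descFactorial k : ℝ)| with hD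
  have hD0 : ∀ k, 0 ≤ D k := fun k => Finset.sum_nonneg fun _ _ => abs_nonneg _
  refine ⟨N, c, ∑ k ∈ Finset.range (K + 1), (D k + C k * 2 ^ N) + 1, min ρ ρ₀, hA, hB, hc, ?_,
    lt_min hρ hρ₀, (min_le_right _ _).trans hρ₀1, fun x y hx0 hx hMy hy =>
    ⟨hlow x y hx0 (hx.trans_le (min_le_left _ _)) hMy hy, fun k hk => ?_⟩⟩
  · have : 0 ≤ ∑ k ∈ Finset.range (K + 1), (D k + C k * 2 ^ N) :=
      Finset.sum_nonneg fun k _ => by have := hD0 k; have := hC0 k; positivity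
    linarith
  · have hx' := hx.trans_le (min_le_right _ _)
    have hy0 : 0 < y := (Real.rpow_pos_of_pos hx0 M).trans_le hMy
    have h1 := hrem k x y hx0 hx' hMy hy
    have hΛ0 : 0 ≤ newtonMajorant s N x y := Finset.sum_nonneg fun p _ => by positivity
    have h2 : |∑ p ∈ boxSupport s N, s p.1 p.2 * (p.2.descFactorial k : ℝ) * (x ^ p.1 * y ^ p.2)|
        ≤ D k * newtonMajorant s N x y := by
      refine (Finset.abs_sum_le_sum_abs _ _).trans ?_
      rw [hD, Finset.sum_mul]
      refine Finset.sum_le_sum fun p hp => ?_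
      rw [abs_mul, abs_of_pos (by positivity : 0 < x ^ p.1 * y ^ p.2)]
      gcongr
      obtain ⟨⟨h1, h2⟩, h3⟩ := mem_boxSupport.1 hp
      exact monomial_le_newtonMajorant hx0.le hy0.le h1 h2 h3
    have h3 := abs_sub_abs_le_abs_sub (y ^ k * (dY^[k] S) (x, y)) (∑ p ∈ boxSupport s N,
        s p.1 p.2 * (p.2.descFactorial k : ℝ) * (x ^ p.1 * y ^ p.2))
    have h4 : D k + C k * 2 ^ N ≤ ∑ k ∈ Finset.range (K + 1), (D k + C k * 2 ^ N) :=
      Finset.single_le_sum (f := fun k => D k + C k * 2 ^ N)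
        (fun k _ => by have := hD0 k; have := hC0 k; positivity) (Finset.mem_range.2 (by omega))
    have h5 : C k * 2 ^ N * x * newtonMajorant s N x y ≤ C k * 2 ^ N * 1 * newtonMajorant s N x y := by
      have := hC0 k
      gcongr
      exact hx'.le.trans hρ₀1
    have h6 : (D k + C k * 2 ^ N) * newtonMajorant s N x y
      ≤ (∑ k ∈ Finset.range (K + 1), (D k + C k * 2 ^ N) + 1) * newtonMajorant s N x y :=
      mul_le_mul_of_nonneg_right (by linarith) hΛ0
    linarith

/-- For y ∈ [a, 2 a] the majorant at (x, y) is comparable to that at (x, a), and keeping only the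
monomial (A, B) of it weakens the estimate. The factor 2 in the region y ≤ 2 x^κ of the Newton
bounds serves to cover all of [a, 2 a]. -/
theorem exists_dyadic_bound {S : ℝ × ℝ → ℝ} (hS : ContDiff ℝ ∞ S) {κ : ℝ} (hκ : 0 < κ) {K : ℕ}
    (hK : 0 < K) (hs : FaceNondegenerate (taylorCoeff S) κ K) {q : ℝ} (hq : 1 ≤ q)
    (hKq : (K : ℝ) - 1 ≤ q) (M : ℝ) {A B : ℕ} (hAB : taylorCoeff S A B ≠ 0) :
    ∃ D ρ : ℝ, 0 < D ∧ 0 < ρ ∧ ρ ≤ 1 ∧ ∀ x a ε : ℝ, 0 < x → x < ρ → x ^ M ≤ a → a ≤ x ^ κ → 0 < ε →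
      volume {y | y ∈ Set.Icc a (2 * a) ∧ |S (x, y)| < ε}
        ≤ ENNReal.ofReal (D * a * (ε / (x ^ A * a ^ B)) ^ (1 / q)) := by
  obtain ⟨N, c, C, ρ, hA, hB, hc, hC, hρ, hρ1, h⟩ := exists_newton_bounds hS hκ hK hs M hAB
  obtain ⟨D, hD, hD'⟩ := exists_volume_sublevel_le_dyadic K hc (C := C * 2 ^ N) (by positivity) hq hKq
  refine ⟨D, ρ, hD, hρ, hρ1, fun x a ε hx0 hx hMa haκ hε => ?_⟩
  have ha : 0 < a := (Real.rpow_pos_of_pos hx0 M).trans_le hMa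
  have hmono := monomial_le_newtonMajorant hx0.le ha.le hA hB hAB
  have hΛ : 0 < newtonMajorant (taylorCoeff S) N x a :=
    (by positivity : 0 < x ^ A * a ^ B).trans_le hmono
  refine (hD' _ (isDerivChain_dY hS x) a ha _ hΛ (fun y hy => ?_) (fun k hk y hy => ?_) ε hε).trans
    (ENNReal.ofReal_le_ofReal ?_)
  · obtain ⟨k, hk, hk'⟩ := (h x y hx0 hx (hMa.trans hy.1) (by linarith [hy.2])).1
    refine ⟨k, hk, le_trans ?_ hk'⟩
    gcongr
    unfold newtonMajorant
    gcongr
    exact hy.1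
  · refine ((h x y hx0 hx (hMa.trans hy.1) (by linarith [hy.2])).2 k hk).trans ?_
    rw [mul_assoc]
    gcongr
    unfold newtonMajorant
    rw [Finset.mul_sum]
    refine Finset.sum_le_sum fun p hp => ?_
    have h1 : y ^ p.2 ≤ 2 ^ N * a ^ p.2 := by
      calc y ^ p.2 ≤ (2 * a) ^ p.2 := pow_le_pow_left₀ (ha.le.trans hy.1) hy.2 _
        _ = 2 ^ p.2 * a ^ p.2 := mul_pow _ _ _
        _ ≤ _ := by
          gcongr
          · norm_num
          · exact (mem_boxSupport.1 hp).1.2.le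
    calc x ^ p.1 * y ^ p.2 ≤ x ^ p.1 * (2 ^ N * a ^ p.2) := by gcongr
      _ = _ := by ring
  · gcongr

/-! ### Estimates near the axis and on whole slices -/

/-- `(A, B)` is the corner of the horizontal ray of the Newton polygon of `s`. -/
def IsLowest (s : ℕ → ℕ → ℝ) (A B : ℕ) : Prop :=
  s A B ≠ 0 ∧ ∀ a b, s a b ≠ 0 → B < b ∨ (B = b ∧ A ≤ a)

theorem exists_isLowest {s : ℕ → ℕ → ℝ} (h : ∃ a b, s a b ≠ 0) : ∃ A B, IsLowest s A B := by
  classical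
  have h1 : ∃ b a, s a b ≠ 0 := by obtain ⟨a, b, h⟩ := h; exact ⟨b, a, h⟩
  have h2 := Nat.find_spec h1
  refine ⟨Nat.find h2, Nat.find h1, Nat.find_spec h2, fun a b hab => ?_⟩
  rcases lt_or_eq_of_le (Nat.find_min' h1 ⟨a, hab⟩) with h3 | h3
  · exact Or.inl h3
  · exact Or.inr ⟨h3, Nat.find_min' h2 (h3 ▸ hab)⟩

theorem IsLowest.snd_le {s : ℕ → ℕ → ℝ} {A B a b : ℕ} (h : IsLowest s A B) (hab : s a b ≠ 0) :
    B ≤ b := by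
  rcases h.2 a b hab with h | h
  · exact h.le
  · exact h.1.le

/-- On the axis ∂_y^B S = s x^A + O(x^(A+1)) with s ≠ 0, because the earlier coefficients of the row
B vanish. Moving off the axis by at most x^(A+1) changes the value by another O(x^(A+1)). -/
theorem exists_lower_bound_near_axis {S : ℝ × ℝ → ℝ} (hS : ContDiff ℝ ∞ S) {A B : ℕ}
    (h : IsLowest (taylorCoeff S) A B) :
    ∃ c ρ : ℝ, 0 < c ∧ 0 < ρ ∧ ρ ≤ 1 ∧ ∀ x y : ℝ, 0 < x → x < ρ → |y| ≤ x ^ (A + 1) →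
      c * x ^ A ≤ |(dY^[B] S) (x, y)| := by
  set f := dY^[B] S with hf
  have hfs : ContDiff ℝ ∞ f := contDiff_iterate_dY hS B
  obtain ⟨C, hC0, hC⟩ := taylor_bound_box hfs (A + 1)
  obtain ⟨C', hC'0, hC'⟩ := exists_bound_of_continuous (contDiff_dY hfs).continuous 1
  set s := taylorCoeff f A 0 with hs
  have hs0 : s ≠ 0 := by
    rw [hs, taylorCoeff_iterate_dY hS]
    simp only [zero_add, Nat.descFactorial_self]
    have := h.1
    positivity
  have hspos : 0 < |s| := abs_pos.2 hs0
  refine ⟨|s| / 2, min 1 (|s| / (2 * (C + C' + 1))), by positivity, by positivity, min_le_left _ _,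
    fun x y hx0 hx hy => ?_⟩
  have hx1 : x ≤ 1 := hx.le.trans (min_le_left _ _)
  have hy1 : |y| ≤ 1 := hy.trans (pow_le_one₀ hx0.le hx1)
  have h1 : |f (x, 0) - s * x ^ A| ≤ C * x ^ (A + 1) := by
    have := hC x 0 (by rwa [abs_of_pos hx0]) (by simp)
    rw [abs_zero, max_eq_left (abs_nonneg x), abs_of_pos hx0] at this
    convert this using 3
    rw [Finset.sum_eq_single A]
    · rw [Finset.sum_eq_single 0]
      · simp [hs]
      · intro b _ hb; simp [hb]
      · simp
    · intro a ha haA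
      refine Finset.sum_eq_zero fun b _ => ?_
      rcases Nat.eq_zero_or_pos b with rfl | hb
      · have : taylorCoeff f a 0 = 0 := by
          rw [taylorCoeff_iterate_dY hS]
          simp only [zero_add]
          have : taylorCoeff S a B = 0 := by
            by_contra hne
            rcases h.2 a B hne with h' | h'
            · omega
            · have := Finset.mem_range.1 ha; omega
          rw [this, zero_mul]
        rw [this]; simp
      · rw [zero_pow hb.ne']; simp
    · simp
  have h2 : |f (x, y) - f (x, 0)| ≤ C' * |y| := by
    have := (convex_Icc (-1 : ℝ) 1).norm_image_sub_le_of_norm_hasDerivWithin_le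
      (f := fun z => f (x, z)) (f' := fun z => dY f (x, z)) (C := C') (x := 0) (y := y)
      (fun z _ => (hasDerivAt_dY hfs x z).hasDerivWithinAt) (fun z hz => by
        rw [Real.norm_eq_abs]
        exact hC' x z (by rwa [abs_of_pos hx0]) (abs_le.2 hz)) (by norm_num) (abs_le.1 hy1)
    simpa [Real.norm_eq_abs] using this
  have h3 : (C + C') * x ^ (A + 1) ≤ |s| / 2 * x ^ A := by
    have h4 : x * (2 * (C + C' + 1)) ≤ |s| := by
      have := hx.le.trans (min_le_right _ _)
      rwa [le_div_iff₀ (by positivity)] at this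
    rw [pow_succ]
    have : 0 < x ^ A := by positivity
    nlinarith
  have h5 : |s * x ^ A| ≤ |f (x, y)| + |f (x, y) - f (x, 0)| + |f (x, 0) - s * x ^ A| := by
    have e : s * x ^ A = f (x, y) - (f (x, y) - f (x, 0)) - (f (x, 0) - s * x ^ A) := by ring
    calc |s * x ^ A| = |f (x, y) - (f (x, y) - f (x, 0)) - (f (x, 0) - s * x ^ A)| := by rw [← e]
      _ ≤ _ := (abs_sub _ _).trans (add_le_add (abs_sub _ _) le_rfl)
  have h6 : C' * |y| ≤ C' * x ^ (A + 1) := by gcongr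
  rw [abs_mul, abs_of_pos (by positivity : 0 < x ^ A)] at h5
  linarith

/-- Near the axis the sublevel sets are controlled by the derivative of order `B`. -/
theorem exists_volume_le_near_axis {S : ℝ × ℝ → ℝ} (hS : ContDiff ℝ ∞ S) {A B : ℕ}
    (h : IsLowest (taylorCoeff S) A B) (hB : B ≠ 0) :
    ∃ C ρ : ℝ, 0 < C ∧ 0 < ρ ∧ ρ ≤ 1 ∧ ∀ x ε : ℝ, 0 < x → x < ρ → 0 < ε →
      volume {y | y ∈ Set.Icc 0 (x ^ (A + 1)) ∧ |S (x, y)| < ε}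
        ≤ ENNReal.ofReal (C * (ε / x ^ A) ^ (1 / (B : ℝ))) := by
  obtain ⟨c, ρ, hc, hρ, hρ1, h⟩ := exists_lower_bound_near_axis hS h
  refine ⟨4 ^ (B + 1) * (1 / c) ^ (1 / (B : ℝ)), ρ, by positivity, hρ, hρ1,
    fun x ε hx0 hx hε => ?_⟩
  refine (volume_sublevel_le_rpow (isDerivChain_dY hS x) hB (l := c * x ^ A) (by positivity) hε
    (fun y hy => h x y hx0 hx (by rw [abs_of_nonneg hy.1]; exact hy.2))).trans
    (le_of_eq ?_)
  rw [mul_assoc, ← Real.mul_rpow (by positivity) (by positivity)]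
  congr 3
  field_simp

/-- For B > 0 the trivial bound x^M and the bound from ∂_y^B S are combined as a geometric mean with
weights 1 - B / q and B / q: this produces ε^(1/q), and a large M makes the power of x as high as
desired. For B = 0 the set is empty unless ε > c x^A, and then the trivial bound suffices. -/
theorem exists_volume_le_near_axis_rpow {S : ℝ × ℝ → ℝ} (hS : ContDiff ℝ ∞ S) {A B : ℕ}
    (h : IsLowest (taylorCoeff S) A B) {q : ℝ} (hq : 0 < q) (hBq : (B : ℝ) < q) (L : ℝ) :
    ∃ M C ρ : ℝ, 0 < C ∧ 0 < ρ ∧ ρ ≤ 1 ∧ ∀ x ε : ℝ, 0 < x → x < ρ → 0 < ε →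
      volume {y | y ∈ Set.Icc 0 (x ^ M) ∧ |S (x, y)| < ε}
        ≤ ENNReal.ofReal (C * ε ^ (1 / q) * x ^ L) := by
  have hq' : 0 < 1 - (B : ℝ) / q := by rw [sub_pos, div_lt_one hq]; exact hBq
  -- The second entry solves M (1 - B / q) - A / q ≥ L. The first puts [0, x^M] inside the region
  -- where ∂_y^B S is bounded below.
  set M : ℝ := max (A + 1 : ℕ) ((L + A / q) / (1 - B / q)) with hM
  have hM1 : ((A + 1 : ℕ) : ℝ) ≤ M := le_max_left _ _
  have hM2 : L + A / q ≤ M * (1 - B / q) := by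
    rw [← div_le_iff₀ hq']; exact le_max_right _ _
  have hxM : ∀ x : ℝ, 0 < x → x ≤ 1 → x ^ M ≤ x ^ (A + 1) := fun x hx0 hx1 => by
    rw [← Real.rpow_natCast]
    exact Real.rpow_le_rpow_of_exponent_ge hx0 hx1 hM1
  rcases Nat.eq_zero_or_pos B with hB | hB
  · subst hB
    obtain ⟨c, ρ, hc, hρ, hρ1, h⟩ := exists_lower_bound_near_axis hS h
    refine ⟨M, (1 / c) ^ (1 / q), ρ, by positivity, hρ, hρ1, fun x ε hx0 hx hε => ?_⟩
    have hx1 := hx.le.trans hρ1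
    rcases le_or_gt ε (c * x ^ A) with hle | hlt
    · have : {y | y ∈ Set.Icc 0 (x ^ M) ∧ |S (x, y)| < ε} = ∅ := by
        ext y
        simp only [Set.mem_ofPred_eq, Set.mem_empty_iff_false, iff_false, not_and, not_lt]
        intro hy
        refine hle.trans (h x y hx0 hx ?_)
        rw [abs_of_nonneg hy.1]
        exact hy.2.trans (hxM x hx0 hx1)
      rw [this]; simp
    · refine (measure_mono (fun y hy => hy.1)).trans ?_
      rw [Real.volume_Icc, sub_zero]
      apply ENNReal.ofReal_le_ofReal
      rw [← Real.mul_rpow (by positivity) hε.le]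
      have h1 : x ^ ((A : ℝ) / q) ≤ (1 / c * ε) ^ (1 / q) := by
        rw [div_eq_mul_one_div, Real.rpow_mul hx0.le, Real.rpow_natCast]
        apply Real.rpow_le_rpow (by positivity) _ (by positivity)
        rw [one_div_mul_eq_div, le_div_iff₀ hc]
        linarith
      calc x ^ M ≤ x ^ ((A : ℝ) / q + L) := by
            apply Real.rpow_le_rpow_of_exponent_ge hx0 hx1
            simp at hM2; linarith
        _ = x ^ ((A : ℝ) / q) * x ^ L := Real.rpow_add hx0 _ _
        _ ≤ _ := by gcongr
  · obtain ⟨C, ρ, hC, hρ, hρ1, h⟩ := exists_volume_le_near_axis hS h hB.ne'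
    have hB' : (0 : ℝ) < B := by exact_mod_cast hB
    refine ⟨M, C ^ ((B : ℝ) / q), ρ, by positivity, hρ, hρ1, fun x ε hx0 hx hε => ?_⟩
    have hx1 := hx.le.trans hρ1
    set v := volume {y | y ∈ Set.Icc 0 (x ^ M) ∧ |S (x, y)| < ε} with hv
    have h1 : v ≤ ENNReal.ofReal (x ^ M) := by
      refine (measure_mono (fun y hy => hy.1)).trans ?_
      rw [Real.volume_Icc, sub_zero]
    have h2 : v ≤ ENNReal.ofReal (C * (ε / x ^ A) ^ (1 / (B : ℝ))) := by
      refine (measure_mono ?_).trans (h x ε hx0 hx hε)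
      rintro y ⟨⟨hy1, hy2⟩, hy3⟩
      exact ⟨⟨hy1, hy2.trans (hxM x hx0 hx1)⟩, hy3⟩
    have hvtop : v ≠ ⊤ := (h1.trans_lt ENNReal.ofReal_lt_top).ne
    rw [← ENNReal.ofReal_toReal hvtop]
    apply ENNReal.ofReal_le_ofReal
    set r := v.toReal with hr
    have hr0 : 0 ≤ r := ENNReal.toReal_nonneg
    have h1' : r ≤ x ^ M := ENNReal.toReal_le_of_le_ofReal (by positivity) h1
    have h2' : r ≤ C * (ε / x ^ A) ^ (1 / (B : ℝ)) :=
      ENNReal.toReal_le_of_le_ofReal (by positivity) h2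
    have e1 : r = r ^ (1 - (B : ℝ) / q) * r ^ ((B : ℝ) / q) := by
      rcases hr0.eq_or_lt with h0 | h0
      · rw [← h0, Real.zero_rpow hq'.ne', zero_mul]
      · rw [← Real.rpow_add h0]; simp
    rw [e1]
    calc r ^ (1 - (B : ℝ) / q) * r ^ ((B : ℝ) / q)
        ≤ (x ^ M) ^ (1 - (B : ℝ) / q) * (C * (ε / x ^ A) ^ (1 / (B : ℝ))) ^ ((B : ℝ) / q) := by
          gcongr
      _ = C ^ ((B : ℝ) / q) * ε ^ (1 / q) * x ^ (M * (1 - B / q) - A / q) := by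
          rw [Real.mul_rpow hC.le (by positivity), ← Real.rpow_mul hx0.le,
            ← Real.rpow_mul (by positivity)]
          have e2 : 1 / (B : ℝ) * (B / q) = 1 / q := by field_simp
          rw [e2, Real.div_rpow hε.le (by positivity), ← Real.rpow_natCast, ← Real.rpow_mul hx0.le,
            Real.rpow_sub hx0]
          rw [show (A : ℝ) * (1 / q) = A / q by ring]
          ring
      _ ≤ _ := by
          gcongr C ^ ((B : ℝ) / q) * ε ^ (1 / q) * ?_
          exact Real.rpow_le_rpow_of_exponent_ge hx0 hx1 (by linarith)

/-- Slice estimate from a point `(A, B)` of the Newton polygon with `B < q`. -/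
theorem exists_slice_bound_low {S : ℝ × ℝ → ℝ} (hS : ContDiff ℝ ∞ S) {κ : ℝ} (hκ : 0 < κ) {K : ℕ}
    (hK : 0 < K) (hs : FaceNondegenerate (taylorCoeff S) κ K) {q : ℝ} (hq : 1 ≤ q)
    (hKq : (K : ℝ) - 1 ≤ q) {A B : ℕ} (hAB : taylorCoeff S A B ≠ 0) (hBq : (B : ℝ) < q) (L : ℝ) :
    ∃ C ρ : ℝ, 0 < C ∧ 0 < ρ ∧ ρ ≤ 1 ∧ ∀ x b ε : ℝ, 0 < x → x < ρ → 0 < b → b ≤ x ^ κ → 0 < ε →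
      volume {y | y ∈ Set.Ioc 0 b ∧ |S (x, y)| < ε}
        ≤ ENNReal.ofReal (C * (ε / x ^ A) ^ (1 / q) * b ^ (1 - B / q) + C * ε ^ (1 / q) * x ^ L) := by
  obtain ⟨A₀, B₀, h₀⟩ := exists_isLowest ⟨A, B, hAB⟩
  have hq0 : 0 < q := by linarith
  have hB₀ : (B₀ : ℝ) < q := lt_of_le_of_lt (by exact_mod_cast h₀.snd_le hAB) hBq
  obtain ⟨M, C, ρ, hC, hρ, hρ1, h1⟩ := exists_volume_le_near_axis_rpow hS h₀ hq0 hB₀ L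
  obtain ⟨D, ρ', hD, hρ', hρ'1, h2⟩ := exists_dyadic_bound hS hκ hK hs hq hKq (M + 1) hAB
  have hγ : 0 < 1 - (B : ℝ) / q := by rw [sub_pos, div_lt_one hq0]; exact hBq
  set g := 1 - (2⁻¹ : ℝ) ^ (1 - (B : ℝ) / q) with hg
  have hg0 : 0 < g := sub_pos.2 (Real.rpow_lt_one (by norm_num) (by norm_num) hγ)
  refine ⟨max C (D / g), min (min ρ ρ') (1 / 2), by positivity, by positivity,
    ((min_le_left _ _).trans (min_le_left _ _)).trans hρ1, fun x b ε hx0 hx hb hbκ hε => ?_⟩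
  have hxρ : x < ρ := hx.trans_le ((min_le_left _ _).trans (min_le_left _ _))
  have hxρ' : x < ρ' := hx.trans_le ((min_le_left _ _).trans (min_le_right _ _))
  have hx2 : x ≤ 1 / 2 := hx.le.trans (min_le_right _ _)
  set Z := {y | x ^ M ≤ y ∧ |S (x, y)| < ε} with hZ
  have hsub : {y | y ∈ Set.Ioc 0 b ∧ |S (x, y)| < ε} ⊆ (Z ∩ Set.Ioc 0 b) ∪
      {y | y ∈ Set.Icc 0 (x ^ M) ∧ |S (x, y)| < ε} := by
    rintro y ⟨hy, hy'⟩
    rcases le_total (x ^ M) y with h | h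
    · exact Or.inl ⟨⟨h, hy'⟩, hy⟩
    · exact Or.inr ⟨⟨hy.1.le, h⟩, hy'⟩
  have hdy : volume (Z ∩ Set.Ioc 0 b) ≤ ENNReal.ofReal
      ((D * (ε / x ^ A) ^ (1 / q)) / g * b ^ (1 - (B : ℝ) / q)) := by
    refine volume_inter_Ioc_le_of_dyadic (by positivity) hγ hb fun a ha hab => ?_
    -- An interval [a, 2 a] reaching the height x^M has a ≥ x^M / 2 ≥ x^(M+1), since x ≤ 1 / 2.
    -- Hence the dyadic bound was requested for the exponent M + 1.
    by_cases hMa : x ^ (M + 1) ≤ a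
    · refine (measure_mono ?_).trans ((h2 x a ε hx0 hxρ' hMa (hab.trans hbκ) hε).trans
        (ENNReal.ofReal_le_ofReal (le_of_eq ?_)))
      · rintro y ⟨hy, hy'⟩
        exact ⟨hy', hy.2⟩
      · rw [← div_div, Real.div_rpow (by positivity) (by positivity) (1 / q), ← Real.rpow_natCast a,
          ← Real.rpow_mul ha.le, Real.rpow_sub ha, Real.rpow_one, mul_one_div]
        ring
    · have : Z ∩ Set.Icc a (2 * a) = ∅ := by
        ext y
        simp only [Set.mem_inter_iff, Set.mem_empty_iff_false, iff_false, not_and]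
        rintro ⟨h3, _⟩ ⟨_, h4⟩
        apply hMa
        rw [Real.rpow_add hx0, Real.rpow_one]
        have : 0 < x ^ M := by positivity
        nlinarith
      rw [this]; simp
  refine (measure_mono hsub).trans ((measure_union_le _ _).trans
    ((add_le_add hdy (h1 x ε hx0 hxρ hε)).trans ?_))
  rw [← ENNReal.ofReal_add (by positivity) (by positivity)]
  apply ENNReal.ofReal_le_ofReal
  have e : D * (ε / x ^ A) ^ (1 / q) / g * b ^ (1 - (B : ℝ) / q)
    = D / g * (ε / x ^ A) ^ (1 / q) * b ^ (1 - (B : ℝ) / q) := by ring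
  rw [e]
  gcongr
  · exact le_max_right _ _
  · exact le_max_left _ _

/-- Slice estimate from a point `(A, B)` of the Newton polygon with `q < B`. -/
theorem exists_slice_bound_high {S : ℝ × ℝ → ℝ} (hS : ContDiff ℝ ∞ S) {κ : ℝ} (hκ : 0 < κ) {K : ℕ}
    (hK : 0 < K) (hs : FaceNondegenerate (taylorCoeff S) κ K) {q : ℝ} (hq : 1 ≤ q)
    (hKq : (K : ℝ) - 1 ≤ q) {A B : ℕ} (hAB : taylorCoeff S A B ≠ 0) (hBq : q < B) (M : ℝ) :
    ∃ C ρ : ℝ, 0 < C ∧ 0 < ρ ∧ ρ ≤ 1 ∧ ∀ x a ε : ℝ, 0 < x → x < ρ → x ^ M ≤ a → 0 < ε →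
      volume {y | y ∈ Set.Icc a (x ^ κ) ∧ |S (x, y)| < ε}
        ≤ ENNReal.ofReal (C * (ε / x ^ A) ^ (1 / q) * a ^ (1 - B / q)) := by
  have hq0 : 0 < q := by linarith
  obtain ⟨D, ρ', hD, hρ', hρ'1, h2⟩ := exists_dyadic_bound hS hκ hK hs hq hKq M hAB
  have hγ : 1 - (B : ℝ) / q < 0 := by rw [sub_neg, one_lt_div hq0]; exact hBq
  set g := 1 - (2 : ℝ) ^ (1 - (B : ℝ) / q) with hg
  have hg0 : 0 < g := sub_pos.2 (Real.rpow_lt_one_of_one_lt_of_neg (by norm_num) hγ)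
  refine ⟨D / g, ρ', by positivity, hρ', hρ'1, fun x a ε hx0 hx hMa hε => ?_⟩
  have ha : 0 < a := (Real.rpow_pos_of_pos hx0 M).trans_le hMa
  have hset : {y | y ∈ Set.Icc a (x ^ κ) ∧ |S (x, y)| < ε}
      = {y | |S (x, y)| < ε} ∩ Set.Icc a (x ^ κ) := by
    ext y; exact and_comm
  rw [hset]
  refine (volume_inter_Icc_le_of_dyadic (D := D * (ε / x ^ A) ^ (1 / q)) (by positivity) hγ ha
    fun a' haa' ha'κ => ?_).trans (ENNReal.ofReal_le_ofReal (le_of_eq (by rw [hg]; ring)))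
  have ha' : 0 < a' := ha.trans_le haa'
  refine (measure_mono ?_).trans ((h2 x a' ε hx0 hx (hMa.trans haa') ha'κ hε).trans
        (ENNReal.ofReal_le_ofReal (le_of_eq ?_)))
  · rintro y ⟨hy, hy'⟩
    exact ⟨hy', hy⟩
  · rw [← div_div, Real.div_rpow (by positivity) (by positivity) (1 / q), ← Real.rpow_natCast a',
      ← Real.rpow_mul ha'.le, Real.rpow_sub ha', Real.rpow_one, mul_one_div]
    ring

/-! ### Slices of the sublevel set in a cusp -/

/-- A continuous bounded function supported in the box of radius `ρ`. -/
structure IsBoxFunction (ρ : ℝ) (φ : ℝ × ℝ → ℝ) : Prop where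
  continuous : Continuous φ
  bounded : ∃ C, 0 ≤ C ∧ ∀ p, |φ p| ≤ C
  support : ∀ p, φ p ≠ 0 → |p.1| < ρ ∧ |p.2| < ρ

theorem IsBoxFunction.integrable {ρ : ℝ} {φ : ℝ × ℝ → ℝ} (h : IsBoxFunction ρ φ) :
    Integrable φ := by
  refine h.continuous.integrable_of_hasCompactSupport (HasCompactSupport.intro
    ((isCompact_Icc (a := -ρ) (b := ρ)).prod (isCompact_Icc (a := -ρ) (b := ρ))) fun p hp => ?_)
  by_contra hne
  obtain ⟨h1, h2⟩ := h.support p hne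
  exact hp ⟨abs_le.1 h1.le, abs_le.1 h2.le⟩

/-- The part `0 < S < ε` of the cusp `0 < y < x ^ κ`. -/
def cuspSublevel (S : ℝ × ℝ → ℝ) (κ ε : ℝ) : Set (ℝ × ℝ) :=
  {p | 0 < p.1 ∧ 0 < p.2 ∧ p.2 < p.1 ^ κ ∧ 0 < S p ∧ S p < ε}

theorem measurableSet_cuspSublevel {S : ℝ × ℝ → ℝ} (hS : Continuous S) (κ ε : ℝ) :
    MeasurableSet (cuspSublevel S κ ε) := by
  unfold cuspSublevel
  refine (measurableSet_lt measurable_const measurable_fst).inter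
    ((measurableSet_lt measurable_const measurable_snd).inter
    ((measurableSet_lt measurable_snd (measurable_fst.pow_const κ)).inter
    ((measurableSet_lt measurable_const hS.measurable).inter
    (measurableSet_lt hS.measurable measurable_const))))

/-- The integral over a vertical slice of the sublevel set in the cusp. -/
noncomputable def sliceIntegral (S φ : ℝ × ℝ → ℝ) (κ ε x : ℝ) : ℝ :=
  ∫ y, (cuspSublevel S κ ε).indicator φ (x, y)

/-- The integral over the sublevel set in the cusp. -/
noncomputable def cuspIntegral (S φ : ℝ × ℝ → ℝ) (κ ε : ℝ) : ℝ :=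
  ∫ p, (cuspSublevel S κ ε).indicator φ p

section Slices

variable {S φ : ℝ × ℝ → ℝ} {κ ε ρ : ℝ}

theorem integrable_indicator_cusp (hS : Continuous S) (hφ : IsBoxFunction ρ φ) (κ ε : ℝ) :
    Integrable ((cuspSublevel S κ ε).indicator φ) :=
  hφ.integrable.indicator (measurableSet_cuspSublevel hS κ ε)

theorem cuspIntegral_eq (hS : Continuous S) (hφ : IsBoxFunction ρ φ) (κ ε : ℝ) :
    cuspIntegral S φ κ ε = ∫ x, sliceIntegral S φ κ ε x := by
  unfold cuspIntegral sliceIntegral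
  rw [Measure.volume_eq_prod, integral_prod]
  rw [← Measure.volume_eq_prod]
  exact integrable_indicator_cusp hS hφ κ ε

theorem integrable_sliceIntegral (hS : Continuous S) (hφ : IsBoxFunction ρ φ) (κ ε : ℝ) :
    Integrable (sliceIntegral S φ κ ε) := by
  have := integrable_indicator_cusp hS hφ κ ε
  rw [Measure.volume_eq_prod] at this
  exact this.integral_prod_left

theorem sliceIntegral_of_nonpos {x : ℝ} (hx : x ≤ 0) : sliceIntegral S φ κ ε x = 0 := by
  unfold sliceIntegral
  have : ∀ y, (cuspSublevel S κ ε).indicator φ (x, y) = 0 := fun y =>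
    Set.indicator_of_notMem (fun h => absurd h.1 (not_lt.2 hx)) _
  simp [this]

theorem sliceIntegral_of_le (hφ : IsBoxFunction ρ φ) {x : ℝ} (hx : ρ ≤ x) :
    sliceIntegral S φ κ ε x = 0 := by
  unfold sliceIntegral
  have : ∀ y, (cuspSublevel S κ ε).indicator φ (x, y) = 0 := fun y => by
    have : φ (x, y) = 0 := by
      by_contra h
      have := (hφ.support _ h).1
      exact absurd (le_abs_self x) (not_le.2 (this.trans_le hx))
    by_cases h : (x, y) ∈ cuspSublevel S κ ε
    · rw [Set.indicator_of_mem h, this]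
    · rw [Set.indicator_of_notMem h]
  simp [this]

/-- Bounding an integral over a set by a bound on its measure. -/
theorem abs_integral_le_of_volume_le {g : ℝ → ℝ} {C R : ℝ} {A : Set ℝ} (hR : 0 ≤ R)
    (hg : ∀ y, |g y| ≤ C) (hA : ∀ y, g y ≠ 0 → y ∈ A) (hvol : volume A ≤ ENNReal.ofReal R) :
    |∫ y, g y| ≤ C * R := by
  have hC : 0 ≤ C := (abs_nonneg _).trans (hg 0)
  -- The set controlling the support need not be measurable; its measurable hull has the same
  -- measure.
  set B := toMeasurable volume A with hB
  have hBm : MeasurableSet B := measurableSet_toMeasurable _ _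
  have hBvol : volume B = volume A := measure_toMeasurable A
  have hfin : volume B < ⊤ := by rw [hBvol]; exact hvol.trans_lt ENNReal.ofReal_lt_top
  have h1 : ∫ y, g y = ∫ y in B, g y := by
    rw [setIntegral_eq_integral_of_forall_compl_eq_zero]
    intro y hy
    by_contra h
    exact hy (subset_toMeasurable _ _ (hA y h))
  rw [h1, ← Real.norm_eq_abs]
  refine (norm_setIntegral_le_of_norm_le_const hfin (C := C) (fun y _ => hg y)).trans ?_
  gcongr
  rw [measureReal_def, hBvol]
  exact ENNReal.toReal_le_of_le_ofReal hR hvol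

theorem abs_sliceIntegral_le {C R x : ℝ} (hC : ∀ p, |φ p| ≤ C) (hR : 0 ≤ R)
    (hvol : volume {y | y ∈ Set.Ioc 0 (x ^ κ) ∧ |S (x, y)| < ε} ≤ ENNReal.ofReal R) :
    |sliceIntegral S φ κ ε x| ≤ C * R := by
  have hC0 : 0 ≤ C := (abs_nonneg _).trans (hC 0)
  refine abs_integral_le_of_volume_le hR (fun y => ?_) (fun y hy => ?_) hvol
  · by_cases h : (x, y) ∈ cuspSublevel S κ ε
    · rw [Set.indicator_of_mem h]; exact hC _
    · rw [Set.indicator_of_notMem h, abs_zero]; exact hC0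
  · have h : (x, y) ∈ cuspSublevel S κ ε := Set.mem_of_indicator_ne_zero hy
    exact ⟨⟨h.2.1, h.2.2.1.le⟩, by rw [abs_of_pos h.2.2.2.1]; exact h.2.2.2.2⟩

theorem abs_sliceIntegral_le_rpow {C x : ℝ} (hC : ∀ p, |φ p| ≤ C) (hx : 0 ≤ x) :
    |sliceIntegral S φ κ ε x| ≤ C * x ^ κ := by
  refine abs_sliceIntegral_le hC (by positivity) ((measure_mono fun y hy => hy.1).trans ?_)
  rw [Real.volume_Ioc, sub_zero]

theorem sliceIntegral_eq_scaled {l : ℝ} (hl : 0 < l) (x : ℝ) :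
    sliceIntegral S φ κ ε x = l * ∫ w, (cuspSublevel S κ ε).indicator φ (x, l * w) := by
  have := Measure.integral_comp_mul_left (fun y => (cuspSublevel S κ ε).indicator φ (x, y)) l
  rw [this, abs_of_pos (by positivity), smul_eq_mul, ← mul_assoc, mul_inv_cancel₀ hl.ne', one_mul]
  rfl

end Slices

/-! ### Compact edges: the quasi-homogeneous limit in a cusp -/

/-- Limit of `S` under quasi-homogeneous dilations. -/
theorem tendsto_quasiHomogeneous {S : ℝ × ℝ → ℝ} (hS : ContDiff ℝ ∞ S) {u v l : ℝ} (hu : 0 < u)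
    (hv : 0 < v) {F : Finset (ℕ × ℕ)}
    (hF : ∀ p : ℕ × ℕ, p ∈ F ↔ taylorCoeff S p.1 p.2 ≠ 0 ∧ u * p.1 + v * p.2 = l)
    (hmin : ∀ a b : ℕ, taylorCoeff S a b ≠ 0 → l ≤ u * a + v * b) (X Y : ℝ) :
    Tendsto (fun δ : ℝ => S (δ ^ u * X, δ ^ v * Y) / δ ^ l) (𝓝[>] 0)
      (𝓝 (∑ p ∈ F, taylorCoeff S p.1 p.2 * X ^ p.1 * Y ^ p.2)) := by
  classical
  have huv : 0 < min u v := lt_min hu hv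
  -- For such N the Taylor remainder, of size δ^(N min u v), is o(δ^l), and the face fits into the
  -- box of exponents below N.
  obtain ⟨N, hN⟩ := exists_nat_gt (l / min u v)
  rw [div_lt_iff₀ huv] at hN
  obtain ⟨C, hC0, hC⟩ := taylor_bound_box hS N
  set s := taylorCoeff S with hs
  set Q := Finset.range N ×ˢ Finset.range N with hQ
  have hFQ : F ⊆ Q := by
    intro p hp
    obtain ⟨h1, h2⟩ := (hF p).1 hp
    have h3 : 0 ≤ u * (p.1 : ℝ) := by positivity
    have h4 : 0 ≤ v * (p.2 : ℝ) := by positivity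
    rw [hQ, Finset.mem_product, Finset.mem_range, Finset.mem_range]
    constructor
    · by_contra! h
      have h5 : (N : ℝ) ≤ p.1 := by exact_mod_cast h
      have : (N : ℝ) * min u v ≤ p.1 * u := by gcongr; exact min_le_left _ _
      linarith
    · by_contra! h
      have h5 : (N : ℝ) ≤ p.2 := by exact_mod_cast h
      have : (N : ℝ) * min u v ≤ p.2 * v := by gcongr; exact min_le_right _ _
      linarith
  have hz : ∀ w : ℝ, 0 < w → Tendsto (fun δ : ℝ => δ ^ w) (𝓝[>] 0) (𝓝 0) := fun w hw => by
    have := (Real.continuous_rpow_const hw.le).tendsto 0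
    rw [Real.zero_rpow hw.ne'] at this
    exact this.mono_left nhdsWithin_le_nhds
  -- the polynomial part
  have hpoly : Tendsto (fun δ : ℝ => (∑ a ∈ Finset.range N, ∑ b ∈ Finset.range N,
      s a b * (δ ^ u * X) ^ a * (δ ^ v * Y) ^ b) / δ ^ l) (𝓝[>] 0)
      (𝓝 (∑ p ∈ F, s p.1 p.2 * X ^ p.1 * Y ^ p.2)) := by
    have h1 : ∀ p ∈ Q, Tendsto (fun δ : ℝ => s p.1 p.2 * (δ ^ u * X) ^ p.1 * (δ ^ v * Y) ^ p.2 / δ ^ l)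
        (𝓝[>] 0) (𝓝 (if p ∈ F then s p.1 p.2 * X ^ p.1 * Y ^ p.2 else 0)) := by
      intro p _
      have e : (fun δ : ℝ => s p.1 p.2 * (δ ^ u * X) ^ p.1 * (δ ^ v * Y) ^ p.2 / δ ^ l)
          =ᶠ[𝓝[>] 0] fun δ => s p.1 p.2 * X ^ p.1 * Y ^ p.2 * δ ^ (u * p.1 + v * p.2 - l) := by
        filter_upwards [self_mem_nhdsWithin] with δ hδ
        have hδ' : 0 < δ := hδ
        rw [Real.rpow_sub hδ', Real.rpow_add hδ', Real.rpow_mul hδ'.le, Real.rpow_mul hδ'.le,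
          Real.rpow_natCast, Real.rpow_natCast, mul_pow, mul_pow]
        ring
      refine Tendsto.congr' e.symm ?_
      split_ifs with hp
      · rw [((hF p).1 hp).2]
        simp
      · by_cases hsp : s p.1 p.2 = 0
        · simp [hsp]
        · have h2 : l < u * p.1 + v * p.2 :=
            lt_of_le_of_ne (hmin _ _ hsp) fun h => hp ((hF p).2 ⟨hsp, h.symm⟩)
          have := (hz _ (sub_pos.2 h2)).const_mul (s p.1 p.2 * X ^ p.1 * Y ^ p.2)
          rwa [mul_zero] at this
    have h2 := tendsto_finsetSum Q h1
    rw [← Finset.sum_filter, Finset.filter_mem_eq_inter, Finset.inter_eq_right.2 hFQ] at h2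
    refine h2.congr fun δ => ?_
    rw [hQ, Finset.sum_product, Finset.sum_div]
    exact Finset.sum_congr rfl fun a _ => by rw [Finset.sum_div]
  -- the remainder
  have hXu : Tendsto (fun δ : ℝ => δ ^ u * X) (𝓝[>] 0) (𝓝 0) := by
    simpa using (hz u hu).mul_const X
  have hYv : Tendsto (fun δ : ℝ => δ ^ v * Y) (𝓝[>] 0) (𝓝 0) := by
    simpa using (hz v hv).mul_const Y
  have hrem : Tendsto (fun δ : ℝ => (S (δ ^ u * X, δ ^ v * Y) - ∑ a ∈ Finset.range N,
      ∑ b ∈ Finset.range N, s a b * (δ ^ u * X) ^ a * (δ ^ v * Y) ^ b) / δ ^ l) (𝓝[>] 0) (𝓝 0) := by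
    have hb : Tendsto (fun δ : ℝ => C * max |X| |Y| ^ N * δ ^ (min u v * N - l)) (𝓝[>] 0) (𝓝 0) := by
      have := (hz (min u v * N - l) (by linarith)).const_mul (C * max |X| |Y| ^ N)
      rwa [mul_zero] at this
    have hX1 : ∀ᶠ δ : ℝ in 𝓝[>] 0, |δ ^ u * X| ≤ 1 := by
      have := hXu.abs
      rw [abs_zero] at this
      exact this.eventually_le_const one_pos
    have hY1 : ∀ᶠ δ : ℝ in 𝓝[>] 0, |δ ^ v * Y| ≤ 1 := by
      have := hYv.abs
      rw [abs_zero] at this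
      exact this.eventually_le_const one_pos
    have hδ1 : ∀ᶠ δ : ℝ in 𝓝[>] 0, δ < 1 :=
      nhdsWithin_le_nhds (eventually_lt_nhds one_pos)
    refine squeeze_zero_norm' ?_ hb
    filter_upwards [hX1, hY1, hδ1, self_mem_nhdsWithin] with δ h1 h2 h3 h4
    have hδ : 0 < δ := h4
    rw [Real.norm_eq_abs, abs_div, abs_of_pos (Real.rpow_pos_of_pos hδ l),
      div_le_iff₀ (Real.rpow_pos_of_pos hδ l)]
    refine (hC _ _ h1 h2).trans ?_
    have h5 : max |δ ^ u * X| |δ ^ v * Y| ≤ max |X| |Y| * δ ^ (min u v) := by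
      have hp := Real.rpow_pos_of_pos hδ (min u v)
      rw [abs_mul, abs_mul, abs_of_pos (Real.rpow_pos_of_pos hδ u),
        abs_of_pos (Real.rpow_pos_of_pos hδ v)]
      refine max_le ?_ ?_
      · rw [mul_comm]
        exact mul_le_mul (le_max_left _ _)
          (Real.rpow_le_rpow_of_exponent_ge hδ h3.le (min_le_left _ _)) (by positivity)
          ((abs_nonneg X).trans (le_max_left _ _))
      · rw [mul_comm]
        exact mul_le_mul (le_max_right _ _)
          (Real.rpow_le_rpow_of_exponent_ge hδ h3.le (min_le_right _ _)) (by positivity)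
          ((abs_nonneg X).trans (le_max_left _ _))
    calc C * max |δ ^ u * X| |δ ^ v * Y| ^ N ≤ C * (max |X| |Y| * δ ^ (min u v)) ^ N := by
          gcongr
      _ = C * max |X| |Y| ^ N * δ ^ (min u v * N - l) * δ ^ l := by
          rw [mul_assoc _ (δ ^ (min u v * N - l)), ← Real.rpow_add hδ, sub_add_cancel,
            Real.rpow_mul hδ.le, Real.rpow_natCast, mul_pow]
          ring
  have := hpoly.add hrem
  rw [add_zero] at this
  refine this.congr fun δ => ?_
  rw [← add_div]
  congr 1
  ring

/-- The indicator of (0, 1) is continuous except at 0 and 1. In the applications the limit takes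
these two values only on a finite set of the integration variable. -/
theorem tendsto_ite_slab {ι : Type*} {l : Filter ι} {f g : ι → ℝ} {a b : ℝ}
    (hf : Tendsto f l (𝓝 a)) (hg : Tendsto g l (𝓝 b)) (h0 : a ≠ 0) (h1 : a ≠ 1) :
    Tendsto (fun i => if 0 < f i ∧ f i < 1 then g i else 0) l
      (𝓝 (if 0 < a ∧ a < 1 then b else 0)) := by
  split_ifs with h
  · refine hg.congr' ?_
    filter_upwards [hf.eventually_const_lt h.1, hf.eventually_lt_const h.2] with i h2 h3
    rw [if_pos ⟨h2, h3⟩]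
  · refine tendsto_const_nhds.congr' ?_
    rcases lt_or_gt_of_ne h0 with h2 | h2
    · filter_upwards [hf.eventually_lt_const h2] with i h3
      rw [if_neg (fun h => absurd h.1 (not_lt.2 h3.le))]
    · have h3 : 1 < a := lt_of_le_of_ne (not_lt.1 fun h3 => h ⟨h2, h3⟩) (Ne.symm h1)
      filter_upwards [hf.eventually_const_lt h3] with i h4
      rw [if_neg (fun h => absurd h.2 (not_lt.2 h4.le))]

/-- The part of a power series with exponents in `F`. -/
noncomputable def facePoly (s : ℕ → ℕ → ℝ) (F : Finset (ℕ × ℕ)) (p : ℝ × ℝ) : ℝ :=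
  ∑ q ∈ F, s q.1 q.2 * p.1 ^ q.1 * p.2 ^ q.2

theorem continuous_facePoly (s : ℕ → ℕ → ℝ) (F : Finset (ℕ × ℕ)) : Continuous (facePoly s F) := by
  unfold facePoly
  fun_prop

/-- Exponents of y being distinct on `F`, the term at `p₁` cannot cancel, and the polynomial in w is
not constant. -/
theorem finite_facePoly_eq {s : ℕ → ℕ → ℝ} {F : Finset (ℕ × ℕ)}
    (hinj : ∀ p ∈ F, ∀ q ∈ F, p.2 = q.2 → p = q) {p₁ : ℕ × ℕ} (hp₁ : p₁ ∈ F) (hp₁0 : p₁.2 ≠ 0)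
    (hs : s p₁.1 p₁.2 ≠ 0) {u : ℝ} (hu : u ≠ 0) (c : ℝ) : {w | facePoly s F (u, w) = c}.Finite := by
  classical
  set Q : Polynomial ℝ := ∑ p ∈ F, Polynomial.C (s p.1 p.2 * u ^ p.1) * Polynomial.X ^ p.2
    - Polynomial.C c with hQ
  have hQ0 : Q ≠ 0 := by
    intro h
    have h1 : Q.coeff p₁.2 = s p₁.1 p₁.2 * u ^ p₁.1 := by
      rw [hQ, Polynomial.coeff_sub, Polynomial.finsetSum_coeff, Polynomial.coeff_C_of_ne_zero hp₁0,
        sub_zero, Finset.sum_eq_single p₁]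
      · rw [Polynomial.coeff_C_mul_X_pow, if_pos rfl]
      · intro p hp hne
        rw [Polynomial.coeff_C_mul_X_pow, if_neg]
        exact fun h => hne (hinj p hp p₁ hp₁ h.symm)
      · exact fun h => (h hp₁).elim
    rw [h, Polynomial.coeff_zero] at h1
    exact (mul_ne_zero hs (pow_ne_zero _ hu)) h1.symm
  refine (Polynomial.finite_setOfPred_isRoot hQ0).subset fun w hw => ?_
  have hw' : facePoly s F (u, w) = c := hw
  change Q.eval w = 0
  rw [hQ, Polynomial.eval_sub, Polynomial.eval_finsetSum]
  simp only [Polynomial.eval_mul, Polynomial.eval_C, Polynomial.eval_pow, Polynomial.eval_X]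
  rw [sub_eq_zero]
  exact hw'

theorem indicator_eq_ite {X : Type*} {A : Set X} {f : X → ℝ} {p : X} {Q : Prop} [Decidable Q]
    (h : p ∈ A ↔ Q) : A.indicator f p = if Q then f p else 0 := by
  split_ifs with hQ
  · exact Set.indicator_of_mem (h.2 hQ) f
  · exact Set.indicator_of_notMem (fun hp => hQ (h.1 hp)) f

/-- The curve y = x^m is invariant under (x, y) ↦ (δ x, δ^m y), so the dilation affects only the
condition on S. -/
theorem mem_cuspSublevel_scaled {S : ℝ × ℝ → ℝ} {m α δ u w : ℝ} (hδ : 0 < δ) (hu : 0 < u) :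
    (δ * u, δ ^ m * w) ∈ cuspSublevel S m (δ ^ α) ↔ (0 < w ∧ w < u ^ m) ∧
      0 < S (δ * u, δ ^ m * w) / δ ^ α ∧ S (δ * u, δ ^ m * w) / δ ^ α < 1 := by
  have h1 : 0 < δ ^ m := Real.rpow_pos_of_pos hδ m
  have h2 : 0 < δ ^ α := Real.rpow_pos_of_pos hδ α
  rw [div_pos_iff_of_pos_right h2, div_lt_one h2]
  change (0 < δ * u ∧ 0 < δ ^ m * w ∧ δ ^ m * w < (δ * u) ^ m ∧ _ ∧ _) ↔ _
  rw [Real.mul_rpow hδ.le hu.le, mul_lt_mul_iff_right₀ h1, mul_pos_iff_of_pos_left h1,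
    mul_pos_iff_of_pos_left hδ]
  tauto

/-- Dominated convergence: the rescaled slice lies in (0, u^m], and the integrand converges except
where the face polynomial equals 0 or 1. An exponent with positive second entry is required since
otherwise this polynomial would not depend on w. -/
theorem tendsto_scaled_slice {S φ : ℝ × ℝ → ℝ} (hS : ContDiff ℝ ∞ S) (hφ : Continuous φ) {C : ℝ}
    (hC : ∀ p, |φ p| ≤ C) {m α : ℝ} (hm : 0 < m) {F : Finset (ℕ × ℕ)}
    (hF : ∀ p : ℕ × ℕ, p ∈ F ↔ taylorCoeff S p.1 p.2 ≠ 0 ∧ (p.1 : ℝ) + m * p.2 = α)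
    (hmin : ∀ a b : ℕ, taylorCoeff S a b ≠ 0 → α ≤ a + m * b) (hne : ∃ p ∈ F, p.2 ≠ 0)
    {u : ℝ} (hu : 0 < u) :
    Tendsto (fun δ : ℝ => ∫ w, (cuspSublevel S m (δ ^ α)).indicator φ (δ * u, δ ^ m * w)) (𝓝[>] 0)
      (𝓝 (∫ w, (cuspSublevel (facePoly (taylorCoeff S) F) m 1).indicator (fun _ => φ (0, 0)) (u, w))) := by
  have hC0 : 0 ≤ C := (abs_nonneg _).trans (hC 0)
  refine tendsto_integral_filter_of_dominated_convergence ((Set.Ioc 0 (u ^ m)).indicator fun _ => C)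
    ?_ ?_ ?_ ?_
  · refine Eventually.of_forall fun δ => ?_
    have h1 : Measurable ((cuspSublevel S m (δ ^ α)).indicator φ) :=
      hφ.measurable.indicator (measurableSet_cuspSublevel hS.continuous _ _)
    exact (h1.comp (measurable_const.prodMk (measurable_id.const_mul (δ ^ m)))).aestronglyMeasurable
  · filter_upwards [self_mem_nhdsWithin] with δ hδ
    refine Eventually.of_forall fun w => ?_
    by_cases h : (δ * u, δ ^ m * w) ∈ cuspSublevel S m (δ ^ α)
    · obtain ⟨h1, _⟩ := (mem_cuspSublevel_scaled hδ hu).1 h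
      rw [Set.indicator_of_mem h, Set.indicator_of_mem (show w ∈ Set.Ioc 0 (u ^ m) from ⟨h1.1, h1.2.le⟩)]
      exact hC _
    · rw [Set.indicator_of_notMem h, norm_zero]
      exact Set.indicator_nonneg (fun _ _ => hC0) _
  · exact (integrableOn_const (by simp)).integrable_indicator measurableSet_Ioc
  · obtain ⟨p₁, hp₁, hp₁0⟩ := hne
    have hinj : ∀ p ∈ F, ∀ q ∈ F, p.2 = q.2 → p = q := by
      intro p hp q hq h
      have h1 := ((hF p).1 hp).2
      have h2 := ((hF q).1 hq).2
      rw [h] at h1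
      ext
      · have : (p.1 : ℝ) = q.1 := by linarith
        exact_mod_cast this
      · exact h
    have hfin : ∀ c, ∀ᵐ w : ℝ, facePoly (taylorCoeff S) F (u, w) ≠ c := fun c =>
      measure_eq_zero_iff_ae_notMem.1
        ((finite_facePoly_eq hinj hp₁ hp₁0 ((hF p₁).1 hp₁).1 hu.ne' c).measure_zero volume)
    filter_upwards [hfin 0, hfin 1] with w h0 h1
    by_cases hw : 0 < w ∧ w < u ^ m
    · have hlim : Tendsto (fun δ : ℝ => S (δ * u, δ ^ m * w) / δ ^ α) (𝓝[>] 0)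
          (𝓝 (facePoly (taylorCoeff S) F (u, w))) := by
        have := tendsto_quasiHomogeneous hS one_pos hm (l := α) (F := F)
          (by simpa using hF) (by simpa using hmin) u w
        simpa [facePoly] using this
      have hφlim : Tendsto (fun δ : ℝ => φ (δ * u, δ ^ m * w)) (𝓝[>] 0) (𝓝 (φ (0, 0))) := by
        have h2 : Tendsto (fun δ : ℝ => (δ * u, δ ^ m * w)) (𝓝 0) (𝓝 (0 * u, 0 ^ m * w)) :=
          (tendsto_id.mul_const u).prodMk_nhds
            (((Real.continuous_rpow_const hm.le).tendsto 0).mul_const w)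
        rw [zero_mul, Real.zero_rpow hm.ne', zero_mul] at h2
        exact ((hφ.tendsto _).comp h2).mono_left nhdsWithin_le_nhds
      have h3 := tendsto_ite_slab hlim hφlim h0 h1
      have e : (cuspSublevel (facePoly (taylorCoeff S) F) m 1).indicator (fun _ => φ (0, 0)) (u, w)
          = if 0 < facePoly (taylorCoeff S) F (u, w) ∧ facePoly (taylorCoeff S) F (u, w) < 1
            then φ (0, 0) else 0 := by
        refine indicator_eq_ite ?_
        simp only [cuspSublevel, Set.mem_ofPred_eq, hu, hw.1, hw.2, true_and]
      rw [e]
      refine h3.congr' ?_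
      filter_upwards [self_mem_nhdsWithin] with δ hδ
      refine (indicator_eq_ite ?_).symm
      rw [mem_cuspSublevel_scaled hδ hu]
      tauto
    · have e : (cuspSublevel (facePoly (taylorCoeff S) F) m 1).indicator (fun _ => φ (0, 0)) (u, w) = 0 :=
        Set.indicator_of_notMem (fun h => hw ⟨h.2.1, h.2.2.1⟩) _
      rw [e]
      refine tendsto_const_nhds.congr' ?_
      filter_upwards [self_mem_nhdsWithin] with δ hδ
      rw [Set.indicator_of_notMem]
      exact fun h => hw ((mem_cuspSublevel_scaled hδ hu).1 h).1

/-- The limit of the cusp integral at a compact edge whose lower end point `(A, B)` satisfies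
`B < d`. -/
theorem tendsto_cuspIntegral_edge {S : ℝ × ℝ → ℝ} (hS : ContDiff ℝ ∞ S) {d m q : ℝ} (hd : 0 < d)
    (hm : 0 < m) {K : ℕ} (hK : 0 < K) (hs : FaceNondegenerate (taylorCoeff S) m K) (hq : 1 ≤ q)
    (hKq : (K : ℝ) - 1 ≤ q) (hqd : q < d) {A B : ℕ} (hAB : taylorCoeff S A B ≠ 0) (hBq : (B : ℝ) < q)
    (hABd : (A : ℝ) + m * B = d * (1 + m)) {F : Finset (ℕ × ℕ)}
    (hF : ∀ p : ℕ × ℕ, p ∈ F ↔ taylorCoeff S p.1 p.2 ≠ 0 ∧ (p.1 : ℝ) + m * p.2 = d * (1 + m))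
    (hmin : ∀ a b : ℕ, taylorCoeff S a b ≠ 0 → d * (1 + m) ≤ a + m * b) (hne : ∃ p ∈ F, p.2 ≠ 0) :
    volume (cuspSublevel (facePoly (taylorCoeff S) F) m 1) < ⊤ ∧ ∃ ρ > 0, ∀ φ, IsBoxFunction ρ φ →
      Tendsto (fun ε : ℝ => cuspIntegral S φ m ε / ε ^ (1 / d)) (𝓝[>] 0)
        (𝓝 (φ (0, 0) * volume.real (cuspSublevel (facePoly (taylorCoeff S) F) m 1))) := by
  set α := d * (1 + m) with hα
  have hα0 : 0 < α := by positivity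
  have hq0 : 0 < q := by linarith
  -- The power of u that the slice estimate leaves after rescaling. It equals m - d (1 + m) / q, and
  -- L < -1 is equivalent to q < d.
  set L : ℝ := -(A / q) + m * (1 - B / q) with hL
  have hL1 : L < -1 := by
    have e : L = m - α / q := by rw [hL, ← hABd]; field_simp; ring
    have : 1 + m < α / q := by
      rw [lt_div_iff₀ hq0, hα]; nlinarith
    linarith
  obtain ⟨C, ρ, hC, hρ, hρ1, hslice⟩ := exists_slice_bound_low hS hm hK hs hq hKq hAB hBq L
  set P := facePoly (taylorCoeff S) F with hP
  -- The dominating function: the width of the cusp for u ≤ 1, the slice estimate for u > 1. The two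
  -- terms of that estimate coincide after rescaling, because the power of x near the axis was also
  -- chosen to be `L`; hence the factor 2.
  set b : ℝ → ℝ := fun u => (Set.Ioc (0 : ℝ) 1).indicator (fun _ => 1) u
    + (Set.Ioi (1 : ℝ)).indicator (fun u => 2 * C * u ^ L) u with hb
  have hbint : Integrable b := by
    refine ((integrableOn_const (by simp)).integrable_indicator measurableSet_Ioc).add ?_
    exact IntegrableOn.integrable_indicator
      ((integrableOn_Ioi_rpow_of_lt hL1 one_pos).const_mul _) measurableSet_Ioi
  have hb0 : ∀ u, 0 ≤ b u := by
    intro u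
    refine add_nonneg (Set.indicator_nonneg (fun _ _ => zero_le_one) _)
      (Set.indicator_nonneg (fun u hu => ?_) _)
    have : (0 : ℝ) < u := lt_trans one_pos hu
    positivity
  have hbound : ∀ (φ : ℝ × ℝ → ℝ) (Cφ δ u : ℝ), (∀ p, |φ p| ≤ Cφ) → 0 < δ → 0 < u → δ * u < ρ →
      |∫ w, (cuspSublevel S m (δ ^ α)).indicator φ (δ * u, δ ^ m * w)| ≤ Cφ * b u := by
    intro φ Cφ δ u hCφ hδ hu hδu
    have hδm : 0 < δ ^ m := Real.rpow_pos_of_pos hδ m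
    have hCφ0 : 0 ≤ Cφ := (abs_nonneg _).trans (hCφ 0)
    have hx0 : 0 < δ * u := by positivity
    have e := sliceIntegral_eq_scaled (S := S) (φ := φ) (κ := m) (ε := δ ^ α) hδm (δ * u)
    have key : |sliceIntegral S φ m (δ ^ α) (δ * u)| ≤ δ ^ m * (Cφ * b u) := by
      rcases le_or_gt u 1 with h1 | h1
      · have hbu : b u = 1 := by
          simp only [hb]
          rw [Set.indicator_of_mem (show u ∈ Set.Ioc (0 : ℝ) 1 from ⟨hu, h1⟩),
            Set.indicator_of_notMem (fun h : u ∈ Set.Ioi (1 : ℝ) => absurd h (not_lt.2 h1)), add_zero]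
        rw [hbu]
        refine (abs_sliceIntegral_le_rpow hCφ hx0.le).trans ?_
        rw [Real.mul_rpow hδ.le hu.le]
        have : u ^ m ≤ 1 := Real.rpow_le_one hu.le h1 hm.le
        nlinarith [mul_nonneg hCφ0 hδm.le]
      · have hbu : b u = 2 * C * u ^ L := by
          simp only [hb]
          rw [Set.indicator_of_notMem (fun h : u ∈ Set.Ioc (0 : ℝ) 1 => absurd h.2 (not_le.2 h1)),
            Set.indicator_of_mem (show u ∈ Set.Ioi (1 : ℝ) from h1), zero_add]
        rw [hbu]
        refine (abs_sliceIntegral_le hCφ (by positivity) (hslice (δ * u) ((δ * u) ^ m) (δ ^ α) hx0 hδu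
          (by positivity) le_rfl (by positivity))).trans (le_of_eq ?_)
        have e1 : (δ ^ α / (δ * u) ^ A) ^ (1 / q) * ((δ * u) ^ m) ^ (1 - (B : ℝ) / q)
            = (δ ^ α) ^ (1 / q) * (δ * u) ^ L := by
          rw [Real.div_rpow (by positivity) (by positivity), ← Real.rpow_natCast (δ * u),
            ← Real.rpow_mul hx0.le, ← Real.rpow_mul hx0.le, hL, Real.rpow_add hx0, Real.rpow_neg hx0.le,
            mul_one_div]
          ring
        have e2 : (δ ^ α) ^ (1 / q) * (δ * u) ^ L = δ ^ m * u ^ L := by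
          rw [Real.mul_rpow hδ.le hu.le, ← mul_assoc, ← Real.rpow_mul hδ.le, ← Real.rpow_add hδ]
          congr 2
          rw [hL, ← hABd]; field_simp; ring
        rw [mul_assoc C, e1, mul_assoc C, e2]
        ring
    rw [e, abs_mul, abs_of_pos hδm] at key
    exact le_of_mul_le_mul_left key hδm
  -- The bounds for S pass to the limit δ → 0 with φ = 1. Thus the slices of the limit set inherit
  -- the dominating function, and its area is finite.
  have hslicevol : ∀ u, volume {w | (u, w) ∈ cuspSublevel P m 1} ≤ ENNReal.ofReal (b u) := by
    intro u
    rcases le_or_gt u 0 with hu | hu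
    · have : {w | (u, w) ∈ cuspSublevel P m 1} = ∅ := by
        ext w
        simp only [cuspSublevel, Set.mem_ofPred_eq, Set.mem_empty_iff_false, iff_false]
        exact fun h => absurd h.1 (not_lt.2 hu)
      rw [this]; simp
    · have hlim := tendsto_scaled_slice hS (φ := fun _ => (1 : ℝ)) continuous_const (C := 1)
        (by simp) hm hF hmin hne hu
      have hmeas : MeasurableSet {w | (u, w) ∈ cuspSublevel P m 1} :=
        measurable_prodMk_left (measurableSet_cuspSublevel (continuous_facePoly _ _) m 1)
      have e1 : ∫ w, (cuspSublevel P m 1).indicator (fun _ => (1 : ℝ)) (u, w)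
          = volume.real {w | (u, w) ∈ cuspSublevel P m 1} := by
        rw [← integral_indicator_one hmeas]
        rfl
      have hfin : volume {w | (u, w) ∈ cuspSublevel P m 1} ≠ ⊤ := by
        refine ((measure_mono (t := Set.Ioc 0 (u ^ m)) fun w hw => ?_).trans_lt (by simp)).ne
        exact ⟨hw.2.1, hw.2.2.1.le⟩
      rw [← ENNReal.ofReal_toReal hfin]
      apply ENNReal.ofReal_le_ofReal
      rw [e1] at hlim
      -- The bound is known only for small δ; taking the minimum makes it hold for all δ without
      -- changing the limit.
      refine le_of_tendsto' (x := 𝓝[>] (0 : ℝ)) (f := fun δ : ℝ => min (b u) (∫ w, (cuspSublevel S m (δ ^ α)).indicator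
        (fun _ => (1 : ℝ)) (δ * u, δ ^ m * w))) ?_ (fun δ => min_le_left _ _)
      refine hlim.congr' ?_
      have : ∀ᶠ δ : ℝ in 𝓝[>] 0, δ < ρ / u :=
        nhdsWithin_le_nhds (eventually_lt_nhds (by positivity))
      filter_upwards [self_mem_nhdsWithin, this] with δ hδ hδu
      rw [min_eq_right]
      have := hbound (fun _ => 1) 1 δ u (by simp) hδ hu ((lt_div_iff₀ hu).1 hδu)
      rw [one_mul] at this
      exact (le_abs_self _).trans this
  have hvol : volume (cuspSublevel P m 1) < ⊤ := by
    rw [Measure.volume_eq_prod, Measure.prod_apply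
      (measurableSet_cuspSublevel (continuous_facePoly _ _) m 1)]
    refine (lintegral_mono fun u => hslicevol u).trans_lt ?_
    rw [← ofReal_integral_eq_lintegral_ofReal hbint (Eventually.of_forall hb0)]
    exact ENNReal.ofReal_lt_top
  refine ⟨hvol, ρ, hρ, fun φ hφ => ?_⟩
  obtain ⟨Cφ, hCφ0, hCφ⟩ := hφ.bounded
  have hlimint : ∫ u, ∫ w, (cuspSublevel P m 1).indicator (fun _ => φ (0, 0)) (u, w)
      = φ (0, 0) * volume.real (cuspSublevel P m 1) := by
    have hmeas := measurableSet_cuspSublevel (continuous_facePoly (taylorCoeff S) F) m 1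
    rw [← integral_prod (f := (cuspSublevel P m 1).indicator (fun _ => φ (0, 0))),
      ← Measure.volume_eq_prod, integral_indicator hmeas, setIntegral_const, smul_eq_mul, mul_comm]
    rw [← Measure.volume_eq_prod]
    exact (integrableOn_const hvol.ne).integrable_indicator hmeas
  have hδlim : Tendsto (fun δ : ℝ => ∫ u, if 0 < u then
      (∫ w, (cuspSublevel S m (δ ^ α)).indicator φ (δ * u, δ ^ m * w)) else 0) (𝓝[>] 0)
      (𝓝 (φ (0, 0) * volume.real (cuspSublevel P m 1))) := by
    rw [← hlimint]
    refine tendsto_integral_filter_of_dominated_convergence (fun u => Cφ * b u) ?_ ?_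
      (hbint.const_mul _) ?_
    · filter_upwards [self_mem_nhdsWithin] with δ hδ
      have hδ0 : 0 < δ := hδ
      have h1 : Measurable fun p : ℝ × ℝ =>
          (cuspSublevel S m (δ ^ α)).indicator φ (δ * p.1, δ ^ m * p.2) :=
        (hφ.continuous.measurable.indicator (measurableSet_cuspSublevel hS.continuous _ _)).comp
          ((measurable_fst.const_mul δ).prodMk (measurable_snd.const_mul (δ ^ m)))
      have h2 : StronglyMeasurable fun u : ℝ =>
          ∫ w, (cuspSublevel S m (δ ^ α)).indicator φ (δ * u, δ ^ m * w) :=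
        h1.stronglyMeasurable.integral_prod_right'
      exact (StronglyMeasurable.ite measurableSet_Ioi h2 stronglyMeasurable_const).aestronglyMeasurable
    · filter_upwards [self_mem_nhdsWithin] with δ hδ
      have hδ0 : 0 < δ := hδ
      refine Eventually.of_forall fun u => ?_
      rw [Real.norm_eq_abs]
      split_ifs with hu
      · by_cases hδu : δ * u < ρ
        · exact hbound φ Cφ δ u hCφ hδ0 hu hδu
        · have e := sliceIntegral_eq_scaled (S := S) (φ := φ) (κ := m) (ε := δ ^ α)
            (Real.rpow_pos_of_pos hδ0 m) (δ * u)
          rw [sliceIntegral_of_le hφ (not_lt.1 hδu)] at e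
          rcases mul_eq_zero.1 e.symm with h | h
          · exact absurd h (Real.rpow_pos_of_pos hδ0 m).ne'
          · rw [h, abs_zero]; exact mul_nonneg hCφ0 (hb0 u)
      · rw [abs_zero]; exact mul_nonneg hCφ0 (hb0 u)
    · refine Eventually.of_forall fun u => ?_
      split_ifs with hu
      · exact tendsto_scaled_slice hS hφ.continuous hCφ hm hF hmin hne hu
      · have : ∀ w, (cuspSublevel P m 1).indicator (fun _ => φ (0, 0)) (u, w) = 0 := fun w =>
          Set.indicator_of_notMem (fun h => hu h.1) _
        simp [this]
  have hcomp : Tendsto (fun ε : ℝ => ε ^ (1 / α)) (𝓝[>] 0) (𝓝[>] 0) := by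
    refine tendsto_nhdsWithin_iff.2 ⟨?_, ?_⟩
    · have := (Real.continuous_rpow_const (by positivity : 0 ≤ 1 / α)).tendsto 0
      rw [Real.zero_rpow (by positivity)] at this
      exact this.mono_left nhdsWithin_le_nhds
    · filter_upwards [self_mem_nhdsWithin] with ε hε
      exact Real.rpow_pos_of_pos hε _
  refine (hδlim.comp hcomp).congr' ?_
  filter_upwards [self_mem_nhdsWithin] with ε hε
  have hε0 : 0 < ε := hε
  set δ := ε ^ (1 / α) with hδdef
  have hδ : 0 < δ := Real.rpow_pos_of_pos hε0 _
  have hδε : δ ^ α = ε := by rw [hδdef, ← Real.rpow_mul hε0.le, one_div_mul_cancel hα0.ne', Real.rpow_one]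
  -- The normalization ε^(1/d) is the Jacobian δ^(1+m) of the dilation.
  have hεd : ε ^ (1 / d) = δ * δ ^ m := by
    rw [← Real.rpow_one_add' hδ.le (by positivity), ← hδε, ← Real.rpow_mul hδ.le, hα]
    congr 1; field_simp
  simp only [Function.comp]
  rw [hδε, cuspIntegral_eq hS.continuous hφ, hεd, eq_div_iff (by positivity)]
  have h1 : ∫ x, sliceIntegral S φ m ε x = δ * ∫ u, sliceIntegral S φ m ε (δ * u) := by
    rw [Measure.integral_comp_mul_left, abs_of_pos (by positivity), smul_eq_mul, ← mul_assoc,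
      mul_inv_cancel₀ hδ.ne', one_mul]
  rw [h1]
  have h2 : ∀ u, sliceIntegral S φ m ε (δ * u) = δ ^ m * if 0 < u then
      (∫ w, (cuspSublevel S m ε).indicator φ (δ * u, δ ^ m * w)) else 0 := by
    intro u
    split_ifs with hu
    · exact sliceIntegral_eq_scaled (Real.rpow_pos_of_pos hδ m) _
    · rw [mul_zero, sliceIntegral_of_nonpos]
      exact mul_nonpos_of_nonneg_of_nonpos hδ.le (not_lt.1 hu)
  simp only [h2]
  rw [integral_const_mul]
  ring

/-! ### Vertices: the logarithmic leading term in a cusp -/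

/-- ε^(1/n) / x is the height at which x^n y^n = ε. In this unit the estimate attached to (n, n) is
W^(1 - n/q) with a negative exponent, so heights beyond W units contribute little, uniformly in x
and ε. -/
theorem volume_tail_at_vertex {S : ℝ × ℝ → ℝ} (hS : ContDiff ℝ ∞ S) {κ : ℝ} (hκ : 0 < κ) {n : ℕ}
    (hn : 2 ≤ n) (hs : FaceNondegenerate (taylorCoeff S) κ n) (hnn : taylorCoeff S n n ≠ 0)
    {q : ℝ} (hq : (n : ℝ) - 1 ≤ q) (hqn : q < n) (M : ℝ) :
    ∃ C ρ : ℝ, 0 < C ∧ 0 < ρ ∧ ρ ≤ 1 ∧ ∀ x ε W : ℝ, 0 < x → x < ρ → 0 < ε → 0 < W →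
      x ^ M ≤ W * (ε ^ (1 / (n : ℝ)) / x) →
      volume {y | y ∈ Set.Icc (W * (ε ^ (1 / (n : ℝ)) / x)) (x ^ κ) ∧ |S (x, y)| < ε}
        ≤ ENNReal.ofReal (C * W ^ (1 - n / q) * (ε ^ (1 / (n : ℝ)) / x)) := by
  have hn2 : (2 : ℝ) ≤ n := by exact_mod_cast hn
  have hq1 : 1 ≤ q := by linarith
  obtain ⟨C, ρ, hC, hρ, hρ1, h⟩ := exists_slice_bound_high hS hκ (by omega) hs hq1 hq hnn hqn M
  refine ⟨C, ρ, hC, hρ, hρ1, fun x ε W hx0 hx hε hW hM => ?_⟩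
  refine (h x _ ε hx0 hx hM hε).trans (ENNReal.ofReal_le_ofReal (le_of_eq ?_))
  set r := ε ^ (1 / (n : ℝ)) / x with hr
  have hr0 : 0 < r := by positivity
  have e : ε / x ^ n = r ^ (n : ℝ) := by
    rw [hr, Real.rpow_natCast, div_pow, one_div, Real.rpow_inv_natCast_pow hε.le (by omega)]
  rw [e, ← Real.rpow_mul hr0.le, Real.mul_rpow hW.le hr0.le]
  have e2 : r ^ ((n : ℝ) * (1 / q)) * r ^ (1 - (n : ℝ) / q) = r := by
    rw [← Real.rpow_add hr0]
    convert Real.rpow_one r using 2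
    ring
  calc C * r ^ ((n : ℝ) * (1 / q)) * (W ^ (1 - (n : ℝ) / q) * r ^ (1 - (n : ℝ) / q))
      = C * W ^ (1 - (n : ℝ) / q) * (r ^ ((n : ℝ) * (1 / q)) * r ^ (1 - (n : ℝ) / q)) := by ring
    _ = _ := by rw [e2]

/-- Trivial bound below one unit of height, tail estimate above, and a separate bound next to the
axis. There, if the lowest row is the row n, its corner is (n, n) and ∂_y^n S gives the exact power
1 / n; if it is lower, the exponent 1 / q > 1 / n is even better for ε ≤ 1. -/
theorem volume_slice_le_at_vertex {S : ℝ × ℝ → ℝ} (hS : ContDiff ℝ ∞ S) {κ : ℝ} (hκ : 0 < κ) {n : ℕ}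
    (hn : 2 ≤ n) (hs : FaceNondegenerate (taylorCoeff S) κ n) (hnn : taylorCoeff S n n ≠ 0)
    (hmin : ∀ a b : ℕ, taylorCoeff S a b ≠ 0 → (n : ℝ) * (1 + κ) ≤ a + κ * b) :
    ∃ C ρ : ℝ, 0 < C ∧ 0 < ρ ∧ ρ ≤ 1 ∧ ∀ x ε : ℝ, 0 < x → x < ρ → 0 < ε → ε ≤ 1 →
      volume {y | y ∈ Set.Ioc 0 (x ^ κ) ∧ |S (x, y)| < ε}
        ≤ ENNReal.ofReal (C * (ε ^ (1 / (n : ℝ)) / x)) := by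
  have hn2 : (2 : ℝ) ≤ n := by exact_mod_cast hn
  set q : ℝ := n - 1 / 2 with hq
  have hq0 : 0 < q := by rw [hq]; linarith
  obtain ⟨A₀, B₀, h₀⟩ := exists_isLowest ⟨n, n, hnn⟩
  obtain ⟨M, C, ρ, hC, hρ, hρ1, hna⟩ : ∃ M C ρ : ℝ, 0 < C ∧ 0 < ρ ∧ ρ ≤ 1 ∧
      ∀ x ε : ℝ, 0 < x → x < ρ → 0 < ε → ε ≤ 1 →
      volume {y | y ∈ Set.Icc 0 (x ^ M) ∧ |S (x, y)| < ε}
        ≤ ENNReal.ofReal (C * (ε ^ (1 / (n : ℝ)) / x)) := by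
    rcases (h₀.snd_le hnn).lt_or_eq with hlt | heq
    · have hlt' : (B₀ : ℝ) + 1 ≤ n := by exact_mod_cast hlt
      obtain ⟨M, C, ρ, hC, hρ, hρ1, h⟩ :=
        exists_volume_le_near_axis_rpow hS h₀ hq0 (by rw [hq]; linarith) (-1)
      refine ⟨M, C, ρ, hC, hρ, hρ1, fun x ε hx0 hx hε hε1 =>
        (h x ε hx0 hx hε).trans (ENNReal.ofReal_le_ofReal ?_)⟩
      rw [Real.rpow_neg_one, mul_assoc, div_eq_mul_inv (ε ^ (1 / (n : ℝ)))]
      refine mul_le_mul_of_nonneg_left (mul_le_mul_of_nonneg_right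
        (Real.rpow_le_rpow_of_exponent_ge hε hε1 (one_div_le_one_div_of_le hq0 (by rw [hq]; linarith)))
        (by positivity)) hC.le
    · have hA : A₀ = n := by
        apply le_antisymm
        · rcases h₀.2 n n hnn with h | h
          · omega
          · exact h.2
        · have := hmin A₀ B₀ h₀.1
          rw [heq] at this
          have : (n : ℝ) ≤ A₀ := by nlinarith
          exact_mod_cast this
      obtain ⟨C, ρ, hC, hρ, hρ1, h⟩ := exists_volume_le_near_axis hS h₀ (by omega)
      refine ⟨((A₀ + 1 : ℕ) : ℝ), C, ρ, hC, hρ, hρ1, fun x ε hx0 hx hε hε1 => ?_⟩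
      have := h x ε hx0 hx hε
      rw [Real.rpow_natCast]
      refine this.trans (ENNReal.ofReal_le_ofReal (le_of_eq ?_))
      rw [hA, heq, Real.div_rpow hε.le (by positivity), one_div,
        Real.pow_rpow_inv_natCast hx0.le (by omega)]
  obtain ⟨C', ρ', hC', hρ', hρ'1, htail⟩ := volume_tail_at_vertex hS hκ hn hs hnn (q := q)
    (by rw [hq]; linarith) (by rw [hq]; linarith) M
  refine ⟨1 + C + C', min ρ ρ', by positivity, by positivity, (min_le_left _ _).trans hρ1,
    fun x ε hx0 hx hε hε1 => ?_⟩
  set r := ε ^ (1 / (n : ℝ)) / x with hr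
  have hr0 : 0 < r := by positivity
  -- `W` differs from 1 only when `r` is below x^M, where the tail estimate is not available; the
  -- gap is covered by the bound near the axis.
  set W := max 1 (x ^ M / r) with hW
  have hW1 : 1 ≤ W := le_max_left _ _
  have hMW : x ^ M ≤ W * r := by
    rw [← div_le_iff₀ hr0]; exact le_max_right _ _
  have hsub : {y | y ∈ Set.Ioc 0 (x ^ κ) ∧ |S (x, y)| < ε} ⊆
      Set.Icc 0 r ∪ {y | y ∈ Set.Icc 0 (x ^ M) ∧ |S (x, y)| < ε} ∪
      {y | y ∈ Set.Icc (W * r) (x ^ κ) ∧ |S (x, y)| < ε} := by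
    rintro y ⟨⟨hy0, hyκ⟩, hy⟩
    by_cases h1 : y ≤ r
    · exact Or.inl (Or.inl ⟨hy0.le, h1⟩)
    by_cases h2 : y ≤ x ^ M
    · exact Or.inl (Or.inr ⟨⟨hy0.le, h2⟩, hy⟩)
    · refine Or.inr ⟨⟨?_, hyκ⟩, hy⟩
      rw [hW, max_mul_of_nonneg _ _ hr0.le, one_mul, div_mul_cancel₀ _ hr0.ne']
      exact max_le (not_le.1 h1).le (not_le.1 h2).le
  have h3 : W ^ (1 - (n : ℝ) / q) ≤ 1 := by
    apply Real.rpow_le_one_of_one_le_of_nonpos hW1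
    rw [sub_nonpos, one_le_div hq0, hq]; linarith
  refine (measure_mono hsub).trans ((measure_union_le _ _).trans (add_le_add (measure_union_le _ _)
    le_rfl) |>.trans ((add_le_add (add_le_add (le_of_eq Real.volume_Icc)
    (hna x ε hx0 (hx.trans_le (min_le_left _ _)) hε hε1))
    (htail x ε W hx0 (hx.trans_le (min_le_right _ _)) hε (by linarith) hMW)).trans ?_))
  rw [sub_zero, ← ENNReal.ofReal_add hr0.le (by positivity), ← ENNReal.ofReal_add (by positivity)
    (by positivity)]
  apply ENNReal.ofReal_le_ofReal
  have : C' * W ^ (1 - (n : ℝ) / q) * r ≤ C' * 1 * r := by gcongr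
  nlinarith

theorem volume_slab_eq {n : ℕ} (hn : n ≠ 0) (s : ℝ) :
    volume {w : ℝ | 0 < w ∧ 0 < s * w ^ n ∧ s * w ^ n < 1} = ENNReal.ofReal (posPow n s) := by
  unfold posPow
  split_ifs with h
  · have hset : {w : ℝ | 0 < w ∧ 0 < s * w ^ n ∧ s * w ^ n < 1} = Set.Ioo 0 (s ^ (-1 / (n : ℝ))) := by
      ext w
      simp only [Set.mem_ofPred_eq, Set.mem_Ioo]
      refine and_congr_right fun hw => ?_
      have hp : 0 < s ^ (-1 / (n : ℝ)) := by positivity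
      have e : (s ^ (-1 / (n : ℝ))) ^ n = s⁻¹ := by
        rw [neg_div, Real.rpow_neg h.le, inv_pow, one_div, Real.rpow_inv_natCast_pow h.le hn]
      rw [← pow_lt_pow_iff_left₀ hw.le hp.le hn, e, lt_inv_comm₀ (by positivity) h, inv_eq_one_div,
        lt_div_iff₀ (by positivity)]
      constructor
      · exact fun h => h.2
      · exact fun h' => ⟨by positivity, h'⟩
    rw [hset, Real.volume_Ioo, sub_zero]
  · have hset : {w : ℝ | 0 < w ∧ 0 < s * w ^ n ∧ s * w ^ n < 1} = ∅ := by
      ext w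
      simp only [Set.mem_ofPred_eq, Set.mem_empty_iff_false, iff_false]
      rintro ⟨h1, h2, _⟩
      exact h (pos_of_mul_pos_left h2 (by positivity))
    rw [hset]; simp

theorem finite_mul_pow_eq {n : ℕ} (hn : n ≠ 0) {s : ℝ} (hs : s ≠ 0) (c : ℝ) :
    {w : ℝ | s * w ^ n = c}.Finite := by
  have h0 : Polynomial.C s * Polynomial.X ^ n - Polynomial.C c ≠ 0 := by
    intro h
    have h1 := congrArg (fun p => Polynomial.coeff p n) h
    simp only [Polynomial.coeff_sub, Polynomial.coeff_C_mul_X_pow, if_true,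
      Polynomial.coeff_C_of_ne_zero hn, sub_zero, Polynomial.coeff_zero] at h1
    exact hs h1
  refine (Polynomial.finite_setOfPred_isRoot h0).subset fun w hw => ?_
  have hw' : s * w ^ n = c := hw
  change Polynomial.eval w _ = 0
  simp [hw']

theorem stronglyMeasurable_sliceIntegral {S φ : ℝ × ℝ → ℝ} (hS : Continuous S) (hφ : Continuous φ)
    (κ ε : ℝ) : StronglyMeasurable (sliceIntegral S φ κ ε) :=
  (hφ.measurable.indicator (measurableSet_cuspSublevel hS κ ε)).stronglyMeasurable.integral_prod_right'

/-- Limit of an integral over slices with uniformly small tails. -/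
theorem tendsto_integral_of_tail {f : ℝ → ℝ → ℝ} {g : ℝ → ℝ} {C W₀ : ℝ} {t : ℝ → ℝ} {l : Filter ℝ}
    [l.IsCountablyGenerated] (hfm : ∀ᶠ ε in l, AEStronglyMeasurable (f ε) volume)
    (hfi : ∀ᶠ ε in l, Integrable (f ε)) (hfC : ∀ᶠ ε in l, ∀ w, |f ε w| ≤ C)
    (hneg : ∀ᶠ ε in l, ∀ w ≤ 0, f ε w = 0)
    (hfg : ∀ᵐ w : ℝ, Tendsto (fun ε => f ε w) l (𝓝 (g w)))
    (hgneg : ∀ w, w ≤ 0 ∨ W₀ < w → g w = 0)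
    (ht : Tendsto t atTop (𝓝 0))
    (htail : ∀ W ≥ 1, ∀ᶠ ε in l, |∫ w in Set.Ioi W, f ε w| ≤ t W) :
    Tendsto (fun ε => ∫ w, f ε w) l (𝓝 (∫ w, g w)) := by
  -- The tail is controlled in integral only, not by a dominating function. So dominated convergence
  -- is used up to W, and the remainder is made small uniformly in ε by the choice of W.
  rw [Metric.tendsto_nhds]
  intro η hη
  obtain ⟨W, hW⟩ := ((ht.eventually_lt_const (half_pos hη)).and
    ((eventually_ge_atTop (1 : ℝ)).and (eventually_ge_atTop W₀))).exists
  obtain ⟨hW1, hW2, hW3⟩ := hW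
  have hlim : Tendsto (fun ε => ∫ w in Set.Iic W, f ε w) l (𝓝 (∫ w in Set.Iic W, g w)) := by
    refine tendsto_integral_filter_of_dominated_convergence ((Set.Ioc 0 W).indicator fun _ => C)
      (hfm.mono fun ε h => h.restrict) ?_ ?_ (ae_restrict_of_ae hfg)
    · filter_upwards [hfC, hneg] with ε h1 h2
      refine (ae_restrict_iff' measurableSet_Iic).2 (Eventually.of_forall fun w hw => ?_)
      by_cases h : 0 < w
      · rw [Set.indicator_of_mem (show w ∈ Set.Ioc 0 W from ⟨h, hw⟩)]; exact h1 w
      · rw [h2 w (not_lt.1 h), norm_zero, Set.indicator_of_notMem]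
        exact fun h' => h h'.1
    · exact ((integrableOn_const (by simp)).integrable_indicator measurableSet_Ioc).restrict
  have hg : ∫ w in Set.Iic W, g w = ∫ w, g w := by
    refine setIntegral_eq_integral_of_forall_compl_eq_zero fun w hw => hgneg w (Or.inr ?_)
    exact hW3.trans_lt (not_le.1 hw)
  rw [hg] at hlim
  filter_upwards [Metric.tendsto_nhds.1 hlim _ (half_pos hη), htail W hW2, hfi] with ε h1 h2 h3
  rw [← intervalIntegral.integral_Iic_add_Ioi h3.integrableOn h3.integrableOn (b := W)]
  rw [Real.dist_eq] at h1 ⊢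
  rw [add_sub_right_comm]
  exact (abs_add_le _ _).trans_lt (by linarith)

theorem integrable_scaled_indicator {S φ : ℝ × ℝ → ℝ} (hS : Continuous S) (hφ : Continuous φ) {C : ℝ}
    (hC : ∀ p, |φ p| ≤ C) (κ ε x : ℝ) {r : ℝ} (hr : 0 < r) :
    Integrable fun w => (cuspSublevel S κ ε).indicator φ (x, r * w) := by
  have hm : Measurable fun w => (cuspSublevel S κ ε).indicator φ (x, r * w) :=
    (hφ.measurable.indicator (measurableSet_cuspSublevel hS κ ε)).comp
      (measurable_const.prodMk (measurable_id.const_mul r))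
  have hC0 : 0 ≤ C := (abs_nonneg _).trans (hC 0)
  refine Integrable.mono' (g := (Set.Icc 0 (x ^ κ / r)).indicator fun _ => C)
    ((integrableOn_const (by simp)).integrable_indicator measurableSet_Icc) hm.aestronglyMeasurable
    (Eventually.of_forall fun w => ?_)
  by_cases h : (x, r * w) ∈ cuspSublevel S κ ε
  · have h1 : 0 < r * w := h.2.1
    have h2 : r * w < x ^ κ := h.2.2.1
    rw [Set.indicator_of_mem h, Set.indicator_of_mem (show w ∈ Set.Icc 0 (x ^ κ / r) from
      ⟨(pos_of_mul_pos_right h1 hr.le).le, by rw [le_div_iff₀ hr]; linarith⟩)]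
    exact hC _
  · rw [Set.indicator_of_notMem h, norm_zero]
    exact Set.indicator_nonneg (fun _ _ => hC0) _

theorem abs_setIntegral_scaled_tail_le {S φ : ℝ × ℝ → ℝ} {C : ℝ}
    (hC : ∀ p, |φ p| ≤ C) {κ ε x r W R : ℝ} (hr : 0 < r) (hR : 0 ≤ R)
    (hvol : volume {y | y ∈ Set.Icc (W * r) (x ^ κ) ∧ |S (x, y)| < ε} ≤ ENNReal.ofReal (R * r)) :
    |∫ w in Set.Ioi W, (cuspSublevel S κ ε).indicator φ (x, r * w)| ≤ C * R := by
  have hC0 : 0 ≤ C := (abs_nonneg _).trans (hC 0)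
  rw [← integral_indicator measurableSet_Ioi]
  refine abs_integral_le_of_volume_le (A := (r * ·) ⁻¹' {y | y ∈ Set.Icc (W * r) (x ^ κ) ∧ |S (x, y)| < ε})
    hR (fun w => ?_) (fun w hw => ?_) ?_
  · by_cases hw : w ∈ Set.Ioi W
    · rw [Set.indicator_of_mem hw]
      by_cases h : (x, r * w) ∈ cuspSublevel S κ ε
      · rw [Set.indicator_of_mem h]; exact hC _
      · rw [Set.indicator_of_notMem h, abs_zero]; exact hC0
    · rw [Set.indicator_of_notMem hw, abs_zero]; exact hC0
  · have hw1 : w ∈ Set.Ioi W := Set.mem_of_indicator_ne_zero hw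
    rw [Set.indicator_of_mem hw1] at hw
    have h : (x, r * w) ∈ cuspSublevel S κ ε := Set.mem_of_indicator_ne_zero hw
    have hw2 : W < w := hw1
    refine ⟨⟨?_, h.2.2.1.le⟩, ?_⟩
    · change W * r ≤ r * w
      rw [mul_comm]; exact mul_le_mul_of_nonneg_left hw2.le hr.le
    · rw [abs_of_pos h.2.2.2.1]; exact h.2.2.2.2
  · rw [Real.volume_preimage_mul_left hr.ne', abs_of_pos (by positivity)]
    calc _ ≤ ENNReal.ofReal r⁻¹ * ENNReal.ofReal (R * r) := by gcongr
      _ = ENNReal.ofReal R := by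
        rw [← ENNReal.ofReal_mul (by positivity)]
        congr 1; field_simp

theorem tendsto_rpow_nhdsGT_zero {w : ℝ} (hw : 0 < w) :
    Tendsto (fun ε : ℝ => ε ^ w) (𝓝[>] 0) (𝓝 0) := by
  have := (Real.continuous_rpow_const hw.le).tendsto 0
  rw [Real.zero_rpow hw.ne'] at this
  exact this.mono_left nhdsWithin_le_nhds

theorem eventually_rpow_mul_lt_rpow {a b : ℝ} (hab : b < a) (w : ℝ) :
    ∀ᶠ ε : ℝ in 𝓝[>] 0, ε ^ a * w < ε ^ b := by
  have h := (tendsto_rpow_nhdsGT_zero (sub_pos.2 hab)).mul_const w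
  rw [zero_mul] at h
  filter_upwards [h.eventually_lt_const one_pos, self_mem_nhdsWithin] with ε h1 hε
  have hε0 : 0 < ε := hε
  have : ε ^ a * w = ε ^ (a - b) * w * ε ^ b := by
    rw [Real.rpow_sub hε0]; field_simp
  rw [this]
  have hb : 0 < ε ^ b := Real.rpow_pos_of_pos hε0 b
  nlinarith

theorem tendsto_rpow_tail {n : ℕ} {q c : ℝ} (hq : 0 < q) (hqn : q < n) :
    Tendsto (fun W : ℝ => c * W ^ (1 - (n : ℝ) / q)) atTop (𝓝 0) := by
  have h : 0 < (n : ℝ) / q - 1 := by rw [sub_pos, one_lt_div hq]; exact hqn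
  have := (tendsto_rpow_neg_atTop h).const_mul c
  rw [mul_zero] at this
  refine this.congr fun W => ?_
  rw [neg_sub]

theorem rpow_div_rpow_eq {n : ℕ} {τ ε : ℝ} (hε : 0 < ε) :
    ε ^ (1 / (n : ℝ)) / ε ^ τ = ε ^ (1 / (n : ℝ) - τ) := (Real.rpow_sub hε _ _).symm

section Vertex

variable {S φ : ℝ × ℝ → ℝ} {κ C : ℝ} {n : ℕ}

/-- On x = ε^τ, y = ε^(1/n - τ) w the monomial of the vertex is exactly ε s w^n, while all other
exponents have weight greater than 1; so S / ε tends to s w^n. The condition κ τ < 1 / n - τ keeps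
these heights inside the cusp. -/
theorem tendsto_slice_inside_vertex_cone (hS : ContDiff ℝ ∞ S) (hκ : 0 < κ)
    (hn : 2 ≤ n) (hs : FaceNondegenerate (taylorCoeff S) κ n) (hnn : taylorCoeff S n n ≠ 0)
    (hφ : Continuous φ) (hC : ∀ p, |φ p| ≤ C) {τ : ℝ} (hτ : 0 < τ) (hκτ : κ * τ < 1 / (n : ℝ) - τ)
    (hmin : ∀ a b : ℕ, taylorCoeff S a b ≠ 0 → (a, b) ≠ (n, n) →
      1 < τ * a + (1 / (n : ℝ) - τ) * b) :
    Tendsto (fun ε : ℝ => ∫ w, (cuspSublevel S κ ε).indicator φ (ε ^ τ, ε ^ (1 / (n : ℝ) - τ) * w))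
      (𝓝[>] 0) (𝓝 (φ (0, 0) * posPow n (taylorCoeff S n n))) := by
  have hn2 : (2 : ℝ) ≤ n := by exact_mod_cast hn
  set s := taylorCoeff S n n with hsdef
  set v := 1 / (n : ℝ) - τ with hv
  have hv0 : 0 < v := lt_trans (by positivity) hκτ
  set q : ℝ := n - 1 / 2 with hq
  have hq0 : 0 < q := by rw [hq]; linarith
  obtain ⟨D, ρ, hD, hρ, hρ1, htail⟩ := volume_tail_at_vertex hS hκ hn hs hnn (q := q)
    (by rw [hq]; linarith) (by rw [hq]; linarith) (v / τ)
  have hC0 : 0 ≤ C := (abs_nonneg _).trans (hC 0)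
  have hint : ∫ w, {w : ℝ | 0 < w ∧ 0 < s * w ^ n ∧ s * w ^ n < 1}.indicator (fun _ => φ (0, 0)) w
      = φ (0, 0) * posPow n s := by
    have hm : MeasurableSet {w : ℝ | 0 < w ∧ 0 < s * w ^ n ∧ s * w ^ n < 1} := by
      have hc : Measurable fun w : ℝ => s * w ^ n := by fun_prop
      exact (measurableSet_lt measurable_const measurable_id).inter
        ((measurableSet_lt measurable_const hc).inter (measurableSet_lt hc measurable_const))
    rw [integral_indicator hm, setIntegral_const, smul_eq_mul, mul_comm, measureReal_def,
      volume_slab_eq (by omega), ENNReal.toReal_ofReal]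
    unfold posPow; split_ifs <;> positivity
  rw [← hint]
  refine tendsto_integral_of_tail (C := C) (W₀ := max 1 (1 / |s|))
    (t := fun W => C * D * W ^ (1 - (n : ℝ) / q)) ?_ ?_ ?_ ?_ ?_ ?_
    (tendsto_rpow_tail hq0 (by rw [hq]; linarith)) ?_
  · filter_upwards [self_mem_nhdsWithin] with ε hε
    exact (integrable_scaled_indicator hS.continuous hφ hC κ ε _
      (Real.rpow_pos_of_pos hε v)).aestronglyMeasurable
  · filter_upwards [self_mem_nhdsWithin] with ε hε
    exact integrable_scaled_indicator hS.continuous hφ hC κ ε _ (Real.rpow_pos_of_pos hε v)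
  · refine Eventually.of_forall fun ε w => ?_
    by_cases h : (ε ^ τ, ε ^ v * w) ∈ cuspSublevel S κ ε
    · rw [Set.indicator_of_mem h]; exact hC _
    · rw [Set.indicator_of_notMem h, abs_zero]; exact hC0
  · filter_upwards [self_mem_nhdsWithin] with ε hε w hw
    refine Set.indicator_of_notMem (fun h => ?_) _
    have h1 : 0 < ε ^ v * w := h.2.1
    exact absurd h1 (not_lt.2 (mul_nonpos_of_nonneg_of_nonpos (Real.rpow_pos_of_pos hε v).le hw))
  · have hfin : ∀ c, ∀ᵐ w : ℝ, s * w ^ n ≠ c := fun c =>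
      measure_eq_zero_iff_ae_notMem.1 ((finite_mul_pow_eq (by omega) hnn c).measure_zero volume)
    filter_upwards [hfin 0, hfin 1] with w h0 h1
    by_cases hw : 0 < w
    · have hlim : Tendsto (fun ε : ℝ => S (ε ^ τ, ε ^ v * w) / ε) (𝓝[>] 0) (𝓝 (s * w ^ n)) := by
        have h2 := tendsto_quasiHomogeneous hS hτ hv0 (l := 1) (F := {(n, n)}) (by
          intro p
          rw [Finset.mem_singleton]
          have hnn1 : τ * n + v * n = 1 := by rw [hv]; field_simp; ring
          constructor
          · rintro rfl; exact ⟨hnn, hnn1⟩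
          · rintro ⟨h2, h3⟩
            by_contra h4
            exact (hmin p.1 p.2 h2 h4).ne' h3) (by
          intro a b hab
          by_cases h4 : (a, b) = (n, n)
          · rw [(Prod.mk.inj h4).1, (Prod.mk.inj h4).2]
            have hnn1 : τ * n + v * n = 1 := by rw [hv]; field_simp; ring
            exact hnn1.ge
          · exact (hmin a b hab h4).le) 1 w
        simp only [Finset.sum_singleton, one_pow, mul_one, Real.rpow_one] at h2
        exact h2
      have hφlim : Tendsto (fun ε : ℝ => φ (ε ^ τ, ε ^ v * w)) (𝓝[>] 0) (𝓝 (φ (0, 0))) := by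
        have h2 := (tendsto_rpow_nhdsGT_zero hv0).mul_const w
        rw [zero_mul] at h2
        exact (hφ.tendsto (0, 0)).comp ((tendsto_rpow_nhdsGT_zero hτ).prodMk_nhds h2)
      have h3 := tendsto_ite_slab hlim hφlim h0 h1
      have e : {w : ℝ | 0 < w ∧ 0 < s * w ^ n ∧ s * w ^ n < 1}.indicator (fun _ => φ (0, 0)) w
          = if 0 < s * w ^ n ∧ s * w ^ n < 1 then φ (0, 0) else 0 :=
        indicator_eq_ite (f := fun _ => φ (0, 0)) (by simp only [Set.mem_ofPred_eq, hw, true_and])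
      rw [e]
      refine h3.congr' ?_
      filter_upwards [self_mem_nhdsWithin,
        eventually_rpow_mul_lt_rpow (a := v) (b := τ * κ) (by linarith) w] with ε hε hlt
      have hε0 : 0 < ε := hε
      refine (indicator_eq_ite ?_).symm
      rw [div_pos_iff_of_pos_right hε0, div_lt_one hε0]
      change (0 < ε ^ τ ∧ 0 < ε ^ v * w ∧ ε ^ v * w < (ε ^ τ) ^ κ ∧ _ ∧ _) ↔ _
      rw [← Real.rpow_mul hε0.le]
      have h4 : 0 < ε ^ τ := Real.rpow_pos_of_pos hε0 τ
      have h5 : 0 < ε ^ v * w := mul_pos (Real.rpow_pos_of_pos hε0 v) hw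
      tauto
    · have e : {w : ℝ | 0 < w ∧ 0 < s * w ^ n ∧ s * w ^ n < 1}.indicator (fun _ => φ (0, 0)) w = 0 :=
        Set.indicator_of_notMem (fun h => hw h.1) _
      rw [e]
      refine tendsto_const_nhds.congr' ?_
      filter_upwards [self_mem_nhdsWithin] with ε hε
      rw [Set.indicator_of_notMem]
      exact fun h => hw (pos_of_mul_pos_right h.2.1 (Real.rpow_pos_of_pos hε v).le)
  · intro w hw
    refine Set.indicator_of_notMem (fun h => ?_) _
    rcases hw with hw | hw
    · exact absurd h.1 (not_lt.2 hw)
    · have hs0 : 0 < |s| := abs_pos.2 hnn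
      have h1 : 1 < w := (le_max_left _ _).trans_lt hw
      have h2 : 1 / |s| < w := (le_max_right _ _).trans_lt hw
      rw [div_lt_iff₀ hs0] at h2
      have h3 : w ≤ w ^ n := le_self_pow₀ h1.le (by omega)
      have h4 : s * w ^ n < 1 := h.2.2
      have hspos : 0 < s := pos_of_mul_pos_left h.2.1 (by positivity)
      rw [abs_of_pos hspos] at h2
      nlinarith
  · intro W hW
    filter_upwards [self_mem_nhdsWithin,
      (tendsto_rpow_nhdsGT_zero hτ).eventually_lt_const hρ] with ε hε hxρ
    have hε0 : 0 < ε := hε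
    have hr : 0 < ε ^ v := Real.rpow_pos_of_pos hε0 v
    rw [mul_assoc C D]
    refine abs_setIntegral_scaled_tail_le hC hr (by positivity) ?_
    have := htail (ε ^ τ) ε W (Real.rpow_pos_of_pos hε0 τ) hxρ hε0 (by linarith) (by
      rw [rpow_div_rpow_eq hε0, ← Real.rpow_mul hε0.le, mul_div_cancel₀ _ hτ.ne', ← hv]
      nlinarith)
    rwa [rpow_div_rpow_eq hε0] at this

/-- An exponent (A, B) of weight less than 1 gives a monomial far larger than ε at the height ε^(1/n
- τ). For fixed W the low slice estimate makes the part below W units negligible; the vertex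
estimate makes the rest small as W grows. -/
theorem tendsto_slice_outside_vertex_cone (hS : ContDiff ℝ ∞ S) (hκ : 0 < κ)
    (hn : 2 ≤ n) (hs : FaceNondegenerate (taylorCoeff S) κ n) (hnn : taylorCoeff S n n ≠ 0)
    (hC : ∀ p, |φ p| ≤ C) {τ : ℝ} (hτ : 0 < τ) (hκτ : κ * τ < 1 / (n : ℝ) - τ)
    {A B : ℕ} (hAB : taylorCoeff S A B ≠ 0) (hB : B < n) (hlt : τ * A + (1 / (n : ℝ) - τ) * B < 1) :
    Tendsto (fun ε : ℝ => ∫ w, (cuspSublevel S κ ε).indicator φ (ε ^ τ, ε ^ (1 / (n : ℝ) - τ) * w))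
      (𝓝[>] 0) (𝓝 0) := by
  have hn2 : (2 : ℝ) ≤ n := by exact_mod_cast hn
  set v := 1 / (n : ℝ) - τ with hv
  have hv0 : 0 < v := lt_trans (by positivity) hκτ
  set q : ℝ := n - 1 / 2 with hq
  have hq0 : 0 < q := by rw [hq]; linarith
  have hqn : q < n := by rw [hq]; linarith
  have hBq : (B : ℝ) < q := by
    have : (B : ℝ) + 1 ≤ n := by exact_mod_cast hB
    rw [hq]; linarith
  obtain ⟨D, ρ, hD, hρ, hρ1, htail⟩ := volume_tail_at_vertex hS hκ hn hs hnn (q := q)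
    (by rw [hq]; linarith) hqn (v / τ)
  obtain ⟨E, ρ', hE, hρ', hρ'1, hlow⟩ := exists_slice_bound_low hS hκ (by omega : 0 < n) hs
    (q := q) (by rw [hq]; linarith) (by rw [hq]; linarith) hAB hBq 0
  have hC0 : 0 ≤ C := (abs_nonneg _).trans (hC 0)
  rw [Metric.tendsto_nhds]
  intro η hη
  obtain ⟨W, hW, hW1⟩ := (((tendsto_rpow_tail (c := C * D) hq0 hqn).eventually_lt_const
    (half_pos hη)).and (eventually_ge_atTop (1 : ℝ))).exists
  have hW0 : 0 < W := by linarith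
  -- The two terms of the low estimate divided by ε^v. Both powers of ε are positive, the second one
  -- because 1 / q > 1 / n > v.
  set h : ℝ → ℝ := fun ε => E * W ^ (1 - (B : ℝ) / q) * ε ^ ((1 - (τ * A + v * B)) / q)
    + E * ε ^ (1 / q - v) with hh
  have hv1 : 0 < 1 / q - v := by
    have h1 : 1 / (n : ℝ) < 1 / q := one_div_lt_one_div_of_lt hq0 hqn
    linarith
  have hhlim : Tendsto (fun ε => C * h ε) (𝓝[>] 0) (𝓝 0) := by
    have h1 := ((tendsto_rpow_nhdsGT_zero (div_pos (sub_pos.2 hlt) hq0)).const_mul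
      (E * W ^ (1 - (B : ℝ) / q))).add ((tendsto_rpow_nhdsGT_zero hv1).const_mul E)
    rw [mul_zero, mul_zero, add_zero] at h1
    have h2 := h1.const_mul C
    rwa [mul_zero] at h2
  filter_upwards [self_mem_nhdsWithin, (tendsto_rpow_nhdsGT_zero hτ).eventually_lt_const hρ,
    (tendsto_rpow_nhdsGT_zero hτ).eventually_lt_const hρ',
    hhlim.eventually_lt_const (half_pos hη),
    eventually_rpow_mul_lt_rpow (a := v) (b := τ * κ) (by linarith) W] with ε hε hxρ hxρ' hhε hWκ
  have hε0 : 0 < ε := hε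
  have hx : 0 < ε ^ τ := Real.rpow_pos_of_pos hε0 τ
  have hr : 0 < ε ^ v := Real.rpow_pos_of_pos hε0 v
  have h1 := htail (ε ^ τ) ε W hx hxρ hε0 hW0 (by
      rw [rpow_div_rpow_eq hε0, ← Real.rpow_mul hε0.le, mul_div_cancel₀ _ hτ.ne', ← hv]
      nlinarith)
  rw [rpow_div_rpow_eq hε0, ← hv] at h1
  have h2 := hlow (ε ^ τ) (W * ε ^ v) ε hx hxρ' (by positivity) (by
    rw [← Real.rpow_mul hε0.le, mul_comm W]; exact hWκ.le) hε0
  have e1 : E * (ε / (ε ^ τ) ^ A) ^ (1 / q) * (W * ε ^ v) ^ (1 - (B : ℝ) / q)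
      + E * ε ^ (1 / q) * (ε ^ τ) ^ (0 : ℝ) = h ε * ε ^ v := by
    rw [Real.rpow_zero, mul_one, hh]
    have e2 : (ε / (ε ^ τ) ^ A) ^ (1 / q) = ε ^ ((1 - τ * A) / q) := by
      rw [← Real.rpow_natCast, ← Real.rpow_mul hε0.le]
      nth_rewrite 1 [← Real.rpow_one ε]
      rw [← Real.rpow_sub hε0, ← Real.rpow_mul hε0.le, mul_one_div]
    rw [e2, Real.mul_rpow hW0.le hr.le, ← Real.rpow_mul hε0.le]
    simp only [add_mul]
    rw [mul_assoc _ (ε ^ ((1 - (τ * A + v * B)) / q)), ← Real.rpow_add hε0, mul_assoc E (ε ^ (1 / q - v)),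
      ← Real.rpow_add hε0, sub_add_cancel]
    have e3 : ε ^ ((1 - τ * A) / q) * ε ^ (v * (1 - (B : ℝ) / q)) = ε ^ ((1 - (τ * A + v * B)) / q + v) := by
      rw [← Real.rpow_add hε0]; congr 1; field_simp; ring
    rw [← e3]; ring
  rw [e1] at h2
  have hh0 : 0 ≤ h ε := by rw [hh]; positivity
  have hsub : {y | y ∈ Set.Ioc 0 ((ε ^ τ) ^ κ) ∧ |S (ε ^ τ, y)| < ε} ⊆
      {y | y ∈ Set.Ioc 0 (W * ε ^ v) ∧ |S (ε ^ τ, y)| < ε} ∪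
      {y | y ∈ Set.Icc (W * ε ^ v) ((ε ^ τ) ^ κ) ∧ |S (ε ^ τ, y)| < ε} := by
    rintro y ⟨hy, hy'⟩
    rcases le_total y (W * ε ^ v) with h3 | h3
    · exact Or.inl ⟨⟨hy.1, h3⟩, hy'⟩
    · exact Or.inr ⟨⟨h3, hy.2⟩, hy'⟩
  have h3 : |sliceIntegral S φ κ ε (ε ^ τ)| ≤ C * ((h ε + D * W ^ (1 - (n : ℝ) / q)) * ε ^ v) := by
    refine abs_sliceIntegral_le hC (by positivity) ((measure_mono hsub).trans
      ((measure_union_le _ _).trans ((add_le_add h2 h1).trans ?_)))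
    rw [← ENNReal.ofReal_add (mul_nonneg hh0 hr.le) (by positivity), ← add_mul]
  rw [sliceIntegral_eq_scaled hr, abs_mul, abs_of_pos hr] at h3
  have h4 : |∫ w, (cuspSublevel S κ ε).indicator φ (ε ^ τ, ε ^ v * w)|
      ≤ C * (h ε + D * W ^ (1 - (n : ℝ) / q)) := by
    refine le_of_mul_le_mul_left (h3.trans (le_of_eq ?_)) hr
    ring
  rw [Real.dist_eq, sub_zero]
  refine h4.trans_lt ?_
  rw [mul_add, ← mul_assoc]
  linarith

end Vertex

theorem image_rpow_Ioo {ε θ : ℝ} (hε : 0 < ε) (hε1 : ε < 1) :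
    (fun τ : ℝ => ε ^ τ) '' Set.Ioo 0 θ = Set.Ioo (ε ^ θ) 1 := by
  have hlog : Real.log ε < 0 := Real.log_neg hε hε1
  ext x
  constructor
  · rintro ⟨τ, ⟨h1, h2⟩, rfl⟩
    exact ⟨Real.rpow_lt_rpow_of_exponent_gt hε hε1 h2, Real.rpow_lt_one hε.le hε1 h1⟩
  · rintro ⟨h1, h2⟩
    have hx : 0 < x := (Real.rpow_pos_of_pos hε θ).trans h1
    have hxlog : Real.log x < 0 := Real.log_neg hx h2
    have e : ε ^ (Real.log x / Real.log ε) = x := by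
      rw [Real.rpow_def_of_pos hε, mul_div_cancel₀ _ hlog.ne, Real.exp_log hx]
    refine ⟨Real.log x / Real.log ε, ⟨div_pos_of_neg_of_neg hxlog hlog, ?_⟩, e⟩
    by_contra! h
    have := Real.rpow_le_rpow_of_exponent_ge hε hε1.le h
    rw [e] at this
    exact absurd h1 (not_lt.2 this)

/-- The substitution x = ε^τ is the source of the logarithm: a density of order 1 / x becomes a
bounded one in τ, with the factor -log ε in front. -/
theorem integral_Ioo_eq_log {ε θ : ℝ} (hε : 0 < ε) (hε1 : ε < 1) (g : ℝ → ℝ) :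
    ∫ x in Set.Ioo (ε ^ θ) 1, g x = -Real.log ε * ∫ τ in Set.Ioo 0 θ, ε ^ τ * g (ε ^ τ) := by
  have hlog : Real.log ε < 0 := Real.log_neg hε hε1
  rw [← image_rpow_Ioo hε hε1, integral_image_eq_integral_abs_deriv_smul measurableSet_Ioo
    (f' := fun τ => ε ^ τ * Real.log ε)
    (fun τ _ => (Real.hasStrictDerivAt_const_rpow hε τ).hasDerivAt.hasDerivWithinAt)]
  · rw [← integral_const_mul]
    congr 1
    funext τ
    rw [abs_mul, abs_of_pos (Real.rpow_pos_of_pos hε τ), abs_of_neg hlog, smul_eq_mul]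
    ring
  · intro a _ b _ hab
    exact (Real.strictAnti_rpow_of_base_lt_one hε hε1).injective hab

/-- The leading term of the cusp integral at a vertex `(n, n)`. -/
theorem tendsto_cuspIntegral_vertex {S : ℝ × ℝ → ℝ} (hS : ContDiff ℝ ∞ S) {κ : ℝ} (hκ : 0 < κ)
    {n : ℕ} (hn : 2 ≤ n) (hs : FaceNondegenerate (taylorCoeff S) κ n) (hnn : taylorCoeff S n n ≠ 0)
    (hmin : ∀ a b : ℕ, taylorCoeff S a b ≠ 0 → (a, b) ≠ (n, n) → (n : ℝ) * (1 + κ) < a + κ * b) :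
    ∃ ρ > 0, ∀ φ, IsBoxFunction ρ φ → ∀ T : ℝ,
      (T = 0 ∧ ∀ a b : ℕ, taylorCoeff S a b ≠ 0 → n ≤ b) ∨
      (∃ m > κ, T = 1 / (1 + m) ∧ (∃ A B : ℕ, taylorCoeff S A B ≠ 0 ∧ B < n ∧
        (A : ℝ) + m * B = n * (1 + m)) ∧
        ∀ a b : ℕ, taylorCoeff S a b ≠ 0 → (n : ℝ) * (1 + m) ≤ a + m * b) →
      Tendsto (fun ε : ℝ => cuspIntegral S φ κ ε / (ε ^ (1 / (n : ℝ)) * Real.log ε)) (𝓝[>] 0)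
        (𝓝 (-(φ (0, 0) * posPow n (taylorCoeff S n n) * (1 / n * (1 / (1 + κ) - T))))) := by
  have hn2 : (2 : ℝ) ≤ n := by exact_mod_cast hn
  have hn0 : (0 : ℝ) < n := by linarith
  have hmin' : ∀ a b : ℕ, taylorCoeff S a b ≠ 0 → (n : ℝ) * (1 + κ) ≤ a + κ * b := by
    intro a b hab
    by_cases h : (a, b) = (n, n)
    · obtain ⟨rfl, rfl⟩ := Prod.mk.inj h
      exact le_of_eq (by ring)
    · exact (hmin a b hab h).le
  obtain ⟨D, ρ, hD, hρ, hρ1, hslice⟩ := volume_slice_le_at_vertex hS hκ hn hs hnn hmin'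
  refine ⟨ρ, hρ, fun φ hφ T hT => ?_⟩
  obtain ⟨C, hC0, hC⟩ := hφ.bounded
  -- x = ε^θ is the abscissa at which the height ε^(1/n) / x meets the boundary x^κ of the cusp.
  set θ : ℝ := 1 / n * (1 / (1 + κ)) with hθ
  have hθ0 : 0 < θ := by positivity
  have hT0 : 0 ≤ T := by
    rcases hT with h | ⟨m, hm, h, _⟩
    · exact h.1.ge
    · rw [h]
      have : 0 < m := hκ.trans hm
      positivity
  have hTθ : 1 / n * T < θ := by
    rw [hθ]
    apply mul_lt_mul_of_pos_left _ (by positivity)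
    rcases hT with h | ⟨m, hm, h, _⟩
    · rw [h.1]; positivity
    · rw [h]; exact one_div_lt_one_div_of_lt (by positivity) (by linarith)
  set G : ℝ := φ (0, 0) * posPow n (taylorCoeff S n n) with hG
  have hlt1 : ∀ᶠ ε : ℝ in 𝓝[>] 0, ε < 1 := nhdsWithin_le_nhds (eventually_lt_nhds one_pos)
  have hmain : Tendsto (fun ε : ℝ => ∫ τ in Set.Ioo 0 θ,
      ε ^ τ * sliceIntegral S φ κ ε (ε ^ τ) / ε ^ (1 / (n : ℝ))) (𝓝[>] 0)
      (𝓝 (∫ τ in Set.Ioo 0 θ, (Set.Ioi (1 / n * T)).indicator (fun _ => G) τ)) := by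
    refine tendsto_integral_filter_of_dominated_convergence (fun _ => C * D) ?_ ?_ ?_ ?_
    · filter_upwards [self_mem_nhdsWithin] with ε hε
      have hε0 : 0 < ε := hε
      have h1 : Measurable fun τ : ℝ => ε ^ τ := (Real.continuous_const_rpow hε0.ne').measurable
      have h2 := (stronglyMeasurable_sliceIntegral hS.continuous hφ.continuous κ ε).measurable
      exact ((h1.mul (h2.comp h1)).div_const _).aestronglyMeasurable
    · filter_upwards [self_mem_nhdsWithin, hlt1] with ε hε hε1
      have hε0 : 0 < ε := hε
      refine Eventually.of_forall fun τ => ?_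
      have hx : 0 < ε ^ τ := Real.rpow_pos_of_pos hε0 τ
      have hr : 0 < ε ^ (1 / (n : ℝ)) := Real.rpow_pos_of_pos hε0 _
      rw [Real.norm_eq_abs, abs_div, abs_mul, abs_of_pos hx, abs_of_pos hr, div_le_iff₀ hr]
      by_cases hxρ : ε ^ τ < ρ
      · have h1 := abs_sliceIntegral_le hC (by positivity) (hslice _ ε hx hxρ hε0 hε1.le)
        calc ε ^ τ * |sliceIntegral S φ κ ε (ε ^ τ)|
            ≤ ε ^ τ * (C * (D * (ε ^ (1 / (n : ℝ)) / ε ^ τ))) := by gcongr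
          _ = _ := by field_simp
      · rw [sliceIntegral_of_le hφ (not_lt.1 hxρ), abs_zero, mul_zero]
        positivity
    · exact integrableOn_const (by simp)
    · have hne : ∀ᵐ τ : ℝ, τ ≠ 1 / n * T := measure_eq_zero_iff_ae_notMem.1 (measure_singleton _)
      filter_upwards [ae_restrict_of_ae hne, ae_restrict_mem measurableSet_Ioo] with τ hτT hτ
      obtain ⟨hτ0, hτθ⟩ := hτ
      have hκτ : κ * τ < 1 / (n : ℝ) - τ := by
        rw [hθ, ← div_eq_mul_one_div, lt_div_iff₀ (by positivity)] at hτθ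
        linarith
      have e : (fun ε : ℝ => ε ^ τ * sliceIntegral S φ κ ε (ε ^ τ) / ε ^ (1 / (n : ℝ)))
          =ᶠ[𝓝[>] 0] fun ε => ∫ w, (cuspSublevel S κ ε).indicator φ (ε ^ τ, ε ^ (1 / (n : ℝ) - τ) * w) := by
        filter_upwards [self_mem_nhdsWithin] with ε hε
        have hε0 : 0 < ε := hε
        rw [sliceIntegral_eq_scaled (Real.rpow_pos_of_pos hε0 (1 / (n : ℝ) - τ)), Real.rpow_sub hε0]
        have := Real.rpow_pos_of_pos hε0 τ
        have := Real.rpow_pos_of_pos hε0 (1 / (n : ℝ))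
        field_simp
      refine Tendsto.congr' e.symm ?_
      -- T / n separates two ranges. For smaller τ the height ε^(1/n) / x is below x^m, and the
      -- other end of the edge dominates the vertex; for larger τ the vertex dominates. For a
      -- horizontal ray the first range is empty.
      rcases lt_or_gt_of_ne hτT with hlt | hgt
      · rw [Set.indicator_of_notMem (show τ ∉ Set.Ioi (1 / n * T) from not_lt.2 hlt.le)]
        rcases hT with h | ⟨m, hm, hTm, ⟨A, B, hAB, hB, hABm⟩, hmin2⟩
        · rw [h.1, mul_zero] at hlt
          exact absurd hlt (not_lt.2 hτ0.le)
        · refine tendsto_slice_outside_vertex_cone hS hκ hn hs hnn hC hτ0 hκτ hAB hB ?_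
          have hm0 : 0 < m := hκ.trans hm
          rw [hTm, ← div_eq_mul_one_div, lt_div_iff₀ (by positivity)] at hlt
          have hB' : (B : ℝ) < n := by exact_mod_cast hB
          have h1 : τ * n + (1 / (n : ℝ) - τ) * n = 1 := by field_simp; ring
          have h2 : (A : ℝ) - n = m * (n - B) := by linarith
          have h3 : τ * A + (1 / (n : ℝ) - τ) * B - 1 = (n - B) * (m * τ - (1 / (n : ℝ) - τ)) := by
            linear_combination τ * h2 + h1
          have h4 : (n - B) * (m * τ - (1 / (n : ℝ) - τ)) < 0 :=
            mul_neg_of_pos_of_neg (by linarith) (by linarith)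
          linarith
      · rw [Set.indicator_of_mem (show τ ∈ Set.Ioi (1 / n * T) from hgt)]
        refine tendsto_slice_inside_vertex_cone hS hκ hn hs hnn hφ.continuous hC hτ0 hκτ ?_
        intro a b hab hne'
        have h1 : τ * n + (1 / (n : ℝ) - τ) * n = 1 := by field_simp; ring
        have h0 := hmin a b hab hne'
        -- The excess of the weight over 1 is decomposed along the line of κ, which settles b ≥ n,
        -- and below along the line of m, which settles b < n.
        have h3 : τ * a + (1 / (n : ℝ) - τ) * b - 1
            = τ * (a + κ * b - n * (1 + κ)) + (1 / (n : ℝ) - τ - κ * τ) * (b - n) := by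
          linear_combination h1
        have h4 : 0 < τ * (a + κ * b - n * (1 + κ)) := mul_pos hτ0 (by linarith)
        rcases le_or_gt n b with hb | hb
        · have hb' : (n : ℝ) ≤ b := by exact_mod_cast hb
          have : 0 ≤ (1 / (n : ℝ) - τ - κ * τ) * (b - n) := mul_nonneg (by linarith) (by linarith)
          linarith
        · rcases hT with h | ⟨m, hm, hTm, _, hmin2⟩
          · exact absurd (h.2 a b hab) (not_le.2 hb)
          · have hm0 : 0 < m := hκ.trans hm
            rw [hTm, ← div_eq_mul_one_div, div_lt_iff₀ (by positivity)] at hgt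
            have h5 := hmin2 a b hab
            have hb' : (b : ℝ) < n := by exact_mod_cast hb
            have h6 : τ * a + (1 / (n : ℝ) - τ) * b - 1
              = τ * (a + m * b - n * (1 + m)) + (m * τ - (1 / (n : ℝ) - τ)) * (n - b) := by
              linear_combination h1
            have h7 : 0 ≤ τ * (a + m * b - n * (1 + m)) := mul_nonneg hτ0.le (by linarith)
            have h8 : 0 < (m * τ - (1 / (n : ℝ) - τ)) * (n - b) :=
              mul_pos (by linarith) (by linarith)
            linarith
  have hGint : ∫ τ in Set.Ioo 0 θ, (Set.Ioi (1 / n * T)).indicator (fun _ => G) τ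
      = G * (1 / n * (1 / (1 + κ) - T)) := by
    rw [setIntegral_indicator measurableSet_Ioi]
    have : Set.Ioo 0 θ ∩ Set.Ioi (1 / n * T) = Set.Ioo (1 / n * T) θ := by
      ext τ
      simp only [Set.mem_inter_iff, Set.mem_Ioo, Set.mem_Ioi]
      have : 0 ≤ 1 / n * T := by positivity
      constructor
      · rintro ⟨⟨_, h1⟩, h2⟩; exact ⟨h2, h1⟩
      · rintro ⟨h1, h2⟩; exact ⟨⟨this.trans_lt h1, h2⟩, h1⟩
    rw [this, setIntegral_const, Real.volume_real_Ioo_of_le hTθ.le, smul_eq_mul, hθ]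
    ring
  rw [hGint] at hmain
  -- For x ≤ ε^θ the width of the cusp alone gives O(ε^(1/n)), which lacks the logarithm of the main
  -- term.
  have hsmall : Tendsto (fun ε : ℝ => (∫ x in Set.Iic (ε ^ θ), sliceIntegral S φ κ ε x) /
      (ε ^ (1 / (n : ℝ)) * Real.log ε)) (𝓝[>] 0) (𝓝 0) := by
    have hb : Tendsto (fun ε : ℝ => -(C * (Real.log ε)⁻¹)) (𝓝[>] 0) (𝓝 0) := by
      have := ((tendsto_inv_atBot_zero.comp Real.tendsto_log_nhdsGT_zero).const_mul C).neg
      rwa [mul_zero, neg_zero] at this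
    refine squeeze_zero_norm' ?_ hb
    filter_upwards [self_mem_nhdsWithin, hlt1] with ε hε hε1
    have hε0 : 0 < ε := hε
    have hlog : Real.log ε < 0 := Real.log_neg hε0 hε1
    have hr : 0 < ε ^ (1 / (n : ℝ)) := Real.rpow_pos_of_pos hε0 _
    have hxθ : 0 < ε ^ θ := Real.rpow_pos_of_pos hε0 θ
    have h1 : ∫ x in Set.Iic (ε ^ θ), sliceIntegral S φ κ ε x
        = ∫ x in Set.Ioc 0 (ε ^ θ), sliceIntegral S φ κ ε x := by
      rw [← setIntegral_eq_of_subset_of_forall_sdiff_eq_zero measurableSet_Iic (s := Set.Ioc 0 (ε ^ θ))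
        (fun x hx => hx.2)]
      rintro x ⟨hx1, hx2⟩
      refine sliceIntegral_of_nonpos (not_lt.1 fun h => hx2 ⟨h, hx1⟩)
    have h2 : ‖∫ x in Set.Ioc 0 (ε ^ θ), sliceIntegral S φ κ ε x‖ ≤ C * (ε ^ θ) ^ κ * ε ^ θ := by
      have := norm_setIntegral_le_of_norm_le_const (μ := volume) (s := Set.Ioc 0 (ε ^ θ))
        (f := sliceIntegral S φ κ ε) (C := C * (ε ^ θ) ^ κ) (by simp) (fun x hx => by
          rw [Real.norm_eq_abs]
          refine (abs_sliceIntegral_le_rpow hC hx.1.le).trans ?_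
          gcongr
          · exact hx.1.le
          · exact hx.2)
      rwa [Real.volume_real_Ioc_of_le hxθ.le, sub_zero] at this
    have h3 : (ε ^ θ) ^ κ * ε ^ θ = ε ^ (1 / (n : ℝ)) := by
      rw [← Real.rpow_mul hε0.le, ← Real.rpow_add hε0]
      congr 1
      rw [hθ]; field_simp; ring
    rw [mul_assoc, h3] at h2
    rw [h1, norm_div, norm_mul, Real.norm_of_nonneg hr.le, Real.norm_eq_abs (Real.log ε),
      abs_of_neg hlog, div_le_iff₀ (mul_pos hr (neg_pos.2 hlog))]
    refine h2.trans (le_of_eq ?_)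
    have := hlog.ne
    field_simp
  have hfinal := hsmall.sub hmain
  rw [zero_sub] at hfinal
  refine hfinal.congr' ?_
  filter_upwards [self_mem_nhdsWithin, hlt1] with ε hε hε1
  have hε0 : 0 < ε := hε
  have hlog : Real.log ε < 0 := Real.log_neg hε0 hε1
  have hr : 0 < ε ^ (1 / (n : ℝ)) := Real.rpow_pos_of_pos hε0 _
  have hint := integrable_sliceIntegral hS.continuous hφ κ ε
  have h1 : ∫ x in Set.Ioi (ε ^ θ), sliceIntegral S φ κ ε x
      = ∫ x in Set.Ioo (ε ^ θ) 1, sliceIntegral S φ κ ε x := by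
    rw [← setIntegral_eq_of_subset_of_forall_sdiff_eq_zero measurableSet_Ioi (s := Set.Ioo (ε ^ θ) 1)
      (fun x hx => hx.1)]
    rintro x ⟨hx1, hx2⟩
    exact sliceIntegral_of_le hφ (hρ1.trans (not_lt.1 fun h => hx2 ⟨hx1, h⟩))
  rw [cuspIntegral_eq hS.continuous hφ, ← intervalIntegral.integral_Iic_add_Ioi hint.integrableOn
    hint.integrableOn (b := ε ^ θ), h1, integral_Ioo_eq_log hε0 hε1, add_div]
  rw [sub_eq_add_neg]
  congr 1
  rw [integral_div]
  have := hlog.ne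
  field_simp

/-! ### Rays: slices next to the axis and away from it -/

/-- Taylor's formula for a function whose derivatives of order less than `n` vanish. -/
theorem exists_eq_iteratedDeriv_mul_pow {f : ℝ → ℝ} (hf : ContDiff ℝ ∞ f) {n : ℕ} (hn : n ≠ 0)
    (h0 : ∀ b < n, iteratedDeriv b f 0 = 0) {y : ℝ} (hy : 0 < y) :
    ∃ ξ ∈ Set.Ioo 0 y, f y = iteratedDeriv n f ξ / n.factorial * y ^ n := by
  obtain ⟨k, rfl⟩ := Nat.exists_eq_succ_of_ne_zero hn
  obtain ⟨ξ, hξ, h⟩ := taylor_mean_remainder_lagrange_iteratedDeriv hy.ne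
    (hf.of_le (by exact_mod_cast le_top)).contDiffOn (n := k)
  rw [Set.uIcc_of_le hy.le] at h
  rw [Set.uIoo_of_lt hy] at hξ
  refine ⟨ξ, hξ, ?_⟩
  have ht : taylorWithinEval f k (Set.Icc 0 y) 0 y = 0 := by
    rw [taylor_within_apply]
    refine Finset.sum_eq_zero fun b hb => ?_
    rw [iteratedDerivWithin_eq_iteratedDeriv (uniqueDiffOn_Icc hy)
      (hf.of_le (by exact_mod_cast le_top)).contDiffAt (Set.left_mem_Icc.2 hy.le),
      h0 b (by rw [Finset.mem_range] at hb; omega), smul_zero]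
  rw [ht, sub_zero, sub_zero] at h
  rw [h]
  simp only [Nat.succ_eq_add_one]
  ring

section Ray

variable {S : ℝ × ℝ → ℝ} {A n : ℕ}

/-- The cusp of exponent A + 1 is contained in the region where |∂_y^n S| is at least a multiple of
x^A, so the estimate near the axis covers whole slices. -/
theorem exists_slice_integral_bound_of_isLowest (hS : ContDiff ℝ ∞ S)
    (h : IsLowest (taylorCoeff S) A n) (hn : n ≠ 0) :
    ∃ D ρ : ℝ, 0 < D ∧ 0 < ρ ∧ ρ ≤ 1 ∧ ∀ φ : ℝ × ℝ → ℝ, ∀ C : ℝ, (∀ p, |φ p| ≤ C) →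
      ∀ x ε : ℝ, 0 < x → x < ρ → 0 < ε →
      |sliceIntegral S φ ((A + 1 : ℕ) : ℝ) ε x| ≤ C * D * x ^ (-(A : ℝ) / n) * ε ^ (1 / (n : ℝ)) := by
  obtain ⟨D, ρ, hD, hρ, hρ1, hv⟩ := exists_volume_le_near_axis hS h hn
  refine ⟨D, ρ, hD, hρ, hρ1, fun φ C hC x ε hx0 hx hε => ?_⟩
  have e : (ε / x ^ A) ^ (1 / (n : ℝ)) = x ^ (-(A : ℝ) / n) * ε ^ (1 / (n : ℝ)) := by
    rw [Real.div_rpow hε.le (by positivity), ← Real.rpow_natCast x A, ← Real.rpow_mul hx0.le,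
      neg_div, Real.rpow_neg hx0.le, mul_one_div, div_eq_mul_inv, mul_comm]
  have := abs_sliceIntegral_le (κ := ((A + 1 : ℕ) : ℝ)) (S := S) (φ := φ) (x := x) (ε := ε) hC
    (R := D * (ε / x ^ A) ^ (1 / (n : ℝ))) (by positivity) ((measure_mono ?_).trans (hv x ε hx0 hx hε))
  · rw [e] at this
    linarith
  · rintro y ⟨hy, hy'⟩
    rw [Real.rpow_natCast] at hy
    exact ⟨⟨hy.1.le, hy.2⟩, hy'⟩

theorem integrableOn_Ioo_rpow_ray (hA : A < n) (ρ : ℝ) :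
    IntegrableOn (fun x : ℝ => x ^ (-(A : ℝ) / n)) (Set.Ioo 0 ρ) := by
  have hn : (0 : ℝ) < n := by exact_mod_cast (Nat.zero_le A).trans_lt hA
  rcases le_or_gt ρ 0 with h | h
  · rw [Set.Ioo_eq_empty (not_lt.2 h)]; exact integrableOn_empty
  · refine (intervalIntegral.integrableOn_Ioo_rpow_iff h).2 ?_
    rw [neg_div, neg_lt_neg_iff, div_lt_one hn]
    exact_mod_cast hA

theorem cuspIntegral_eq_Ioo (hS : Continuous S) {φ : ℝ × ℝ → ℝ} {ρ : ℝ} (hφ : IsBoxFunction ρ φ)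
    (κ ε : ℝ) : cuspIntegral S φ κ ε = ∫ x in Set.Ioo 0 ρ, sliceIntegral S φ κ ε x := by
  rw [cuspIntegral_eq hS hφ, setIntegral_eq_integral_of_forall_compl_eq_zero]
  intro x hx
  rcases le_or_gt x 0 with h | h
  · exact sliceIntegral_of_nonpos h
  · exact sliceIntegral_of_le hφ (not_lt.1 fun h2 => hx ⟨h, h2⟩)

/-- The cusp integral next to a horizontal ray of height `n`. -/
theorem abs_cuspIntegral_le_of_isLowest (hS : ContDiff ℝ ∞ S)
    (h : IsLowest (taylorCoeff S) A n) (hA : A < n) :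
    ∃ ρ > 0, ∀ φ, IsBoxFunction ρ φ → ∃ C, ∀ ε : ℝ, 0 < ε →
      |cuspIntegral S φ ((A + 1 : ℕ) : ℝ) ε| ≤ C * ε ^ (1 / (n : ℝ)) := by
  obtain ⟨D, ρ, hD, hρ, hρ1, hb⟩ := exists_slice_integral_bound_of_isLowest hS h (by omega)
  refine ⟨ρ, hρ, fun φ hφ => ?_⟩
  obtain ⟨C, hC0, hC⟩ := hφ.bounded
  refine ⟨∫ x in Set.Ioo 0 ρ, C * D * x ^ (-(A : ℝ) / n), fun ε hε => ?_⟩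
  rw [cuspIntegral_eq_Ioo hS.continuous hφ, ← integral_mul_const, ← Real.norm_eq_abs]
  refine norm_integral_le_of_norm_le (((integrableOn_Ioo_rpow_ray hA ρ).const_mul _).mul_const _) ?_
  filter_upwards [ae_restrict_mem measurableSet_Ioo] with x hx
  exact hb φ C hC x ε hx.1 hx.2 hε

/-- As the lower y-derivatives vanish on the axis, S(x, y) is y^n times ∂_y^n S / n! at an
intermediate point. So for fixed x the slice, in units of ε^(1/n), tends to a slab for a(x) w^n. The
bound x^(-A/n) is integrable because A < n, and it dominates in x. -/
theorem tendsto_cuspIntegral_ray (hS : ContDiff ℝ ∞ S)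
    (h : IsLowest (taylorCoeff S) A n) (hA : A < n) {ρ₀ : ℝ} (hρ₀ : 0 < ρ₀)
    (hvan : ∀ x : ℝ, 0 < x → x < ρ₀ → ∀ b < n, (dY^[b] S) (x, 0) = 0) :
    ∃ ρ > 0, ∀ φ, IsBoxFunction ρ φ →
      IntegrableOn (fun x => posPow n ((dY^[n] S) (x, 0) / n.factorial) * φ (x, 0)) (Set.Ioi 0) ∧
      Tendsto (fun ε : ℝ => cuspIntegral S φ ((A + 1 : ℕ) : ℝ) ε / ε ^ (1 / (n : ℝ))) (𝓝[>] 0)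
        (𝓝 (∫ x in Set.Ioi 0, posPow n ((dY^[n] S) (x, 0) / n.factorial) * φ (x, 0))) := by
  have hn : n ≠ 0 := by omega
  have hn0 : (0 : ℝ) < n := by positivity
  obtain ⟨D, ρ₁, hD, hρ₁, hρ₁1, hb⟩ := exists_slice_integral_bound_of_isLowest hS h hn
  obtain ⟨c, ρ₂, hc, hρ₂, hρ₂1, hlow⟩ := exists_lower_bound_near_axis hS h
  set ρ := min ρ₀ (min ρ₁ ρ₂) with hρdef
  have hρ : 0 < ρ := lt_min hρ₀ (lt_min hρ₁ hρ₂)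
  set a : ℝ → ℝ := fun x => (dY^[n] S) (x, 0) / n.factorial with ha
  have hfac : (0 : ℝ) < n.factorial := by positivity
  have hacont : Continuous a := by
    have := (contDiff_iterate_dY hS n).continuous
    rw [ha]; fun_prop
  have halow : ∀ x, 0 < x → x < ρ → c / n.factorial * x ^ A ≤ |a x| := by
    intro x hx0 hx
    rw [ha]
    simp only
    rw [abs_div, abs_of_pos hfac, div_mul_eq_mul_div]
    gcongr
    exact hlow x 0 hx0 (hx.trans_le ((min_le_right _ _).trans (min_le_right _ _)))
      (by rw [abs_zero]; positivity)
  refine ⟨ρ, hρ, fun φ hφ => ?_⟩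
  obtain ⟨C, hC0, hC⟩ := hφ.bounded
  have hrep : ∀ x, 0 < x → x < ρ → ∀ y, 0 < y → ∃ ξ ∈ Set.Ioo 0 y,
      S (x, y) = (dY^[n] S) (x, ξ) / n.factorial * y ^ n := by
    intro x hx0 hx y hy
    have hf : ContDiff ℝ ∞ (fun z => S (x, z)) := by fun_prop
    obtain ⟨ξ, hξ, h1⟩ := exists_eq_iteratedDeriv_mul_pow hf hn (fun b hb => by
      rw [iteratedDeriv_snd hS]
      exact hvan x hx0 (hx.trans_le (min_le_left _ _)) b hb) hy
    refine ⟨ξ, hξ, ?_⟩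
    rw [h1, iteratedDeriv_snd hS]
  have hpos0 : ∀ t, 0 ≤ posPow n t := fun t => by unfold posPow; split_ifs <;> positivity
  have hbound : ∀ x, 0 < x → x < ρ → ∀ᶠ ε : ℝ in 𝓝[>] 0,
      |sliceIntegral S φ ((A + 1 : ℕ) : ℝ) ε x / ε ^ (1 / (n : ℝ))| ≤ C * D * x ^ (-(A : ℝ) / n) := by
    intro x hx0 hx
    filter_upwards [self_mem_nhdsWithin] with ε hε
    have hr : 0 < ε ^ (1 / (n : ℝ)) := Real.rpow_pos_of_pos hε _
    rw [abs_div, abs_of_pos hr, div_le_iff₀ hr]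
    exact hb φ C hC x ε hx0 (hx.trans_le ((min_le_right _ _).trans (min_le_left _ _))) hε
  have hlim : ∀ x, 0 < x → x < ρ → Tendsto
      (fun ε : ℝ => sliceIntegral S φ ((A + 1 : ℕ) : ℝ) ε x / ε ^ (1 / (n : ℝ))) (𝓝[>] 0)
      (𝓝 (posPow n (a x) * φ (x, 0))) := by
    intro x hx0 hx
    have hax : a x ≠ 0 := by
      have : 0 < c / n.factorial * x ^ A := by positivity
      exact abs_pos.1 (this.trans_le (halow x hx0 hx))
    have hm : MeasurableSet {w : ℝ | 0 < w ∧ 0 < a x * w ^ n ∧ a x * w ^ n < 1} := by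
      have hc : Measurable fun w : ℝ => a x * w ^ n := by fun_prop
      exact (measurableSet_lt measurable_const measurable_id).inter
        ((measurableSet_lt measurable_const hc).inter (measurableSet_lt hc measurable_const))
    have hint : ∫ w, {w : ℝ | 0 < w ∧ 0 < a x * w ^ n ∧ a x * w ^ n < 1}.indicator
        (fun _ => φ (x, 0)) w = posPow n (a x) * φ (x, 0) := by
      rw [integral_indicator hm, setIntegral_const, smul_eq_mul, measureReal_def,
        volume_slab_eq hn, ENNReal.toReal_ofReal (hpos0 _)]
    rw [← hint]
    have e : (fun ε : ℝ => sliceIntegral S φ ((A + 1 : ℕ) : ℝ) ε x / ε ^ (1 / (n : ℝ))) =ᶠ[𝓝[>] 0]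
        fun ε => ∫ w, (cuspSublevel S ((A + 1 : ℕ) : ℝ) ε).indicator φ (x, ε ^ (1 / (n : ℝ)) * w) := by
      filter_upwards [self_mem_nhdsWithin] with ε hε
      have hr : 0 < ε ^ (1 / (n : ℝ)) := Real.rpow_pos_of_pos hε _
      rw [sliceIntegral_eq_scaled hr, mul_div_cancel_left₀ _ hr.ne']
    refine Tendsto.congr' e.symm ?_
    set k : ℝ := c / n.factorial * x ^ A with hk
    have hk0 : 0 < k := by positivity
    -- On the cusp the coefficient of y^n is at least `k` in modulus, so k w^n < 1 on the sublevel
    -- set; this confines w to (0, W] and dominates in w for fixed x.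
    set W : ℝ := max 1 (1 / k) with hW
    refine tendsto_integral_filter_of_dominated_convergence
      ((Set.Ioc 0 W).indicator fun _ => C) ?_ ?_ ?_ ?_
    · filter_upwards [self_mem_nhdsWithin] with ε hε
      exact (integrable_scaled_indicator hS.continuous hφ.continuous hC _ ε _
        (Real.rpow_pos_of_pos hε _)).aestronglyMeasurable
    · filter_upwards [self_mem_nhdsWithin] with ε hε
      have hε0 : 0 < ε := hε
      have hr : 0 < ε ^ (1 / (n : ℝ)) := Real.rpow_pos_of_pos hε0 _
      refine Eventually.of_forall fun w => ?_
      by_cases hmem : (x, ε ^ (1 / (n : ℝ)) * w) ∈ cuspSublevel S ((A + 1 : ℕ) : ℝ) ε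
      · obtain ⟨-, h1, h2, h3, h4⟩ := hmem
        have hw : 0 < w := pos_of_mul_pos_right h1 hr.le
        have hwW : w ≤ W := by
          obtain ⟨ξ, hξ, h5⟩ := hrep x hx0 hx _ h1
          have h6 : k ≤ |(dY^[n] S) (x, ξ) / n.factorial| := by
            rw [hk, abs_div, abs_of_pos hfac, div_mul_eq_mul_div]
            gcongr
            refine hlow x ξ hx0 (hx.trans_le ((min_le_right _ _).trans (min_le_right _ _))) ?_
            simp only [Real.rpow_natCast] at h2
            rw [abs_of_pos hξ.1]
            exact (hξ.2.trans h2).le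
          have h7 : k * w ^ n < 1 := by
            have h8 : |S (x, ε ^ (1 / (n : ℝ)) * w)| < ε := by rw [abs_of_pos h3]; exact h4
            rw [h5, abs_mul, mul_pow, one_div, Real.rpow_inv_natCast_pow hε0.le hn, abs_mul,
              abs_of_pos hε0, abs_of_pos (pow_pos hw n)] at h8
            have h9 : k * (ε * w ^ n) < ε := lt_of_le_of_lt
              (mul_le_mul_of_nonneg_right h6 (by positivity)) h8
            nlinarith
          by_contra! h8
          have h9 : 1 < w := (le_max_left _ _).trans_lt h8
          have h10 : 1 / k < w := (le_max_right _ _).trans_lt h8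
          rw [div_lt_iff₀ hk0] at h10
          have h11 : w ≤ w ^ n := le_self_pow₀ h9.le hn
          nlinarith
        rw [Set.indicator_of_mem (show w ∈ Set.Ioc 0 W from ⟨hw, hwW⟩), Real.norm_eq_abs]
        by_cases h : (x, ε ^ (1 / (n : ℝ)) * w) ∈ cuspSublevel S ((A + 1 : ℕ) : ℝ) ε
        · rw [Set.indicator_of_mem h]; exact hC _
        · rw [Set.indicator_of_notMem h, abs_zero]; exact hC0
      · rw [Set.indicator_of_notMem hmem, norm_zero]
        exact Set.indicator_nonneg (fun _ _ => hC0) _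
    · exact (integrable_indicator_iff measurableSet_Ioc).2 (integrableOn_const (by simp))
    · have hfin : ∀ c, ∀ᵐ w : ℝ, a x * w ^ n ≠ c := fun c =>
        measure_eq_zero_iff_ae_notMem.1 ((finite_mul_pow_eq hn hax c).measure_zero volume)
      filter_upwards [hfin 0, hfin 1] with w h0 h1
      by_cases hw : 0 < w
      · have hr0 : Tendsto (fun ε : ℝ => ε ^ (1 / (n : ℝ)) * w) (𝓝[>] 0) (𝓝 0) := by
          simpa using (tendsto_rpow_nhdsGT_zero (one_div_pos.2 hn0)).mul_const w
        have hSlim : Tendsto (fun ε : ℝ => S (x, ε ^ (1 / (n : ℝ)) * w) / ε) (𝓝[>] 0)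
            (𝓝 (a x * w ^ n)) := by
          -- Intermediate points for all ε at once, with the default 0 for ε ≤ 0, which the
          -- one-sided limit does not see.
          have hg : ∀ ε : ℝ, ∃ ξ : ℝ, 0 < ε → ξ ∈ Set.Ioo 0 (ε ^ (1 / (n : ℝ)) * w) ∧
              S (x, ε ^ (1 / (n : ℝ)) * w) =
                (dY^[n] S) (x, ξ) / n.factorial * (ε ^ (1 / (n : ℝ)) * w) ^ n := by
            intro ε
            by_cases hε : 0 < ε
            · obtain ⟨ξ, hξ, h5⟩ := hrep x hx0 hx _ (mul_pos (Real.rpow_pos_of_pos hε (1 / (n : ℝ))) hw)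
              exact ⟨ξ, fun _ => ⟨hξ, h5⟩⟩
            · exact ⟨0, fun h => absurd h hε⟩
          choose ξ hξ using hg
          have hξ0 : Tendsto ξ (𝓝[>] 0) (𝓝 0) := by
            refine tendsto_of_tendsto_of_tendsto_of_le_of_le' tendsto_const_nhds hr0 ?_ ?_
            · filter_upwards [self_mem_nhdsWithin] with ε hε
              exact (hξ ε hε).1.1.le
            · filter_upwards [self_mem_nhdsWithin] with ε hε
              exact (hξ ε hε).1.2.le
          have hcont : Continuous fun z => (dY^[n] S) (x, z) / n.factorial := by
            have := (contDiff_iterate_dY hS n).continuous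
            fun_prop
          have h2 := ((hcont.tendsto 0).comp hξ0).mul_const (w ^ n)
          refine h2.congr' ?_
          filter_upwards [self_mem_nhdsWithin] with ε hε
          have hε0 : 0 < ε := hε
          rw [(hξ ε hε).2, mul_pow, one_div, Real.rpow_inv_natCast_pow hε0.le hn]
          simp only [Function.comp]
          field_simp
        have hφlim : Tendsto (fun ε : ℝ => φ (x, ε ^ (1 / (n : ℝ)) * w)) (𝓝[>] 0) (𝓝 (φ (x, 0))) :=
          (hφ.continuous.tendsto (x, 0)).comp (tendsto_const_nhds.prodMk_nhds hr0)
        have h3 := tendsto_ite_slab hSlim hφlim h0 h1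
        have e : {w : ℝ | 0 < w ∧ 0 < a x * w ^ n ∧ a x * w ^ n < 1}.indicator (fun _ => φ (x, 0)) w
            = if 0 < a x * w ^ n ∧ a x * w ^ n < 1 then φ (x, 0) else 0 :=
          indicator_eq_ite (f := fun _ => φ (x, 0)) (by simp only [Set.mem_ofPred_eq, hw, true_and])
        rw [e]
        refine h3.congr' ?_
        filter_upwards [self_mem_nhdsWithin, hr0.eventually_lt_const
          (show (0 : ℝ) < x ^ ((A + 1 : ℕ) : ℝ) from Real.rpow_pos_of_pos hx0 _)] with ε hε hlt
        have hε0 : 0 < ε := hε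
        refine (indicator_eq_ite ?_).symm
        rw [div_pos_iff_of_pos_right hε0, div_lt_one hε0]
        change (0 < x ∧ 0 < ε ^ (1 / (n : ℝ)) * w ∧ ε ^ (1 / (n : ℝ)) * w < x ^ ((A + 1 : ℕ) : ℝ) ∧ _ ∧ _) ↔ _
        have h5 : 0 < ε ^ (1 / (n : ℝ)) * w := mul_pos (Real.rpow_pos_of_pos hε0 _) hw
        tauto
      · have e : {w : ℝ | 0 < w ∧ 0 < a x * w ^ n ∧ a x * w ^ n < 1}.indicator (fun _ => φ (x, 0)) w = 0 :=
          Set.indicator_of_notMem (fun h => hw h.1) _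
        rw [e]
        refine tendsto_const_nhds.congr' ?_
        filter_upwards [self_mem_nhdsWithin] with ε hε
        rw [Set.indicator_of_notMem]
        exact fun h => hw (pos_of_mul_pos_right h.2.1 (Real.rpow_pos_of_pos hε _).le)
  have hdom := ((integrableOn_Ioo_rpow_ray hA ρ).const_mul (C * D))
  have hae : ∀ᵐ x ∂(volume.restrict (Set.Ioo 0 ρ)), x ∈ Set.Ioo 0 ρ := ae_restrict_mem measurableSet_Ioo
  have hgm : Measurable fun x => posPow n (a x) * φ (x, 0) := by
    have h1 : Measurable (posPow (n : ℝ)) := by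
      unfold posPow
      exact Measurable.ite measurableSet_Ioi (measurable_id.pow_const _) measurable_const
    have h2 : Continuous fun x : ℝ => φ (x, 0) := hφ.continuous.comp (by fun_prop)
    exact (h1.comp hacont.measurable).mul h2.measurable
  have hIoo : IntegrableOn (fun x => posPow n (a x) * φ (x, 0)) (Set.Ioo 0 ρ) := by
    refine Integrable.mono' hdom hgm.aestronglyMeasurable ?_
    filter_upwards [hae] with x hx
    rw [Real.norm_eq_abs]
    exact le_of_tendsto (hlim x hx.1 hx.2).abs (hbound x hx.1 hx.2)
  have hzero : ∀ x ∈ Set.Ioi (0 : ℝ) \ Set.Ioo 0 ρ, posPow n (a x) * φ (x, 0) = 0 := by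
    rintro x ⟨hx, hx'⟩
    have : φ (x, 0) = 0 := by
      by_contra h
      exact hx' ⟨hx, (le_abs_self x).trans_lt (hφ.support _ h).1⟩
    rw [this, mul_zero]
  refine ⟨?_, ?_⟩
  · rw [← integrable_indicator_iff measurableSet_Ioi]
    refine ((integrable_indicator_iff measurableSet_Ioo).2 hIoo).congr (ae_of_all _ fun x => ?_)
    by_cases hx : x ∈ Set.Ioo 0 ρ
    · rw [Set.indicator_of_mem hx, Set.indicator_of_mem (show x ∈ Set.Ioi 0 from hx.1)]
    · rw [Set.indicator_of_notMem hx]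
      by_cases hx' : x ∈ Set.Ioi (0 : ℝ)
      · rw [Set.indicator_of_mem hx', hzero x ⟨hx', hx⟩]
      · rw [Set.indicator_of_notMem hx']
  · rw [setIntegral_eq_of_subset_of_forall_sdiff_eq_zero measurableSet_Ioi
      (fun x (hx : x ∈ Set.Ioo 0 ρ) => hx.1) hzero]
    have e : ∀ ε : ℝ, cuspIntegral S φ ((A + 1 : ℕ) : ℝ) ε / ε ^ (1 / (n : ℝ)) =
        ∫ x in Set.Ioo 0 ρ, sliceIntegral S φ ((A + 1 : ℕ) : ℝ) ε x / ε ^ (1 / (n : ℝ)) := fun ε => by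
      rw [cuspIntegral_eq_Ioo hS.continuous hφ, integral_div]
    simp only [e]
    refine tendsto_integral_filter_of_dominated_convergence _ ?_ ?_ hdom ?_
    · exact Eventually.of_forall fun ε => ((stronglyMeasurable_sliceIntegral hS.continuous
        hφ.continuous _ ε).measurable.div_const _).aestronglyMeasurable
    · filter_upwards [self_mem_nhdsWithin] with ε hε
      filter_upwards [hae] with x hx
      have hr : 0 < ε ^ (1 / (n : ℝ)) := Real.rpow_pos_of_pos hε _
      rw [Real.norm_eq_abs, abs_div, abs_of_pos hr, div_le_iff₀ hr]
      exact hb φ C hC x ε hx.1 (hx.2.trans_le ((min_le_right _ _).trans (min_le_left _ _))) hε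
    · filter_upwards [hae] with x hx
      exact hlim x hx.1 hx.2

end Ray

/-- Away from the ray the cusp integral is negligible. -/
theorem tendsto_cuspIntegral_off_ray {S : ℝ × ℝ → ℝ} (hS : ContDiff ℝ ∞ S) {κ : ℝ} (hκ : 0 < κ)
    {n A : ℕ} (hn : 2 ≤ n) (hs : FaceNondegenerate (taylorCoeff S) κ n)
    (hnA : taylorCoeff S n A ≠ 0) (hA : A < n) :
    ∃ ρ > 0, ∀ φ, IsBoxFunction ρ φ →
      Tendsto (fun ε : ℝ => cuspIntegral S φ κ ε / ε ^ (1 / (n : ℝ))) (𝓝[>] 0) (𝓝 0) := by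
  have hn2 : (2 : ℝ) ≤ n := by exact_mod_cast hn
  have hn0 : (0 : ℝ) < n := by linarith
  set q : ℝ := n - 1 / 2 with hq
  have hq0 : 0 < q := by rw [hq]; linarith
  have hqn : q < n := by rw [hq]; linarith
  have hAq : (A : ℝ) < q := by
    have : (A : ℝ) + 1 ≤ n := by exact_mod_cast hA
    rw [hq]; linarith
  have hA1 : 0 < 1 - (A : ℝ) / q := by rw [sub_pos, div_lt_one hq0]; exact hAq
  have hnq : 1 < (n : ℝ) / q := by rw [one_lt_div hq0]; exact hqn
  -- δ must be small enough that x^e dominates the slice estimate for x ≤ 1 and that e < -1. The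
  -- integral is then split at x₀ = ε^(1/n), with the width of the cusp below and x^e above, and the
  -- two parts gain ε^(κ/n) and ε^(δ/n).
  set δ : ℝ := min (κ * (1 - A / q)) (((n : ℝ) / q - 1) / 2) with hδ
  have hδ0 : 0 < δ := lt_min (by positivity) (by linarith)
  have hδ1 : δ ≤ ((n : ℝ) / q - 1) / 2 := min_le_right _ _
  set e : ℝ := -((n : ℝ) / q) + δ with he
  have he1 : e < -1 := by rw [he]; linarith
  obtain ⟨D, ρ, hD, hρ, hρ1, hlow⟩ := exists_slice_bound_low hS hκ (by omega : 0 < n) hs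
    (q := q) (by rw [hq]; linarith) (by rw [hq]; linarith) hnA hAq e
  refine ⟨ρ, hρ, fun φ hφ => ?_⟩
  obtain ⟨C, hC0, hC⟩ := hφ.bounded
  have hslice : ∀ x ε : ℝ, 0 < x → 0 < ε →
      |sliceIntegral S φ κ ε x| ≤ C * (2 * D * ε ^ (1 / q) * x ^ e) := by
    intro x ε hx0 hε
    by_cases hx : x < ρ
    · have hx1 : x ≤ 1 := (hx.trans_le hρ1).le
      refine abs_sliceIntegral_le hC (by positivity) ((hlow x (x ^ κ) ε hx0 hx
        (Real.rpow_pos_of_pos hx0 κ) le_rfl hε).trans (ENNReal.ofReal_le_ofReal ?_))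
      have h1 : (ε / x ^ n) ^ (1 / q) * (x ^ κ) ^ (1 - (A : ℝ) / q)
          = ε ^ (1 / q) * x ^ (-((n : ℝ) / q) + κ * (1 - A / q)) := by
        rw [Real.div_rpow hε.le (by positivity), ← Real.rpow_natCast x n, ← Real.rpow_mul hx0.le,
          ← Real.rpow_mul hx0.le, Real.rpow_add hx0, Real.rpow_neg hx0.le, mul_one_div]
        ring
      have h2 : x ^ (-((n : ℝ) / q) + κ * (1 - A / q)) ≤ x ^ e :=
        Real.rpow_le_rpow_of_exponent_ge hx0 hx1 (by rw [he]; gcongr; exact min_le_left _ _)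
      rw [mul_assoc D, h1]
      have h3 : 0 ≤ D * ε ^ (1 / q) := by positivity
      nlinarith
    · rw [sliceIntegral_of_le hφ (not_lt.1 hx), abs_zero]
      positivity
  have hmain : ∀ ε : ℝ, 0 < ε → |cuspIntegral S φ κ ε| ≤ C * (ε ^ (1 / (n : ℝ))) ^ κ * ε ^ (1 / (n : ℝ))
      + C * (2 * D * ε ^ (1 / q)) * (-(ε ^ (1 / (n : ℝ))) ^ (e + 1) / (e + 1)) := by
    intro ε hε
    set x₀ := ε ^ (1 / (n : ℝ)) with hx₀
    have hx₀0 : 0 < x₀ := Real.rpow_pos_of_pos hε _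
    rw [cuspIntegral_eq hS.continuous hφ]
    set g₁ : ℝ → ℝ := (Set.Ioc 0 x₀).indicator fun _ => C * x₀ ^ κ with hg₁
    set g₂ : ℝ → ℝ := (Set.Ioi x₀).indicator fun x => C * (2 * D * ε ^ (1 / q)) * x ^ e with hg₂
    have hi₁ : Integrable g₁ := (integrable_indicator_iff measurableSet_Ioc).2 (integrableOn_const (by simp))
    have hi₂ : Integrable g₂ := (integrable_indicator_iff measurableSet_Ioi).2
      ((integrableOn_Ioi_rpow_of_lt he1 hx₀0).const_mul _)
    have e1 : ∫ x, g₁ x = C * x₀ ^ κ * x₀ := by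
      rw [hg₁, integral_indicator measurableSet_Ioc, setIntegral_const,
        Real.volume_real_Ioc_of_le hx₀0.le, smul_eq_mul, sub_zero, mul_comm]
    have e2 : ∫ x, g₂ x = C * (2 * D * ε ^ (1 / q)) * (-x₀ ^ (e + 1) / (e + 1)) := by
      rw [hg₂, integral_indicator measurableSet_Ioi, integral_const_mul, integral_Ioi_rpow_of_lt he1 hx₀0]
    rw [← e1, ← e2, ← integral_add hi₁ hi₂, ← Real.norm_eq_abs]
    refine norm_integral_le_of_norm_le (hi₁.add hi₂) (ae_of_all _ fun x => ?_)
    rw [Real.norm_eq_abs]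
    rcases le_or_gt x 0 with hx | hx
    · rw [sliceIntegral_of_nonpos hx, abs_zero, hg₁, hg₂,
        Set.indicator_of_notMem (fun h : x ∈ Set.Ioc 0 x₀ => absurd h.1 (not_lt.2 hx)),
        Set.indicator_of_notMem (fun h : x ∈ Set.Ioi x₀ => absurd (hx₀0.trans h) (not_lt.2 hx)), add_zero]
    · rcases le_or_gt x x₀ with hx' | hx'
      · rw [hg₁, hg₂, Set.indicator_of_mem (show x ∈ Set.Ioc 0 x₀ from ⟨hx, hx'⟩),
          Set.indicator_of_notMem (fun h : x ∈ Set.Ioi x₀ => absurd h (not_lt.2 hx')), add_zero]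
        refine (abs_sliceIntegral_le_rpow hC hx.le).trans ?_
        gcongr
      · rw [hg₁, hg₂, Set.indicator_of_mem (show x ∈ Set.Ioi x₀ from hx'),
          Set.indicator_of_notMem (fun h : x ∈ Set.Ioc 0 x₀ => absurd h.2 (not_le.2 hx')), zero_add]
        refine (hslice x ε hx hε).trans (le_of_eq ?_)
        ring
  have hb : Tendsto (fun ε : ℝ => C * ε ^ (κ / n) + C * (2 * D) * (-1 / (e + 1)) * ε ^ (δ / n)) (𝓝[>] 0)
      (𝓝 0) := by
    have h1 := ((tendsto_rpow_nhdsGT_zero (div_pos hκ hn0)).const_mul C).add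
      ((tendsto_rpow_nhdsGT_zero (div_pos hδ0 hn0)).const_mul (C * (2 * D) * (-1 / (e + 1))))
    rwa [mul_zero, mul_zero, add_zero] at h1
  refine squeeze_zero_norm' ?_ hb
  filter_upwards [self_mem_nhdsWithin] with ε hε
  have hε0 : 0 < ε := hε
  have hr : 0 < ε ^ (1 / (n : ℝ)) := Real.rpow_pos_of_pos hε0 _
  rw [Real.norm_eq_abs, abs_div, abs_of_pos hr, div_le_iff₀ hr]
  refine (hmain ε hε0).trans (le_of_eq ?_)
  have h1 : (ε ^ (1 / (n : ℝ))) ^ κ = ε ^ (κ / n) := by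
    rw [← Real.rpow_mul hε0.le]; congr 1; ring
  have h2 : ε ^ (1 / q) * (ε ^ (1 / (n : ℝ))) ^ (e + 1) = ε ^ (δ / n) * ε ^ (1 / (n : ℝ)) := by
    rw [← Real.rpow_mul hε0.le, ← Real.rpow_add hε0, ← Real.rpow_add hε0]
    congr 1
    rw [he]
    field_simp
    ring
  rw [h1, add_mul]
  congr 1
  calc C * (2 * D * ε ^ (1 / q)) * (-(ε ^ (1 / (n : ℝ))) ^ (e + 1) / (e + 1))
      = C * (2 * D) * (-1 / (e + 1)) * (ε ^ (1 / q) * (ε ^ (1 / (n : ℝ))) ^ (e + 1)) := by ring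
    _ = _ := by rw [h2]; ring

/-! ### Decomposition of the plane into eight cusps -/

section Fold

/-- A fundamental domain argument for an area-preserving involution. Applied to the two sign changes
and to the exchange of the coordinates it yields the eight cusps. -/
theorem volume_eq_fold {e : ℝ × ℝ → ℝ × ℝ} (he : MeasurePreserving e) (hinv : ∀ p, e (e p) = p)
    {A B E : Set (ℝ × ℝ)} (hB : MeasurableSet B) (hE : MeasurableSet E)
    (hdisj : ∀ p ∈ A, e p ∉ B) (hcov : ∀ᵐ p : ℝ × ℝ, p ∈ E → p ∈ A ∨ e p ∈ B) :
    volume E = volume (A ∩ E) + volume (B ∩ e ⁻¹' E) := by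
  have h1 : volume (e ⁻¹' (B ∩ e ⁻¹' E)) = volume (B ∩ e ⁻¹' E) :=
    he.measure_preimage (hB.inter (he.measurable hE)).nullMeasurableSet
  have h2 : e ⁻¹' (B ∩ e ⁻¹' E) = e ⁻¹' B ∩ E := by
    ext p; simp [hinv]
  rw [← h1, h2, ← measure_union (Set.disjoint_left.2 fun p hp hp' => hdisj p hp.1 hp'.1)
    ((he.measurable hB).inter hE)]
  refine measure_congr ?_
  filter_upwards [hcov] with p hp
  refine propext ⟨fun h => ?_, fun h => ?_⟩
  · rcases hp h with h' | h'
    · exact Or.inl ⟨h', h⟩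
    · exact Or.inr ⟨h', h⟩
  · rcases h with h | h
    · exact h.2
    · exact h.2

theorem measurePreserving_neg_fst : MeasurePreserving fun p : ℝ × ℝ => (-p.1, p.2) :=
  (Measure.measurePreserving_neg (volume : Measure ℝ)).prod (MeasurePreserving.id volume)

theorem measurePreserving_neg_snd : MeasurePreserving fun p : ℝ × ℝ => (p.1, -p.2) :=
  (MeasurePreserving.id volume).prod (Measure.measurePreserving_neg (volume : Measure ℝ))

theorem measurePreserving_prod_swap : MeasurePreserving (Prod.swap : ℝ × ℝ → ℝ × ℝ) :=
  Measure.measurePreserving_swap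

theorem volume_graph {g : ℝ → ℝ} (hg : Measurable g) : volume {p : ℝ × ℝ | p.2 = g p.1} = 0 := by
  have hm : MeasurableSet {p : ℝ × ℝ | p.2 = g p.1} :=
    measurableSet_eq_fun measurable_snd (hg.comp measurable_fst)
  rw [Measure.volume_eq_prod, Measure.measure_prod_null hm]
  exact Eventually.of_forall fun x => measure_singleton (g x)

theorem ae_fst_ne_zero : ∀ᵐ p : ℝ × ℝ, p.1 ≠ 0 := by
  suffices h : volume {p : ℝ × ℝ | p.1 = 0} = 0 from measure_eq_zero_iff_ae_notMem.1 h
  have : {p : ℝ × ℝ | p.1 = 0} = Prod.swap ⁻¹' {p : ℝ × ℝ | p.2 = (fun _ => 0 : ℝ → ℝ) p.1} := rfl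
  rw [this, measurePreserving_prod_swap.measure_preimage
    (measurableSet_eq_fun measurable_snd measurable_const).nullMeasurableSet]
  exact volume_graph measurable_const

theorem ae_snd_ne_zero : ∀ᵐ p : ℝ × ℝ, p.2 ≠ 0 :=
  measure_eq_zero_iff_ae_notMem.1 (volume_graph (measurable_const : Measurable fun _ : ℝ => (0 : ℝ)))

/-- The cusp `0 < y < x ^ κ`. -/
def cusp (κ : ℝ) : Set (ℝ × ℝ) := {p | 0 < p.1 ∧ 0 < p.2 ∧ p.2 < p.1 ^ κ}

theorem measurableSet_cusp (κ : ℝ) : MeasurableSet (cusp κ) :=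
  (measurableSet_lt measurable_const measurable_fst).inter
    ((measurableSet_lt measurable_const measurable_snd).inter
    (measurableSet_lt measurable_snd (measurable_fst.pow_const κ)))

/-- The exchange of the coordinates carries the part above y = x^κ to the cusp of exponent κ⁻¹; the
curve itself is null. -/
theorem volume_quadrant_eq {κ : ℝ} (hκ : 0 < κ) {E : Set (ℝ × ℝ)} (hE : MeasurableSet E) :
    volume {p : ℝ × ℝ | 0 < p.1 ∧ 0 < p.2 ∧ p ∈ E} =
      volume (cusp κ ∩ E) + volume (cusp κ⁻¹ ∩ Prod.swap ⁻¹' E) := by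
  set Q : Set (ℝ × ℝ) := {p | 0 < p.1 ∧ 0 < p.2 ∧ p ∈ E} with hQ
  have hQm : MeasurableSet Q := (measurableSet_lt measurable_const measurable_fst).inter
    ((measurableSet_lt measurable_const measurable_snd).inter hE)
  have hlt : ∀ x y : ℝ, 0 < x → 0 < y → (x < y ^ κ⁻¹ ↔ x ^ κ < y) := fun x y hx hy =>
    Real.lt_rpow_inv_iff_of_pos hx.le hy.le hκ
  rw [volume_eq_fold (A := cusp κ) measurePreserving_prod_swap (fun p => Prod.swap_swap p) 
    (measurableSet_cusp κ⁻¹) hQm]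
  · congr 2
    · ext p
      simp only [cusp, hQ, Set.mem_inter_iff, Set.mem_ofPred_eq]
      tauto
    · ext p
      simp only [cusp, hQ, Set.mem_inter_iff, Set.mem_ofPred_eq, Set.mem_preimage, Prod.fst_swap,
        Prod.snd_swap]
      tauto
  · rintro ⟨x, y⟩ ⟨h1, h2, h3⟩ ⟨h4, h5, h6⟩
    exact absurd ((hlt x y h1 h2).1 h6) (not_lt.2 h3.le)
  · have := measure_eq_zero_iff_ae_notMem.1 (volume_graph (measurable_id.pow_const κ))
    filter_upwards [this] with p hp hpQ
    rcases lt_or_gt_of_ne hp with h | h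
    · exact Or.inl ⟨hpQ.1, hpQ.2.1, h⟩
    · exact Or.inr ⟨hpQ.2.1, hpQ.1, (hlt _ _ hpQ.1 hpQ.2.1).2 h⟩

theorem volume_eq_sum_cusps {κ : ℝ} (hκ : 0 < κ) {E : Set (ℝ × ℝ)} (hE : MeasurableSet E) :
    volume E = ∑ σ ∈ ({1, -1} : Finset ℝ), ∑ τ ∈ ({1, -1} : Finset ℝ),
      (volume (cusp κ ∩ (fun p => (σ * p.1, τ * p.2)) ⁻¹' E) +
        volume (cusp κ⁻¹ ∩ (fun p => (σ * p.2, τ * p.1)) ⁻¹' E)) := by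
  have hmul : ∀ σ τ : ℝ, Measurable fun p : ℝ × ℝ => (σ * p.1, τ * p.2) := fun σ τ => by fun_prop
  have hquad : ∀ σ τ : ℝ, volume {p : ℝ × ℝ | 0 < p.1 ∧ 0 < p.2 ∧ (σ * p.1, τ * p.2) ∈ E} =
      volume (cusp κ ∩ (fun p => (σ * p.1, τ * p.2)) ⁻¹' E) +
        volume (cusp κ⁻¹ ∩ (fun p => (σ * p.2, τ * p.1)) ⁻¹' E) := fun σ τ =>
    volume_quadrant_eq hκ (hmul σ τ hE)
  have hX : MeasurableSet {p : ℝ × ℝ | 0 < p.1} := measurableSet_lt measurable_const measurable_fst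
  have hY : MeasurableSet {p : ℝ × ℝ | 0 < p.2} := measurableSet_lt measurable_const measurable_snd
  have h1 : ∀ E : Set (ℝ × ℝ), MeasurableSet E → volume E = volume ({p : ℝ × ℝ | 0 < p.1} ∩ E)
      + volume ({p : ℝ × ℝ | 0 < p.1} ∩ (fun p : ℝ × ℝ => (-p.1, p.2)) ⁻¹' E) := fun E hE => by
    refine volume_eq_fold measurePreserving_neg_fst (fun p => by simp) hX hE ?_ ?_
    · rintro p (hp : 0 < p.1) (hp' : 0 < -p.1); linarith
    · filter_upwards [ae_fst_ne_zero] with p hp _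
      rcases lt_or_gt_of_ne hp with h | h
      · exact Or.inr (neg_pos.2 h)
      · exact Or.inl h
  have h2 : ∀ E : Set (ℝ × ℝ), MeasurableSet E → volume E = volume ({p : ℝ × ℝ | 0 < p.2} ∩ E)
      + volume ({p : ℝ × ℝ | 0 < p.2} ∩ (fun p : ℝ × ℝ => (p.1, -p.2)) ⁻¹' E) := fun E hE => by
    refine volume_eq_fold measurePreserving_neg_snd (fun p => by simp) hY hE ?_ ?_
    · rintro p (hp : 0 < p.2) (hp' : 0 < -p.2); linarith
    · filter_upwards [ae_snd_ne_zero] with p hp _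
      rcases lt_or_gt_of_ne hp with h | h
      · exact Or.inr (neg_pos.2 h)
      · exact Or.inl h
  have hne : (1 : ℝ) ∉ ({-1} : Finset ℝ) := by norm_num
  simp only [← hquad, Finset.sum_insert hne, Finset.sum_singleton]
  rw [h1 E hE, h2 _ (hX.inter hE), h2 _ (hX.inter (measurePreserving_neg_fst.measurable hE))]
  congr 2 <;> congr 1 <;> ext p <;>
    simp only [Set.mem_inter_iff, Set.mem_ofPred_eq, Set.mem_preimage, one_mul, neg_mul] <;> tauto

/-- Formulated as an identity of measures, so that the decomposition of integrals follows by change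
of variables, with no approximation by simple functions. -/
theorem volume_eq_sum_map {κ : ℝ} (hκ : 0 < κ) :
    (volume : Measure (ℝ × ℝ)) = ∑ σ ∈ ({1, -1} : Finset ℝ), ∑ τ ∈ ({1, -1} : Finset ℝ),
      ((volume.restrict (cusp κ)).map (fun p => (σ * p.1, τ * p.2)) +
        (volume.restrict (cusp κ⁻¹)).map (fun p => (σ * p.2, τ * p.1))) := by
  have hmul : ∀ σ τ : ℝ, Measurable fun p : ℝ × ℝ => (σ * p.1, τ * p.2) := fun σ τ => by fun_prop
  have hmul' : ∀ σ τ : ℝ, Measurable fun p : ℝ × ℝ => (σ * p.2, τ * p.1) := fun σ τ => by fun_prop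
  ext E hE
  rw [volume_eq_sum_cusps hκ hE]
  simp only [Measure.finsetSum_apply, Measure.add_apply, Measure.map_apply (hmul _ _) hE,
    Measure.map_apply (hmul' _ _) hE, Measure.restrict_apply (hmul _ _ hE),
    Measure.restrict_apply (hmul' _ _ hE), Set.inter_comm]

theorem integral_eq_sum_cusps {κ : ℝ} (hκ : 0 < κ) {h : ℝ × ℝ → ℝ} (hh : Integrable h) :
    ∫ p, h p = ∑ σ ∈ ({1, -1} : Finset ℝ), ∑ τ ∈ ({1, -1} : Finset ℝ),
      ((∫ p in cusp κ, h (σ * p.1, τ * p.2)) + ∫ p in cusp κ⁻¹, h (σ * p.2, τ * p.1)) := by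
  have hmul : ∀ σ τ : ℝ, Measurable fun p : ℝ × ℝ => (σ * p.1, τ * p.2) := fun σ τ => by fun_prop
  have hmul' : ∀ σ τ : ℝ, Measurable fun p : ℝ × ℝ => (σ * p.2, τ * p.1) := fun σ τ => by fun_prop
  have hh' := hh
  rw [volume_eq_sum_map hκ] at hh'
  simp only [integrable_finsetSum_measure, integrable_add_measure] at hh'
  conv_lhs => rw [volume_eq_sum_map hκ]
  rw [integral_finsetSum_measure]
  · refine Finset.sum_congr rfl fun σ hσ => ?_
    rw [integral_finsetSum_measure]
    · refine Finset.sum_congr rfl fun τ hτ => ?_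
      obtain ⟨i1, i2⟩ := hh' σ hσ τ hτ
      rw [integral_add_measure i1 i2, integral_map (hmul σ τ).aemeasurable i1.aestronglyMeasurable,
        integral_map (hmul' σ τ).aemeasurable i2.aestronglyMeasurable]
    · intro τ hτ
      exact (hh' σ hσ τ hτ).1.add_measure (hh' σ hσ τ hτ).2
  · intro σ hσ
    rw [integrable_finsetSum_measure]
    intro τ hτ
    exact (hh' σ hσ τ hτ).1.add_measure (hh' σ hσ τ hτ).2

theorem cuspSublevel_eq_inter (S : ℝ × ℝ → ℝ) (κ ε : ℝ) :
    cuspSublevel S κ ε = cusp κ ∩ {p | 0 < S p ∧ S p < ε} := by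
  ext p
  simp only [cuspSublevel, cusp, Set.mem_inter_iff, Set.mem_ofPred_eq]
  tauto

theorem measurableSet_sublevel {S : ℝ × ℝ → ℝ} (hS : Continuous S) (ε : ℝ) :
    MeasurableSet {p : ℝ × ℝ | 0 < S p ∧ S p < ε} :=
  (measurableSet_lt measurable_const hS.measurable).inter
    (measurableSet_lt hS.measurable measurable_const)

theorem volume_sublevel_eq_sum {f : ℝ × ℝ → ℝ} (hf : Continuous f) {κ : ℝ} (hκ : 0 < κ) (ε : ℝ) :
    volume {p | 0 < f p ∧ f p < ε} = ∑ σ ∈ ({1, -1} : Finset ℝ), ∑ τ ∈ ({1, -1} : Finset ℝ),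
      (volume (cuspSublevel (reflect σ τ f) κ ε) +
        volume (cuspSublevel (reflect σ τ f ∘ Prod.swap) κ⁻¹ ε)) := by
  rw [volume_eq_sum_cusps hκ (measurableSet_sublevel hf ε)]
  simp only [cuspSublevel_eq_inter]
  rfl

theorem sublevelIntegral_eq_sum {S φ : ℝ × ℝ → ℝ} (hS : Continuous S) {ρ : ℝ}
    (hφ : IsBoxFunction ρ φ) {κ : ℝ} (hκ : 0 < κ) (ε : ℝ) :
    sublevelIntegral S φ ε = ∑ σ ∈ ({1, -1} : Finset ℝ), ∑ τ ∈ ({1, -1} : Finset ℝ),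
      (cuspIntegral (reflect σ τ S) (reflect σ τ φ) κ ε +
        cuspIntegral (reflect σ τ S ∘ Prod.swap) (reflect σ τ φ ∘ Prod.swap) κ⁻¹ ε) := by
  unfold sublevelIntegral cuspIntegral
  rw [← integral_indicator (measurableSet_sublevel hS ε),
    integral_eq_sum_cusps hκ (hφ.integrable.indicator (measurableSet_sublevel hS ε))]
  simp only [cuspSublevel_eq_inter, ← Set.indicator_indicator, integral_indicator (measurableSet_cusp _)]
  rfl

end Fold

theorem abs_eq_one_of_mem {σ : ℝ} (h : σ ∈ ({1, -1} : Finset ℝ)) : |σ| = 1 := by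
  rw [Finset.mem_insert, Finset.mem_singleton] at h
  rcases h with rfl | rfl <;> simp

theorem IsBoxFunction.reflect {ρ : ℝ} {φ : ℝ × ℝ → ℝ} (h : IsBoxFunction ρ φ) {σ τ : ℝ}
    (hσ : |σ| = 1) (hτ : |τ| = 1) : IsBoxFunction ρ (reflect σ τ φ) where
  continuous := h.continuous.comp (by fun_prop)
  bounded := by
    obtain ⟨C, h0, hC⟩ := h.bounded
    exact ⟨C, h0, fun p => hC _⟩
  support := fun p hp => by
    have := h.support _ hp
    simpa [abs_mul, hσ, hτ] using this

theorem IsBoxFunction.comp_swap {ρ : ℝ} {φ : ℝ × ℝ → ℝ} (h : IsBoxFunction ρ φ) :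
    IsBoxFunction ρ (φ ∘ Prod.swap) where
  continuous := h.continuous.comp continuous_swap
  bounded := by
    obtain ⟨C, h0, hC⟩ := h.bounded
    exact ⟨C, h0, fun p => hC _⟩
  support := fun p hp => (h.support _ hp).symm

theorem IsBoxFunction.mono {ρ ρ' : ℝ} {φ : ℝ × ℝ → ℝ} (h : IsBoxFunction ρ φ) (hρ : ρ ≤ ρ') :
    IsBoxFunction ρ' φ where
  continuous := h.continuous
  bounded := h.bounded
  support := fun p hp => ⟨(h.support p hp).1.trans_le hρ, (h.support p hp).2.trans_le hρ⟩

/-- A statement about finitely many sign patterns holds on a common box. -/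
theorem exists_common_radius {P : ℝ → ℝ → (ℝ × ℝ → ℝ) → Prop}
    (h : ∀ σ ∈ ({1, -1} : Finset ℝ), ∀ τ ∈ ({1, -1} : Finset ℝ),
      ∃ ρ > 0, ∀ φ, IsBoxFunction ρ φ → P σ τ φ) :
    ∃ ρ > 0, ∀ φ, IsBoxFunction ρ φ →
      ∀ σ ∈ ({1, -1} : Finset ℝ), ∀ τ ∈ ({1, -1} : Finset ℝ), P σ τ φ := by
  have m1 : (1 : ℝ) ∈ ({1, -1} : Finset ℝ) := by simp
  have m2 : (-1 : ℝ) ∈ ({1, -1} : Finset ℝ) := by simp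
  obtain ⟨a, ha, ha'⟩ := h 1 m1 1 m1
  obtain ⟨b, hb, hb'⟩ := h 1 m1 (-1) m2
  obtain ⟨c, hc, hc'⟩ := h (-1) m2 1 m1
  obtain ⟨d, hd, hd'⟩ := h (-1) m2 (-1) m2
  refine ⟨min (min a b) (min c d), by positivity, fun φ hφ σ hσ τ hτ => ?_⟩
  rw [Finset.mem_insert, Finset.mem_singleton] at hσ hτ
  rcases hσ with rfl | rfl <;> rcases hτ with rfl | rfl
  · exact ha' φ (hφ.mono ((min_le_left _ _).trans (min_le_left _ _)))
  · exact hb' φ (hφ.mono ((min_le_left _ _).trans (min_le_right _ _)))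
  · exact hc' φ (hφ.mono ((min_le_right _ _).trans (min_le_left _ _)))
  · exact hd' φ (hφ.mono ((min_le_right _ _).trans (min_le_right _ _)))

/-- The limit of a sublevel integral is the sum of the limits of its eight cusp integrals. -/
theorem tendsto_sublevelIntegral_of_cusps {S : ℝ × ℝ → ℝ} (hS : Continuous S) {κ : ℝ} (hκ : 0 < κ)
    {g : ℝ → ℝ} {ι : Type*} {ok : ι → Prop}
    {L L' : ι → ℝ → ℝ → (ℝ × ℝ → ℝ) → ℝ}
    (h : ∀ σ ∈ ({1, -1} : Finset ℝ), ∀ τ ∈ ({1, -1} : Finset ℝ), ∃ ρ > 0, ∀ φ, IsBoxFunction ρ φ → ∀ i, ok i →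
      Tendsto (fun ε => cuspIntegral (reflect σ τ S) φ κ ε / g ε) (𝓝[>] 0) (𝓝 (L i σ τ φ)))
    (h' : ∀ σ ∈ ({1, -1} : Finset ℝ), ∀ τ ∈ ({1, -1} : Finset ℝ), ∃ ρ > 0, ∀ φ, IsBoxFunction ρ φ → ∀ i, ok i →
      Tendsto (fun ε => cuspIntegral (reflect σ τ S ∘ Prod.swap) φ κ⁻¹ ε / g ε) (𝓝[>] 0)
        (𝓝 (L' i σ τ φ))) :
    ∃ ρ > 0, ∀ φ, IsBoxFunction ρ φ → ∀ i, ok i →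
      Tendsto (fun ε => sublevelIntegral S φ ε / g ε) (𝓝[>] 0)
        (𝓝 (∑ σ ∈ ({1, -1} : Finset ℝ), ∑ τ ∈ ({1, -1} : Finset ℝ),
          (L i σ τ (reflect σ τ φ) + L' i σ τ (reflect σ τ φ ∘ Prod.swap)))) := by
  obtain ⟨ρ, hρ, h1⟩ := exists_common_radius h
  obtain ⟨ρ', hρ', h2⟩ := exists_common_radius h'
  refine ⟨min ρ ρ', lt_min hρ hρ', fun φ hφ i hi => ?_⟩
  have e : ∀ ε, sublevelIntegral S φ ε / g ε =
      ∑ σ ∈ ({1, -1} : Finset ℝ), ∑ τ ∈ ({1, -1} : Finset ℝ),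
      (cuspIntegral (reflect σ τ S) (reflect σ τ φ) κ ε / g ε +
        cuspIntegral (reflect σ τ S ∘ Prod.swap) (reflect σ τ φ ∘ Prod.swap) κ⁻¹ ε / g ε) := fun ε => by
    rw [sublevelIntegral_eq_sum hS hφ hκ, Finset.sum_div]
    refine Finset.sum_congr rfl fun σ _ => ?_
    rw [Finset.sum_div]
    exact Finset.sum_congr rfl fun τ _ => add_div _ _ _
  simp only [e]
  refine tendsto_finsetSum _ fun σ hσ => tendsto_finsetSum _ fun τ hτ => ?_
  have hb : IsBoxFunction (min ρ ρ') (reflect σ τ φ) :=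
    hφ.reflect (abs_eq_one_of_mem hσ) (abs_eq_one_of_mem hτ)
  exact (h1 _ (hb.mono (min_le_left _ _)) σ hσ τ hτ i hi).add
    (h2 _ (hb.comp_swap.mono (min_le_right _ _)) σ hσ τ hτ i hi)

theorem isBigO_sublevelIntegral_of_cusps {S : ℝ × ℝ → ℝ} (hS : Continuous S) {κ : ℝ} (hκ : 0 < κ)
    {g : ℝ → ℝ}
    (h : ∀ σ ∈ ({1, -1} : Finset ℝ), ∀ τ ∈ ({1, -1} : Finset ℝ), ∃ ρ > 0, ∀ φ, IsBoxFunction ρ φ →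
      cuspIntegral (reflect σ τ S) φ κ =O[𝓝[>] 0] g)
    (h' : ∀ σ ∈ ({1, -1} : Finset ℝ), ∀ τ ∈ ({1, -1} : Finset ℝ), ∃ ρ > 0, ∀ φ, IsBoxFunction ρ φ →
      cuspIntegral (reflect σ τ S ∘ Prod.swap) φ κ⁻¹ =O[𝓝[>] 0] g) :
    ∃ ρ > 0, ∀ φ, IsBoxFunction ρ φ → sublevelIntegral S φ =O[𝓝[>] 0] g := by
  obtain ⟨ρ, hρ, h1⟩ := exists_common_radius h
  obtain ⟨ρ', hρ', h2⟩ := exists_common_radius h'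
  refine ⟨min ρ ρ', lt_min hρ hρ', fun φ hφ => ?_⟩
  have e : sublevelIntegral S φ = fun ε =>
      ∑ σ ∈ ({1, -1} : Finset ℝ), ∑ τ ∈ ({1, -1} : Finset ℝ),
      (cuspIntegral (reflect σ τ S) (reflect σ τ φ) κ ε +
        cuspIntegral (reflect σ τ S ∘ Prod.swap) (reflect σ τ φ ∘ Prod.swap) κ⁻¹ ε) :=
    funext fun ε => sublevelIntegral_eq_sum hS hφ hκ ε
  rw [e]
  refine IsBigO.fun_sum fun σ hσ => IsBigO.fun_sum fun τ hτ => ?_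
  have hb : IsBoxFunction (min ρ ρ') (reflect σ τ φ) :=
    hφ.reflect (abs_eq_one_of_mem hσ) (abs_eq_one_of_mem hτ)
  exact (h1 _ (hb.mono (min_le_left _ _)) σ hσ τ hτ).add
    (h2 _ (hb.comp_swap.mono (min_le_right _ _)) σ hσ τ hτ)

/-! ### Areas of quasi-homogeneous sublevel sets -/

theorem posPow_nonneg (d s : ℝ) : 0 ≤ posPow d s := by
  unfold posPow; split_ifs <;> positivity

theorem measurable_posPow (d : ℝ) : Measurable (posPow d) := by
  unfold posPow
  exact Measurable.ite measurableSet_Ioi (measurable_id.pow_const _) measurable_const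

theorem volume_eq_add_neg_fst {E : Set (ℝ × ℝ)} (hE : MeasurableSet E) :
    volume E = volume {p : ℝ × ℝ | 0 < p.1 ∧ p ∈ E}
      + volume {p : ℝ × ℝ | 0 < p.1 ∧ (-p.1, p.2) ∈ E} := by
  have hX : MeasurableSet {p : ℝ × ℝ | 0 < p.1} := measurableSet_lt measurable_const measurable_fst
  refine volume_eq_fold measurePreserving_neg_fst (fun p => by simp) hX hE ?_ ?_
  · rintro p (hp : 0 < p.1) (hp' : 0 < -p.1); linarith
  · filter_upwards [ae_fst_ne_zero] with p hp _
    rcases lt_or_gt_of_ne hp with h | h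
    · exact Or.inr (neg_pos.2 h)
    · exact Or.inl h

/-- For g > 0 the conditions on u describe the interval (0, R) with R = g^(-1/α), and R^(m+1) =
g^(-1/d) because α = d (1 + m). -/
theorem lintegral_rpow_sublevel {d m g : ℝ} (hd : 0 < d) (hm : 0 < m) :
    ∫⁻ u : ℝ, (if 0 < u ∧ 0 < u ^ (d * (1 + m)) * g ∧ u ^ (d * (1 + m)) * g < 1 then
      ENNReal.ofReal (u ^ m) else 0) = ENNReal.ofReal ((m + 1)⁻¹ * posPow d g) := by
  set α := d * (1 + m) with hα
  have hα0 : 0 < α := by positivity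
  by_cases hg : 0 < g
  · set R := g ^ (-1 / α) with hR
    have hR0 : 0 < R := Real.rpow_pos_of_pos hg _
    have hRα : R ^ α * g = 1 := by
      rw [hR, ← Real.rpow_mul hg.le, div_mul_cancel₀ _ hα0.ne', Real.rpow_neg_one,
        inv_mul_cancel₀ hg.ne']
    have hRm : R ^ (m + 1) = g ^ (-1 / d) := by
      rw [hR, ← Real.rpow_mul hg.le]
      congr 1
      rw [hα]
      have : 1 + m ≠ 0 := by positivity
      field_simp
      ring
    have e : (fun u : ℝ => if 0 < u ∧ 0 < u ^ α * g ∧ u ^ α * g < 1 then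
        ENNReal.ofReal (u ^ m) else 0) = (Set.Ioo 0 R).indicator fun u => ENNReal.ofReal (u ^ m) := by
      funext u
      rw [Set.indicator_apply]
      refine if_congr ?_ rfl rfl
      constructor
      · rintro ⟨h1, h2, h3⟩
        refine ⟨h1, ?_⟩
        rw [← hRα] at h3
        exact (Real.rpow_lt_rpow_iff h1.le hR0.le hα0).1 (lt_of_mul_lt_mul_right h3 hg.le)
      · rintro ⟨h1, h2⟩
        have h3 := Real.rpow_pos_of_pos h1 α
        refine ⟨h1, by positivity, ?_⟩
        rw [← hRα]
        exact mul_lt_mul_of_pos_right (Real.rpow_lt_rpow h1.le h2 hα0) hg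
    have hint : IntegrableOn (fun u : ℝ => u ^ m) (Set.Ioo 0 R) :=
      (intervalIntegral.integrableOn_Ioo_rpow_iff hR0).2 (by linarith)
    rw [e, lintegral_indicator measurableSet_Ioo, ← ofReal_integral_eq_lintegral_ofReal hint]
    · rw [← integral_Ioc_eq_integral_Ioo, ← intervalIntegral.integral_of_le hR0.le,
        integral_rpow (Or.inl (by linarith)), Real.zero_rpow (by linarith), sub_zero, hRm]
      congr 1
      unfold posPow
      rw [if_pos hg]
      ring
    · filter_upwards [ae_restrict_mem measurableSet_Ioo] with u hu
      exact (Real.rpow_pos_of_pos hu.1 m).le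
  · have e : (fun u : ℝ => if 0 < u ∧ 0 < u ^ α * g ∧ u ^ α * g < 1 then
        ENNReal.ofReal (u ^ m) else 0) = fun _ => 0 := by
      funext u
      rw [if_neg]
      rintro ⟨h1, h2, -⟩
      exact hg (pos_of_mul_pos_right h2 (Real.rpow_pos_of_pos h1 α).le)
    rw [e, lintegral_zero]
    unfold posPow
    rw [if_neg hg, mul_zero, ENNReal.ofReal_zero]

/-- The area of the sublevel set of a quasi-homogeneous function in a half plane. -/
theorem volume_halfplane_quasiHomogeneous {f : ℝ × ℝ → ℝ} (hf : Continuous f) {d m : ℝ} (hd : 0 < d)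
    (hm : 0 < m) (hhom : ∀ u > 0, ∀ v, f (u, u ^ m * v) = u ^ (d * (1 + m)) * f (1, v)) :
    volume {p : ℝ × ℝ | 0 < p.1 ∧ 0 < f p ∧ f p < 1} =
      ENNReal.ofReal (m + 1)⁻¹ * ∫⁻ t, ENNReal.ofReal (posPow d (f (1, t))) := by
  set α := d * (1 + m) with hα
  have hg : Continuous fun t => f (1, t) := hf.comp (by fun_prop)
  have hEm : MeasurableSet {p : ℝ × ℝ | 0 < p.1 ∧ 0 < f p ∧ f p < 1} :=
    (measurableSet_lt measurable_const measurable_fst).inter (measurableSet_sublevel hf 1)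
  have hslice : ∀ u : ℝ, volume (Prod.mk u ⁻¹' {p : ℝ × ℝ | 0 < p.1 ∧ 0 < f p ∧ f p < 1}) =
      ∫⁻ t, (if 0 < u ∧ 0 < u ^ α * f (1, t) ∧ u ^ α * f (1, t) < 1 then
        ENNReal.ofReal (u ^ m) else 0) := by
    intro u
    by_cases hu : 0 < u
    · have hum : 0 < u ^ m := Real.rpow_pos_of_pos hu m
      set B : Set ℝ := {t | 0 < u ^ α * f (1, t) ∧ u ^ α * f (1, t) < 1} with hB
      have hBm : MeasurableSet B :=
        (measurableSet_lt measurable_const (hg.measurable.const_mul _)).inter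
          (measurableSet_lt (hg.measurable.const_mul _) measurable_const)
      -- The substitution v = u^m t makes the slice depend on f only through f(1, t); by Tonelli the
      -- integration in u can then be done first.
      have e1 : (fun t => u ^ m * t) ⁻¹' (Prod.mk u ⁻¹' {p : ℝ × ℝ | 0 < p.1 ∧ 0 < f p ∧ f p < 1}) = B := by
        ext t
        simp only [Set.mem_preimage, Set.mem_ofPred_eq, hB, hhom u hu t, hu, true_and]
      have e2 := Real.volume_preimage_mul_left hum.ne'
        (Prod.mk u ⁻¹' {p : ℝ × ℝ | 0 < p.1 ∧ 0 < f p ∧ f p < 1})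
      rw [e1, abs_of_pos (inv_pos.2 hum)] at e2
      have e3 : (fun t => if 0 < u ∧ 0 < u ^ α * f (1, t) ∧ u ^ α * f (1, t) < 1 then
        ENNReal.ofReal (u ^ m) else 0) = B.indicator fun _ => ENNReal.ofReal (u ^ m) := by
        funext t
        rw [Set.indicator_apply]
        exact if_congr (by simp only [hu, true_and, hB, Set.mem_ofPred_eq]) rfl rfl
      rw [e3, lintegral_indicator hBm, setLIntegral_const, e2, ← mul_assoc,
        ← ENNReal.ofReal_mul hum.le, mul_inv_cancel₀ hum.ne', ENNReal.ofReal_one, one_mul]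
    · have e1 : Prod.mk u ⁻¹' {p : ℝ × ℝ | 0 < p.1 ∧ 0 < f p ∧ f p < 1} = ∅ := by
        ext t
        simp only [Set.mem_preimage, Set.mem_ofPred_eq, hu, false_and, Set.mem_empty_iff_false]
      rw [e1, measure_empty]
      simp only [hu, false_and, if_false, lintegral_zero]
  rw [Measure.volume_eq_prod, Measure.prod_apply hEm]
  simp only [hslice]
  rw [lintegral_lintegral_swap]
  · have hL : ∀ t, ∫⁻ u : ℝ, (if 0 < u ∧ 0 < u ^ α * f (1, t) ∧ u ^ α * f (1, t) < 1 then
        ENNReal.ofReal (u ^ m) else 0) = ENNReal.ofReal ((m + 1)⁻¹ * posPow d (f (1, t))) := fun t =>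
      lintegral_rpow_sublevel hd hm
    simp only [hL, ENNReal.ofReal_mul (inv_nonneg.2 (by linarith : 0 ≤ m + 1))]
    exact lintegral_const_mul _ ((measurable_posPow d).comp hg.measurable).ennreal_ofReal
  · refine (Measurable.ite ?_ ?_ measurable_const).aemeasurable
    · have h1 : Measurable fun p : ℝ × ℝ => p.1 ^ α * f (1, p.2) :=
        (measurable_fst.pow_const α).mul (hg.measurable.comp measurable_snd)
      exact (measurableSet_lt measurable_const measurable_fst).inter
        ((measurableSet_lt measurable_const h1).inter (measurableSet_lt h1 measurable_const))
    · exact (measurable_fst.pow_const m).ennreal_ofReal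

theorem facePoly_quasiHomogeneous {s : ℕ → ℕ → ℝ} {F : Finset (ℕ × ℕ)} {m α : ℝ}
    (hF : ∀ p ∈ F, (p.1 : ℝ) + m * p.2 = α) (σ : ℝ) {u : ℝ} (hu : 0 < u) (v : ℝ) :
    facePoly s F (σ * u, u ^ m * v) = u ^ α * facePoly s F (σ, v) := by
  unfold facePoly
  rw [Finset.mul_sum]
  refine Finset.sum_congr rfl fun p hp => ?_
  rw [← hF p hp, Real.rpow_add hu, Real.rpow_mul hu.le, Real.rpow_natCast, Real.rpow_natCast]
  simp only [mul_pow]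
  ring

/-- Integrability is read off from the finiteness of the area, so that the zeros of f(±1, ·) need
not be examined. -/
theorem integrable_posPow_of_volume_lt_top {f : ℝ × ℝ → ℝ} (hf : Continuous f) {d m : ℝ} (hd : 0 < d)
    (hm : 0 < m) (hhom : ∀ σ : ℝ, ∀ u > 0, ∀ v, f (σ * u, u ^ m * v) = u ^ (d * (1 + m)) * f (σ, v))
    (hfin : volume {p | 0 < f p ∧ f p < 1} < ⊤) :
    Integrable (fun t => posPow d (f (1, t))) ∧ Integrable (fun t => posPow d (f (-1, t))) ∧
    volume.real {p | 0 < f p ∧ f p < 1} =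
      (m + 1)⁻¹ * ∫ t, (posPow d (f (1, t)) + posPow d (f (-1, t))) := by
  have hm1 : 0 < (m + 1)⁻¹ := by positivity
  have hc1 : ∀ σ : ℝ, Continuous fun t => f (σ, t) := fun σ => hf.comp (by fun_prop)
  have hmeas : ∀ σ : ℝ, AEStronglyMeasurable (fun t => posPow d (f (σ, t))) volume := fun σ =>
    ((measurable_posPow d).comp (hc1 σ).measurable).aestronglyMeasurable
  have hsplit := volume_eq_add_neg_fst (measurableSet_sublevel hf 1)
  have e1 := volume_halfplane_quasiHomogeneous hf hd hm (fun u hu v => by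
    simpa using hhom 1 u hu v)
  have hf' : Continuous fun p : ℝ × ℝ => f (-p.1, p.2) := hf.comp (by fun_prop)
  have e2 := volume_halfplane_quasiHomogeneous hf' hd hm (fun u hu v => by
    simpa using hhom (-1) u hu v)
  simp only [Set.mem_ofPred_eq] at hsplit
  rw [e1, e2] at hsplit
  rw [hsplit] at hfin
  have hofReal : ENNReal.ofReal (m + 1)⁻¹ ≠ 0 := by
    rw [Ne, ENNReal.ofReal_eq_zero, not_le]; exact hm1
  obtain ⟨f1, f2⟩ := ENNReal.add_lt_top.1 hfin
  have g1 : ∫⁻ t, ENNReal.ofReal (posPow d (f (1, t))) ≠ ⊤ := fun h => by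
    rw [h, ENNReal.mul_top hofReal] at f1; exact absurd f1 (lt_irrefl _)
  have g2 : ∫⁻ t, ENNReal.ofReal (posPow d (f (-1, t))) ≠ ⊤ := fun h => by
    rw [h, ENNReal.mul_top hofReal] at f2; exact absurd f2 (lt_irrefl _)
  have i1 := (lintegral_ofReal_ne_top_iff_integrable (hmeas 1)
    (Eventually.of_forall fun t => posPow_nonneg d _)).1 g1
  have i2 := (lintegral_ofReal_ne_top_iff_integrable (hmeas (-1))
    (Eventually.of_forall fun t => posPow_nonneg d _)).1 g2
  refine ⟨i1, i2, ?_⟩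
  rw [measureReal_def, hsplit, integral_add i1 i2,
    integral_eq_lintegral_of_nonneg_ae (Eventually.of_forall fun t => posPow_nonneg d _) (hmeas 1),
    integral_eq_lintegral_of_nonneg_ae (Eventually.of_forall fun t => posPow_nonneg d _) (hmeas (-1)),
    ENNReal.toReal_add f1.ne f2.ne, ENNReal.toReal_mul, ENNReal.toReal_mul,
    ENNReal.toReal_ofReal hm1.le, mul_add]

/-! ### Summation over the cusps in the cases edge, vertex and ray -/

section SignPatterns

theorem taylorCoeff_reflect_ne_zero {S : ℝ × ℝ → ℝ} (hS : ContDiff ℝ ∞ S) {σ τ : ℝ} (hσ : |σ| = 1)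
    (hτ : |τ| = 1) (a b : ℕ) : taylorCoeff (reflect σ τ S) a b ≠ 0 ↔ taylorCoeff S a b ≠ 0 := by
  have h1 : σ ≠ 0 := by rintro rfl; simp at hσ
  have h2 : τ ≠ 0 := by rintro rfl; simp at hτ
  rw [taylorCoeff_reflect hS, Ne, mul_eq_zero, not_or]
  exact ⟨fun h => h.2, fun h => ⟨mul_ne_zero (pow_ne_zero _ h1) (pow_ne_zero _ h2), h⟩⟩

theorem taylorCoeff_reflect_swap_ne_zero {S : ℝ × ℝ → ℝ} (hS : ContDiff ℝ ∞ S) {σ τ : ℝ}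
    (hσ : |σ| = 1) (hτ : |τ| = 1) (a b : ℕ) :
    taylorCoeff (reflect σ τ S ∘ Prod.swap) a b ≠ 0 ↔ taylorCoeff S b a ≠ 0 := by
  rw [taylorCoeff_comp_swap (contDiff_reflect hS σ τ), taylorCoeff_reflect_ne_zero hS hσ hτ]

theorem facePoly_reflect {S : ℝ × ℝ → ℝ} (hS : ContDiff ℝ ∞ S) (σ τ : ℝ) (F : Finset (ℕ × ℕ)) :
    facePoly (taylorCoeff (reflect σ τ S)) F = reflect σ τ (facePoly (taylorCoeff S) F) := by
  funext p
  unfold facePoly reflect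
  refine Finset.sum_congr rfl fun p _ => ?_
  have := taylorCoeff_reflect hS σ τ p.1 p.2
  unfold reflect at this
  rw [this, mul_pow, mul_pow]
  ring

theorem facePoly_swap {S : ℝ × ℝ → ℝ} (hS : ContDiff ℝ ∞ S) (F : Finset (ℕ × ℕ)) :
    facePoly (taylorCoeff (S ∘ Prod.swap)) (F.map (Equiv.prodComm ℕ ℕ).toEmbedding) =
      facePoly (taylorCoeff S) F ∘ Prod.swap := by
  funext p
  unfold facePoly
  rw [Finset.sum_map]
  refine Finset.sum_congr rfl fun q _ => ?_
  simp only [Equiv.coe_toEmbedding, Equiv.prodComm_apply, Prod.fst_swap, Prod.snd_swap,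
    taylorCoeff_comp_swap hS]
  ring

end SignPatterns

/-- The leading term when the bisectrix meets the interior of a compact edge. -/
theorem tendsto_sublevelIntegral_edge {S : ℝ × ℝ → ℝ} (hS : ContDiff ℝ ∞ S) {d m q : ℝ}
    (hm : 0 < m) {K : ℕ} (hK : 0 < K)
    (hs : ∀ σ ∈ ({1, -1} : Finset ℝ), ∀ τ ∈ ({1, -1} : Finset ℝ),
      FaceNondegenerate (taylorCoeff (reflect σ τ S)) m K)
    (hs' : ∀ σ ∈ ({1, -1} : Finset ℝ), ∀ τ ∈ ({1, -1} : Finset ℝ),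
      FaceNondegenerate (taylorCoeff (reflect σ τ S ∘ Prod.swap)) m⁻¹ K)
    (hq : 1 ≤ q) (hKq : (K : ℝ) - 1 ≤ q) (hqd : q < d) {A B A' B' : ℕ}
    (hAB : taylorCoeff S A B ≠ 0) (hBq : (B : ℝ) < q) (hABd : (A : ℝ) + m * B = d * (1 + m))
    (hAB' : taylorCoeff S A' B' ≠ 0) (hAq' : (A' : ℝ) < q) (hABd' : (A' : ℝ) + m * B' = d * (1 + m))
    {F : Finset (ℕ × ℕ)}
    (hF : ∀ p : ℕ × ℕ, p ∈ F ↔ taylorCoeff S p.1 p.2 ≠ 0 ∧ (p.1 : ℝ) + m * p.2 = d * (1 + m))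
    (hmin : ∀ a b : ℕ, taylorCoeff S a b ≠ 0 → d * (1 + m) ≤ a + m * b) :
    Integrable (fun y => posPow d (facePoly (taylorCoeff S) F (1, y))) ∧
    Integrable (fun y => posPow d (facePoly (taylorCoeff S) F (-1, y))) ∧
    ∃ ρ > 0, ∀ φ, IsBoxFunction ρ φ →
      Tendsto (fun ε : ℝ => sublevelIntegral S φ ε / ε ^ (1 / d)) (𝓝[>] 0)
        (𝓝 ((m + 1)⁻¹ * φ (0, 0) * ∫ y, (posPow d (facePoly (taylorCoeff S) F (1, y)) +
          posPow d (facePoly (taylorCoeff S) F (-1, y))))) := by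
  have hd : 0 < d := by linarith
  set f := facePoly (taylorCoeff S) F with hf
  have hfc : Continuous f := continuous_facePoly _ _
  have hside : ∀ σ ∈ ({1, -1} : Finset ℝ), ∀ τ ∈ ({1, -1} : Finset ℝ),
      volume (cuspSublevel (reflect σ τ f) m 1) < ⊤ ∧ ∃ ρ > 0, ∀ φ, IsBoxFunction ρ φ →
      Tendsto (fun ε : ℝ => cuspIntegral (reflect σ τ S) φ m ε / ε ^ (1 / d)) (𝓝[>] 0)
        (𝓝 (φ (0, 0) * volume.real (cuspSublevel (reflect σ τ f) m 1))) := by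
    intro σ hσ τ hτ
    have hne := taylorCoeff_reflect_ne_zero hS (abs_eq_one_of_mem hσ) (abs_eq_one_of_mem hτ)
    rw [hf, ← facePoly_reflect hS]
    refine tendsto_cuspIntegral_edge (contDiff_reflect hS σ τ) hd hm hK (hs σ hσ τ hτ) hq hKq hqd
      ((hne A B).2 hAB) hBq hABd (fun p => by rw [hF, hne]) (fun a b hab => hmin a b ((hne a b).1 hab))
      ⟨(A', B'), (hF _).2 ⟨hAB', hABd'⟩, ?_⟩
    -- B' = 0 would give A' = d (1 + m) > d.
    rintro (h : B' = 0)
    rw [h, Nat.cast_zero, mul_zero, add_zero] at hABd'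
    nlinarith
  have hside' : ∀ σ ∈ ({1, -1} : Finset ℝ), ∀ τ ∈ ({1, -1} : Finset ℝ),
      volume (cuspSublevel (reflect σ τ f ∘ Prod.swap) m⁻¹ 1) < ⊤ ∧ ∃ ρ > 0, ∀ φ, IsBoxFunction ρ φ →
      Tendsto (fun ε : ℝ => cuspIntegral (reflect σ τ S ∘ Prod.swap) φ m⁻¹ ε / ε ^ (1 / d)) (𝓝[>] 0)
        (𝓝 (φ (0, 0) * volume.real (cuspSublevel (reflect σ τ f ∘ Prod.swap) m⁻¹ 1))) := by
    intro σ hσ τ hτ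
    have hne := taylorCoeff_reflect_swap_ne_zero hS (abs_eq_one_of_mem hσ) (abs_eq_one_of_mem hτ)
    have hline : ∀ a b : ℝ, (b + m⁻¹ * a = d * (1 + m⁻¹) ↔ a + m * b = d * (1 + m)) := fun a b => by
      constructor
      · intro h
        have : m * (b + m⁻¹ * a) = m * (d * (1 + m⁻¹)) := by rw [h]
        field_simp at this
        linarith
      · intro h
        field_simp
        linarith
    rw [hf, ← facePoly_reflect hS, ← facePoly_swap (contDiff_reflect hS σ τ)]
    refine tendsto_cuspIntegral_edge (contDiff_comp_swap (contDiff_reflect hS σ τ)) hd (inv_pos.2 hm) hK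
      (hs' σ hσ τ hτ) hq hKq hqd ((hne B' A').2 hAB') hAq' ((hline _ _).2 hABd') (fun p => ?_)
      (fun a b hab => ?_) ⟨(B, A), ?_, ?_⟩
    · rw [hne, hline, Finset.mem_map_equiv, hF]
      rfl
    · have := hmin b a ((hne a b).1 hab)
      have h2 : m⁻¹ * (d * (1 + m)) ≤ m⁻¹ * (b + m * a) := by gcongr
      field_simp at h2 ⊢
      linarith
    · rw [Finset.mem_map_equiv, hF]
      exact ⟨hAB, hABd⟩
    · rintro (h : A = 0)
      rw [h, Nat.cast_zero, zero_add] at hABd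
      nlinarith
  -- The finite area in each cusp, a by-product of the slice estimates, gives finite area in the
  -- plane and with it the integrability claimed in the theorem.
  have hfin : volume {p | 0 < f p ∧ f p < 1} < ⊤ := by
    rw [volume_sublevel_eq_sum hfc hm 1, ENNReal.sum_lt_top]
    intro σ hσ
    rw [ENNReal.sum_lt_top]
    intro τ hτ
    exact ENNReal.add_lt_top.2 ⟨(hside σ hσ τ hτ).1, (hside' σ hσ τ hτ).1⟩
  have hhom : ∀ σ : ℝ, ∀ u > 0, ∀ v, f (σ * u, u ^ m * v) = u ^ (d * (1 + m)) * f (σ, v) :=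
    fun σ u hu v => facePoly_quasiHomogeneous (fun p hp => ((hF p).1 hp).2) σ hu v
  obtain ⟨i1, i2, hvol⟩ := integrable_posPow_of_volume_lt_top hfc hd hm hhom hfin
  have hreal : volume.real {p | 0 < f p ∧ f p < 1} =
      ∑ σ ∈ ({1, -1} : Finset ℝ), ∑ τ ∈ ({1, -1} : Finset ℝ),
      (volume.real (cuspSublevel (reflect σ τ f) m 1) +
        volume.real (cuspSublevel (reflect σ τ f ∘ Prod.swap) m⁻¹ 1)) := by
    rw [measureReal_def, volume_sublevel_eq_sum hfc hm 1, ENNReal.toReal_sum]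
    · refine Finset.sum_congr rfl fun σ hσ => ?_
      rw [ENNReal.toReal_sum]
      · refine Finset.sum_congr rfl fun τ hτ => ?_
        rw [ENNReal.toReal_add (hside σ hσ τ hτ).1.ne (hside' σ hσ τ hτ).1.ne]
        rfl
      · intro τ hτ
        exact (ENNReal.add_lt_top.2 ⟨(hside σ hσ τ hτ).1, (hside' σ hσ τ hτ).1⟩).ne
    · intro σ hσ
      refine (ENNReal.sum_lt_top.2 fun τ hτ => ?_).ne
      exact ENNReal.add_lt_top.2 ⟨(hside σ hσ τ hτ).1, (hside' σ hσ τ hτ).1⟩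
  refine ⟨i1, i2, ?_⟩
  obtain ⟨ρ, hρ, h⟩ := tendsto_sublevelIntegral_of_cusps (ι := Unit) (ok := fun _ => True)
    (g := fun ε : ℝ => ε ^ (1 / d)) hS.continuous hm
    (L := fun _ σ τ φ => φ (0, 0) * volume.real (cuspSublevel (reflect σ τ f) m 1))
    (L' := fun _ σ τ φ => φ (0, 0) * volume.real (cuspSublevel (reflect σ τ f ∘ Prod.swap) m⁻¹ 1))
    (fun σ hσ τ hτ => by
      obtain ⟨ρ, hρ, h⟩ := (hside σ hσ τ hτ).2
      exact ⟨ρ, hρ, fun φ hφ _ _ => h φ hφ⟩)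
    (fun σ hσ τ hτ => by
      obtain ⟨ρ, hρ, h⟩ := (hside' σ hσ τ hτ).2
      exact ⟨ρ, hρ, fun φ hφ _ _ => h φ hφ⟩)
  refine ⟨ρ, hρ, fun φ hφ => ?_⟩
  have h1 := h φ hφ () trivial
  have e : ∀ σ τ : ℝ, reflect σ τ φ (0, 0) = φ (0, 0) := fun σ τ => by simp [reflect]
  have e' : ∀ σ τ : ℝ, (reflect σ τ φ ∘ Prod.swap) (0, 0) = φ (0, 0) := fun σ τ => by simp [reflect]
  simp only [e, e', ← mul_add, ← Finset.mul_sum] at h1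
  rw [← hreal, hvol] at h1
  convert h1 using 2
  ring

/-- A face polynomial of degree less than `K` has no positive zero of order `K`. -/
theorem exists_sum_descFactorial_ne_zero {s : ℕ → ℕ → ℝ} {μ α : ℝ} {K : ℕ} {F : Finset (ℕ × ℕ)}
    (hne : F.Nonempty) (hF : ∀ p ∈ F, s p.1 p.2 ≠ 0 ∧ (p.1 : ℝ) + μ * p.2 = α)
    (hK : ∀ p ∈ F, p.2 < K) {t : ℝ} (ht : 0 < t) :
    ∃ k < K, ∑ p ∈ F, s p.1 p.2 * (p.2.descFactorial k : ℝ) * t ^ p.2 ≠ 0 := by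
  -- The derivative whose order is the degree in t sees only the top term, which is unique on a
  -- line.
  obtain ⟨p, hp, hmax⟩ := F.exists_max_image (fun p => p.2) hne
  obtain ⟨h1, h2⟩ := hF p hp
  refine ⟨p.2, hK p hp, ?_⟩
  rw [Finset.sum_eq_single p]
  · rw [Nat.descFactorial_self]
    exact mul_ne_zero (mul_ne_zero h1 (by positivity)) (by positivity)
  · intro r hr hrp
    have hlt : r.2 < p.2 := by
      refine lt_of_le_of_ne (hmax r hr) fun h3 => hrp ?_
      have h4 := (hF r hr).2
      rw [h3, ← h2] at h4
      have h5 : (r.1 : ℝ) = p.1 := by linarith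
      exact Prod.ext (by exact_mod_cast h5) h3
    rw [Nat.descFactorial_of_lt hlt, Nat.cast_zero, mul_zero, zero_mul]
  · exact fun h => absurd hp h

theorem faceNondegenerate_of_snd_lt {s : ℕ → ℕ → ℝ} {κ : ℝ} {K : ℕ}
    (h : ∀ μ ≥ κ, ∀ p : ℕ × ℕ, s p.1 p.2 ≠ 0 →
      (∀ a b : ℕ, s a b ≠ 0 → (p.1 : ℝ) + μ * p.2 ≤ a + μ * b) → p.2 < K) :
    FaceNondegenerate s κ K := fun μ hμ _ _ hne hF hmin _ ht =>
  exists_sum_descFactorial_ne_zero hne (fun p hp => (hF p).1 hp) (fun p hp => h μ hμ p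
    ((hF p).1 hp).1 fun a b hab => ((hF p).1 hp).2.trans_le (hmin a b hab)) ht

/-- The edge on one side of the vertex `(n, n)`: either it is the horizontal ray (`T = 0`), or it
lies on a line `a + m * b = n * (1 + m)` with `κ < m` (`T = 1 / (1 + m)`). -/
def VertexSide (s : ℕ → ℕ → ℝ) (n : ℕ) (κ T : ℝ) : Prop :=
  (T = 0 ∧ ∀ a b : ℕ, s a b ≠ 0 → n ≤ b) ∨
    (∃ m > κ, T = 1 / (1 + m) ∧ (∃ A B : ℕ, s A B ≠ 0 ∧ B < n ∧
      (A : ℝ) + m * B = n * (1 + m)) ∧ ∀ a b : ℕ, s a b ≠ 0 → (n : ℝ) * (1 + m) ≤ a + m * b)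

theorem VertexSide.congr {s s' : ℕ → ℕ → ℝ} {n : ℕ} {κ T : ℝ} (h : VertexSide s n κ T)
    (hs : ∀ a b, s' a b ≠ 0 ↔ s a b ≠ 0) : VertexSide s' n κ T := by
  unfold VertexSide at h ⊢
  simpa only [hs] using h

/-- σ^n τ^n s has the sign of s in all four quadrants if n is even, and is positive in exactly two
of them if n is odd. -/
theorem sum_posPow_signs (n : ℕ) {s : ℝ} (hs : s ≠ 0) :
    ∑ σ ∈ ({1, -1} : Finset ℝ), ∑ τ ∈ ({1, -1} : Finset ℝ), posPow n (σ ^ n * τ ^ n * s) =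
      etaFactor n s * |s| ^ (-1 / (n : ℝ)) := by
  have hne : (1 : ℝ) ∉ ({-1} : Finset ℝ) := by norm_num
  simp only [Finset.sum_insert hne, Finset.sum_singleton]
  unfold etaFactor posPow
  rcases lt_or_gt_of_ne hs with h | h
  · rcases Nat.even_or_odd n with hn | hn
    · simp [hn, hn.neg_one_pow, not_lt.2 h.le]
    · have : ¬ Even n := Nat.not_even_iff_odd.2 hn
      simp [this, hn.neg_one_pow, not_lt.2 h.le, h, abs_of_neg h]
      ring
  · rcases Nat.even_or_odd n with hn | hn
    · simp [hn, hn.neg_one_pow, h, abs_of_pos h]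
      ring
    · have : ¬ Even n := Nat.not_even_iff_odd.2 hn
      simp [this, hn.neg_one_pow, not_lt.2 h.le, h, abs_of_pos h]
      ring

/-- The leading term when the bisectrix meets the Newton polygon in a vertex. -/
theorem tendsto_sublevelIntegral_vertex {S : ℝ × ℝ → ℝ} (hS : ContDiff ℝ ∞ S) {κ : ℝ} (hκ : 0 < κ)
    {n : ℕ} (hn : 2 ≤ n)
    (hs : ∀ σ ∈ ({1, -1} : Finset ℝ), ∀ τ ∈ ({1, -1} : Finset ℝ),
      FaceNondegenerate (taylorCoeff (reflect σ τ S)) κ n)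
    (hs' : ∀ σ ∈ ({1, -1} : Finset ℝ), ∀ τ ∈ ({1, -1} : Finset ℝ),
      FaceNondegenerate (taylorCoeff (reflect σ τ S ∘ Prod.swap)) κ⁻¹ n)
    (hnn : taylorCoeff S n n ≠ 0)
    (hmin : ∀ a b : ℕ, taylorCoeff S a b ≠ 0 → (a, b) ≠ (n, n) → (n : ℝ) * (1 + κ) < a + κ * b) :
    ∃ ρ > 0, ∀ φ, IsBoxFunction ρ φ → ∀ T T' : ℝ, VertexSide (taylorCoeff S) n κ T →
      VertexSide (fun a b => taylorCoeff S b a) n κ⁻¹ T' →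
      Tendsto (fun ε : ℝ => sublevelIntegral S φ ε / (ε ^ (1 / (n : ℝ)) * Real.log ε)) (𝓝[>] 0)
        (𝓝 (-(φ (0, 0) * (etaFactor n (taylorCoeff S n n) * |taylorCoeff S n n| ^ (-1 / (n : ℝ))) *
          (1 / n * (1 - T - T'))))) := by
  set s := taylorCoeff S n n with hsdef
  have hcoef : ∀ σ τ : ℝ, taylorCoeff (reflect σ τ S) n n = σ ^ n * τ ^ n * s := fun σ τ =>
    taylorCoeff_reflect hS σ τ n n
  have hcoef' : ∀ σ τ : ℝ, taylorCoeff (reflect σ τ S ∘ Prod.swap) n n = σ ^ n * τ ^ n * s :=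
    fun σ τ => by rw [taylorCoeff_comp_swap (contDiff_reflect hS σ τ), hcoef]
  obtain ⟨ρ, hρ, h⟩ := tendsto_sublevelIntegral_of_cusps (ι := ℝ × ℝ)
    (ok := fun i => VertexSide (taylorCoeff S) n κ i.1 ∧
      VertexSide (fun a b => taylorCoeff S b a) n κ⁻¹ i.2)
    (g := fun ε : ℝ => ε ^ (1 / (n : ℝ)) * Real.log ε) hS.continuous hκ
    (L := fun i σ τ φ => -(φ (0, 0) * posPow n (σ ^ n * τ ^ n * s) * (1 / n * (1 / (1 + κ) - i.1))))
    (L' := fun i σ τ φ => -(φ (0, 0) * posPow n (σ ^ n * τ ^ n * s) * (1 / n * (1 / (1 + κ⁻¹) - i.2))))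
    (fun σ hσ τ hτ => by
      have hne := taylorCoeff_reflect_ne_zero hS (abs_eq_one_of_mem hσ) (abs_eq_one_of_mem hτ)
      obtain ⟨ρ, hρ, h⟩ := tendsto_cuspIntegral_vertex (contDiff_reflect hS σ τ) hκ hn (hs σ hσ τ hτ)
        ((hne n n).2 hnn) (fun a b hab hab' => hmin a b ((hne a b).1 hab) hab')
      refine ⟨ρ, hρ, fun φ hφ i hi => ?_⟩
      rw [hcoef] at h
      exact h φ hφ i.1 (hi.1.congr hne))
    (fun σ hσ τ hτ => by
      have hne := taylorCoeff_reflect_swap_ne_zero hS (abs_eq_one_of_mem hσ) (abs_eq_one_of_mem hτ)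
      obtain ⟨ρ, hρ, h⟩ := tendsto_cuspIntegral_vertex (contDiff_comp_swap (contDiff_reflect hS σ τ))
        (inv_pos.2 hκ) hn (hs' σ hσ τ hτ) ((hne n n).2 hnn) (fun a b hab hab' => by
          have h1 := hmin b a ((hne a b).1 hab) (fun h => hab' (by
            rw [Prod.mk.injEq] at h ⊢; exact h.symm))
          have h2 : κ⁻¹ * (n * (1 + κ)) < κ⁻¹ * (b + κ * a) := by gcongr
          field_simp at h2 ⊢
          linarith)
      refine ⟨ρ, hρ, fun φ hφ i hi => ?_⟩
      rw [hcoef'] at h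
      exact h φ hφ i.2 (hi.2.congr hne))
  refine ⟨ρ, hρ, fun φ hφ T T' hT hT' => ?_⟩
  have h1 := h φ hφ (T, T') ⟨hT, hT'⟩
  have e : ∀ σ τ : ℝ, reflect σ τ φ (0, 0) = φ (0, 0) := fun σ τ => by simp [reflect]
  have e' : ∀ σ τ : ℝ, (reflect σ τ φ ∘ Prod.swap) (0, 0) = φ (0, 0) := fun σ τ => by simp [reflect]
  have e2 : ∀ t : ℝ, -(φ (0, 0) * t * (1 / n * (1 / (1 + κ) - T))) +
      -(φ (0, 0) * t * (1 / n * (1 / (1 + κ⁻¹) - T'))) = -(φ (0, 0) * (1 / n * (1 - T - T'))) * t := by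
    intro t
    -- The auxiliary exponent κ cancels between the two families of cusps.
    have : 1 / (1 + κ) + 1 / (1 + κ⁻¹) = 1 := by
      have : 1 + κ ≠ 0 := by positivity
      field_simp
      ring
    linear_combination -(φ (0, 0) * t * (1 / n)) * this
  simp only [e, e', e2, ← Finset.mul_sum, sum_posPow_signs n hnn] at h1
  convert h1 using 2
  ring

theorem slabMeasure_eq {n : ℕ} (hn : n ≠ 0) (a : ℝ) :
    slabMeasure n a = posPow n a + posPow n ((-1) ^ n * a) := by
  -- For a = 0 the slab is the whole line. Its real-valued measure is 0 by convention, which agrees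
  -- with `posPow` at 0.
  by_cases ha : a = 0
  · subst ha
    simp [slabMeasure, posPow, measureReal_def]
  have hm : ∀ c : ℝ, MeasurableSet {w : ℝ | 0 < w ∧ 0 < c * w ^ n ∧ c * w ^ n < 1} := fun c => by
    have hc : Measurable fun w : ℝ => c * w ^ n := by fun_prop
    exact (measurableSet_lt measurable_const measurable_id).inter
      ((measurableSet_lt measurable_const hc).inter (measurableSet_lt hc measurable_const))
  set A := {w : ℝ | 0 < w ∧ 0 < a * w ^ n ∧ a * w ^ n < 1} with hA
  set B := {w : ℝ | 0 < w ∧ 0 < ((-1) ^ n * a) * w ^ n ∧ ((-1) ^ n * a) * w ^ n < 1} with hB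
  have hneg : volume ((fun w : ℝ => -w) ⁻¹' B) = volume B :=
    (Measure.measurePreserving_neg volume).measure_preimage (hm _).nullMeasurableSet
  have hmem : ∀ w : ℝ, -w ∈ B ↔ w < 0 ∧ 0 < a * w ^ n ∧ a * w ^ n < 1 := fun w => by
    have e : ((-1) ^ n * a) * (-w) ^ n = a * w ^ n := by
      have h1 : ((-1 : ℝ) ^ n) * (-1) ^ n = 1 := by rw [← mul_pow]; simp
      rw [neg_pow w n]
      linear_combination a * w ^ n * h1
    rw [hB, Set.mem_ofPred_eq, e, neg_pos]
  have hae : {t : ℝ | 0 ≤ a * t ^ n ∧ a * t ^ n ≤ 1} =ᵐ[volume]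
      (A ∪ (fun w : ℝ => -w) ⁻¹' B : Set ℝ) := by
    have hfin : ∀ c, ∀ᵐ w : ℝ, a * w ^ n ≠ c := fun c =>
      measure_eq_zero_iff_ae_notMem.1 ((finite_mul_pow_eq hn ha c).measure_zero volume)
    filter_upwards [hfin 0, hfin 1] with w h0 h1
    refine propext ⟨fun h => ?_, fun h => ?_⟩
    · obtain ⟨h2, h3⟩ : 0 ≤ a * w ^ n ∧ a * w ^ n ≤ 1 := h
      have h4 := lt_of_le_of_ne h2 (Ne.symm h0)
      have h5 := lt_of_le_of_ne h3 h1
      have hw : w ≠ 0 := by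
        rintro rfl; rw [zero_pow hn, mul_zero] at h0; exact h0 rfl
      rcases lt_or_gt_of_ne hw with h6 | h6
      · exact Or.inr ((hmem w).2 ⟨h6, h4, h5⟩)
      · exact Or.inl ⟨h6, h4, h5⟩
    · rcases h with h | h
      · exact ⟨h.2.1.le, h.2.2.le⟩
      · have := (hmem w).1 h
        exact ⟨this.2.1.le, this.2.2.le⟩
  have hdisj : Disjoint A ((fun w : ℝ => -w) ⁻¹' B) :=
    Set.disjoint_left.2 fun w h1 h2 => absurd h1.1 (not_lt.2 ((hmem w).1 h2).1.le)
  unfold slabMeasure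
  rw [measureReal_def, measure_congr hae, measure_union hdisj (measurable_neg (hm _)), hneg, hA, hB,
    volume_slab_eq hn, volume_slab_eq hn, ← ENNReal.ofReal_add (posPow_nonneg _ _) (posPow_nonneg _ _),
    ENNReal.toReal_ofReal (add_nonneg (posPow_nonneg _ _) (posPow_nonneg _ _))]

theorem slabMeasure_of_odd {n : ℕ} (hn : Odd n) {a : ℝ} (ha : a ≠ 0) :
    slabMeasure n a = |a| ^ (-1 / (n : ℝ)) := by
  rw [slabMeasure_eq (by rintro rfl; simp at hn), hn.neg_one_pow]
  unfold posPow
  rcases lt_or_gt_of_ne ha with h | h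
  · simp [not_lt.2 h.le, h, abs_of_neg h]
  · simp [not_lt.2 h.le, h, abs_of_pos h]

section Ray

variable {S : ℝ × ℝ → ℝ} {A n : ℕ}

/-- After the exchange of the coordinates the lowest row becomes the first column. Comparison with
the exponent (n, A) shows that a minimizing exponent has second entry at most A < n, so the degree
alone excludes zeros of order n and superadaptedness is not needed. -/
theorem faceNondegenerate_swap_of_isLowest (h : IsLowest (taylorCoeff S) A n) (hA : A < n) {s' : ℕ → ℕ → ℝ}
    (hs' : ∀ a b, s' a b ≠ 0 ↔ taylorCoeff S b a ≠ 0) {κ : ℝ} (hκ : 0 < κ) :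
    FaceNondegenerate s' κ n := by
  refine faceNondegenerate_of_snd_lt fun μ hμ p hp hmin => ?_
  have hμ0 : 0 < μ := lt_of_lt_of_le hκ hμ
  have h1 := hmin n A ((hs' _ _).2 h.1)
  have h2 : (n : ℝ) ≤ p.1 := by exact_mod_cast h.snd_le ((hs' _ _).1 hp)
  have h3 : μ * p.2 ≤ μ * A := by linarith
  have h4 : (p.2 : ℝ) ≤ A := le_of_mul_le_mul_left h3 hμ0
  have h5 : p.2 ≤ A := by exact_mod_cast h4
  omega

theorem isLowest_congr {s s' : ℕ → ℕ → ℝ} (h : IsLowest s A n) (hs : ∀ a b, s' a b ≠ 0 ↔ s a b ≠ 0) :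
    IsLowest s' A n := by
  unfold IsLowest at h ⊢
  simpa only [hs] using h

theorem exists_off_ray (hS : ContDiff ℝ ∞ S) (h : IsLowest (taylorCoeff S) A n) (hA : A < n) (hn : 2 ≤ n)
    {σ : ℝ} (hσ : σ ∈ ({1, -1} : Finset ℝ)) {τ : ℝ} (hτ : τ ∈ ({1, -1} : Finset ℝ)) :
    ∃ ρ > 0, ∀ φ, IsBoxFunction ρ φ →
      Tendsto (fun ε : ℝ => cuspIntegral (reflect σ τ S ∘ Prod.swap) φ ((A + 1 : ℕ) : ℝ)⁻¹ ε /
        ε ^ (1 / (n : ℝ))) (𝓝[>] 0) (𝓝 0) := by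
  have hne := taylorCoeff_reflect_swap_ne_zero hS (abs_eq_one_of_mem hσ) (abs_eq_one_of_mem hτ)
  have hκ : (0 : ℝ) < ((A + 1 : ℕ) : ℝ)⁻¹ := by positivity
  exact tendsto_cuspIntegral_off_ray (contDiff_comp_swap (contDiff_reflect hS σ τ)) hκ hn
    (faceNondegenerate_swap_of_isLowest h hA hne hκ) ((hne n A).2 h.1) hA

/-- The bound for smooth phases when the bisectrix meets the interior of the horizontal ray. -/
theorem isBigO_sublevelIntegral_ray (hS : ContDiff ℝ ∞ S)
    (h : IsLowest (taylorCoeff S) A n) (hA : A < n) (hn : 2 ≤ n) :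
    ∃ ρ > 0, ∀ φ, IsBoxFunction ρ φ →
      sublevelIntegral S φ =O[𝓝[>] 0] fun ε : ℝ => ε ^ (1 / (n : ℝ)) := by
  refine isBigO_sublevelIntegral_of_cusps hS.continuous (κ := ((A + 1 : ℕ) : ℝ)) (by positivity)
    (fun σ hσ τ hτ => ?_) (fun σ hσ τ hτ => ?_)
  · have hne := taylorCoeff_reflect_ne_zero hS (abs_eq_one_of_mem hσ) (abs_eq_one_of_mem hτ)
    obtain ⟨ρ, hρ, h1⟩ := abs_cuspIntegral_le_of_isLowest (contDiff_reflect hS σ τ)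
      (isLowest_congr h hne) hA
    refine ⟨ρ, hρ, fun φ hφ => ?_⟩
    obtain ⟨C, hC⟩ := h1 φ hφ
    refine IsBigO.of_bound C ?_
    filter_upwards [self_mem_nhdsWithin] with ε hε
    rw [Real.norm_eq_abs, Real.norm_of_nonneg (Real.rpow_pos_of_pos hε _).le]
    exact hC ε hε
  · obtain ⟨ρ, hρ, h1⟩ := exists_off_ray hS h hA hn hσ hτ
    refine ⟨ρ, hρ, fun φ hφ => isBigO_of_div_tendsto_nhds ?_ 0 (h1 φ hφ)⟩
    filter_upwards [self_mem_nhdsWithin] with ε hε h0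
    exact absurd h0 (Real.rpow_pos_of_pos hε _).ne'

theorem iterate_dY_reflect (hS : ContDiff ℝ ∞ S) (σ τ : ℝ) (b : ℕ) (x : ℝ) :
    (dY^[b] (reflect σ τ S)) (x, 0) = τ ^ b * (dY^[b] S) (σ * x, 0) := by
  have h1 := congrFun (iteratedDeriv_snd (contDiff_reflect hS σ τ) b x) 0
  have h2 := congrFun (iteratedDeriv_snd hS b (σ * x)) 0
  rw [← h1, ← h2]
  have h3 : ContDiff ℝ b (fun y => S (σ * x, y)) :=
    (hS.comp (by fun_prop : ContDiff ℝ ∞ fun y : ℝ => (σ * x, y))).of_le (by exact_mod_cast le_top)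
  have := congrFun (iteratedDeriv_comp_const_mul h3 τ) 0
  simp only [mul_zero] at this
  simpa [reflect] using this

/-- The leading term when the bisectrix meets the interior of the horizontal ray and the phase is
divisible by `y ^ n`. -/
theorem tendsto_sublevelIntegral_ray (hS : ContDiff ℝ ∞ S)
    (h : IsLowest (taylorCoeff S) A n) (hA : A < n) (hn : 2 ≤ n) {ρ₀ : ℝ} (hρ₀ : 0 < ρ₀)
    (hvan : ∀ x : ℝ, |x| < ρ₀ → ∀ b < n, (dY^[b] S) (x, 0) = 0) :
    ∃ ρ > 0, ∀ φ, IsBoxFunction ρ φ →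
      Integrable (fun x => slabMeasure n ((dY^[n] S) (x, 0) / n.factorial) * φ (x, 0)) ∧
      Tendsto (fun ε : ℝ => sublevelIntegral S φ ε / ε ^ (1 / (n : ℝ))) (𝓝[>] 0)
        (𝓝 (∫ x, slabMeasure n ((dY^[n] S) (x, 0) / n.factorial) * φ (x, 0))) := by
  have hn0 : n ≠ 0 := by omega
  set a : ℝ → ℝ := fun x => (dY^[n] S) (x, 0) / n.factorial with ha
  have hside : ∀ σ ∈ ({1, -1} : Finset ℝ), ∀ τ ∈ ({1, -1} : Finset ℝ), ∃ ρ > 0, ∀ φ, IsBoxFunction ρ φ →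
      IntegrableOn (fun x => posPow n (τ ^ n * a (σ * x)) * φ (x, 0)) (Set.Ioi 0) ∧
      Tendsto (fun ε : ℝ => cuspIntegral (reflect σ τ S) φ ((A + 1 : ℕ) : ℝ) ε / ε ^ (1 / (n : ℝ)))
        (𝓝[>] 0) (𝓝 (∫ x in Set.Ioi 0, posPow n (τ ^ n * a (σ * x)) * φ (x, 0))) := by
    intro σ hσ τ hτ
    have hne := taylorCoeff_reflect_ne_zero hS (abs_eq_one_of_mem hσ) (abs_eq_one_of_mem hτ)
    obtain ⟨ρ, hρ, h1⟩ := tendsto_cuspIntegral_ray (contDiff_reflect hS σ τ)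
      (isLowest_congr h hne) hA hρ₀ (fun x hx0 hx b hb => by
        rw [iterate_dY_reflect hS, hvan _ (by
          rw [abs_mul, abs_eq_one_of_mem hσ, one_mul, abs_of_pos hx0]; exact hx) b hb, mul_zero])
    refine ⟨ρ, hρ, fun φ hφ => ?_⟩
    have e : ∀ x, τ ^ n * a (σ * x) = (dY^[n] (reflect σ τ S)) (x, 0) / n.factorial := fun x => by
      rw [iterate_dY_reflect hS, mul_div_assoc]
    simp only [e]
    exact h1 φ hφ
  obtain ⟨ρ₁, hρ₁, hint⟩ := exists_common_radius (P := fun σ τ φ =>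
    IntegrableOn (fun x => posPow n (τ ^ n * a (σ * x)) * φ (x, 0)) (Set.Ioi 0)) (fun σ hσ τ hτ => by
      obtain ⟨ρ, hρ, h⟩ := hside σ hσ τ hτ
      exact ⟨ρ, hρ, fun φ hφ => (h φ hφ).1⟩)
  obtain ⟨ρ₂, hρ₂, hlim⟩ := tendsto_sublevelIntegral_of_cusps (ι := Unit) (ok := fun _ => True)
    (g := fun ε : ℝ => ε ^ (1 / (n : ℝ))) (κ := ((A + 1 : ℕ) : ℝ)) hS.continuous (by positivity)
    (L := fun _ σ τ φ => ∫ x in Set.Ioi 0, posPow n (τ ^ n * a (σ * x)) * φ (x, 0))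
    (L' := fun _ _ _ _ => 0)
    (fun σ hσ τ hτ => by
      obtain ⟨ρ, hρ, h⟩ := hside σ hσ τ hτ
      exact ⟨ρ, hρ, fun φ hφ _ _ => (h φ hφ).2⟩)
    (fun σ hσ τ hτ => by
      obtain ⟨ρ, hρ, h⟩ := exists_off_ray hS h hA hn hσ hτ
      exact ⟨ρ, hρ, fun φ hφ _ _ => h φ hφ⟩)
  refine ⟨min ρ₁ ρ₂, lt_min hρ₁ hρ₂, fun φ hφ => ?_⟩
  set g : ℝ → ℝ := fun x => slabMeasure n (a x) * φ (x, 0) with hg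
  have m1 : (1 : ℝ) ∈ ({1, -1} : Finset ℝ) := by simp
  have m2 : (-1 : ℝ) ∈ ({1, -1} : Finset ℝ) := by simp
  have hi : ∀ σ ∈ ({1, -1} : Finset ℝ), ∀ τ ∈ ({1, -1} : Finset ℝ),
      IntegrableOn (fun x => posPow n (τ ^ n * a (σ * x)) * φ (σ * x, 0)) (Set.Ioi 0) := by
    intro σ hσ τ hτ
    have := hint _ ((hφ.mono (min_le_left _ _)).reflect (abs_eq_one_of_mem hσ) (abs_eq_one_of_mem hτ)) σ hσ τ hτ
    simpa [reflect] using this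
  have hsum : ∀ σ : ℝ, ∀ x, posPow n (1 ^ n * a (σ * x)) * φ (σ * x, 0)
      + posPow n ((-1) ^ n * a (σ * x)) * φ (σ * x, 0) = g (σ * x) := fun σ x => by
    rw [hg]
    simp only
    rw [slabMeasure_eq hn0, one_pow, one_mul, add_mul]
  have hgi : ∀ σ ∈ ({1, -1} : Finset ℝ), IntegrableOn (fun x => g (σ * x)) (Set.Ioi 0) := by
    intro σ hσ
    have := (hi σ hσ 1 m1).add (hi σ hσ (-1) m2)
    exact this.congr (Eventually.of_forall fun x => hsum σ x)
  have hpos : IntegrableOn g (Set.Ioi 0) := by simpa using hgi 1 m1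
  have hneg : IntegrableOn g (Set.Iic 0) := by
    have h1 : IntegrableOn (fun x => g (-x)) (Set.Ioi 0) := by simpa using hgi (-1) m2
    rw [integrableOn_Iic_iff_integrableOn_Iio]
    have h2 := (Measure.measurePreserving_neg (volume : Measure ℝ)).integrableOn_comp_preimage
      (Homeomorph.neg ℝ).measurableEmbedding (f := g) (s := Set.Iio 0)
    have h3 : (Neg.neg : ℝ → ℝ) ⁻¹' Set.Iio 0 = Set.Ioi 0 := by ext; simp
    rw [h3] at h2
    exact h2.1 h1
  refine ⟨?_, ?_⟩
  · rw [← integrableOn_univ, ← Set.Iic_union_Ioi (a := (0 : ℝ))]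
    exact hneg.union hpos
  · have h1 := hlim φ (hφ.mono (min_le_right _ _)) () trivial
    have e : (∫ x, g x) = ∑ σ ∈ ({1, -1} : Finset ℝ), ∑ τ ∈ ({1, -1} : Finset ℝ),
        ((∫ x in Set.Ioi 0, posPow n (τ ^ n * a (σ * x)) * reflect σ τ φ (x, 0)) + 0) := by
      have hne : (1 : ℝ) ∉ ({-1} : Finset ℝ) := by norm_num
      have h2 : ∀ σ ∈ ({1, -1} : Finset ℝ), ∑ τ ∈ ({1, -1} : Finset ℝ),
          ((∫ x in Set.Ioi 0, posPow n (τ ^ n * a (σ * x)) * reflect σ τ φ (x, 0)) + 0)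
          = ∫ x in Set.Ioi 0, g (σ * x) := by
        intro σ hσ
        simp only [Finset.sum_insert hne, Finset.sum_singleton, add_zero, reflect, mul_zero]
        rw [← integral_add (hi σ hσ 1 m1) (hi σ hσ (-1) m2)]
        simp only [hsum]
      rw [Finset.sum_congr rfl h2, Finset.sum_insert hne, Finset.sum_singleton]
      simp only [one_mul, neg_mul]
      rw [integral_comp_neg_Ioi, neg_zero, add_comm, intervalIntegral.integral_Iic_add_Ioi hneg hpos]
    rw [e]
    exact h1

end Ray

/-! ### Position of the bisectrix relative to the Newton polygon -/

/-- Dickson's lemma: the minimal exponents form an antichain in ℕ × ℕ and are therefore finite in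
number. This lets extrema over all exponents be taken over a finite set. -/
theorem exists_finset_dominating (P : ℕ → ℕ → Prop) :
    ∃ G : Finset (ℕ × ℕ), (∀ g ∈ G, P g.1 g.2) ∧
      ∀ a b, P a b → ∃ g ∈ G, g.1 ≤ a ∧ g.2 ≤ b := by
  have hfin : {p : ℕ × ℕ | Minimal (fun p : ℕ × ℕ => P p.1 p.2) p}.Finite :=
    WellQuasiOrderedLE.finite_of_isAntichain (setOfPred_minimal_antichain _)
  refine ⟨hfin.toFinset, fun g hg => ((hfin.mem_toFinset).1 hg).1, fun a b hab => ?_⟩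
  obtain ⟨g, hg, hg'⟩ := exists_minimal_le_of_wellFoundedLT (fun p : ℕ × ℕ => P p.1 p.2) (a, b) hab
  exact ⟨g, hfin.mem_toFinset.2 hg', hg.1, hg.2⟩

/-- The position of the bisectrix with respect to the Newton polygon of a set of exponents. -/
theorem newton_classification {P : ℕ → ℕ → Prop} {d : ℝ} (hd : 0 < d)
    (hA : ∀ κ > 0, ∃ a b : ℕ, P a b ∧ (a : ℝ) + κ * b ≤ d * (1 + κ))
    (hB : ∀ a b a' b' : ℕ, P a b → P a' b' → ∀ l l' : ℝ, 0 ≤ l → 0 ≤ l' → l + l' = 1 →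
      ¬ (l * a + l' * a' < d ∧ l * b + l' * b' < d)) :
    (∃ m > 0, (∀ a b : ℕ, P a b → d * (1 + m) ≤ a + m * b) ∧
      (∃ A B : ℕ, P A B ∧ (B : ℝ) < d ∧ (A : ℝ) + m * B = d * (1 + m)) ∧
      ∃ A B : ℕ, P A B ∧ (A : ℝ) < d ∧ (A : ℝ) + m * B = d * (1 + m)) ∨
    (∃ n : ℕ, (n : ℝ) = d ∧ P n n ∧ ∃ κ > 0, ∀ a b : ℕ, P a b → (a, b) ≠ (n, n) →
      (n : ℝ) * (1 + κ) < a + κ * b) ∨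
    (∃ n : ℕ, (n : ℝ) = d ∧ (∀ a b : ℕ, P a b → n ≤ b) ∧ ∃ A < n, P A n) ∨
    (∃ n : ℕ, (n : ℝ) = d ∧ (∀ a b : ℕ, P a b → n ≤ a) ∧ ∃ B < n, P n B) := by
  have hvertex : ∀ κ > 0, (∀ a b : ℕ, P a b → ¬ ((a : ℝ) = d ∧ (b : ℝ) = d) →
      d * (1 + κ) < a + κ * b) →
      ∃ n : ℕ, (n : ℝ) = d ∧ P n n ∧ ∃ κ > 0, ∀ a b : ℕ, P a b → (a, b) ≠ (n, n) →
      (n : ℝ) * (1 + κ) < a + κ * b := by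
    intro κ hκ h
    obtain ⟨a, b, hab, hle⟩ := hA κ hκ
    by_cases heq : (a : ℝ) = d ∧ (b : ℝ) = d
    · obtain ⟨ha, hb⟩ := heq
      have : a = b := by
        have : (a : ℝ) = b := ha.trans hb.symm
        exact_mod_cast this
      subst this
      refine ⟨a, ha, hab, κ, hκ, fun a' b' hab' hne => ?_⟩
      rw [ha]
      refine h a' b' hab' fun h' => hne ?_
      rw [← ha] at h'
      exact Prod.ext (by exact_mod_cast h'.1) (by exact_mod_cast h'.2)
    · exact absurd (h a b hab heq) (not_lt.2 hle)
  have hpt : ∀ a b : ℕ, P a b → (b : ℝ) < d → d ≤ a := by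
    intro a b hab hb
    by_contra! h
    exact hB a b a b hab hab 1 0 zero_le_one le_rfl (by norm_num) ⟨by simpa using h, by simpa using hb⟩
  -- Otherwise the segment from (a, b), on the right, to (a', b'), on the left, contains a point
  -- with both coordinates less than d; the weights chosen here exhibit it.
  have hcross : ∀ a b a' b' : ℕ, P a b → P a' b' → (b : ℝ) < d → (a' : ℝ) < d →
      (d - a') * (d - b) ≤ (a - d) * (b' - d) := by
    intro a b a' b' hab hab' hb ha'
    by_contra! hlt
    have hX : 0 ≤ (a : ℝ) - d := sub_nonneg.2 (hpt a b hab hb)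
    have hZ : 0 ≤ (b' : ℝ) - d := by
      by_contra! h
      have := hpt a' b' hab' (by linarith)
      linarith
    have hY : 0 < d - a' := by linarith
    have hW : 0 < d - b := by linarith
    have hT : 0 < (d - b) + (a - d) + ((d - a') + (b' - d)) := by linarith
    set T := (d - b) + (a - d) + ((d - a') + (b' - d)) with hTdef
    refine hB a b a' b' hab hab' (((d - a') + (b' - d)) / T) (((d - b) + (a - d)) / T)
      (by apply div_nonneg <;> linarith) (by apply div_nonneg <;> linarith) ?_ ⟨?_, ?_⟩
    · rw [← add_div, div_eq_one_iff_eq hT.ne']; ring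
    · rw [div_mul_eq_mul_div, div_mul_eq_mul_div, ← add_div, div_lt_iff₀ hT, hTdef]
      nlinarith
    · rw [div_mul_eq_mul_div, div_mul_eq_mul_div, ← add_div, div_lt_iff₀ hT, hTdef]
      nlinarith
  -- The smallest integer greater than d: exponents are integers, so an entry exceeding d is at
  -- least `N`.
  set N := ⌊d⌋₊ + 1 with hN
  have hNd : d < N := by rw [hN]; exact_mod_cast Nat.lt_floor_add_one d
  have hgt : ∀ k : ℕ, d < k → (N : ℝ) ≤ k := fun k hk => by
    have : ⌊d⌋₊ < k := (Nat.floor_lt hd.le).2 hk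
    exact_mod_cast this
  by_cases hR : ∃ a b : ℕ, P a b ∧ (b : ℝ) < d
  · by_cases hL : ∃ a b : ℕ, P a b ∧ (a : ℝ) < d
    · obtain ⟨G, hG1, hG2⟩ := exists_finset_dominating P
      classical
      set Gr := G.filter fun g => (g.2 : ℝ) < d with hg_right
      set Gl := G.filter fun g => (g.1 : ℝ) < d with hg_left
      have hg_rightne : Gr.Nonempty := by
        obtain ⟨a, b, hab, hb⟩ := hR
        obtain ⟨g, hg, _, hg2⟩ := hG2 a b hab
        have : (g.2 : ℝ) ≤ b := by exact_mod_cast hg2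
        exact ⟨g, Finset.mem_filter.2 ⟨hg, by linarith⟩⟩
      have hg_leftne : Gl.Nonempty := by
        obtain ⟨a, b, hab, ha⟩ := hL
        obtain ⟨g, hg, hg1, _⟩ := hG2 a b hab
        have : (g.1 : ℝ) ≤ a := by exact_mod_cast hg1
        exact ⟨g, Finset.mem_filter.2 ⟨hg, by linarith⟩⟩
      -- A line with parameter m through (d, d) supports the exponents below height d iff m ≤ r, the
      -- smallest ratio there, and those to the left of (d, d) iff m ≥ l, the largest ratio there.
      -- Always l ≤ r; equality gives an edge, and strict inequality a vertex, with κ the midpoint.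
      obtain ⟨p, hp, hpmin⟩ := Gr.exists_min_image (fun g => ((g.1 : ℝ) - d) / (d - g.2)) hg_rightne
      obtain ⟨p', hp', hpmax⟩ := Gl.exists_max_image (fun g => (d - (g.1 : ℝ)) / (g.2 - d)) hg_leftne
      obtain ⟨hpG, hpd⟩ := Finset.mem_filter.1 hp
      obtain ⟨hpG', hpd'⟩ := Finset.mem_filter.1 hp'
      have hLpos : ∀ a b : ℕ, P a b → (a : ℝ) < d → d < b := by
        intro a b hab ha
        have h1 := hcross p.1 p.2 a b (hG1 p hpG) hab hpd ha
        have h2 : 0 < (d - a) * (d - p.2) := mul_pos (by linarith) (by linarith)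
        have h3 := hpt p.1 p.2 (hG1 p hpG) hpd
        by_contra! h4
        have : ((p.1 : ℝ) - d) * (b - d) ≤ 0 := mul_nonpos_of_nonneg_of_nonpos (by linarith) (by linarith)
        linarith
      set r := ((p.1 : ℝ) - d) / (d - p.2) with hr
      set l := (d - (p'.1 : ℝ)) / (p'.2 - d) with hl
      have hp'b := hLpos p'.1 p'.2 (hG1 p' hpG') hpd'
      have hl0 : 0 < l := div_pos (by linarith) (by linarith)
      have hlr : l ≤ r := by
        rw [hl, hr, div_le_div_iff₀ (by linarith) (by linarith)]
        exact hcross p.1 p.2 p'.1 p'.2 (hG1 p hpG) (hG1 p' hpG') hpd hpd'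
      have hRr : ∀ a b : ℕ, P a b → (b : ℝ) < d → r * (d - b) ≤ a - d := by
        intro a b hab hb
        obtain ⟨g, hg, hg1, hg2⟩ := hG2 a b hab
        have e1 : (g.1 : ℝ) ≤ a := by exact_mod_cast hg1
        have e2 : (g.2 : ℝ) ≤ b := by exact_mod_cast hg2
        have h1 := hpmin g (Finset.mem_filter.2 ⟨hg, by linarith⟩)
        have h2 : r ≤ ((g.1 : ℝ) - d) / (d - g.2) := h1
        rw [le_div_iff₀ (by linarith)] at h2
        have h3 : r * (d - b) ≤ r * (d - g.2) := by
          apply mul_le_mul_of_nonneg_left _ (hl0.le.trans hlr); linarith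
        linarith
      have hLl : ∀ a b : ℕ, P a b → (a : ℝ) < d → d - a ≤ l * (b - d) := by
        intro a b hab ha
        obtain ⟨g, hg, hg1, hg2⟩ := hG2 a b hab
        have e1 : (g.1 : ℝ) ≤ a := by exact_mod_cast hg1
        have e2 : (g.2 : ℝ) ≤ b := by exact_mod_cast hg2
        have h1 := hpmax g (Finset.mem_filter.2 ⟨hg, by linarith⟩)
        have h2 : (d - (g.1 : ℝ)) / (g.2 - d) ≤ l := h1
        have h4 := hLpos g.1 g.2 (hG1 g hg) (by linarith)
        rw [div_le_iff₀ (by linarith)] at h2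
        have h3 : l * (g.2 - d) ≤ l * (b - d) := by
          apply mul_le_mul_of_nonneg_left _ hl0.le; linarith
        linarith
      rcases hlr.eq_or_lt with heq | hlt
      · left
        refine ⟨r, hl0.trans_le hlr, fun a b hab => ?_, ⟨p.1, p.2, hG1 p hpG, hpd, ?_⟩,
          p'.1, p'.2, hG1 p' hpG', hpd', ?_⟩
        · rcases lt_or_ge (b : ℝ) d with hb | hb
          · have := hRr a b hab hb; linarith
          · rcases lt_or_ge (a : ℝ) d with ha | ha
            · have := hLl a b hab ha; rw [heq] at this; linarith
            · have : 0 ≤ r * (b - d) := mul_nonneg (hl0.le.trans hlr) (by linarith)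
              linarith
        · have : r * (d - p.2) = p.1 - d := by rw [hr, div_mul_cancel₀]; linarith
          linarith
        · have : l * (p'.2 - d) = d - p'.1 := by rw [hl, div_mul_cancel₀]; linarith
          rw [heq] at this
          linarith
      · right; left
        have hκ0 : 0 < (l + r) / 2 := by linarith
        refine hvertex ((l + r) / 2) hκ0 fun a b hab hne => ?_
        rcases lt_or_ge (b : ℝ) d with hb | hb
        · have h1 := hRr a b hab hb
          have h2 : (l + r) / 2 * (d - b) < r * (d - b) :=
            mul_lt_mul_of_pos_right (by linarith) (by linarith)
          linarith
        · rcases lt_or_ge (a : ℝ) d with ha | ha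
          · have h1 := hLl a b hab ha
            have h3 := hLpos a b hab ha
            have h2 : l * (b - d) < (l + r) / 2 * (b - d) :=
              mul_lt_mul_of_pos_right (by linarith) (by linarith)
            linarith
          · have h1 : 0 ≤ (l + r) / 2 * (b - d) := mul_nonneg hκ0.le (by linarith)
            rcases ha.lt_or_eq with h2 | h2
            · linarith
            · have h3 : d < b := lt_of_le_of_ne hb fun h => hne ⟨h2.symm, h.symm⟩
              have : 0 < (l + r) / 2 * (b - d) := mul_pos hκ0 (by linarith)
              linarith
    · push Not at hL
      by_cases hV : ∃ a b : ℕ, P a b ∧ (a : ℝ) = d ∧ (b : ℝ) < d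
      · obtain ⟨n, B, hnB, rfl, hB⟩ := hV
        exact Or.inr (Or.inr (Or.inr ⟨n, rfl, fun a b hab => by exact_mod_cast hL a b hab, B,
          by exact_mod_cast hB, hnB⟩))
      · push Not at hV
        right; left
        -- κ is so small that exponents with a ≥ N lie above the line through (d, d) whatever b is.
        have hκ0 : 0 < (N - d) / (d + 1) := div_pos (by linarith) (by linarith)
        refine hvertex ((N - d) / (d + 1)) hκ0 fun a b hab hne => ?_
        have h1 := hL a b hab
        rcases h1.lt_or_eq with h2 | h2
        · have h3 := hgt a h2
          have h4 : (N - d) / (d + 1) * d < N - d := by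
            rw [div_mul_eq_mul_div, div_lt_iff₀ (by linarith)]
            nlinarith
          have h5 : 0 ≤ (N - d) / (d + 1) * b := by positivity
          linarith
        · have h3 : d < b := lt_of_le_of_ne (hV a b hab h2.symm) fun h => hne ⟨h2.symm, h.symm⟩
          have : (N - d) / (d + 1) * d < (N - d) / (d + 1) * b := mul_lt_mul_of_pos_left h3 hκ0
          linarith
  · push Not at hR
    by_cases hH : ∃ a b : ℕ, P a b ∧ (b : ℝ) = d ∧ (a : ℝ) < d
    · obtain ⟨A, n, hAn, rfl, hA'⟩ := hH
      exact Or.inr (Or.inr (Or.inl ⟨n, rfl, fun a b hab => by exact_mod_cast hR a b hab, A,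
        by exact_mod_cast hA', hAn⟩))
    · push Not at hH
      right; left
      -- κ is so large that exponents with b ≥ N lie above the line through (d, d) whatever a is.
      have hκ0 : 0 < (d + 1) / (N - d) := div_pos (by linarith) (by linarith)
      refine hvertex ((d + 1) / (N - d)) hκ0 fun a b hab hne => ?_
      have h1 := hR a b hab
      rcases h1.lt_or_eq with h2 | h2
      · have h3 := hgt b h2
        have h4 : d + 1 ≤ (d + 1) / (N - d) * (b - d) := by
          rw [div_mul_eq_mul_div, le_div_iff₀ (by linarith)]
          apply mul_le_mul_of_nonneg_left <;> linarith
        have h5 : (0 : ℝ) ≤ a := by positivity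
        linarith
      · have h3 : d < a := lt_of_le_of_ne (hH a b hab h2.symm) fun h => hne ⟨h.symm, h2.symm⟩
        rw [← h2]
        linarith

section NewtonPolygon

variable {S : ℝ × ℝ → ℝ}

theorem mem_newtonPolygon_of_le {a b : ℕ} (h : taylorCoeff S a b ≠ 0) {t : ℝ × ℝ} (h1 : (a : ℝ) ≤ t.1)
    (h2 : (b : ℝ) ≤ t.2) : t ∈ newtonPolygon S :=
  subset_convexHull ℝ _ ⟨a, b, h, h1, h2⟩

theorem convex_newtonPolygon : Convex ℝ (newtonPolygon S) := convex_convexHull ℝ _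

theorem le_of_mem_newtonPolygon {u v c : ℝ} (hu : 0 ≤ u) (hv : 0 ≤ v)
    (h : ∀ a b : ℕ, taylorCoeff S a b ≠ 0 → c ≤ u * a + v * b) {t : ℝ × ℝ}
    (ht : t ∈ newtonPolygon S) : c ≤ u * t.1 + v * t.2 := by
  have hconv : Convex ℝ {t : ℝ × ℝ | c ≤ u * t.1 + v * t.2} := by
    intro x hx y hy α β hα hβ hαβ
    have hx' : c ≤ u * x.1 + v * x.2 := hx
    have hy' : c ≤ u * y.1 + v * y.2 := hy
    change c ≤ u * (α * x.1 + β * y.1) + v * (α * x.2 + β * y.2)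
    have h1 := mul_le_mul_of_nonneg_left hx' hα
    have h2 := mul_le_mul_of_nonneg_left hy' hβ
    have h3 : c = α * c + β * c := by rw [← add_mul, hαβ, one_mul]
    nlinarith
  refine convexHull_min ?_ hconv ht
  rintro t ⟨a, b, hab, h1, h2⟩
  change c ≤ u * t.1 + v * t.2
  have h3 := mul_le_mul_of_nonneg_left h1 hu
  have h4 := mul_le_mul_of_nonneg_left h2 hv
  have := h a b hab
  linarith

theorem bddBelow_diagonal : BddBelow {t : ℝ | ((t, t) : ℝ × ℝ) ∈ newtonPolygon S} := by
  refine ⟨0, fun t ht => ?_⟩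
  have := le_of_mem_newtonPolygon (u := 1) (v := 0) (c := 0) zero_le_one le_rfl
    (fun a b _ => by positivity) ht
  simpa using this

theorem newtonDist_le {t : ℝ} (h : ((t, t) : ℝ × ℝ) ∈ newtonPolygon S) : newtonDist S ≤ t :=
  csInf_le bddBelow_diagonal h

theorem nonempty_diagonal {a b : ℕ} (h : taylorCoeff S a b ≠ 0) :
    {t : ℝ | ((t, t) : ℝ × ℝ) ∈ newtonPolygon S}.Nonempty :=
  ⟨max a b, mem_newtonPolygon_of_le h (le_max_left _ _) (le_max_right _ _)⟩

/-- Without exponents the polygon is empty and the infimum is 0 by convention, which a positive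
distance excludes. -/
theorem exists_taylorCoeff_ne_zero (hd : 0 < newtonDist S) : ∃ a b, taylorCoeff S a b ≠ 0 := by
  by_contra! h
  have : newtonPolygon S = ∅ := by
    unfold newtonPolygon
    have : {t : ℝ × ℝ | ∃ a b : ℕ, taylorCoeff S a b ≠ 0 ∧ (a : ℝ) ≤ t.1 ∧ (b : ℝ) ≤ t.2} = ∅ :=
      Set.eq_empty_of_forall_notMem fun t ⟨a, b, hab, _⟩ => hab (h a b)
    rw [this, convexHull_empty]
  unfold newtonDist at hd
  simp [this] at hd

/-- Attainment of the infimum is not needed: the bound is inherited from diagonal points of the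
polygon arbitrarily close to it. -/
theorem le_newtonDist {u v c : ℝ} (hu : 0 ≤ u) (hv : 0 ≤ v) (hd : 0 < newtonDist S)
    (h : ∀ a b : ℕ, taylorCoeff S a b ≠ 0 → c ≤ u * a + v * b) : c ≤ newtonDist S * (u + v) := by
  obtain ⟨a, b, hab⟩ := exists_taylorCoeff_ne_zero hd
  refine le_of_forall_pos_le_add fun η hη => ?_
  obtain ⟨t, ht, htd⟩ := Real.lt_sInf_add_pos (nonempty_diagonal hab)
    (show 0 < η / (u + v + 1) by positivity)
  have h1 := le_of_mem_newtonPolygon hu hv h ht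
  have h2 : t < newtonDist S + η / (u + v + 1) := htd
  have h3 : t * (u + v) ≤ (newtonDist S + η / (u + v + 1)) * (u + v) :=
    mul_le_mul_of_nonneg_right h2.le (by positivity)
  have h4 : η / (u + v + 1) * (u + v) ≤ η := by
    rw [div_mul_eq_mul_div, div_le_iff₀ (by positivity)]
    nlinarith
  simp only at h1
  nlinarith

/-- The two inputs of `newton_classification`: a linear form with positive weights attains its
minimum at an exponent, and by `le_newtonDist` this one is on or below the line through (d, d). A
convex combination with both coordinates less than d could be raised to a diagonal point of the
polygon before (d, d). -/
theorem classification (hd : 0 < newtonDist S) :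
    (∃ m > 0, (∀ a b : ℕ, taylorCoeff S a b ≠ 0 → newtonDist S * (1 + m) ≤ a + m * b) ∧
      (∃ A B : ℕ, taylorCoeff S A B ≠ 0 ∧ (B : ℝ) < newtonDist S ∧
        (A : ℝ) + m * B = newtonDist S * (1 + m)) ∧
      ∃ A B : ℕ, taylorCoeff S A B ≠ 0 ∧ (A : ℝ) < newtonDist S ∧
        (A : ℝ) + m * B = newtonDist S * (1 + m)) ∨
    (∃ n : ℕ, (n : ℝ) = newtonDist S ∧ taylorCoeff S n n ≠ 0 ∧ ∃ κ > 0, ∀ a b : ℕ,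
      taylorCoeff S a b ≠ 0 → (a, b) ≠ (n, n) → (n : ℝ) * (1 + κ) < a + κ * b) ∨
    (∃ n : ℕ, (n : ℝ) = newtonDist S ∧ (∀ a b : ℕ, taylorCoeff S a b ≠ 0 → n ≤ b) ∧
      ∃ A < n, taylorCoeff S A n ≠ 0) ∨
    (∃ n : ℕ, (n : ℝ) = newtonDist S ∧ (∀ a b : ℕ, taylorCoeff S a b ≠ 0 → n ≤ a) ∧
      ∃ B < n, taylorCoeff S n B ≠ 0) := by
  refine newton_classification (P := fun a b => taylorCoeff S a b ≠ 0) hd (fun κ hκ => ?_) ?_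
  · obtain ⟨G, hG1, hG2⟩ := exists_finset_dominating fun a b => taylorCoeff S a b ≠ 0
    obtain ⟨a, b, hab⟩ := exists_taylorCoeff_ne_zero hd
    obtain ⟨g, hg, -⟩ := hG2 a b hab
    obtain ⟨p, hp, hmin⟩ := G.exists_min_image (fun g => (g.1 : ℝ) + κ * g.2) ⟨g, hg⟩
    refine ⟨p.1, p.2, hG1 p hp, ?_⟩
    refine le_newtonDist zero_le_one hκ.le hd fun a b hab => ?_
    obtain ⟨g, hg, h1, h2⟩ := hG2 a b hab
    refine (hmin g hg).trans ?_
    rw [one_mul]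
    gcongr
  · rintro a b a' b' hab hab' l l' hl hl' hll ⟨h1, h2⟩
    have hmem : (l * a + l' * a', l * b + l' * b') ∈ newtonPolygon S :=
      convex_newtonPolygon (mem_newtonPolygon_of_le hab (t := (a, b)) le_rfl le_rfl)
        (mem_newtonPolygon_of_le hab' (t := (a', b')) le_rfl le_rfl) hl hl' hll
    set t := max (l * a + l' * a') (l * b + l' * b') with ht
    have htmem : ((t, t) : ℝ × ℝ) ∈ newtonPolygon S := by
      have hg : (l • ((a : ℝ) + (t - (l * a + l' * a')), (b : ℝ) + (t - (l * b + l' * b'))) +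
          l' • ((a' : ℝ) + (t - (l * a + l' * a')), (b' : ℝ) + (t - (l * b + l' * b'))) : ℝ × ℝ)
          ∈ newtonPolygon S := by
        have e1 : 0 ≤ t - (l * a + l' * a') := sub_nonneg.2 (le_max_left _ _)
        have e2 : 0 ≤ t - (l * b + l' * b') := sub_nonneg.2 (le_max_right _ _)
        exact convex_newtonPolygon (mem_newtonPolygon_of_le hab (by simp [e1]) (by simp [e2]))
          (mem_newtonPolygon_of_le hab' (by simp [e1]) (by simp [e2])) hl hl' hll
      convert hg using 1
      ext
      · simp only [Prod.fst_add, Prod.smul_fst, smul_eq_mul]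
        linear_combination -(t - (l * a + l' * a')) * hll
      · simp only [Prod.snd_add, Prod.smul_snd, smul_eq_mul]
        linear_combination -(t - (l * b + l' * b')) * hll
    have := newtonDist_le htmem
    exact absurd this (not_le.2 (max_lt h1 h2))

end NewtonPolygon

/-! ### Superadaptedness as nondegeneracy of faces -/

theorem exists_face_finset (s : ℕ → ℕ → ℝ) {m : ℝ} (hm : 0 < m) (α : ℝ) :
    ∃ F : Finset (ℕ × ℕ), ∀ p : ℕ × ℕ, p ∈ F ↔ s p.1 p.2 ≠ 0 ∧ (p.1 : ℝ) + m * p.2 = α := by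
  have hfin : {p : ℕ × ℕ | s p.1 p.2 ≠ 0 ∧ (p.1 : ℝ) + m * p.2 = α}.Finite := by
    refine ((Finset.range (⌊α⌋₊ + 1) ×ˢ Finset.range (⌊α / m⌋₊ + 1)).finite_toSet).subset ?_
    rintro p ⟨-, hp⟩
    have h1 : (0 : ℝ) ≤ p.1 := by positivity
    have h2 : 0 ≤ m * p.2 := by positivity
    rw [Finset.mem_coe, Finset.mem_product, Finset.mem_range, Finset.mem_range, Nat.lt_succ_iff,
      Nat.lt_succ_iff]
    refine ⟨Nat.le_floor (by linarith), Nat.le_floor ?_⟩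
    rw [le_div_iff₀ hm]
    linarith
  exact ⟨hfin.toFinset, fun p => hfin.mem_toFinset⟩

section Edge

variable {S : ℝ × ℝ → ℝ} {m c : ℝ}

theorem mem_newtonFace_iff (hm : 0 ≤ m)
    (hmin : ∀ a b : ℕ, taylorCoeff S a b ≠ 0 → c ≤ a + m * b)
    (hatt : ∃ t ∈ newtonPolygon S, t.1 + m * t.2 = c) {t : ℝ × ℝ} :
    t ∈ newtonFace S 1 m ↔ t ∈ newtonPolygon S ∧ t.1 + m * t.2 = c := by
  have hle : ∀ t ∈ newtonPolygon S, c ≤ t.1 + m * t.2 := fun t ht => by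
    simpa using le_of_mem_newtonPolygon (u := 1) (v := m) zero_le_one hm
      (fun a b hab => by rw [one_mul]; exact hmin a b hab) ht
  obtain ⟨t₀, h0, h0'⟩ := hatt
  simp only [newtonFace, one_mul, Set.mem_ofPred_eq]
  constructor
  · rintro ⟨h1, h2⟩
    have := h2 t₀ h0
    exact ⟨h1, le_antisymm (by linarith) (hle t h1)⟩
  · rintro ⟨h1, h2⟩
    exact ⟨h1, fun t' ht' => h2.trans_le (hle t' ht')⟩

theorem mem_newtonPolygon {a b : ℕ} (h : taylorCoeff S a b ≠ 0) :
    ((a : ℝ), (b : ℝ)) ∈ newtonPolygon S := mem_newtonPolygon_of_le h le_rfl le_rfl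

theorem edgeFun_eq_facePoly {F : Finset (ℕ × ℕ)}
    (hF : ∀ p : ℕ × ℕ, p ∈ F ↔ taylorCoeff S p.1 p.2 ≠ 0 ∧ (p.1 : ℝ) + m * p.2 = c)
    (hm : 0 ≤ m) (hmin : ∀ a b : ℕ, taylorCoeff S a b ≠ 0 → c ≤ a + m * b)
    (hatt : ∃ t ∈ newtonPolygon S, t.1 + m * t.2 = c) (x y : ℝ) :
    edgeFun S (newtonFace S 1 m) x y = facePoly (taylorCoeff S) F (x, y) := by
  unfold edgeFun facePoly
  rw [tsum_eq_sum (s := F)]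
  · refine Finset.sum_congr rfl fun p hp => ?_
    obtain ⟨h1, h2⟩ := (hF p).1 hp
    unfold edgeTerm
    rw [Set.indicator_of_mem]
    exact (mem_newtonFace_iff hm hmin hatt).2 ⟨mem_newtonPolygon h1, h2⟩
  · intro p hp
    unfold edgeTerm
    by_cases h : taylorCoeff S p.1 p.2 = 0
    · classical
      rw [Set.indicator_apply]
      split_ifs <;> simp [h]
    · rw [Set.indicator_of_notMem]
      exact fun h' => hp ((hF p).2 ⟨h, ((mem_newtonFace_iff hm hmin hatt).1 h').2⟩)

theorem iteratedDeriv_facePoly (s : ℕ → ℕ → ℝ) (F : Finset (ℕ × ℕ)) (x y : ℝ) (k : ℕ) :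
    iteratedDeriv k (fun z => facePoly s F (x, z)) y * y ^ k =
      ∑ p ∈ F, s p.1 p.2 * x ^ p.1 * (p.2.descFactorial k : ℝ) * y ^ p.2 := by
  unfold facePoly
  rw [iteratedDeriv_fun_sum fun p _ => by fun_prop, Finset.sum_mul]
  refine Finset.sum_congr rfl fun p _ => ?_
  change iteratedDeriv k (fun z => s p.1 p.2 * x ^ p.1 * z ^ p.2) y * y ^ k = _
  rw [iteratedDeriv_const_mul_field, iteratedDeriv_pow]
  rcases le_or_gt k p.2 with h | h
  · have : y ^ (p.2 - k) * y ^ k = y ^ p.2 := by rw [← pow_add, Nat.sub_add_cancel h]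
    linear_combination s p.1 p.2 * x ^ p.1 * (p.2.descFactorial k : ℝ) * this
  · rw [Nat.descFactorial_of_lt h]
    simp

/-- A face with two exponents is a compact edge containing (d, d), and the sums are nonzero
multiples of the derivatives of S_e(σ, ·) at τ t; if they all vanished there would be a zero of
order K ≥ d. A face with one exponent is a monomial, without zeros off the axes. -/
theorem exists_sum_ne_zero_of_isSuperadapted (hsuper : IsSuperadapted S) (hm : 0 < m)
    {F : Finset (ℕ × ℕ)}
    (hF : ∀ p : ℕ × ℕ, p ∈ F ↔ taylorCoeff S p.1 p.2 ≠ 0 ∧ (p.1 : ℝ) + m * p.2 = newtonDist S * (1 + m))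
    (hmin : ∀ a b : ℕ, taylorCoeff S a b ≠ 0 → newtonDist S * (1 + m) ≤ a + m * b)
    (hmem : (newtonDist S, newtonDist S) ∈ newtonPolygon S) (hne : F.Nonempty) {K : ℕ} (hK0 : 0 < K)
    (hK : newtonDist S ≤ K) {σ τ t : ℝ} (hσ : σ = 1 ∨ σ = -1) (hτ : τ = 1 ∨ τ = -1) (ht : 0 < t) :
    ∃ k < K, ∑ p ∈ F, σ ^ p.1 * τ ^ p.2 * taylorCoeff S p.1 p.2 * (p.2.descFactorial k : ℝ) * t ^ p.2
      ≠ 0 := by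
  have hσ0 : σ ≠ 0 := by rcases hσ with rfl | rfl <;> norm_num
  have hτ0 : τ ≠ 0 := by rcases hτ with rfl | rfl <;> norm_num
  have hatt : ∃ t ∈ newtonPolygon S, t.1 + m * t.2 = newtonDist S * (1 + m) :=
    ⟨_, hmem, by ring⟩
  rcases Finset.Nontrivial.eq_1 F ▸ Classical.em F.Nontrivial with hnt | hnt
  · by_contra! hzero
    have hedge : IsCompactEdge S m (newtonFace S 1 m) := by
      refine ⟨hm, rfl, ?_⟩
      obtain ⟨p, hp, r, hr, hpr⟩ := hnt
      refine ⟨((p.1 : ℝ), (p.2 : ℝ)), (mem_newtonFace_iff hm.le hmin hatt).2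
          ⟨mem_newtonPolygon ((hF p).1 hp).1, ((hF p).1 hp).2⟩,
        ((r.1 : ℝ), (r.2 : ℝ)), (mem_newtonFace_iff hm.le hmin hatt).2
          ⟨mem_newtonPolygon ((hF r).1 hr).1, ((hF r).1 hr).2⟩, fun h => hpr ?_⟩
      rw [Prod.mk.injEq, Nat.cast_inj, Nat.cast_inj] at h
      exact Prod.ext h.1 h.2
    have hy : τ * t ≠ 0 := mul_ne_zero hτ0 ht.ne'
    have hlt := hsuper m _ hedge ⟨newtonDist S, (mem_newtonFace_iff hm.le hmin hatt).2
      ⟨hmem, by ring⟩⟩ σ hσ (τ * t) hy K (by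
        simp only [edgeFun_eq_facePoly hF hm.le hmin hatt]
        rw [natCast_le_analyticOrderAt_iff_iteratedDeriv_eq_zero]
        · intro k hk
          have h1 := iteratedDeriv_facePoly (taylorCoeff S) F σ (τ * t) k
          have h2 : ∑ p ∈ F, taylorCoeff S p.1 p.2 * σ ^ p.1 * (p.2.descFactorial k : ℝ) * (τ * t) ^ p.2 = 0 := by
            rw [← hzero k hk]
            exact Finset.sum_congr rfl fun p _ => by rw [mul_pow]; ring
          rw [h2] at h1
          exact (mul_eq_zero.1 h1).resolve_right (pow_ne_zero _ hy)
        · unfold facePoly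
          fun_prop)
    exact absurd hlt (not_lt.2 hK)
  · obtain ⟨p, hp⟩ := hne
    have hall : ∀ r ∈ F, r = p := fun r hr => by
      by_contra h
      exact hnt ⟨r, hr, p, hp, h⟩
    refine ⟨0, hK0, ?_⟩
    rw [Finset.sum_eq_single p (fun r hr h => absurd (hall r hr) h) (fun h => absurd hp h)]
    rw [Nat.descFactorial_zero, Nat.cast_one, mul_one]
    exact mul_ne_zero (mul_ne_zero (mul_ne_zero (pow_ne_zero _ hσ0) (pow_ne_zero _ hτ0))
      ((hF p).1 hp).1) (by positivity)

end Edge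

section Transfer

open Polynomial in
-- The descending factorials of order less than n span the polynomials of degree less than n; the
-- induction removes the leading term of `R`.
theorem sum_eval_eq_zero_of_descFactorial {ι : Type*} {F : Finset ι} {v : ι → ℝ} {a : ι → ℕ} {K : ℕ}
    (h : ∀ k < K, ∑ p ∈ F, v p * ((a p).descFactorial k : ℝ) = 0) :
    ∀ n ≤ K, ∀ R : ℝ[X], R.degree < n → ∑ p ∈ F, v p * R.eval (a p : ℝ) = 0 := by
  intro n
  induction n with
  | zero =>
    intro _ R hR
    have : R = 0 := by
      rw [← Polynomial.degree_eq_bot]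
      exact Nat.WithBot.lt_zero_iff.1 (by simpa using hR)
    simp [this]
  | succ n ih =>
    intro hn R hR
    set D := descPochhammer ℝ n with hD
    have hDm : D.Monic := monic_descPochhammer ℝ n
    have hDd : D.natDegree = n := descPochhammer_natDegree ℝ n
    set R' := R - C (R.coeff n) * D with hR'
    have hdeg : R'.degree < n := by
      rw [Polynomial.degree_lt_iff_coeff_zero]
      intro j hj
      rw [hR', coeff_sub, coeff_C_mul]
      rcases hj.eq_or_lt with rfl | hj
      · have : D.coeff n = 1 := by
          have := hDm.coeff_natDegree
          rwa [hDd] at this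
        rw [this]; ring
      · rw [coeff_eq_zero_of_degree_lt (hR.trans_le (by exact_mod_cast hj)),
          coeff_eq_zero_of_natDegree_lt (p := D) (by rw [hDd]; exact hj)]
        ring
    have h1 := ih (by omega) R' hdeg
    have h2 := h n (by omega)
    simp only [hR', eval_sub, eval_mul, eval_C, hD, descPochhammer_eval_eq_descFactorial] at h1
    have h3 : ∑ p ∈ F, v p * R.eval (a p : ℝ) = ∑ p ∈ F, v p * (R.eval (a p : ℝ)
        - R.coeff n * ((a p).descFactorial n : ℝ)) + R.coeff n * ∑ p ∈ F, v p * ((a p).descFactorial n : ℝ) := by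
      rw [Finset.mul_sum, ← Finset.sum_add_distrib]
      exact Finset.sum_congr rfl fun p _ => by ring
    rw [h3, h1, h2, mul_zero, add_zero]

/-- On a line, the order of vanishing of a quasi-homogeneous polynomial may be computed with respect
to either variable. -/
theorem sum_descFactorial_transfer {F : Finset (ℕ × ℕ)} {w : ℕ × ℕ → ℝ} {ν α : ℝ} (hν : 0 < ν)
    (hline : ∀ p ∈ F, (p.1 : ℝ) + ν * p.2 = α) {K : ℕ} {t : ℝ} (ht : 0 < t)
    (h : ∀ k < K, ∑ p ∈ F, w p * (p.1.descFactorial k : ℝ) * t ^ p.1 = 0) {k : ℕ} (hk : k < K) :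
    ∑ p ∈ F, w p * (p.2.descFactorial k : ℝ) * (t ^ (-ν)) ^ p.2 = 0 := by
  classical
  -- On the line p.2 = (α - p.1) / ν, so a descending factorial of order k in p.2 is a polynomial of
  -- degree at most k in p.1. The identity t^(p.1) = t^α (t^(-ν))^(p.2) moves the zero from t to
  -- t^(-ν).
  set R : Polynomial ℝ := (descPochhammer ℝ k).comp
    (Polynomial.C (α / ν) + Polynomial.C (-1 / ν) * Polynomial.X) with hR
  have hdeg : R.degree < K := by
    refine lt_of_le_of_lt Polynomial.degree_le_natDegree ?_
    have h1 : R.natDegree ≤ k * 1 := by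
      refine Polynomial.natDegree_comp_le.trans ?_
      rw [descPochhammer_natDegree]
      refine Nat.mul_le_mul_left k ?_
      refine (Polynomial.natDegree_add_le _ _).trans (max_le (by simp) ?_)
      exact (Polynomial.natDegree_C_mul_le _ _).trans Polynomial.natDegree_X_le
    exact_mod_cast (h1.trans_eq (mul_one k)).trans_lt hk
  have h1 := sum_eval_eq_zero_of_descFactorial (F := F) (v := fun p => w p * t ^ p.1)
    (a := fun p => p.1) (K := K) (fun j hj => by
      rw [← h j hj]
      exact Finset.sum_congr rfl fun p _ => by ring) K le_rfl R hdeg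
  have h2 : ∀ p ∈ F, w p * t ^ p.1 * R.eval (p.1 : ℝ)
      = t ^ α * (w p * (p.2.descFactorial k : ℝ) * (t ^ (-ν)) ^ p.2) := by
    intro p hp
    have e1 : (p.1 : ℝ) = α - ν * p.2 := by linarith [hline p hp]
    have e2 : R.eval (p.1 : ℝ) = (p.2.descFactorial k : ℝ) := by
      rw [hR, Polynomial.eval_comp, ← descPochhammer_eval_eq_descFactorial ℝ]
      congr 1
      simp only [Polynomial.eval_add, Polynomial.eval_mul, Polynomial.eval_C, Polynomial.eval_X]
      rw [e1]
      field_simp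
      ring
    have e3 : t ^ p.1 = t ^ α * (t ^ (-ν)) ^ p.2 := by
      rw [← Real.rpow_natCast t p.1, e1, ← Real.rpow_natCast (t ^ (-ν)), ← Real.rpow_mul ht.le,
        ← Real.rpow_add ht]
      congr 1
      ring
    rw [e2, e3]
    ring
  rw [Finset.sum_congr rfl h2, ← Finset.mul_sum] at h1
  exact (mul_eq_zero.1 h1).resolve_left (Real.rpow_pos_of_pos ht α).ne'

end Transfer

theorem eq_or_eq_neg_of_mem {σ : ℝ} (h : σ ∈ ({1, -1} : Finset ℝ)) : σ = 1 ∨ σ = -1 := by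
  simpa using h

section Superadapted

variable {S : ℝ × ℝ → ℝ} {κ : ℝ} {K : ℕ}

/-- Since (d, d) is on the supporting line of κ, a steeper weight μ ≥ κ leaves two cases. If the
supporting line of μ passes strictly below (d, d), its exponents have second entry less than d and
the degree bounds the order of zeros; if it contains (d, d), superadaptedness applies. -/
theorem faceNondegenerate_of_isSuperadapted (hS : ContDiff ℝ ∞ S) (hsuper : IsSuperadapted S)
    (hκ : 0 < κ) (hmem : (newtonDist S, newtonDist S) ∈ newtonPolygon S)
    (hmin : ∀ a b : ℕ, taylorCoeff S a b ≠ 0 → newtonDist S * (1 + κ) ≤ a + κ * b)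
    (hK0 : 0 < K) (hK : newtonDist S ≤ K) {σ τ : ℝ} (hσ : σ ∈ ({1, -1} : Finset ℝ))
    (hτ : τ ∈ ({1, -1} : Finset ℝ)) : FaceNondegenerate (taylorCoeff (reflect σ τ S)) κ K := by
  intro μ hμ α F hne hF hmin' t ht
  have hμ0 : 0 < μ := lt_of_lt_of_le hκ hμ
  have hnz := taylorCoeff_reflect_ne_zero hS (abs_eq_one_of_mem hσ) (abs_eq_one_of_mem hτ)
  simp only [hnz] at hF hmin'
  have hα : α ≤ newtonDist S * (1 + μ) := by
    have := le_of_mem_newtonPolygon (u := 1) (v := μ) zero_le_one hμ0.le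
      (fun a b hab => by rw [one_mul]; exact hmin' a b hab) hmem
    simp only at this
    linarith
  rcases hα.lt_or_eq with hlt | rfl
  · refine exists_sum_descFactorial_ne_zero (μ := μ) (α := α) hne
      (fun p hp => by rw [hnz]; exact (hF p).1 hp) (fun p hp => ?_) ht
    obtain ⟨h1, h2⟩ := (hF p).1 hp
    have h3 : (p.2 : ℝ) < newtonDist S := by
      by_contra! h
      have h4 := hmin p.1 p.2 h1
      have h5 : 0 ≤ (μ - κ) * (p.2 - newtonDist S) := mul_nonneg (by linarith) (by linarith)
      nlinarith
    exact_mod_cast h3.trans_le hK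
  · obtain ⟨k, hk, h⟩ := exists_sum_ne_zero_of_isSuperadapted hsuper hμ0 hF hmin' hmem hne hK0 hK
      (eq_or_eq_neg_of_mem hσ) (eq_or_eq_neg_of_mem hτ) ht
    refine ⟨k, hk, ?_⟩
    simpa only [taylorCoeff_reflect hS] using h

/-- The same dichotomy on the other side of (d, d). Superadaptedness speaks of zeros in y only, so
for a face through (d, d) the order of vanishing is transferred from one variable to the other by
`sum_descFactorial_transfer`. -/
theorem faceNondegenerate_swap_of_isSuperadapted (hS : ContDiff ℝ ∞ S) (hsuper : IsSuperadapted S)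
    (hκ : 0 < κ) (hmem : (newtonDist S, newtonDist S) ∈ newtonPolygon S)
    (hmin : ∀ a b : ℕ, taylorCoeff S a b ≠ 0 → newtonDist S * (1 + κ) ≤ a + κ * b)
    (hK0 : 0 < K) (hK : newtonDist S ≤ K) {σ τ : ℝ} (hσ : σ ∈ ({1, -1} : Finset ℝ))
    (hτ : τ ∈ ({1, -1} : Finset ℝ)) :
    FaceNondegenerate (taylorCoeff (reflect σ τ S ∘ Prod.swap)) κ⁻¹ K := by
  intro μ hμ α F hne hF hmin' t ht
  have hμ0 : 0 < μ := lt_of_lt_of_le (inv_pos.2 hκ) hμ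
  have hν0 : 0 < μ⁻¹ := inv_pos.2 hμ0
  have hνκ : μ⁻¹ ≤ κ := inv_le_of_inv_le₀ hκ hμ
  have hnz := taylorCoeff_reflect_swap_ne_zero hS (abs_eq_one_of_mem hσ) (abs_eq_one_of_mem hτ)
  simp only [hnz] at hF hmin'
  have hline : ∀ a b c : ℝ, b + μ * a = c ↔ a + μ⁻¹ * b = μ⁻¹ * c := fun a b c => by
    constructor
    · rintro rfl; field_simp; ring
    · intro h
      have : μ * (a + μ⁻¹ * b) = μ * (μ⁻¹ * c) := by rw [h]
      field_simp at this
      linarith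
  have hmin'' : ∀ a b : ℕ, taylorCoeff S a b ≠ 0 → μ⁻¹ * α ≤ a + μ⁻¹ * b := fun a b hab => by
    have h1 := mul_le_mul_of_nonneg_left (hmin' b a hab) hν0.le
    have h2 : μ⁻¹ * (b + μ * a) = a + μ⁻¹ * b := by field_simp; ring
    rwa [h2] at h1
  have hα : μ⁻¹ * α ≤ newtonDist S * (1 + μ⁻¹) := by
    have := le_of_mem_newtonPolygon (u := 1) (v := μ⁻¹) zero_le_one hν0.le
      (fun a b hab => by rw [one_mul]; exact hmin'' a b hab) hmem
    simp only at this
    linarith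
  rcases hα.lt_or_eq with hlt | heq
  · refine exists_sum_descFactorial_ne_zero (μ := μ) (α := α) hne
      (fun p hp => by rw [hnz]; exact (hF p).1 hp) (fun p hp => ?_) ht
    obtain ⟨h1, h2⟩ := (hF p).1 hp
    have h3 : (p.2 : ℝ) < newtonDist S := by
      by_contra! h
      have h4 := hmin p.2 p.1 h1
      have h5 := (hline p.2 p.1 α).1 h2
      have h6 : 0 ≤ (κ - μ⁻¹) * (p.2 - newtonDist S) := mul_nonneg (by linarith) (by linarith)
      have h7 : μ⁻¹ * (newtonDist S * (1 + κ)) ≤ μ⁻¹ * (p.2 + κ * p.1) := by gcongr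
      have h8 : κ * (p.2 + μ⁻¹ * p.1) < κ * (newtonDist S * (1 + μ⁻¹)) := by
        rw [h5]; gcongr
      nlinarith
    exact_mod_cast h3.trans_le hK
  · set F' := F.map (Equiv.prodComm ℕ ℕ).toEmbedding with hF'
    have hmemF' : ∀ p : ℕ × ℕ, p ∈ F' ↔ taylorCoeff S p.1 p.2 ≠ 0 ∧
        (p.1 : ℝ) + μ⁻¹ * p.2 = newtonDist S * (1 + μ⁻¹) := fun p => by
      rw [hF', Finset.mem_map_equiv, hF, ← heq, ← hline]
      rfl
    by_contra! hzero
    obtain ⟨k, hk, h⟩ := exists_sum_ne_zero_of_isSuperadapted hsuper hν0 hmemF'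
      (fun a b hab => by rw [← heq]; exact hmin'' a b hab) hmem (by simpa [hF'] using hne) hK0 hK
      (eq_or_eq_neg_of_mem hσ) (eq_or_eq_neg_of_mem hτ) (t := t ^ (-μ⁻¹)) (Real.rpow_pos_of_pos ht _)
    refine h (sum_descFactorial_transfer (w := fun p => σ ^ p.1 * τ ^ p.2 * taylorCoeff S p.1 p.2) hν0
      (fun p hp => ((hmemF' p).1 hp).2) ht (fun j hj => ?_) hk)
    rw [← hzero j hj, hF', Finset.sum_map]
    refine Finset.sum_congr rfl fun p _ => ?_
    simp only [Equiv.coe_toEmbedding, Equiv.prodComm_apply, Prod.fst_swap, Prod.snd_swap,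
      taylorCoeff_comp_swap (contDiff_reflect hS σ τ), taylorCoeff_reflect hS]

end Superadapted

/-! ### Edges met by the bisectrix -/

section Position

variable {S : ℝ × ℝ → ℝ}

/-- Points of the Newton polygon on a supporting line lie above the lowest exponent on it. -/
theorem le_snd_of_mem_line {m c β : ℝ} (hm : 0 < m)
    (hmin : ∀ a b : ℕ, taylorCoeff S a b ≠ 0 → c ≤ a + m * b)
    (hβ : ∀ a b : ℕ, taylorCoeff S a b ≠ 0 → (a : ℝ) + m * b = c → β ≤ b) {t : ℝ × ℝ}
    (ht : t ∈ newtonPolygon S) (htc : t.1 + m * t.2 = c) : β ≤ t.2 := by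
  -- An open half-plane together with a half-line of its boundary is convex, and it contains each
  -- generating quadrant.
  have hconv : Convex ℝ {t : ℝ × ℝ | c ≤ t.1 + m * t.2 ∧ (t.1 + m * t.2 = c → β ≤ t.2)} := by
    rintro x ⟨hx, hx'⟩ y ⟨hy, hy'⟩ l l' hl hl' hll
    have e : (l • x + l' • y).1 + m * (l • x + l' • y).2 = l * (x.1 + m * x.2) + l' * (y.1 + m * y.2) := by
      simp only [Prod.fst_add, Prod.smul_fst, Prod.snd_add, Prod.smul_snd, smul_eq_mul]
      ring
    have hc : c = l * c + l' * c := by rw [← add_mul, hll, one_mul]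
    have h1 := mul_le_mul_of_nonneg_left hx hl
    have h2 := mul_le_mul_of_nonneg_left hy hl'
    refine ⟨by rw [e]; linarith, fun heq => ?_⟩
    rw [e] at heq
    have h3 : l * (x.1 + m * x.2) = l * c := by linarith
    have h4 : l' * (y.1 + m * y.2) = l' * c := by linarith
    have h5 : l * β ≤ l * x.2 := by
      rcases hl.eq_or_lt with h | h
      · rw [← h, zero_mul, zero_mul]
      · exact mul_le_mul_of_nonneg_left (hx' (mul_left_cancel₀ h.ne' h3)) hl
    have h6 : l' * β ≤ l' * y.2 := by
      rcases hl'.eq_or_lt with h | h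
      · rw [← h, zero_mul, zero_mul]
      · exact mul_le_mul_of_nonneg_left (hy' (mul_left_cancel₀ h.ne' h4)) hl'
    have h7 : β = l * β + l' * β := by rw [← add_mul, hll, one_mul]
    simp only [Prod.snd_add, Prod.smul_snd, smul_eq_mul]
    linarith
  refine (convexHull_min ?_ hconv ht).2 htc
  rintro t ⟨a, b, hab, h1, h2⟩
  have h3 := mul_le_mul_of_nonneg_left h2 hm.le
  have h4 := hmin a b hab
  refine ⟨by linarith, fun h => ?_⟩
  exact (hβ a b hab (by linarith)).trans h2

theorem le_fst_of_mem_line {m c β : ℝ} (hm : 0 < m)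
    (hmin : ∀ a b : ℕ, taylorCoeff S a b ≠ 0 → c ≤ a + m * b)
    (hβ : ∀ a b : ℕ, taylorCoeff S a b ≠ 0 → (a : ℝ) + m * b = c → β ≤ a) {t : ℝ × ℝ}
    (ht : t ∈ newtonPolygon S) (htc : t.1 + m * t.2 = c) : β ≤ t.1 := by
  have hconv : Convex ℝ {t : ℝ × ℝ | c ≤ t.1 + m * t.2 ∧ (t.1 + m * t.2 = c → β ≤ t.1)} := by
    rintro x ⟨hx, hx'⟩ y ⟨hy, hy'⟩ l l' hl hl' hll
    have e : (l • x + l' • y).1 + m * (l • x + l' • y).2 = l * (x.1 + m * x.2) + l' * (y.1 + m * y.2) := by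
      simp only [Prod.fst_add, Prod.smul_fst, Prod.snd_add, Prod.smul_snd, smul_eq_mul]
      ring
    have hc : c = l * c + l' * c := by rw [← add_mul, hll, one_mul]
    have h1 := mul_le_mul_of_nonneg_left hx hl
    have h2 := mul_le_mul_of_nonneg_left hy hl'
    refine ⟨by rw [e]; linarith, fun heq => ?_⟩
    rw [e] at heq
    have h3 : l * (x.1 + m * x.2) = l * c := by linarith
    have h4 : l' * (y.1 + m * y.2) = l' * c := by linarith
    have h5 : l * β ≤ l * x.1 := by
      rcases hl.eq_or_lt with h | h
      · rw [← h, zero_mul, zero_mul]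
      · exact mul_le_mul_of_nonneg_left (hx' (mul_left_cancel₀ h.ne' h3)) hl
    have h6 : l' * β ≤ l' * y.1 := by
      rcases hl'.eq_or_lt with h | h
      · rw [← h, zero_mul, zero_mul]
      · exact mul_le_mul_of_nonneg_left (hy' (mul_left_cancel₀ h.ne' h4)) hl'
    have h7 : β = l * β + l' * β := by rw [← add_mul, hll, one_mul]
    simp only [Prod.fst_add, Prod.smul_fst, smul_eq_mul]
    linarith
  refine (convexHull_min ?_ hconv ht).2 htc
  rintro t ⟨a, b, hab, h1, h2⟩
  have h3 := mul_le_mul_of_nonneg_left h2 hm.le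
  have h4 := hmin a b hab
  refine ⟨by linarith, fun h => ?_⟩
  exact (hβ a b hab (by linarith)).trans h1

/-- A diagonal point of a face minimizes u t₁ + v t₂, which increases along the diagonal; so it is
the first diagonal point of the polygon, (d, d). -/
theorem exists_of_bisectrixMeetsInterior {u v : ℝ} (huv : 0 < u + v)
    (h : BisectrixMeetsInterior (newtonFace S u v)) :
    (newtonDist S, newtonDist S) ∈ newtonPolygon S ∧
    (∀ t ∈ newtonPolygon S, newtonDist S * (u + v) ≤ u * t.1 + v * t.2) ∧
    ∃ p ∈ newtonPolygon S, ∃ q ∈ newtonPolygon S, p ≠ q ∧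
      u * p.1 + v * p.2 = newtonDist S * (u + v) ∧ u * q.1 + v * q.2 = newtonDist S * (u + v) ∧
      ∃ l l' : ℝ, 0 < l ∧ 0 < l' ∧ l + l' = 1 ∧ l * p.1 + l' * q.1 = newtonDist S ∧
        l * p.2 + l' * q.2 = newtonDist S := by
  obtain ⟨t, p, ⟨hp, hp'⟩, q, ⟨hq, hq'⟩, hpq, l, l', hl, hl', hll, heq⟩ := h
  have h1 : l * p.1 + l' * q.1 = t := by simpa using congrArg Prod.fst heq
  have h2 : l * p.2 + l' * q.2 = t := by simpa using congrArg Prod.snd heq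
  have hpqeq : u * p.1 + v * p.2 = u * q.1 + v * q.2 := le_antisymm (hp' q hq) (hq' p hp)
  have hval : u * p.1 + v * p.2 = t * (u + v) := by
    have : l * (u * p.1 + v * p.2) + l' * (u * q.1 + v * q.2) = t * (u + v) := by
      rw [mul_add t]; nth_rewrite 1 [← h1]; rw [← h2]; ring
    rw [← hpqeq, ← add_mul, hll, one_mul] at this
    exact this
  have htN : ((t, t) : ℝ × ℝ) ∈ newtonPolygon S := by
    rw [← heq]
    exact convex_newtonPolygon hp hq hl.le hl'.le hll
  have htd : t = newtonDist S := by
    refine le_antisymm (le_csInf ⟨t, htN⟩ fun τ hτ => ?_) (newtonDist_le htN)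
    have := hp' _ hτ
    rw [hval] at this
    simp only at this
    exact le_of_mul_le_mul_right (by linarith) huv
  rw [htd] at h1 h2 hval htN
  exact ⟨htN, fun t' ht' => hval ▸ hp' t' ht', p, hp, q, hq, hpq, hval, hpqeq ▸ hval, l, l', hl, hl',
    hll, h1, h2⟩

theorem eq_of_convex_combination {l l' x y c : ℝ} (hl : 0 < l) (hl' : 0 < l') (hll : l + l' = 1)
    (hx : c ≤ x) (hy : c ≤ y) (h : l * x + l' * y = c) : x = c ∧ y = c := by
  have hc : c = l * c + l' * c := by rw [← add_mul, hll, one_mul]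
  have h1 := mul_le_mul_of_nonneg_left hx hl.le
  have h2 := mul_le_mul_of_nonneg_left hy hl'.le
  exact ⟨mul_left_cancel₀ hl.ne' (by linarith), mul_left_cancel₀ hl'.ne' (by linarith)⟩

/-- A segment with (d, d) in its interior lies on every supporting line through (d, d), and lines of
different slopes share only one point. -/
theorem IsCompactEdge.slope_eq {m m₀ : ℝ} {e : Set (ℝ × ℝ)} (he : IsCompactEdge S m e)
    (hb : BisectrixMeetsInterior e) (hm₀ : 0 < m₀)
    (hmin : ∀ a b : ℕ, taylorCoeff S a b ≠ 0 → newtonDist S * (1 + m₀) ≤ a + m₀ * b) :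
    m = m₀ := by
  obtain ⟨hm, rfl, -⟩ := he
  obtain ⟨-, -, p, hp, q, hq, hpq, h1, h2, l, l', hl, hl', hll, e1, e2⟩ :=
    exists_of_bisectrixMeetsInterior (by positivity) hb
  have hle : ∀ t ∈ newtonPolygon S, newtonDist S * (1 + m₀) ≤ t.1 + m₀ * t.2 := fun t ht => by
    simpa using le_of_mem_newtonPolygon zero_le_one hm₀.le
      (fun a b hab => by rw [one_mul]; exact hmin a b hab) ht
  obtain ⟨h3, h4⟩ := eq_of_convex_combination hl hl' hll (hle p hp) (hle q hq) (by
    linear_combination e1 + m₀ * e2)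
  by_contra hne
  have h5 : p.2 = newtonDist S := by
    have : (m - m₀) * (p.2 - newtonDist S) = 0 := by linear_combination h1 - h3
    have := (mul_eq_zero.1 this).resolve_left (sub_ne_zero.2 hne)
    linarith
  have h6 : q.2 = newtonDist S := by
    have : (m - m₀) * (q.2 - newtonDist S) = 0 := by linear_combination h2 - h4
    have := (mul_eq_zero.1 this).resolve_left (sub_ne_zero.2 hne)
    linarith
  refine hpq (Prod.ext ?_ (h5.trans h6.symm))
  rw [h5] at h3
  rw [h6] at h4
  linarith

/-- The edge would lie on the supporting line of κ, and the only exponent on that line is (n, n). -/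
theorem not_bisectrixMeetsInterior_of_vertex {n : ℕ} (hn : (n : ℝ) = newtonDist S) {κ : ℝ} (hκ : 0 < κ)
    (hmin : ∀ a b : ℕ, taylorCoeff S a b ≠ 0 → (a, b) ≠ (n, n) → (n : ℝ) * (1 + κ) < a + κ * b)
    {m : ℝ} {e : Set (ℝ × ℝ)} (he : IsCompactEdge S m e) : ¬ BisectrixMeetsInterior e := by
  intro hb
  have hmin' : ∀ a b : ℕ, taylorCoeff S a b ≠ 0 → newtonDist S * (1 + κ) ≤ a + κ * b := by
    intro a b hab
    rw [← hn]
    by_cases h : (a, b) = (n, n)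
    · rw [(Prod.mk.inj h).1, (Prod.mk.inj h).2]; linarith
    · exact (hmin a b hab h).le
  have hmκ := he.slope_eq hb hκ hmin'
  obtain ⟨hm, rfl, -⟩ := he
  rw [hmκ] at hb
  obtain ⟨-, -, p, hp, q, hq, hpq, h1, h2, l, l', hl, hl', hll, e1, e2⟩ :=
    exists_of_bisectrixMeetsInterior (by positivity) hb
  rw [one_mul] at h1 h2
  have hβ : ∀ a b : ℕ, taylorCoeff S a b ≠ 0 → (a : ℝ) + κ * b = newtonDist S * (1 + κ) →
      newtonDist S ≤ b := by
    intro a b hab h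
    by_cases h' : (a, b) = (n, n)
    · rw [(Prod.mk.inj h').2, hn]
    · have := hmin a b hab h'
      rw [hn] at this
      linarith
  obtain ⟨h3, h4⟩ := eq_of_convex_combination hl hl' hll (le_snd_of_mem_line hκ hmin' hβ hp h1)
    (le_snd_of_mem_line hκ hmin' hβ hq h2) e2
  refine hpq (Prod.ext ?_ (h3.trans h4.symm))
  rw [h3] at h1
  rw [h4] at h2
  linarith

theorem not_bisectrixMeetsInterior_of_le_snd
    (hle : ∀ a b : ℕ, taylorCoeff S a b ≠ 0 → newtonDist S ≤ b)
    {m : ℝ} {e : Set (ℝ × ℝ)} (he : IsCompactEdge S m e) : ¬ BisectrixMeetsInterior e := by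
  intro hb
  obtain ⟨hm, rfl, -⟩ := he
  obtain ⟨-, -, p, hp, q, hq, hpq, h1, h2, l, l', hl, hl', hll, e1, e2⟩ :=
    exists_of_bisectrixMeetsInterior (by positivity) hb
  have hle' : ∀ t ∈ newtonPolygon S, newtonDist S ≤ t.2 := fun t ht => by
    simpa using le_of_mem_newtonPolygon (u := 0) (v := 1) le_rfl zero_le_one
      (fun a b hab => by simpa using hle a b hab) ht
  obtain ⟨h3, h4⟩ := eq_of_convex_combination hl hl' hll (hle' p hp) (hle' q hq) e2
  refine hpq (Prod.ext ?_ (h3.trans h4.symm))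
  rw [h3] at h1
  rw [h4] at h2
  linarith

theorem not_bisectrixMeetsInterior_of_le_fst
    (hle : ∀ a b : ℕ, taylorCoeff S a b ≠ 0 → newtonDist S ≤ a)
    {m : ℝ} {e : Set (ℝ × ℝ)} (he : IsCompactEdge S m e) : ¬ BisectrixMeetsInterior e := by
  intro hb
  obtain ⟨hm, rfl, -⟩ := he
  obtain ⟨-, -, p, hp, q, hq, hpq, h1, h2, l, l', hl, hl', hll, e1, e2⟩ :=
    exists_of_bisectrixMeetsInterior (by positivity) hb
  have hle' : ∀ t ∈ newtonPolygon S, newtonDist S ≤ t.1 := fun t ht => by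
    simpa using le_of_mem_newtonPolygon (u := 1) (v := 0) zero_le_one le_rfl
      (fun a b hab => by simpa using hle a b hab) ht
  obtain ⟨h3, h4⟩ := eq_of_convex_combination hl hl' hll (hle' p hp) (hle' q hq) e1
  refine hpq (Prod.ext (h3.trans h4.symm) ?_)
  rw [h3] at h1
  rw [h4] at h2
  exact mul_left_cancel₀ hm.ne' (by linarith)

theorem mem_openSegment_of_edge {m : ℝ} {A B A' B' : ℕ} (hm : 0 < m)
    (hB : (B : ℝ) < newtonDist S) (hline : (A : ℝ) + m * B = newtonDist S * (1 + m))
    (hA' : (A' : ℝ) < newtonDist S)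
    (hline' : (A' : ℝ) + m * B' = newtonDist S * (1 + m)) :
    ((newtonDist S, newtonDist S) : ℝ × ℝ) ∈
      openSegment ℝ ((A : ℝ), (B : ℝ)) ((A' : ℝ), (B' : ℝ)) := by
  set d := newtonDist S
  have h1 : 0 < (A : ℝ) - d := by
    have : (A : ℝ) - d = m * (d - B) := by linear_combination hline
    rw [this]; exact mul_pos hm (by linarith)
  have hT : 0 < (A : ℝ) - A' := by linarith
  refine ⟨(d - A') / (A - A'), (A - d) / (A - A'), div_pos (by linarith) hT, div_pos h1 hT, ?_, ?_⟩
  · rw [← add_div, div_eq_one_iff_eq hT.ne']; ring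
  · ext
    · simp only [Prod.fst_add, Prod.smul_fst, smul_eq_mul]
      field_simp
      ring
    · simp only [Prod.snd_add, Prod.smul_snd, smul_eq_mul]
      have e1 : m * (B : ℝ) = d * (1 + m) - A := by linarith
      have e2 : m * (B' : ℝ) = d * (1 + m) - A' := by linarith
      refine mul_left_cancel₀ hm.ne' ?_
      calc m * ((d - A') / (A - A') * B + (A - d) / (A - A') * B')
          = ((d - A') * (m * B) + (A - d) * (m * B')) / (A - A') := by ring
        _ = m * d := by
          rw [e1, e2, div_eq_iff hT.ne']; ring

theorem not_extreme_of_edge {m : ℝ} {A B A' B' : ℕ} (hm : 0 < m) (hAB : taylorCoeff S A B ≠ 0)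
    (hB : (B : ℝ) < newtonDist S) (hline : (A : ℝ) + m * B = newtonDist S * (1 + m))
    (hAB' : taylorCoeff S A' B' ≠ 0) (hA' : (A' : ℝ) < newtonDist S)
    (hline' : (A' : ℝ) + m * B' = newtonDist S * (1 + m)) :
    ((newtonDist S, newtonDist S) : ℝ × ℝ) ∉ (newtonPolygon S).extremePoints ℝ := by
  intro h
  have := (mem_extremePoints.1 h).2 _ (mem_newtonPolygon hAB) _ (mem_newtonPolygon hAB')
    (mem_openSegment_of_edge hm hB hline hA' hline')
  have h1 := congrArg Prod.snd this.1
  simp only at h1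
  linarith

theorem not_extreme_of_horizontal {n A : ℕ} (hn : (n : ℝ) = newtonDist S) (hA : A < n)
    (hAn : taylorCoeff S A n ≠ 0) :
    ((newtonDist S, newtonDist S) : ℝ × ℝ) ∉ (newtonPolygon S).extremePoints ℝ := by
  intro h
  have hA' : (A : ℝ) < n := by exact_mod_cast hA
  rw [← hn] at h
  have hq : ((2 * n - A : ℝ), (n : ℝ)) ∈ newtonPolygon S :=
    mem_newtonPolygon_of_le hAn (by simp only; linarith) le_rfl
  have := (mem_extremePoints.1 h).2 _ (mem_newtonPolygon hAn) _ hq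
    ⟨1 / 2, 1 / 2, by norm_num, by norm_num, by norm_num, by
      ext <;> simp only [Prod.fst_add, Prod.smul_fst, Prod.snd_add, Prod.smul_snd, smul_eq_mul] <;> ring⟩
  have h1 := congrArg Prod.fst this.1
  simp only at h1
  linarith

theorem not_extreme_of_vertical {n B : ℕ} (hn : (n : ℝ) = newtonDist S) (hB : B < n)
    (hnB : taylorCoeff S n B ≠ 0) :
    ((newtonDist S, newtonDist S) : ℝ × ℝ) ∉ (newtonPolygon S).extremePoints ℝ := by
  intro h
  have hB' : (B : ℝ) < n := by exact_mod_cast hB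
  rw [← hn] at h
  have hq : ((n : ℝ), (2 * n - B : ℝ)) ∈ newtonPolygon S :=
    mem_newtonPolygon_of_le hnB le_rfl (by simp only; linarith)
  have := (mem_extremePoints.1 h).2 _ (mem_newtonPolygon hnB) _ hq
    ⟨1 / 2, 1 / 2, by norm_num, by norm_num, by norm_num, by
      ext <;> simp only [Prod.fst_add, Prod.smul_fst, Prod.snd_add, Prod.smul_snd, smul_eq_mul] <;> ring⟩
  have h1 := congrArg Prod.snd this.1
  simp only at h1
  linarith

/-- The interior condition forces a point of the ray strictly to the left of (d, d): otherwise both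
ends of the segment would coincide with (d, d). -/
theorem le_snd_of_horizontalRay (h : BisectrixMeetsInterior (horizontalRay S)) :
    (∀ a b : ℕ, taylorCoeff S a b ≠ 0 → newtonDist S ≤ b) ∧
    ∃ t ∈ newtonPolygon S, t.1 < newtonDist S ∧ t.2 = newtonDist S := by
  obtain ⟨-, hle, p, hp, q, hq, hpq, h1, h2, l, l', hl, hl', hll, e1, e2⟩ :=
    exists_of_bisectrixMeetsInterior (by norm_num) h
  simp only [zero_mul, zero_add, one_mul, mul_one] at h1 h2 hle
  refine ⟨fun a b hab => hle _ (mem_newtonPolygon hab), ?_⟩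
  by_contra! hne
  have hp1 : newtonDist S ≤ p.1 := by
    by_contra! h; exact hne p hp h h1
  have hq1 : newtonDist S ≤ q.1 := by
    by_contra! h; exact hne q hq h h2
  obtain ⟨h3, h4⟩ := eq_of_convex_combination hl hl' hll hp1 hq1 e1
  exact hpq (Prod.ext (h3.trans h4.symm) (h1.trans h2.symm))

theorem le_fst_of_verticalRay (h : BisectrixMeetsInterior (verticalRay S)) :
    (∀ a b : ℕ, taylorCoeff S a b ≠ 0 → newtonDist S ≤ a) ∧
    ∃ t ∈ newtonPolygon S, t.2 < newtonDist S ∧ t.1 = newtonDist S := by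
  obtain ⟨-, hle, p, hp, q, hq, hpq, h1, h2, l, l', hl, hl', hll, e1, e2⟩ :=
    exists_of_bisectrixMeetsInterior (by norm_num) h
  simp only [zero_mul, add_zero, one_mul, mul_one] at h1 h2 hle
  refine ⟨fun a b hab => hle _ (mem_newtonPolygon hab), ?_⟩
  by_contra! hne
  have hp1 : newtonDist S ≤ p.2 := by
    by_contra! h; exact hne p hp h h1
  have hq1 : newtonDist S ≤ q.2 := by
    by_contra! h; exact hne q hq h h2
  obtain ⟨h3, h4⟩ := eq_of_convex_combination hl hl' hll hp1 hq1 e2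
  exact hpq (Prod.ext (h1.trans h2.symm) (h3.trans h4.symm))

end Position

/-! ### The two edges at a vertex and their slopes -/

section VertexEdges

/-- Each parameter is tested on the exponent that realizes the other; this gives both inequalities
between m and m'. -/
theorem VertexSide.unique {s : ℕ → ℕ → ℝ} {n : ℕ} {κ T T' : ℝ} (h : VertexSide s n κ T)
    (h' : VertexSide s n κ T') : T = T' := by
  rcases h with ⟨rfl, h⟩ | ⟨m, hm, rfl, ⟨A, B, hAB, hB, hl⟩, hmin⟩
  · rcases h' with ⟨rfl, h'⟩ | ⟨m', hm', rfl, ⟨A', B', hAB', hB', hl'⟩, hmin'⟩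
    · rfl
    · exact absurd (h A' B' hAB') (not_le.2 hB')
  · rcases h' with ⟨rfl, h'⟩ | ⟨m', hm', rfl, ⟨A', B', hAB', hB', hl'⟩, hmin'⟩
    · exact absurd (h' A B hAB) (not_le.2 hB)
    · have hBn : (0 : ℝ) < n - B := by
        have : (B : ℝ) < n := by exact_mod_cast hB
        linarith
      have hBn' : (0 : ℝ) < n - B' := by
        have : (B' : ℝ) < n := by exact_mod_cast hB'
        linarith
      have h1 := hmin A' B' hAB'
      have h2 := hmin' A B hAB
      have h3 : m' ≤ m := le_of_mul_le_mul_right (by linarith : m' * (n - B) ≤ m * (n - B)) hBn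
      have h4 : m ≤ m' := le_of_mul_le_mul_right (by linarith : m * (n - B') ≤ m' * (n - B')) hBn'
      rw [le_antisymm h3 h4]

variable {S : ℝ × ℝ → ℝ} {n : ℕ} {κ : ℝ}

/-- The edge of slope `s` at the vertex `(n, n)` lies to the right of the vertex. -/
def IsRightEdge (S : ℝ × ℝ → ℝ) (n : ℕ) (κ : ℝ) (s : EReal) : Prop :=
  ∃ T, VertexSide (taylorCoeff S) n κ T ∧
    ((s = 0 ∧ T = 0) ∨ ∃ m > κ, s = ((-1 / m : ℝ) : EReal) ∧ T = 1 / (1 + m))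

/-- The edge of slope `s` at the vertex `(n, n)` lies to the left of the vertex. -/
def IsLeftEdge (S : ℝ × ℝ → ℝ) (n : ℕ) (κ : ℝ) (s : EReal) : Prop :=
  ∃ T, VertexSide (fun a b => taylorCoeff S b a) n κ⁻¹ T ∧
    ((s = ⊥ ∧ T = 0) ∨ ∃ m > 0, m < κ ∧ s = ((-1 / m : ℝ) : EReal) ∧ T = 1 / (1 + m⁻¹))

theorem isRightEdge_or_isLeftEdge
    (hmin : ∀ a b : ℕ, taylorCoeff S a b ≠ 0 → (a, b) ≠ (n, n) → (n : ℝ) * (1 + κ) < a + κ * b)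
    {s : EReal} {e : Set (ℝ × ℝ)} (he : IsEdgeOfSlope S s e) (hmem : (((n : ℝ), (n : ℝ)) : ℝ × ℝ) ∈ e) :
    IsRightEdge S n κ s ∨ IsLeftEdge S n κ s := by
  rcases he with ⟨rfl, rfl⟩ | ⟨m, rfl, hm, rfl, hnt⟩ | ⟨rfl, rfl⟩
  · refine Or.inr ⟨0, Or.inl ⟨rfl, fun a b hab => ?_⟩, Or.inl ⟨rfl, rfl⟩⟩
    have := hmem.2 _ (mem_newtonPolygon hab)
    simp only [one_mul, zero_mul, add_zero] at this
    exact_mod_cast this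
  · have hminm : ∀ a b : ℕ, taylorCoeff S a b ≠ 0 → (n : ℝ) * (1 + m) ≤ a + m * b := fun a b hab => by
      have := hmem.2 _ (mem_newtonPolygon hab)
      simp only [one_mul] at this
      linarith
    obtain ⟨q, hq, hqn⟩ := hnt.exists_ne ((n : ℝ), (n : ℝ))
    have hqline : q.1 + m * q.2 = n * (1 + m) := by
      have h1 := hmem.2 _ hq.1
      have h2 := hq.2 _ hmem.1
      simp only [one_mul] at h1 h2
      linarith
    -- A second point of the edge decides the side: below height n the edge goes to the right, above
    -- it to the left. An exponent of the same kind exists on the line, and its position relative to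
    -- the line of κ compares m with κ.
    rcases lt_trichotomy q.2 n with h | h | h
    · left
      obtain ⟨A, B, hAB, hl, hB⟩ : ∃ A B : ℕ, taylorCoeff S A B ≠ 0 ∧ (A : ℝ) + m * B = n * (1 + m) ∧
          (B : ℝ) < n := by
        by_contra! hne
        exact absurd (le_snd_of_mem_line hm hminm hne hq.1 hqline) (not_le.2 h)
      have hκm : κ < m := by
        have := hmin A B hAB (fun h' => by
          rw [(Prod.mk.inj h').2] at hB; exact lt_irrefl _ hB)
        exact lt_of_mul_lt_mul_right (by linarith : κ * (n - B) < m * (n - B)) (by linarith)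
      exact ⟨1 / (1 + m), Or.inr ⟨m, hκm, rfl, ⟨A, B, hAB, by exact_mod_cast hB, hl⟩, hminm⟩,
        Or.inr ⟨m, hκm, rfl, rfl⟩⟩
    · exfalso
      refine hqn (Prod.ext ?_ h)
      rw [h] at hqline
      simp only
      linarith
    · right
      have hq1 : q.1 < n := by
        have : m * n < m * q.2 := mul_lt_mul_of_pos_left h hm
        linarith
      obtain ⟨A, B, hAB, hl, hA⟩ : ∃ A B : ℕ, taylorCoeff S A B ≠ 0 ∧ (A : ℝ) + m * B = n * (1 + m) ∧
          (A : ℝ) < n := by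
        by_contra! hne
        exact absurd (le_fst_of_mem_line hm hminm hne hq.1 hqline) (not_le.2 hq1)
      have hBn : (n : ℝ) < B := by
        have : m * n < m * B := by linarith
        exact lt_of_mul_lt_mul_left this hm.le
      have hmκ : m < κ := by
        have := hmin A B hAB (fun h' => by
          rw [(Prod.mk.inj h').2] at hBn; exact lt_irrefl _ hBn)
        exact lt_of_mul_lt_mul_right (by linarith : m * (B - n) < κ * (B - n)) (by linarith)
      have hscale : ∀ x y : ℝ, y + m⁻¹ * x = m⁻¹ * (x + m * y) := fun x y => by field_simp; ring
      refine ⟨1 / (1 + m⁻¹), Or.inr ⟨m⁻¹, ?_, rfl, ⟨B, A, hAB, by exact_mod_cast hA, ?_⟩, ?_⟩,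
        Or.inr ⟨m, hm, hmκ, rfl, rfl⟩⟩
      · exact inv_strictAnti₀ hm hmκ
      · rw [hscale, hl]; field_simp; ring
      · intro a b hab
        have h1 := mul_le_mul_of_nonneg_left (hminm b a hab) (inv_pos.2 hm).le
        rw [← hscale] at h1
        refine le_trans (le_of_eq ?_) h1
        field_simp; ring
  · refine Or.inl ⟨0, Or.inl ⟨rfl, fun a b hab => ?_⟩, Or.inl ⟨rfl, rfl⟩⟩
    have := hmem.2 _ (mem_newtonPolygon hab)
    simp only [one_mul, zero_mul, zero_add] at this
    exact_mod_cast this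

theorem IsRightEdge.unique (hκ : 0 < κ) {s s' : EReal} (h : IsRightEdge S n κ s)
    (h' : IsRightEdge S n κ s') : s = s' := by
  obtain ⟨T, hT, hs⟩ := h
  obtain ⟨T', hT', hs'⟩ := h'
  have hTT := hT.unique hT'
  subst hTT
  rcases hs with ⟨rfl, h0⟩ | ⟨m, hm, rfl, h0⟩
  · rcases hs' with ⟨rfl, h0'⟩ | ⟨m', hm', rfl, h0'⟩
    · rfl
    · have : 0 < 1 / (1 + m') := by
        have : 0 < m' := hκ.trans hm'
        positivity
      linarith
  · have hm0 : 0 < m := hκ.trans hm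
    rcases hs' with ⟨rfl, h0'⟩ | ⟨m', hm', rfl, h0'⟩
    · have : 0 < 1 / (1 + m) := by positivity
      linarith
    · have hm0' : 0 < m' := hκ.trans hm'
      rw [h0] at h0'
      have h1 : 1 + m ≠ 0 := by positivity
      have h2 : 1 + m' ≠ 0 := by positivity
      have : m = m' := by
        rw [div_eq_div_iff h1 h2] at h0'
        linarith
      rw [this]

theorem IsLeftEdge.unique {s s' : EReal} (h : IsLeftEdge S n κ s)
    (h' : IsLeftEdge S n κ s') : s = s' := by
  obtain ⟨T, hT, hs⟩ := h
  obtain ⟨T', hT', hs'⟩ := h'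
  have hTT := hT.unique hT'
  subst hTT
  rcases hs with ⟨rfl, h0⟩ | ⟨m, hm, -, rfl, h0⟩
  · rcases hs' with ⟨rfl, h0'⟩ | ⟨m', hm', -, rfl, h0'⟩
    · rfl
    · have : 0 < 1 / (1 + m'⁻¹) := by
        have : 0 < m'⁻¹ := inv_pos.2 hm'
        positivity
      linarith
  · have hm0 : 0 < m⁻¹ := inv_pos.2 hm
    rcases hs' with ⟨rfl, h0'⟩ | ⟨m', hm', -, rfl, h0'⟩
    · have : 0 < 1 / (1 + m⁻¹) := by positivity
      linarith
    · have hm0' : 0 < m'⁻¹ := inv_pos.2 hm'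
      rw [h0] at h0'
      have h1 : 1 + m⁻¹ ≠ 0 := by positivity
      have h2 : 1 + m'⁻¹ ≠ 0 := by positivity
      have : m⁻¹ = m'⁻¹ := by
        rw [div_eq_div_iff h1 h2] at h0'
        linarith
      rw [inv_injective this]

theorem IsRightEdge.lt (hκ : 0 < κ) {s : EReal} (h : IsRightEdge S n κ s) :
    ((-1 / κ : ℝ) : EReal) < s := by
  obtain ⟨T, hT, ⟨rfl, -⟩ | ⟨m, hm, rfl, -⟩⟩ := h
  · rw [EReal.coe_neg']
    exact div_neg_of_neg_of_pos (by norm_num) hκ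
  · rw [EReal.coe_lt_coe_iff, neg_div, neg_div, neg_lt_neg_iff]
    exact one_div_lt_one_div_of_lt hκ hm

theorem IsLeftEdge.lt {s : EReal} (h : IsLeftEdge S n κ s) :
    s < ((-1 / κ : ℝ) : EReal) := by
  obtain ⟨T, hT, ⟨rfl, -⟩ | ⟨m, hm, hmκ, rfl, -⟩⟩ := h
  · exact EReal.bot_lt_coe _
  · rw [EReal.coe_lt_coe_iff, neg_div, neg_div, neg_lt_neg_iff]
    exact one_div_lt_one_div_of_lt hm hmκ

theorem ereal_inv_sub_one (x : ℝ) : ((x : EReal) - 1)⁻¹ = ((x - 1)⁻¹ : ℝ) := by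
  rw [EReal.coe_inv, EReal.coe_sub, EReal.coe_one]

/-- The slopes of the two edges at a vertex. -/
theorem exists_vertexSides (hκ : 0 < κ)
    (hmin : ∀ a b : ℕ, taylorCoeff S a b ≠ 0 → (a, b) ≠ (n, n) → (n : ℝ) * (1 + κ) < a + κ * b)
    {s₁ s₂ : EReal} {e₁ e₂ : Set (ℝ × ℝ)} (h₁ : IsEdgeOfSlope S s₁ e₁) (h₂ : IsEdgeOfSlope S s₂ e₂)
    (hlt : s₂ < s₁) (hmem₁ : (((n : ℝ), (n : ℝ)) : ℝ × ℝ) ∈ e₁)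
    (hmem₂ : (((n : ℝ), (n : ℝ)) : ℝ × ℝ) ∈ e₂) :
    ∃ T T' : ℝ, VertexSide (taylorCoeff S) n κ T ∧ VertexSide (fun a b => taylorCoeff S b a) n κ⁻¹ T' ∧
      ((s₁ - 1)⁻¹ - (s₂ - 1)⁻¹).toReal = -(1 - T - T') := by
  -- Right edges have slope greater than -1 / κ, left edges less, and each side has only one; so s₂
  -- < s₁ identifies s₁ with the right edge and s₂ with the left one.
  rcases isRightEdge_or_isLeftEdge hmin h₁ hmem₁ with hr₁ | hl₁ <;>
    rcases isRightEdge_or_isLeftEdge hmin h₂ hmem₂ with hr₂ | hl₂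
  · exact absurd (hr₂.unique hκ hr₁) hlt.ne
  · obtain ⟨T, hT, hs⟩ := hr₁
    obtain ⟨T', hT', hs'⟩ := hl₂
    have e1 : (s₁ - 1)⁻¹ = ((-(1 - T) : ℝ) : EReal) := by
      rcases hs with ⟨rfl, rfl⟩ | ⟨m, hm, rfl, rfl⟩
      · rw [← EReal.coe_zero, ereal_inv_sub_one]; norm_num
      · have hm0 : 0 < m := hκ.trans hm
        rw [ereal_inv_sub_one, EReal.coe_eq_coe_iff]
        have h1 : 1 + m ≠ 0 := by positivity
        have h2 : -1 / m - 1 = -(1 + m) / m := by field_simp; ring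
        rw [h2]
        field_simp
        ring
    have e2 : (s₂ - 1)⁻¹ = ((-T' : ℝ) : EReal) := by
      rcases hs' with ⟨rfl, rfl⟩ | ⟨m, hm, hm', rfl, rfl⟩
      -- The vertical edge: the inverse of ⊥ is 0 in the extended reals, as the convention for s₂ =
      -- -∞ demands.
      · rw [EReal.bot_sub, EReal.inv_bot]; simp
      · rw [ereal_inv_sub_one, EReal.coe_eq_coe_iff]
        have h1 : 1 + m ≠ 0 := by positivity
        have h2 : -1 / m - 1 = -(1 + m) / m := by field_simp; ring
        have h3 : 1 + m⁻¹ = (1 + m) / m := by field_simp; ring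
        rw [h2, h3]
        field_simp
    refine ⟨T, T', hT, hT', ?_⟩
    rw [e1, e2, ← EReal.coe_sub, EReal.toReal_coe]
    ring
  · exact absurd (hlt.trans (hl₁.lt.trans (hr₂.lt hκ))) (lt_irrefl _)
  · exact absurd (hl₂.unique hl₁) hlt.ne

end VertexEdges

/-! ### Optimality of the exponent -/

/-- Zeros at which the derivative does not vanish are isolated. -/
theorem volume_zero_diff_zero_deriv {f g : ℝ → ℝ} (h : ∀ y, HasDerivAt f (g y) y) :
    volume {y | f y = 0 ∧ g y ≠ 0} = 0 := by
  refine measure_null_of_locally_null _ fun y hy => ⟨{y}, ?_, by simp⟩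
  have h1 := (h y).eventually_ne (c := 0) hy.2
  rw [eventually_nhdsWithin_iff] at h1
  filter_upwards [self_mem_nhdsWithin, nhdsWithin_le_nhds h1] with z hz hz'
  by_contra hne
  exact hz' hne hz.1

theorem volume_zero_diff_zero_dY {f : ℝ × ℝ → ℝ} (hf : ContDiff ℝ ∞ f) :
    volume {p | f p = 0 ∧ dY f p ≠ 0} = 0 := by
  have hm : MeasurableSet {p | f p = 0 ∧ dY f p ≠ 0} :=
    (measurableSet_eq_fun hf.continuous.measurable measurable_const).inter
      (measurableSet_eq_fun (contDiff_dY hf).continuous.measurable measurable_const).compl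
  rw [Measure.volume_eq_prod, Measure.measure_prod_null hm]
  exact Eventually.of_forall fun x => volume_zero_diff_zero_deriv (hasDerivAt_dY hf x)

theorem volume_zero_diff_zero_dX {f : ℝ × ℝ → ℝ} (hf : ContDiff ℝ ∞ f) :
    volume {p | f p = 0 ∧ dX f p ≠ 0} = 0 := by
  have hm : MeasurableSet {p | f p = 0 ∧ dX f p ≠ 0} :=
    (measurableSet_eq_fun hf.continuous.measurable measurable_const).inter
      (measurableSet_eq_fun (contDiff_dX hf).continuous.measurable measurable_const).compl
  rw [← measurePreserving_prod_swap.measure_preimage hm.nullMeasurableSet, Measure.volume_eq_prod,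
    Measure.measure_prod_null (measurable_swap hm)]
  exact Eventually.of_forall fun y => volume_zero_diff_zero_deriv fun x => hasDerivAt_dX hf x y

/-- The zeros of a smooth function near a point at which it does not vanish to infinite order form
a null set. -/
theorem exists_volume_zeros_eq_zero {S : ℝ × ℝ → ℝ} (hS : ContDiff ℝ ∞ S) {a b : ℕ}
    (h : taylorCoeff S a b ≠ 0) : ∃ W ∈ 𝓝 (0 : ℝ × ℝ), volume ({p | S p = 0} ∩ W) = 0 := by
  -- Up to a null set the zeros of f are zeros of its partial derivative g. Iteration reaches the
  -- derivative of order (a, b), which has no zeros near the origin.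
  have step : ∀ f g : ℝ × ℝ → ℝ, volume {p | f p = 0 ∧ g p ≠ 0} = 0 →
      (∃ W ∈ 𝓝 (0 : ℝ × ℝ), volume ({p | g p = 0} ∩ W) = 0) →
      ∃ W ∈ 𝓝 (0 : ℝ × ℝ), volume ({p | f p = 0} ∩ W) = 0 := by
    rintro f g h1 ⟨W, hW, h2⟩
    refine ⟨W, hW, measure_mono_null ?_ (measure_union_null h1 h2)⟩
    rintro p ⟨hp, hpW⟩
    by_cases hg : g p = 0
    · exact Or.inr ⟨hg, hpW⟩
    · exact Or.inl ⟨hp, hg⟩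
  have hX : ∀ k : ℕ, ∀ f : ℝ × ℝ → ℝ, ContDiff ℝ ∞ f →
      (∃ W ∈ 𝓝 (0 : ℝ × ℝ), volume ({p | (dX^[k] f) p = 0} ∩ W) = 0) →
      ∃ W ∈ 𝓝 (0 : ℝ × ℝ), volume ({p | f p = 0} ∩ W) = 0 := by
    intro k
    induction k with
    | zero => exact fun f _ h => h
    | succ k ih => exact fun f hf h => step f _ (volume_zero_diff_zero_dX hf) (ih _ (contDiff_dX hf) h)
  have hY : ∀ k : ℕ, ∀ f : ℝ × ℝ → ℝ, ContDiff ℝ ∞ f →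
      (∃ W ∈ 𝓝 (0 : ℝ × ℝ), volume ({p | (dY^[k] f) p = 0} ∩ W) = 0) →
      ∃ W ∈ 𝓝 (0 : ℝ × ℝ), volume ({p | f p = 0} ∩ W) = 0 := by
    intro k
    induction k with
    | zero => exact fun f _ h => h
    | succ k ih => exact fun f hf h => step f _ (volume_zero_diff_zero_dY hf) (ih _ (contDiff_dY hf) h)
  have hs := contDiff_iterate_dY hS b
  refine hY b S hS (hX a _ hs ?_)
  have h0 : (dX^[a] (dY^[b] S)) 0 ≠ 0 := fun h0 => h (by
    rw [taylorCoeff_eq hS, show ((0, 0) : ℝ × ℝ) = 0 from rfl, h0, zero_div])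
  refine ⟨{p | (dX^[a] (dY^[b] S)) p ≠ 0},
    (contDiff_iterate_dX hs a).continuous.continuousAt.eventually_ne h0, ?_⟩
  convert measure_empty (μ := (volume : Measure (ℝ × ℝ))) using 2
  ext p
  simp

/-- Every exponent has weight at least 1, so each Taylor monomial is at most ε on the box of sides
ε^u and ε^v; the order N makes the remainder O(ε) as well. -/
theorem exists_sublevel_box {S : ℝ × ℝ → ℝ} (hS : ContDiff ℝ ∞ S) {u v : ℝ} (hu : 0 < u) (hv : 0 < v)
    (hw : ∀ a b : ℕ, taylorCoeff S a b ≠ 0 → 1 ≤ u * a + v * b) :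
    ∃ C > 0, ∀ ε : ℝ, 0 < ε → ε ≤ 1 → ∀ x y : ℝ, |x| ≤ ε ^ u → |y| ≤ ε ^ v → |S (x, y)| < C * ε := by
  obtain ⟨N, hN⟩ := exists_nat_ge (max (1 / u) (1 / v))
  have hNu : 1 ≤ u * N := by
    have := (div_le_iff₀ hu).1 ((le_max_left _ _).trans hN); linarith
  have hNv : 1 ≤ v * N := by
    have := (div_le_iff₀ hv).1 ((le_max_right _ _).trans hN); linarith
  obtain ⟨C, hC0, hC⟩ := taylor_bound_box hS N
  set M := ∑ a ∈ Finset.range N, ∑ b ∈ Finset.range N, |taylorCoeff S a b| with hM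
  have hM0 : 0 ≤ M := Finset.sum_nonneg fun a _ => Finset.sum_nonneg fun b _ => abs_nonneg _
  refine ⟨C + M + 1, by positivity, fun ε hε hε1 x y hx hy => ?_⟩
  have hpow : ∀ w : ℝ, 1 ≤ w → ε ^ w ≤ ε := fun w hw => by
    simpa using Real.rpow_le_rpow_of_exponent_ge hε hε1 hw
  have hle1 : ∀ w : ℝ, 0 < w → ε ^ w ≤ 1 := fun w hw => Real.rpow_le_one hε.le hε1 hw.le
  have h1 := hC x y (hx.trans (hle1 u hu)) (hy.trans (hle1 v hv))
  have h2 : max |x| |y| ^ N ≤ ε := by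
    rcases max_choice |x| |y| with h | h <;> rw [h]
    · refine (pow_le_pow_left₀ (abs_nonneg _) hx N).trans ?_
      rw [← Real.rpow_natCast, ← Real.rpow_mul hε.le]
      exact hpow _ hNu
    · refine (pow_le_pow_left₀ (abs_nonneg _) hy N).trans ?_
      rw [← Real.rpow_natCast, ← Real.rpow_mul hε.le]
      exact hpow _ hNv
  have h3 : |∑ a ∈ Finset.range N, ∑ b ∈ Finset.range N, taylorCoeff S a b * x ^ a * y ^ b| ≤ M * ε := by
    rw [hM, Finset.sum_mul]
    refine (Finset.abs_sum_le_sum_abs _ _).trans (Finset.sum_le_sum fun a _ => ?_)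
    rw [Finset.sum_mul]
    refine (Finset.abs_sum_le_sum_abs _ _).trans (Finset.sum_le_sum fun b _ => ?_)
    by_cases h0 : taylorCoeff S a b = 0
    · simp [h0]
    · rw [abs_mul, abs_mul, mul_assoc, abs_pow, abs_pow]
      refine mul_le_mul_of_nonneg_left ?_ (abs_nonneg _)
      calc |x| ^ a * |y| ^ b ≤ (ε ^ u) ^ a * (ε ^ v) ^ b := by gcongr
        _ = ε ^ (u * a + v * b) := by
          rw [Real.rpow_add hε, Real.rpow_mul hε.le, Real.rpow_mul hε.le, Real.rpow_natCast,
            Real.rpow_natCast]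
        _ ≤ ε := hpow _ (hw a b h0)
  have h4 := abs_sub_abs_le_abs_sub (S (x, y))
    (∑ a ∈ Finset.range N, ∑ b ∈ Finset.range N, taylorCoeff S a b * x ^ a * y ^ b)
  have h5 : C * max |x| |y| ^ N ≤ C * ε := mul_le_mul_of_nonneg_left h2 hC0
  nlinarith

theorem measurableSet_preimage_Ioo {S : ℝ × ℝ → ℝ} (hS : Continuous S) (a b : ℝ) :
    MeasurableSet {p | a < S p ∧ S p < b} :=
  (measurableSet_lt measurable_const hS.measurable).inter (measurableSet_lt hS.measurable measurable_const)

/-- A pair of weights bounds the leading exponent from above. -/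
theorem not_isBigO_of_weights {S : ℝ × ℝ → ℝ} (hS : ContDiff ℝ ∞ S) {a₀ b₀ : ℕ}
    (hne : taylorCoeff S a₀ b₀ ≠ 0) {u v r : ℝ} (hu : 0 < u) (hv : 0 < v) (hr : u + v < r)
    (hw : ∀ a b : ℕ, taylorCoeff S a b ≠ 0 → 1 ≤ u * a + v * b) {U : Set (ℝ × ℝ)}
    (hU : U ∈ 𝓝 (0 : ℝ × ℝ)) :
    ∃ φ, IsTestFunction U φ ∧ ¬ (sublevelIntegral S φ =O[𝓝[>] 0] (fun ε : ℝ => ε ^ r) ∧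
      sublevelIntegral (-S) φ =O[𝓝[>] 0] (fun ε : ℝ => ε ^ r)) := by
  obtain ⟨W, hW, hWnull⟩ := exists_volume_zeros_eq_zero hS hne
  obtain ⟨C, hC, hbox⟩ := exists_sublevel_box hS hu hv hw
  obtain ⟨R, hR, hRU⟩ := Metric.nhds_basis_closedBall.mem_iff.1 (inter_mem hU hW)
  let φ : ContDiffBump (0 : ℝ × ℝ) := ⟨R / 2, R, by positivity, by linarith⟩
  have hcs : HasCompactSupport φ := φ.hasCompactSupport
  have hφi : Integrable (φ : ℝ × ℝ → ℝ) := φ.continuous.integrable_of_hasCompactSupport hcs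
  refine ⟨φ, ⟨φ.contDiff, hcs, ?_⟩, fun ⟨h1, h2⟩ => ?_⟩
  · rw [φ.tsupport_eq]; exact hRU.trans Set.inter_subset_left
  have h3 := (h1.add h2).comp_tendsto (k := fun ε : ℝ => C * ε) (l' := 𝓝[>] 0) (by
    refine tendsto_nhdsWithin_iff.2 ⟨?_, ?_⟩
    · exact ((continuous_const.mul continuous_id).tendsto' 0 0 (by simp)).mono_left nhdsWithin_le_nhds
    · filter_upwards [self_mem_nhdsWithin] with ε hε
      exact mul_pos hC hε)
  obtain ⟨D, hD⟩ := h3.bound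
  have hsmall : ∀ w : ℝ, 0 < w → ∀ᶠ ε : ℝ in 𝓝[>] 0, ε ^ w < R / 2 := fun w hw =>
    (tendsto_rpow_nhdsGT_zero hw).eventually_lt_const (by positivity)
  -- For small ε, φ = 1 on the box of area 4 ε^(u+v), where 0 < |S| < C ε up to a null set. As φ ≥
  -- 0, the two integrals together are at least this area; taking S and -S together avoids any
  -- discussion of signs.
  have hlow : ∀ᶠ ε : ℝ in 𝓝[>] 0, 4 * ε ^ (u + v) ≤ D * C ^ r * ε ^ r := by
    filter_upwards [hD, hsmall u hu, hsmall v hv, self_mem_nhdsWithin,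
      nhdsWithin_le_nhds (eventually_le_nhds (zero_lt_one' ℝ))] with ε hε hεu hεv hε0 hε1
    have hε0 : 0 < ε := hε0
    simp only [Function.comp_apply] at hε
    rw [Real.norm_of_nonneg (Real.rpow_nonneg (by positivity) r), Real.mul_rpow hC.le hε0.le,
      ← mul_assoc] at hε
    refine le_trans ?_ ((le_abs_self _).trans hε)
    set Bx : Set (ℝ × ℝ) := Set.Ioo (-ε ^ u) (ε ^ u) ×ˢ Set.Ioo (-ε ^ v) (ε ^ v) with hBx
    have hBm : MeasurableSet Bx := measurableSet_Ioo.prod measurableSet_Ioo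
    have hε2 : 0 ≤ ε ^ u := Real.rpow_nonneg hε0.le _
    have hε3 : 0 ≤ ε ^ v := Real.rpow_nonneg hε0.le _
    have hvol : volume.real Bx = 4 * ε ^ (u + v) := by
      rw [hBx, Measure.volume_eq_prod, measureReal_prod_prod, Real.volume_real_Ioo_of_le (by linarith),
        Real.volume_real_Ioo_of_le (by linarith), Real.rpow_add hε0]
      ring
    have hone : ∀ p ∈ Bx, φ p = 1 ∧ p ∈ W := by
      rintro ⟨x, y⟩ ⟨⟨hx1, hx2⟩, hy1, hy2⟩
      have hp : ((x, y) : ℝ × ℝ) ∈ Metric.closedBall 0 (R / 2) := by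
        rw [mem_closedBall_zero_iff, Prod.norm_def, max_le_iff]
        exact ⟨abs_le.2 ⟨by linarith, by linarith⟩, abs_le.2 ⟨by linarith, by linarith⟩⟩
      exact ⟨φ.one_of_mem_closedBall hp,
        (hRU (Metric.closedBall_subset_closedBall (by linarith) hp)).2⟩
    have hbS : ∀ p ∈ Bx, |S p| < C * ε := by
      rintro ⟨x, y⟩ ⟨⟨hx1, hx2⟩, hy1, hy2⟩
      exact hbox ε hε0 hε1 x y (abs_le.2 ⟨hx1.le, hx2.le⟩) (abs_le.2 ⟨hy1.le, hy2.le⟩)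
    have hm1 := measurableSet_preimage_Ioo hS.continuous 0 (C * ε)
    have hm2 := measurableSet_preimage_Ioo hS.neg.continuous 0 (C * ε)
    have hdisj : Disjoint {p | 0 < S p ∧ S p < C * ε} {p | 0 < -S p ∧ -S p < C * ε} :=
      Set.disjoint_left.2 fun p hp hp' => by
        have := hp.1; have := hp'.1; linarith
    have hsum : sublevelIntegral S φ (C * ε) + sublevelIntegral (-S) φ (C * ε) =
        ∫ p in {p | 0 < S p ∧ S p < C * ε} ∪ {p | 0 < -S p ∧ -S p < C * ε}, φ p :=
      (setIntegral_union hdisj hm2 hφi.integrableOn hφi.integrableOn).symm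
    rw [hsum, ← hvol, ← integral_indicator_one hBm, integral_indicator hBm]
    calc ∫ p in Bx, (1 : ℝ × ℝ → ℝ) p = ∫ p in Bx, φ p :=
          setIntegral_congr_fun hBm fun p hp => (hone p hp).1.symm
      _ = ∫ p in Bx \ ({p | S p = 0} ∩ W), φ p :=
          (setIntegral_congr_set (sdiff_null_ae_eq_self hWnull)).symm
      _ ≤ _ := by
          refine setIntegral_mono_set hφi.integrableOn (Eventually.of_forall fun p => φ.nonneg)
            (LE.le.eventuallyLE ?_)
          rintro p ⟨hp, hp'⟩
          have h4 := abs_lt.1 (hbS p hp)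
          rcases lt_trichotomy (S p) 0 with h5 | h5 | h5
          · exact Or.inr ⟨by linarith, by linarith⟩
          · exact absurd ⟨h5, (hone p hp).2⟩ hp'
          · exact Or.inl ⟨h5, h4.2⟩
  have hlim : Tendsto (fun ε : ℝ => D * C ^ r * ε ^ (r - (u + v))) (𝓝[>] 0) (𝓝 (D * C ^ r * 0)) :=
    (tendsto_rpow_nhdsGT_zero (by linarith)).const_mul _
  rw [mul_zero] at hlim
  obtain ⟨ε, hε1, hε2, hε0⟩ := ((hlow.and ((hlim.eventually_lt_const (zero_lt_one' ℝ)).and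
    self_mem_nhdsWithin)).exists)
  have hε0 : 0 < ε := hε0
  have h6 : 0 < ε ^ (u + v) := Real.rpow_pos_of_pos hε0 _
  have h7 : ε ^ r = ε ^ (r - (u + v)) * ε ^ (u + v) := by
    rw [← Real.rpow_add hε0]; congr 1; ring
  rw [h7] at hε1
  nlinarith

/-- On each side of a vertex there is an edge. -/
theorem exists_vertexSide {s : ℕ → ℕ → ℝ} {n : ℕ} {κ : ℝ}
    (hmin : ∀ a b : ℕ, s a b ≠ 0 → (a, b) ≠ (n, n) → (n : ℝ) * (1 + κ) < a + κ * b) :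
    ∃ T, VertexSide s n κ T := by
  classical
  by_cases hall : ∀ a b : ℕ, s a b ≠ 0 → n ≤ b
  · exact ⟨0, Or.inl ⟨rfl, hall⟩⟩
  push Not at hall
  obtain ⟨a₀, b₀, hab₀, hb₀⟩ := hall
  -- Only finitely many rows are below n, and in each only the leftmost exponent matters; m is the
  -- smallest of the ratios (a - n) / (n - b).
  let Q : Finset ℕ := (Finset.range n).filter fun b => ∃ a, s a b ≠ 0
  let A : ℕ → ℕ := fun b => if h : ∃ a, s a b ≠ 0 then Nat.find h else 0
  have hA : ∀ b, (∃ a, s a b ≠ 0) → s (A b) b ≠ 0 := fun b h => by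
    simp only [A, dif_pos h]; exact Nat.find_spec h
  have hA' : ∀ a b, s a b ≠ 0 → A b ≤ a := fun a b h => by
    simp only [A, dif_pos (⟨a, h⟩ : ∃ a, s a b ≠ 0)]; exact Nat.find_min' _ h
  obtain ⟨B, hB, hBmin⟩ := Q.exists_min_image (fun b => ((A b : ℝ) - n) / (n - b))
    ⟨b₀, by simp only [Q, Finset.mem_filter, Finset.mem_range]; exact ⟨hb₀, a₀, hab₀⟩⟩
  simp only [Q, Finset.mem_filter, Finset.mem_range] at hB hBmin
  have hpos : ∀ b : ℕ, b < n → (0 : ℝ) < n - b := fun b hb => sub_pos.2 (by exact_mod_cast hb)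
  have hs := hA B hB.2
  set m := ((A B : ℝ) - n) / (n - B) with hm
  have hline : (A B : ℝ) + m * B = n * (1 + m) := by
    have h1 : m * ((n : ℝ) - B) = A B - n := div_mul_cancel₀ _ (hpos B hB.1).ne'
    linarith
  have hκm : κ < m := by
    rw [hm, lt_div_iff₀ (hpos B hB.1)]
    have := hmin _ _ hs (by rintro h; rw [Prod.mk.injEq] at h; omega)
    linarith
  refine ⟨1 / (1 + m), Or.inr ⟨m, hκm, rfl, ⟨A B, B, hs, hB.1, hline⟩, fun a b hab => ?_⟩⟩
  by_cases heq : (a, b) = (n, n)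
  · rw [Prod.mk.injEq] at heq; rw [heq.1, heq.2]; linarith
  have h1 := hmin a b hab heq
  rcases lt_or_ge b n with hb | hb
  · have h2 := hBmin b ⟨hb, a, hab⟩
    rw [le_div_iff₀ (hpos b hb)] at h2
    have h3 : (A b : ℝ) ≤ a := by exact_mod_cast hA' a b hab
    linarith
  · have h2 : (n : ℝ) ≤ b := by exact_mod_cast hb
    nlinarith

/-! ### Asymptotics and leading exponent for globally smooth phases -/

section Negation

variable {S : ℝ × ℝ → ℝ}

theorem newtonPolygon_neg : newtonPolygon (-S) = newtonPolygon S := by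
  simp only [newtonPolygon, taylorCoeff_neg, neg_ne_zero]

theorem newtonDist_neg : newtonDist (-S) = newtonDist S := by
  simp only [newtonDist, newtonPolygon_neg]

theorem newtonFace_neg (u v : ℝ) : newtonFace (-S) u v = newtonFace S u v := by
  simp only [newtonFace, newtonPolygon_neg]

theorem edgeFun_neg (e : Set (ℝ × ℝ)) (x y : ℝ) : edgeFun (-S) e x y = -edgeFun S e x y := by
  simp only [edgeFun, ← tsum_neg]
  refine tsum_congr fun p => ?_
  simp only [edgeTerm, taylorCoeff_neg, neg_mul]
  exact congrFun (Set.indicator_neg _ _) p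

theorem IsSuperadapted.neg (h : IsSuperadapted S) : IsSuperadapted (-S) := by
  intro m e he hb σ hσ y hy k hk
  rw [newtonDist_neg]
  refine h m e ⟨he.1, by rw [he.2.1, newtonFace_neg], he.2.2⟩ hb σ hσ y hy k (hk.trans (le_of_eq ?_))
  rw [show (fun z => edgeFun (-S) e σ z) = -fun z => edgeFun S e σ z from
    funext fun z => edgeFun_neg e σ z]
  exact analyticOrderAt_neg

end Negation

section Swap

variable {S : ℝ × ℝ → ℝ}

theorem sublevelIntegral_comp_swap (S φ : ℝ × ℝ → ℝ) (ε : ℝ) :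
    sublevelIntegral (S ∘ Prod.swap) (φ ∘ Prod.swap) ε = sublevelIntegral S φ ε :=
  measurePreserving_prod_swap.setIntegral_preimage_emb
    MeasurableEquiv.prodComm.measurableEmbedding φ {p | 0 < S p ∧ S p < ε}

end Swap

section Global

variable {S : ℝ × ℝ → ℝ}

/-- The limit when the bisectrix meets the interior of a compact edge. -/
theorem tendsto_edgeCoeff (hS : ContDiff ℝ ∞ S) (hsuper : IsSuperadapted S) (hd : 1 < newtonDist S)
    {m : ℝ} {A B A' B' : ℕ} (hm : 0 < m)
    (hmin : ∀ a b : ℕ, taylorCoeff S a b ≠ 0 → newtonDist S * (1 + m) ≤ a + m * b)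
    (hAB : taylorCoeff S A B ≠ 0) (hB : (B : ℝ) < newtonDist S)
    (hline : (A : ℝ) + m * B = newtonDist S * (1 + m))
    (hAB' : taylorCoeff S A' B' ≠ 0) (hA' : (A' : ℝ) < newtonDist S)
    (hline' : (A' : ℝ) + m * B' = newtonDist S * (1 + m)) :
    Integrable (fun y : ℝ => posPow (newtonDist S) (edgeFun S (newtonFace S 1 m) 1 y)) ∧
    Integrable (fun y : ℝ => posPow (newtonDist S) (edgeFun S (newtonFace S 1 m) (-1) y)) ∧
    ∃ ρ > 0, ∀ φ, IsBoxFunction ρ φ →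
      Tendsto (fun ε : ℝ => sublevelIntegral S φ ε / ε ^ (1 / newtonDist S)) (𝓝[>] 0)
        (𝓝 (edgeCoeff S m (newtonFace S 1 m) φ)) := by
  set d := newtonDist S with hdef
  have hmem : (d, d) ∈ newtonPolygon S := convex_newtonPolygon.openSegment_subset
    (mem_newtonPolygon hAB) (mem_newtonPolygon hAB') (mem_openSegment_of_edge hm hB hline hA' hline')
  obtain ⟨F, hF⟩ := exists_face_finset (taylorCoeff S) hm (d * (1 + m))
  have hE : ∀ x y, edgeFun S (newtonFace S 1 m) x y = facePoly (taylorCoeff S) F (x, y) :=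
    edgeFun_eq_facePoly hF hm.le hmin ⟨(d, d), hmem, by ring⟩
  have hK0 : 0 < ⌈d⌉₊ := Nat.ceil_pos.2 (by linarith)
  have hKd : (⌈d⌉₊ : ℝ) - 1 < d := by linarith [Nat.ceil_lt_add_one (by linarith : 0 ≤ d)]
  -- With K = ⌈d⌉, `q` must be less than d, at least 1 and K - 1, and greater than B and A'. This is
  -- possible since all four numbers are less than d.
  set q := max (max 1 ((⌈d⌉₊ : ℝ) - 1)) ((max (B : ℝ) A' + d) / 2) with hq
  have hmax : max (B : ℝ) A' < d := max_lt hB hA'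
  have hq2 : (max (B : ℝ) A' + d) / 2 ≤ q := le_max_right _ _
  have hres := tendsto_sublevelIntegral_edge hS (q := q) hm hK0
    (fun σ hσ τ hτ => faceNondegenerate_of_isSuperadapted hS hsuper hm hmem hmin hK0 (Nat.le_ceil _) hσ hτ)
    (fun σ hσ τ hτ =>
      faceNondegenerate_swap_of_isSuperadapted hS hsuper hm hmem hmin hK0 (Nat.le_ceil _) hσ hτ)
    ((le_max_left _ _).trans (le_max_left _ _)) ((le_max_right _ _).trans (le_max_left _ _))
    (max_lt (max_lt hd hKd) (by linarith)) hAB (by linarith [le_max_left (B : ℝ) A']) hline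
    hAB' (by linarith [le_max_right (B : ℝ) A']) hline' hF hmin
  simp only [edgeCoeff, hE]
  exact hres

theorem tendsto_vertex (hS : ContDiff ℝ ∞ S) (hsuper : IsSuperadapted S) (hd : 1 < newtonDist S)
    {n : ℕ} (hn : (n : ℝ) = newtonDist S) (hnn : taylorCoeff S n n ≠ 0) {κ : ℝ} (hκ : 0 < κ)
    (hmin : ∀ a b : ℕ, taylorCoeff S a b ≠ 0 → (a, b) ≠ (n, n) → (n : ℝ) * (1 + κ) < a + κ * b) :
    ∃ ρ > 0, ∀ φ, IsBoxFunction ρ φ → ∀ T T' : ℝ, VertexSide (taylorCoeff S) n κ T →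
      VertexSide (fun a b => taylorCoeff S b a) n κ⁻¹ T' →
      Tendsto (fun ε : ℝ => sublevelIntegral S φ ε / (ε ^ (1 / (n : ℝ)) * Real.log ε)) (𝓝[>] 0)
        (𝓝 (-(φ (0, 0) * (etaFactor n (taylorCoeff S n n) * |taylorCoeff S n n| ^ (-1 / (n : ℝ))) *
          (1 / n * (1 - T - T'))))) := by
  have hn2 : 2 ≤ n := by
    rw [← hn] at hd
    exact_mod_cast hd
  have hmem : (newtonDist S, newtonDist S) ∈ newtonPolygon S := hn ▸ mem_newtonPolygon hnn
  have hmin' : ∀ a b : ℕ, taylorCoeff S a b ≠ 0 → newtonDist S * (1 + κ) ≤ a + κ * b := by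
    intro a b hab
    rw [← hn]
    by_cases h : (a, b) = (n, n)
    · rw [Prod.mk.injEq] at h; rw [h.1, h.2]; linarith
    · exact (hmin a b hab h).le
  exact tendsto_sublevelIntegral_vertex hS hκ hn2
    (fun σ hσ τ hτ => faceNondegenerate_of_isSuperadapted hS hsuper hκ hmem hmin' (by omega) hn.ge hσ hτ)
    (fun σ hσ τ hτ =>
      faceNondegenerate_swap_of_isSuperadapted hS hsuper hκ hmem hmin' (by omega) hn.ge hσ hτ) hnn hmin

theorem exists_isLowest_of_le_snd {n A : ℕ} (hle : ∀ a b : ℕ, taylorCoeff S a b ≠ 0 → n ≤ b) (hA : A < n)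
    (hAn : taylorCoeff S A n ≠ 0) : ∃ A₀ < n, IsLowest (taylorCoeff S) A₀ n := by
  obtain ⟨A₀, B₀, h⟩ := exists_isLowest ⟨A, n, hAn⟩
  have hB : B₀ = n := le_antisymm (h.snd_le hAn) (hle _ _ h.1)
  subst hB
  rcases h.2 A B₀ hAn with h1 | h1
  · exact absurd h1 (lt_irrefl _)
  · exact ⟨A₀, h1.2.trans_lt hA, h⟩

theorem isBigO_rpow_nhdsGT_zero {r s : ℝ} (h : r ≤ s) :
    (fun ε : ℝ => ε ^ s) =O[𝓝[>] 0] fun ε : ℝ => ε ^ r := by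
  refine IsBigO.of_bound 1 ?_
  filter_upwards [self_mem_nhdsWithin, nhdsWithin_le_nhds (eventually_le_nhds (zero_lt_one' ℝ))]
    with ε hε hε1
  have hε : 0 < ε := hε
  rw [Real.norm_of_nonneg (Real.rpow_nonneg hε.le _), Real.norm_of_nonneg (Real.rpow_nonneg hε.le _),
    one_mul]
  exact Real.rpow_le_rpow_of_exponent_ge hε hε1 h

theorem isBigO_rpow_mul_log {r s : ℝ} (h : r < s) :
    (fun ε : ℝ => ε ^ s * Real.log ε) =O[𝓝[>] 0] fun ε : ℝ => ε ^ r := by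
  have h1 := ((tendsto_log_mul_rpow_nhdsGT_zero (sub_pos.2 h)).isBigO_one ℝ).mul
    (isBigO_refl (fun ε : ℝ => ε ^ r) (𝓝[>] 0))
  simp only [one_mul] at h1
  refine h1.congr' ?_ EventuallyEq.rfl
  filter_upwards [self_mem_nhdsWithin] with ε hε
  rw [mul_assoc, ← Real.rpow_add hε, sub_add_cancel, mul_comm]

theorem isBigO_of_tendsto_div {F g : ℝ → ℝ} {L : ℝ} (hg : ∀ᶠ ε in 𝓝[>] (0 : ℝ), g ε ≠ 0)
    (h : Tendsto (fun ε => F ε / g ε) (𝓝[>] 0) (𝓝 L)) : F =O[𝓝[>] 0] g :=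
  isBigO_of_div_tendsto_nhds (hg.mono fun _ h h0 => absurd h0 h) L h

theorem eventually_rpow_ne_zero (r : ℝ) : ∀ᶠ ε in 𝓝[>] (0 : ℝ), ε ^ r ≠ 0 := by
  filter_upwards [self_mem_nhdsWithin] with ε hε
  exact (Real.rpow_pos_of_pos hε _).ne'

theorem eventually_log_ne_zero : ∀ᶠ ε in 𝓝[>] (0 : ℝ), Real.log ε ≠ 0 :=
  (Real.tendsto_log_nhdsGT_zero.eventually_lt_atBot 0).mono fun _ h => h.ne

/-- The upper bounds for all phases in superadapted coordinates. -/
theorem isBigO_sublevelIntegral (hS : ContDiff ℝ ∞ S) (hsuper : IsSuperadapted S)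
    (hd : 1 < newtonDist S) :
    ∃ ρ > 0, ∀ φ, IsBoxFunction ρ φ → ∀ r < 1 / newtonDist S,
      sublevelIntegral S φ =O[𝓝[>] 0] fun ε : ℝ => ε ^ r := by
  have hn2 : ∀ n : ℕ, (n : ℝ) = newtonDist S → 2 ≤ n := fun n hn => by
    rw [← hn] at hd
    exact_mod_cast hd
  rcases classification (by linarith : 0 < newtonDist S) with
    ⟨m, hm, hmin, ⟨A, B, hAB, hB, hline⟩, A', B', hAB', hA', hline'⟩ | ⟨n, hn, hnn, κ, hκ, hmin⟩ |
    ⟨n, hn, hle, A, hA, hAn⟩ | ⟨n, hn, hle, A, hA, hAn⟩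
  · obtain ⟨-, -, ρ, hρ, h⟩ := tendsto_edgeCoeff hS hsuper hd hm hmin hAB hB hline hAB' hA' hline'
    exact ⟨ρ, hρ, fun φ hφ r hr => (isBigO_of_tendsto_div (eventually_rpow_ne_zero _) (h φ hφ)).trans
      (isBigO_rpow_nhdsGT_zero hr.le)⟩
  · obtain ⟨ρ, hρ, h⟩ := tendsto_vertex hS hsuper hd hn hnn hκ hmin
    obtain ⟨T, hT⟩ := exists_vertexSide hmin
    obtain ⟨T', hT'⟩ := exists_vertexSide (s := fun a b => taylorCoeff S b a) (n := n) (κ := κ⁻¹)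
      (fun a b hab hne => by
        have h1 := hmin b a hab (fun h => hne (by rw [Prod.mk.injEq] at h ⊢; exact h.symm))
        have h2 : κ⁻¹ * (n * (1 + κ)) < κ⁻¹ * (b + κ * a) := by gcongr
        field_simp at h2 ⊢
        linarith)
    refine ⟨ρ, hρ, fun φ hφ r hr => (isBigO_of_tendsto_div ?_ (h φ hφ T T' hT hT')).trans
      (isBigO_rpow_mul_log (by rwa [hn]))⟩
    filter_upwards [eventually_rpow_ne_zero _, eventually_log_ne_zero] with ε h1 h2
    exact mul_ne_zero h1 h2
  · obtain ⟨A₀, hA₀, hlow⟩ := exists_isLowest_of_le_snd hle hA hAn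
    obtain ⟨ρ, hρ, h⟩ := isBigO_sublevelIntegral_ray hS hlow hA₀ (hn2 n hn)
    exact ⟨ρ, hρ, fun φ hφ r hr => (h φ hφ).trans (isBigO_rpow_nhdsGT_zero (by rw [hn]; exact hr.le))⟩
  · have hsw := taylorCoeff_comp_swap hS
    obtain ⟨A₀, hA₀, hlow⟩ := exists_isLowest_of_le_snd (S := S ∘ Prod.swap) (n := n) (A := A)
      (fun a b hab => hle b a (by rwa [hsw] at hab)) hA (by rwa [hsw])
    obtain ⟨ρ, hρ, h⟩ := isBigO_sublevelIntegral_ray (contDiff_comp_swap hS) hlow hA₀ (hn2 n hn)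
    refine ⟨ρ, hρ, fun φ hφ r hr => IsBigO.trans ?_ (isBigO_rpow_nhdsGT_zero (s := 1 / (n : ℝ))
      (by rw [hn]; exact hr.le))⟩
    exact (h _ hφ.comp_swap).congr_left fun ε => sublevelIntegral_comp_swap S φ ε

/-- For an edge or a vertex, the weights of a supporting line through (d, d), normalized to the
value 1 there, have sum 1 / d. For a ray one of the weights would be 0; it is replaced by a positive
one, at the cost of half of r - 1 / d. -/
theorem exists_weights (hd : 1 < newtonDist S) {r : ℝ} (hr : 1 / newtonDist S < r) :
    ∃ u > 0, ∃ v > 0, u + v < r ∧ ∀ a b : ℕ, taylorCoeff S a b ≠ 0 → 1 ≤ u * a + v * b := by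
  have hd0 : 0 < newtonDist S := by linarith
  have key : ∀ m > 0, (∀ a b : ℕ, taylorCoeff S a b ≠ 0 → newtonDist S * (1 + m) ≤ a + m * b) →
      ∃ u > 0, ∃ v > 0, u + v < r ∧ ∀ a b : ℕ, taylorCoeff S a b ≠ 0 → 1 ≤ u * a + v * b := by
    intro m hm hmin
    refine ⟨1 / (newtonDist S * (1 + m)), by positivity, m / (newtonDist S * (1 + m)), by positivity, ?_,
      fun a b hab => ?_⟩
    · rw [← add_div]
      convert hr using 1
      field_simp
    · rw [div_mul_eq_mul_div, div_mul_eq_mul_div, ← add_div, le_div_iff₀ (by positivity), one_mul, one_mul]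
      exact hmin a b hab
  have hray : ∀ n : ℕ, (n : ℝ) = newtonDist S → ∀ k : ℕ, n ≤ k → 1 ≤ 1 / newtonDist S * k := by
    intro n hn k hk
    rw [one_div, ← div_eq_inv_mul, le_div_iff₀ hd0, one_mul, ← hn]
    exact_mod_cast hk
  rcases classification hd0 with ⟨m, hm, hmin, -⟩ | ⟨n, hn, hnn, κ, hκ, hmin⟩ |
    ⟨n, hn, hle, -⟩ | ⟨n, hn, hle, -⟩
  · exact key m hm hmin
  · refine key κ hκ fun a b hab => ?_
    rw [← hn]
    by_cases h : (a, b) = (n, n)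
    · rw [Prod.mk.injEq] at h; rw [h.1, h.2]; linarith
    · exact (hmin a b hab h).le
  · have hη : 0 < (r - 1 / newtonDist S) / 2 := by linarith
    refine ⟨_, hη, 1 / newtonDist S, by positivity, by linarith, fun a b hab => ?_⟩
    have := hray n hn b (hle a b hab)
    have : 0 ≤ (r - 1 / newtonDist S) / 2 * a := by positivity
    linarith
  · have hη : 0 < (r - 1 / newtonDist S) / 2 := by linarith
    refine ⟨1 / newtonDist S, by positivity, _, hη, by linarith, fun a b hab => ?_⟩
    have := hray n hn a (hle a b hab)
    have : 0 ≤ (r - 1 / newtonDist S) / 2 * b := by positivity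
    linarith

/-- The open box of radius `ρ` about the origin. -/
def box (ρ : ℝ) : Set (ℝ × ℝ) := {p | |p.1| < ρ ∧ |p.2| < ρ}

theorem isOpen_box (ρ : ℝ) : IsOpen (box ρ) :=
  (isOpen_lt continuous_fst.abs continuous_const).inter (isOpen_lt continuous_snd.abs continuous_const)

theorem zero_mem_box {ρ : ℝ} (hρ : 0 < ρ) : (0 : ℝ × ℝ) ∈ box ρ := by
  simp [box, hρ]

theorem IsTestFunction.isBoxFunction {ρ : ℝ} {φ : ℝ × ℝ → ℝ} (h : IsTestFunction (box ρ) φ) :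
    IsBoxFunction ρ φ where
  continuous := h.1.continuous
  bounded := by
    obtain ⟨C, hC⟩ := h.1.continuous.bounded_above_of_compact_support h.2.1
    exact ⟨C, (norm_nonneg _).trans (hC 0), hC⟩
  support := fun p hp => h.2.2 (subset_tsupport φ hp)

theorem IsTestFunction.mono {U W : Set (ℝ × ℝ)} {φ : ℝ × ℝ → ℝ} (h : IsTestFunction U φ) (hUW : U ⊆ W) :
    IsTestFunction W φ := ⟨h.1, h.2.1, h.2.2.trans hUW⟩

theorem box_mono {ρ ρ' : ℝ} (h : ρ ≤ ρ') : box ρ ⊆ box ρ' := fun _ hp =>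
  ⟨hp.1.trans_le h, hp.2.trans_le h⟩

/-- Smooth phases in superadapted coordinates have leading exponent `1 / d`. -/
theorem hasLeadingExponent (hS : ContDiff ℝ ∞ S) (hsuper : IsSuperadapted S) (hd : 1 < newtonDist S) :
    HasLeadingExponent S (1 / newtonDist S) := by
  obtain ⟨ρ₁, hρ₁, h₁⟩ := isBigO_sublevelIntegral hS hsuper hd
  obtain ⟨ρ₂, hρ₂, h₂⟩ := isBigO_sublevelIntegral (S := -S) hS.neg hsuper.neg (by rwa [newtonDist_neg])
  rw [newtonDist_neg] at h₂
  refine ⟨⟨box (min ρ₁ ρ₂), (isOpen_box _).mem_nhds (zero_mem_box (lt_min hρ₁ hρ₂)), fun φ hφ r hr =>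
    ⟨h₁ φ (hφ.mono (box_mono (min_le_left _ _))).isBoxFunction r hr,
      h₂ φ (hφ.mono (box_mono (min_le_right _ _))).isBoxFunction r hr⟩⟩, fun r hr U hU => ?_⟩
  obtain ⟨u, hu, v, hv, huv, hw⟩ := exists_weights hd hr
  obtain ⟨a, b, hab⟩ := exists_taylorCoeff_ne_zero (by linarith : 0 < newtonDist S)
  exact not_isBigO_of_weights hS hab hu hv huv hw hU

end Global

/-! ### Uniqueness of the leading terms of an expansion -/

section Expansions

variable {F : ℝ → ℝ} {r c c' : ℕ → ℝ} {L : ℝ}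

theorem HasLogExpansion.tendsto_sub (h : HasLogExpansion F r c c') :
    Tendsto (fun ε : ℝ => F ε / ε ^ r 0 - (c 0 + c' 0 * Real.log ε)) (𝓝[>] 0) (𝓝 0) := by
  refine (h 0).tendsto_div_nhds_zero.congr' ?_
  filter_upwards [eventually_rpow_ne_zero (r 0)] with ε hε
  simp only [zero_add, Finset.range_one, Finset.sum_singleton]
  field_simp

/-- A limit of `F ε / ε ^ r 0` determines the leading coefficients. -/
theorem HasLogExpansion.coeff_eq (h : HasLogExpansion F r c c')
    (hF : Tendsto (fun ε : ℝ => F ε / ε ^ r 0) (𝓝[>] 0) (𝓝 L)) : c' 0 = 0 ∧ c 0 = L := by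
  have h1 : Tendsto (fun ε : ℝ => c 0 + c' 0 * Real.log ε) (𝓝[>] 0) (𝓝 L) := by
    simpa using hF.sub h.tendsto_sub
  have h2 : Tendsto (fun ε : ℝ => (Real.log ε)⁻¹) (𝓝[>] 0) (𝓝 0) :=
    tendsto_inv_atBot_zero.comp Real.tendsto_log_nhdsGT_zero
  have h3 := (h1.sub_const (c 0)).mul h2
  rw [mul_zero] at h3
  have h4 : c' 0 = 0 := by
    refine tendsto_nhds_unique (tendsto_const_nhds.congr' ?_) h3
    filter_upwards [eventually_log_ne_zero] with ε hε
    field_simp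
    ring
  refine ⟨h4, ?_⟩
  simp only [h4, zero_mul, add_zero] at h1
  exact tendsto_nhds_unique tendsto_const_nhds h1

/-- A limit of `F ε / (ε ^ r 0 * log ε)` determines the leading logarithmic coefficient. -/
theorem HasLogExpansion.log_coeff_eq (h : HasLogExpansion F r c c')
    (hF : Tendsto (fun ε : ℝ => F ε / (ε ^ r 0 * Real.log ε)) (𝓝[>] 0) (𝓝 L)) : c' 0 = L := by
  have h2 : Tendsto (fun ε : ℝ => (Real.log ε)⁻¹) (𝓝[>] 0) (𝓝 0) :=
    tendsto_inv_atBot_zero.comp Real.tendsto_log_nhdsGT_zero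
  have h3 := (hF.sub (h.tendsto_sub.mul h2)).sub (h2.const_mul (c 0))
  rw [mul_zero, mul_zero, sub_zero, sub_zero] at h3
  refine tendsto_nhds_unique (tendsto_const_nhds.congr' ?_) h3
  filter_upwards [eventually_log_ne_zero, eventually_rpow_ne_zero (r 0)] with ε hε hε'
  field_simp
  ring

theorem HasLogExpansion.isBigO (h : HasLogExpansion F r c c') {s : ℝ} (hs : s < r 0) :
    F =O[𝓝[>] 0] fun ε : ℝ => ε ^ s := by
  have h1 := (h 0).isBigO.trans (isBigO_rpow_nhdsGT_zero hs.le)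
  have h2 := (((isBigO_rpow_nhdsGT_zero hs.le).const_mul_left (c 0)).add
    ((isBigO_rpow_mul_log hs).const_mul_left (c' 0))).add h1
  refine h2.congr_left fun ε => ?_
  simp only [zero_add, Finset.range_one, Finset.sum_singleton]
  ring

theorem HasLogExpansion.eq_zero_of_isBigO (h : HasLogExpansion F r c c') {s : ℝ} (hs : r 0 < s)
    (hF : F =O[𝓝[>] 0] fun ε : ℝ => ε ^ s) : c 0 = 0 ∧ c' 0 = 0 := by
  refine (h.coeff_eq (L := 0) (IsLittleO.tendsto_div_nhds_zero (hF.trans_isLittleO ?_))).symm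
  refine (isLittleO_iff_tendsto' ((eventually_rpow_ne_zero _).mono fun _ h h0 => absurd h0 h)).2 ?_
  refine (tendsto_rpow_nhdsGT_zero (sub_pos.2 hs)).congr' ?_
  filter_upwards [self_mem_nhdsWithin] with ε hε
  exact Real.rpow_sub hε _ _

/-- If r 0 < ρ, the upper bounds annihilate all leading coefficients for small supports, against the
normalization. If r 0 > ρ, the expansions themselves give bounds of an order between ρ and r 0 for
all test functions, against the optimality of ρ. -/
theorem HasLeadingExponent.eq_of_isSublevelExpansion {S : ℝ × ℝ → ℝ} {ρ : ℝ} (h : HasLeadingExponent S ρ)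
    {W : Set (ℝ × ℝ)} {r : ℕ → ℝ} {c c' C C' : (ℝ × ℝ → ℝ) → ℕ → ℝ}
    (hW : IsSublevelExpansion S W r c c' C C') : r 0 = ρ := by
  obtain ⟨⟨U, hU, hup⟩, hlow⟩ := h
  rcases lt_trichotomy (r 0) ρ with hlt | heq | hgt
  · exfalso
    obtain ⟨φ, hφ, hne⟩ := hW.leading (W ∩ U) (inter_mem hW.mem_nhds hU) Set.inter_subset_left
    obtain ⟨s, hs1, hs2⟩ := exists_between hlt
    obtain ⟨h1, h2⟩ := hup φ (hφ.mono Set.inter_subset_right) s hs2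
    obtain ⟨h3, h4⟩ := hW.expansion φ (hφ.mono Set.inter_subset_left)
    have h5 := h3.eq_zero_of_isBigO hs1 h1
    have h6 := h4.eq_zero_of_isBigO hs1 h2
    rcases hne with hne | hne | hne | hne
    · exact hne h5.1
    · exact hne h5.2
    · exact hne h6.1
    · exact hne h6.2
  · exact heq
  · exfalso
    obtain ⟨s, hs1, hs2⟩ := exists_between hgt
    obtain ⟨φ, hφ, hne⟩ := hlow s hs1 W hW.mem_nhds
    obtain ⟨h3, h4⟩ := hW.expansion φ hφ
    exact hne ⟨h3.isBigO hs2, h4.isBigO hs2⟩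

end Expansions

/-! ### Dependence on the phase near the origin only -/

section Localization

/-- A function that is smooth near the origin agrees near the origin with a smooth function. -/
theorem exists_contDiff_eqOn {S : ℝ × ℝ → ℝ} {V : Set (ℝ × ℝ)} (hV : V ∈ 𝓝 (0 : ℝ × ℝ))
    (hS : ContDiffOn ℝ ∞ S V) :
    ∃ T : ℝ × ℝ → ℝ, ContDiff ℝ ∞ T ∧ ∃ ρ > 0, ∀ p ∈ box ρ, S p = T p := by
  obtain ⟨R, hR, hRV⟩ := Metric.nhds_basis_closedBall.mem_iff.1 (interior_mem_nhds.2 hV)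
  let χ : ContDiffBump (0 : ℝ × ℝ) := ⟨R / 2, R, by positivity, by linarith⟩
  refine ⟨fun p => χ p * S p, contDiff_iff_contDiffAt.2 fun p => ?_, R / 2, by positivity, fun p hp => ?_⟩
  · by_cases hp : p ∈ tsupport χ
    · rw [χ.tsupport_eq] at hp
      exact χ.contDiffAt.mul (hS.contDiffAt (mem_interior_iff_mem_nhds.1 (hRV hp)))
    · have h0 : (fun p => χ p * S p) =ᶠ[𝓝 p] fun _ => 0 := by
        filter_upwards [(isClosed_tsupport χ).isOpen_compl.mem_nhds hp] with z hz
        rw [image_eq_zero_of_notMem_tsupport hz, zero_mul]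
      exact contDiffAt_const.congr_of_eventuallyEq h0
  · have : p ∈ Metric.closedBall (0 : ℝ × ℝ) (R / 2) := by
      rw [mem_closedBall_zero_iff, Prod.norm_def]
      exact max_le hp.1.le hp.2.le
    simp [χ.one_of_mem_closedBall this]

theorem sublevelIntegral_congr {S T φ : ℝ × ℝ → ℝ} {ρ : ℝ} (h : ∀ p ∈ box ρ, S p = T p)
    (hφ : IsBoxFunction ρ φ) : sublevelIntegral S φ = sublevelIntegral T φ := by
  funext ε
  have hsub : ∀ R : ℝ × ℝ → ℝ, sublevelIntegral R φ ε =
      ∫ p in box ρ ∩ {p | 0 < R p ∧ R p < ε}, φ p := fun R => by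
    rw [sublevelIntegral, Set.inter_comm, ← setIntegral_indicator (isOpen_box ρ).measurableSet,
      Set.indicator_eq_self.2 (show Function.support φ ⊆ box ρ from fun p hp => hφ.support p hp)]
  rw [hsub S, hsub T]
  congr 2
  ext p
  constructor
  · rintro ⟨hp, hp'⟩
    exact ⟨hp, by rwa [Set.mem_ofPred_eq, ← h p hp]⟩
  · rintro ⟨hp, hp'⟩
    exact ⟨hp, by rwa [Set.mem_ofPred_eq, h p hp]⟩

theorem taylorCoeff_eq_of_eqOn_box {S T : ℝ × ℝ → ℝ} {ρ : ℝ} (hρ : 0 < ρ)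
    (h : ∀ p ∈ box ρ, S p = T p) : taylorCoeff S = taylorCoeff T := by
  have h1 : S =ᶠ[𝓝 0] T := by
    filter_upwards [(isOpen_box ρ).mem_nhds (zero_mem_box hρ)] with p hp
    exact h p hp
  funext a b
  exact taylorCoeff_congr h1 a b

variable {S T : ℝ × ℝ → ℝ}

/-- All Newton data are functions of the Taylor coefficients, so passing to a globally smooth phase
with the same germ changes none of them. -/
theorem newtonPolygon_congr (h : taylorCoeff S = taylorCoeff T) : newtonPolygon S = newtonPolygon T := by
  simp only [newtonPolygon, h]

theorem newtonDist_congr (h : taylorCoeff S = taylorCoeff T) : newtonDist S = newtonDist T := by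
  simp only [newtonDist, newtonPolygon_congr h]

theorem newtonFace_congr (h : taylorCoeff S = taylorCoeff T) : newtonFace S = newtonFace T := by
  funext u v
  simp only [newtonFace, newtonPolygon_congr h]

theorem edgeTerm_congr (h : taylorCoeff S = taylorCoeff T) : edgeTerm S = edgeTerm T := by
  funext e x y
  simp only [edgeTerm, h]

theorem edgeFun_congr (h : taylorCoeff S = taylorCoeff T) : edgeFun S = edgeFun T := by
  funext e x y
  simp only [edgeFun, edgeTerm_congr h]

theorem isCompactEdge_congr (h : taylorCoeff S = taylorCoeff T) : IsCompactEdge S = IsCompactEdge T := by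
  funext m e
  simp only [IsCompactEdge, newtonFace_congr h]

theorem horizontalRay_congr (h : taylorCoeff S = taylorCoeff T) : horizontalRay S = horizontalRay T := by
  simp only [horizontalRay, newtonFace_congr h]

theorem verticalRay_congr (h : taylorCoeff S = taylorCoeff T) : verticalRay S = verticalRay T := by
  simp only [verticalRay, newtonFace_congr h]

theorem isEdgeOfSlope_congr (h : taylorCoeff S = taylorCoeff T) : IsEdgeOfSlope S = IsEdgeOfSlope T := by
  funext s e
  simp only [IsEdgeOfSlope, isCompactEdge_congr h, horizontalRay_congr h, verticalRay_congr h]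

theorem isSuperadapted_congr (h : taylorCoeff S = taylorCoeff T) : IsSuperadapted S = IsSuperadapted T := by
  simp only [IsSuperadapted, isCompactEdge_congr h, edgeFun_congr h, newtonDist_congr h]

theorem edgeCoeff_congr (h : taylorCoeff S = taylorCoeff T) : edgeCoeff S = edgeCoeff T := by
  funext m e φ
  simp only [edgeCoeff, edgeFun_congr h, newtonDist_congr h]

theorem vertexCoeff_congr (h : taylorCoeff S = taylorCoeff T) : vertexCoeff S = vertexCoeff T := by
  funext n s₁ s₂ φ
  simp only [vertexCoeff, h]

theorem hasLeadingExponent_congr {ρ : ℝ} (hρ : 0 < ρ) (h : ∀ p ∈ box ρ, S p = T p) {r : ℝ}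
    (hT : HasLeadingExponent T r) : HasLeadingExponent S r := by
  have hneg : ∀ p ∈ box ρ, (-S) p = (-T) p := fun p hp => by simp [h p hp]
  have hbox : box ρ ∈ 𝓝 (0 : ℝ × ℝ) := (isOpen_box ρ).mem_nhds (zero_mem_box hρ)
  obtain ⟨⟨U, hU, h1⟩, h2⟩ := hT
  refine ⟨⟨U ∩ box ρ, inter_mem hU hbox, fun φ hφ s hs => ?_⟩, fun s hs U hU => ?_⟩
  · have hφ' := (hφ.mono Set.inter_subset_right).isBoxFunction
    rw [sublevelIntegral_congr h hφ', sublevelIntegral_congr hneg hφ']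
    exact h1 φ (hφ.mono Set.inter_subset_left) s hs
  · obtain ⟨φ, hφ, hne⟩ := h2 s hs (U ∩ box ρ) (inter_mem hU hbox)
    have hφ' := (hφ.mono Set.inter_subset_right).isBoxFunction
    refine ⟨φ, hφ.mono Set.inter_subset_left, ?_⟩
    rwa [sublevelIntegral_congr h hφ', sublevelIntegral_congr hneg hφ']

end Localization

/-! ### Real-analytic phases and the coefficient function on a ray -/

section Analytic

theorem eventually_hasSum_iteratedDeriv {g : ℝ → ℝ} (hg : AnalyticAt ℝ g 0) :
    ∀ᶠ x in 𝓝 (0 : ℝ), HasSum (fun k : ℕ => iteratedDeriv k g 0 / k.factorial * x ^ k) (g x) := by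
  filter_upwards [hg.hasFPowerSeriesAt.eventually_hasSum] with x hx
  simpa [FormalMultilinearSeries.ofScalars_apply_eq, mul_comm] using hx

theorem AnalyticAt.dY {f : ℝ × ℝ → ℝ} {p : ℝ × ℝ} (h : AnalyticAt ℝ f p) : AnalyticAt ℝ (dY f) p :=
  ((ContinuousLinearMap.apply ℝ ℝ ((0, 1) : ℝ × ℝ)).analyticAt _).comp h.fderiv

theorem AnalyticAt.iterate_dY {f : ℝ × ℝ → ℝ} {p : ℝ × ℝ} (h : AnalyticAt ℝ f p) (k : ℕ) :
    AnalyticAt ℝ (_root_.dY^[k] f) p := by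
  induction k with
  | zero => exact h
  | succ k ih => rw [Function.iterate_succ_apply']; exact ih.dY

theorem AnalyticAt.comp_axis {f : ℝ × ℝ → ℝ} {x : ℝ} (h : AnalyticAt ℝ f (x, 0)) :
    AnalyticAt ℝ (fun x => f (x, 0)) x :=
  h.comp (f := fun x : ℝ => ((x, 0) : ℝ × ℝ)) (analyticAt_id.prod analyticAt_const)

variable {S : ℝ × ℝ → ℝ}

theorem eventually_hasSum_taylorCoeff (hS : ContDiff ℝ ∞ S) (ha : AnalyticAt ℝ S 0) (b : ℕ) :
    ∀ᶠ x in 𝓝 (0 : ℝ), HasSum (fun k : ℕ => taylorCoeff S k b * x ^ k)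
      ((dY^[b] S) (x, 0) / b.factorial) := by
  filter_upwards [eventually_hasSum_iteratedDeriv (AnalyticAt.comp_axis (ha.iterate_dY b))] with x hx
  refine (hx.div_const (b.factorial : ℝ)).congr_fun fun k => ?_
  simp only [taylorCoeff, iteratedDeriv_snd hS]
  field_simp

/-- The leading term for real-analytic phases when the bisectrix meets the horizontal ray. -/
theorem exists_ray_coefficient (hS : ContDiff ℝ ∞ S) (ha : AnalyticAt ℝ S 0) {n A : ℕ} (hn : 2 ≤ n)
    (hle : ∀ a b : ℕ, taylorCoeff S a b ≠ 0 → n ≤ b) (hA : A < n) (hAn : taylorCoeff S A n ≠ 0) :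
    ∃ a : ℝ → ℝ, ∃ ρ > 0, (∀ x, |x| < ρ → AnalyticAt ℝ a x) ∧
      (∀ x, |x| < ρ → HasSum (fun k : ℕ => taylorCoeff S k n * x ^ k) (a x)) ∧
      ∀ φ, IsBoxFunction ρ φ →
        Integrable (fun x => slabMeasure n (a x) * φ (x, 0)) ∧
        Tendsto (fun ε : ℝ => sublevelIntegral S φ ε / ε ^ (1 / (n : ℝ))) (𝓝[>] 0)
          (𝓝 (∫ x, slabMeasure n (a x) * φ (x, 0))) := by
  obtain ⟨A₀, hA₀, hlow⟩ := exists_isLowest_of_le_snd hle hA hAn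
  have h1 : ∀ᶠ x in 𝓝 (0 : ℝ), AnalyticAt ℝ (fun x => (dY^[n] S) (x, 0) / (n.factorial : ℝ)) x := by
    have hc : Tendsto (fun x : ℝ => ((x, 0) : ℝ × ℝ)) (𝓝 0) (𝓝 0) :=
      (Continuous.prodMk continuous_id continuous_const).tendsto' _ _ rfl
    filter_upwards [hc.eventually ha.eventually_analyticAt] with x hx
    exact (AnalyticAt.comp_axis (hx.iterate_dY n)).div_const
  -- Analyticity enters here: the functions ∂_y^b S(x, 0) with b < n have zero Taylor series and
  -- therefore vanish near 0; for a merely smooth phase they would only be flat.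
  have h2 : ∀ᶠ x in 𝓝 (0 : ℝ), ∀ b ∈ Finset.range n, (dY^[b] S) (x, 0) = 0 := by
    rw [Finset.eventually_all]
    intro b hb
    filter_upwards [eventually_hasSum_taylorCoeff hS ha b] with x hx
    have h0 : (fun k : ℕ => taylorCoeff S k b * x ^ k) = fun _ => 0 := by
      funext k
      have : taylorCoeff S k b = 0 := by
        by_contra hne
        exact absurd (hle k b hne) (not_le.2 (Finset.mem_range.1 hb))
      rw [this, zero_mul]
    rw [h0] at hx
    have := hx.unique hasSum_zero
    rwa [div_eq_zero_iff, or_iff_left (by positivity)] at this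
  obtain ⟨ρ₀, hρ₀, hev⟩ := Metric.eventually_nhds_iff.1
    (h1.and (h2.and (eventually_hasSum_taylorCoeff hS ha n)))
  simp only [Real.dist_eq, sub_zero] at hev
  obtain ⟨ρ, hρ, h⟩ := tendsto_sublevelIntegral_ray hS hlow hA₀ hn hρ₀
    (fun x hx b hb => (hev hx).2.1 b (Finset.mem_range.2 hb))
  exact ⟨_, min ρ₀ ρ, lt_min hρ₀ hρ, fun x hx => (hev (hx.trans_le (min_le_left _ _))).1,
    fun x hx => (hev (hx.trans_le (min_le_left _ _))).2.2, fun φ hφ => h φ (hφ.mono (min_le_right _ _))⟩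

/-- Lattice points of the ray have second entry n, so the double series reduces to the one over the
row n. -/
theorem hasSum_edgeTerm_horizontalRay {n A : ℕ} (hle : ∀ a b : ℕ, taylorCoeff S a b ≠ 0 → n ≤ b)
    (hAn : taylorCoeff S A n ≠ 0) {x s : ℝ} (h : HasSum (fun k : ℕ => taylorCoeff S k n * x ^ k) s)
    (y : ℝ) : HasSum (edgeTerm S (horizontalRay S) x y) (s * y ^ n) := by
  classical
  have hN : ∀ t ∈ newtonPolygon S, (n : ℝ) ≤ t.2 := fun t ht => by
    have := le_of_mem_newtonPolygon (u := 0) (v := 1) (c := n) le_rfl zero_le_one (fun a b hab => by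
      have : (n : ℝ) ≤ b := by exact_mod_cast hle a b hab
      linarith) ht
    linarith
  have hinj : Function.Injective fun k : ℕ => (k, n) := fun a b hab => (Prod.mk.inj hab).1
  refine (hinj.hasSum_iff fun p hp => ?_).1 ?_
  · refine Set.indicator_of_notMem (fun hmem => hp ⟨p.1, ?_⟩) _
    have h1 := hmem.2 _ (mem_newtonPolygon hAn)
    have h2 := hN _ hmem.1
    have h3 : (p.2 : ℝ) = n := le_antisymm (by simpa using h1) h2
    exact Prod.ext rfl (by exact_mod_cast h3.symm)
  · refine (h.mul_right (y ^ n)).congr_fun fun k => ?_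
    by_cases h0 : taylorCoeff S k n = 0
    · simp [edgeTerm, Set.indicator_apply_eq_zero, h0]
    · have hmem : ((k : ℝ), (n : ℝ)) ∈ horizontalRay S := ⟨mem_newtonPolygon h0, fun t ht => by
        simpa using hN t ht⟩
      simp [edgeTerm, hmem]

theorem hasSum_edgeTerm_verticalRay {n B : ℕ} (hle : ∀ a b : ℕ, taylorCoeff S a b ≠ 0 → n ≤ a)
    (hnB : taylorCoeff S n B ≠ 0) {y s : ℝ} (h : HasSum (fun k : ℕ => taylorCoeff S n k * y ^ k) s)
    (x : ℝ) : HasSum (edgeTerm S (verticalRay S) x y) (s * x ^ n) := by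
  classical
  have hN : ∀ t ∈ newtonPolygon S, (n : ℝ) ≤ t.1 := fun t ht => by
    have := le_of_mem_newtonPolygon (u := 1) (v := 0) (c := n) zero_le_one le_rfl (fun a b hab => by
      have : (n : ℝ) ≤ a := by exact_mod_cast hle a b hab
      linarith) ht
    linarith
  have hinj : Function.Injective fun k : ℕ => (n, k) := fun a b hab => (Prod.mk.inj hab).2
  refine (hinj.hasSum_iff fun p hp => ?_).1 ?_
  · refine Set.indicator_of_notMem (fun hmem => hp ⟨p.2, ?_⟩) _
    have h1 := hmem.2 _ (mem_newtonPolygon hnB)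
    have h2 := hN _ hmem.1
    have h3 : (p.1 : ℝ) = n := le_antisymm (by simpa using h1) h2
    exact Prod.ext (by exact_mod_cast h3.symm) rfl
  · refine (h.mul_right (x ^ n)).congr_fun fun k => ?_
    by_cases h0 : taylorCoeff S n k = 0
    · simp [edgeTerm, Set.indicator_apply_eq_zero, h0]
    · have hmem : ((n : ℝ), (k : ℝ)) ∈ verticalRay S := ⟨mem_newtonPolygon h0, fun t ht => by
        simpa using hN t ht⟩
      simp only [edgeTerm, Function.comp_apply, Set.indicator_apply, Set.mem_ofPred_eq, hmem, if_true]
      ring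

end Analytic

/-! ### The three cases of the theorem -/

section Clauses

variable {S : ℝ × ℝ → ℝ}

/-- One radius serves all edges because only one edge can qualify, by `IsCompactEdge.slope_eq`. In
the other positions of the bisectrix the claim is vacuous and the radius 1 is arbitrary. -/
theorem edge_asymptotics (hS : ContDiff ℝ ∞ S) (hsuper : IsSuperadapted S) (hd : 1 < newtonDist S) :
    ∃ ρ > 0, ∀ (m : ℝ) (e : Set (ℝ × ℝ)), IsCompactEdge S m e → BisectrixMeetsInterior e →
      Integrable (fun y : ℝ => posPow (newtonDist S) (edgeFun S e 1 y)) ∧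
      Integrable (fun y : ℝ => posPow (newtonDist S) (edgeFun S e (-1) y)) ∧
      ∀ φ, IsBoxFunction ρ φ →
        Tendsto (fun ε : ℝ => sublevelIntegral S φ ε / ε ^ (1 / newtonDist S)) (𝓝[>] 0)
          (𝓝 (edgeCoeff S m e φ)) := by
  rcases classification (by linarith : 0 < newtonDist S) with
    ⟨m₀, hm₀, hmin, ⟨A, B, hAB, hB, hline⟩, A', B', hAB', hA', hline'⟩ | ⟨n, hn, hnn, κ, hκ, hmin⟩ |
    ⟨n, hn, hle, A, hA, hAn⟩ | ⟨n, hn, hle, A, hA, hAn⟩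
  · obtain ⟨h1, h2, ρ, hρ, h3⟩ := tendsto_edgeCoeff hS hsuper hd hm₀ hmin hAB hB hline hAB' hA' hline'
    refine ⟨ρ, hρ, fun m e he hb => ?_⟩
    obtain rfl := he.slope_eq hb hm₀ hmin
    rw [he.2.1]
    exact ⟨h1, h2, h3⟩
  · exact ⟨1, one_pos, fun m e he hb =>
      absurd hb (not_bisectrixMeetsInterior_of_vertex hn hκ hmin he)⟩
  · exact ⟨1, one_pos, fun m e he hb => absurd hb (not_bisectrixMeetsInterior_of_le_snd
      (fun a b hab => by rw [← hn]; exact_mod_cast hle a b hab) he)⟩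
  · exact ⟨1, one_pos, fun m e he hb => absurd hb (not_bisectrixMeetsInterior_of_le_fst
      (fun a b hab => by rw [← hn]; exact_mod_cast hle a b hab) he)⟩

theorem vertex_asymptotics (hS : ContDiff ℝ ∞ S) (hsuper : IsSuperadapted S) (hd : 1 < newtonDist S) :
    ∃ ρ > 0, ((newtonDist S, newtonDist S) : ℝ × ℝ) ∈ (newtonPolygon S).extremePoints ℝ →
      ∃ n : ℕ, (n : ℝ) = newtonDist S ∧ taylorCoeff S n n ≠ 0 ∧
        ∀ (s₁ s₂ : EReal) (e₁ e₂ : Set (ℝ × ℝ)),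
          IsEdgeOfSlope S s₁ e₁ → IsEdgeOfSlope S s₂ e₂ → s₂ < s₁ →
          (((n : ℝ), (n : ℝ)) : ℝ × ℝ) ∈ e₁ → (((n : ℝ), (n : ℝ)) : ℝ × ℝ) ∈ e₂ →
          ∀ φ, IsBoxFunction ρ φ →
            Tendsto (fun ε : ℝ => sublevelIntegral S φ ε / (ε ^ (1 / newtonDist S) * Real.log ε))
              (𝓝[>] 0) (𝓝 (vertexCoeff S n s₁ s₂ φ)) := by
  rcases classification (by linarith : 0 < newtonDist S) with
    ⟨m₀, hm₀, hmin, ⟨A, B, hAB, hB, hline⟩, A', B', hAB', hA', hline'⟩ | ⟨n, hn, hnn, κ, hκ, hmin⟩ |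
    ⟨n, hn, hle, A, hA, hAn⟩ | ⟨n, hn, hle, A, hA, hAn⟩
  · exact ⟨1, one_pos, fun h => absurd h (not_extreme_of_edge hm₀ hAB hB hline hAB' hA' hline')⟩
  · obtain ⟨ρ, hρ, h⟩ := tendsto_vertex hS hsuper hd hn hnn hκ hmin
    refine ⟨ρ, hρ, fun _ => ⟨n, hn, hnn, fun s₁ s₂ e₁ e₂ h₁ h₂ hlt hm₁ hm₂ φ hφ => ?_⟩⟩
    obtain ⟨T, T', hT, hT', hTT⟩ := exists_vertexSides hκ hmin h₁ h₂ hlt hm₁ hm₂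
    rw [vertexCoeff, hTT, ← hn]
    convert h φ hφ T T' hT hT' using 2
    ring
  · exact ⟨1, one_pos, fun h => absurd h (not_extreme_of_horizontal hn hA hAn)⟩
  · exact ⟨1, one_pos, fun h => absurd h (not_extreme_of_vertical hn hA hAn)⟩

/-- A point of the polygon at height d strictly to the left of (d, d) violates the supporting lines
of a vertex or of a vertical ray, and for an edge some exponent would be lower than d. -/
theorem exists_of_horizontalRay (hd : 1 < newtonDist S) (hb : BisectrixMeetsInterior (horizontalRay S)) :
    ∃ n : ℕ, (n : ℝ) = newtonDist S ∧ (∀ a b : ℕ, taylorCoeff S a b ≠ 0 → n ≤ b) ∧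
      ∃ A < n, taylorCoeff S A n ≠ 0 := by
  obtain ⟨hle, t, ht, ht1, ht2⟩ := le_snd_of_horizontalRay hb
  rcases classification (by linarith : 0 < newtonDist S) with
    ⟨m₀, hm₀, hmin, ⟨A, B, hAB, hB, -⟩, -⟩ | ⟨n, hn, hnn, κ, hκ, hmin⟩ | h | ⟨n, hn, hle', -⟩
  · exact absurd (hle A B hAB) (not_le.2 hB)
  · exfalso
    have := le_of_mem_newtonPolygon (u := 1) (v := κ) (c := n * (1 + κ)) zero_le_one hκ.le
      (fun a b hab => by
        by_cases h : (a, b) = (n, n)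
        · rw [Prod.mk.injEq] at h; rw [h.1, h.2]; linarith
        · linarith [hmin a b hab h]) ht
    rw [ht2, hn] at this
    linarith
  · exact h
  · exfalso
    have := le_of_mem_newtonPolygon (u := 1) (v := 0) (c := n) zero_le_one le_rfl
      (fun a b hab => by
        have : (n : ℝ) ≤ a := by exact_mod_cast hle' a b hab
        linarith) ht
    linarith

theorem exists_of_verticalRay (hd : 1 < newtonDist S) (hb : BisectrixMeetsInterior (verticalRay S)) :
    ∃ n : ℕ, (n : ℝ) = newtonDist S ∧ (∀ a b : ℕ, taylorCoeff S a b ≠ 0 → n ≤ a) ∧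
      ∃ B < n, taylorCoeff S n B ≠ 0 := by
  obtain ⟨hle, t, ht, ht1, ht2⟩ := le_fst_of_verticalRay hb
  rcases classification (by linarith : 0 < newtonDist S) with
    ⟨m₀, hm₀, hmin, -, A, B, hAB, hA, -⟩ | ⟨n, hn, hnn, κ, hκ, hmin⟩ | ⟨n, hn, hle', -⟩ | h
  · exact absurd (hle A B hAB) (not_le.2 hA)
  · exfalso
    have := le_of_mem_newtonPolygon (u := 1) (v := κ) (c := n * (1 + κ)) zero_le_one hκ.le
      (fun a b hab => by
        by_cases h : (a, b) = (n, n)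
        · rw [Prod.mk.injEq] at h; rw [h.1, h.2]; linarith
        · linarith [hmin a b hab h]) ht
    rw [ht2, hn] at this
    nlinarith
  · exfalso
    have := le_of_mem_newtonPolygon (u := 0) (v := 1) (c := n) le_rfl zero_le_one
      (fun a b hab => by
        have : (n : ℝ) ≤ b := by exact_mod_cast hle' a b hab
        linarith) ht
    linarith
  · exact h

theorem horizontalRay_asymptotics (hS : ContDiff ℝ ∞ S) (hd : 1 < newtonDist S) :
    ∃ ρ > 0, AnalyticAt ℝ S 0 → BisectrixMeetsInterior (horizontalRay S) →
      ∃ n : ℕ, (n : ℝ) = newtonDist S ∧ ∃ a : ℝ → ℝ, (∀ x, |x| < ρ → AnalyticAt ℝ a x) ∧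
        (∀ x, |x| < ρ → ∀ y : ℝ, HasSum (edgeTerm S (horizontalRay S) x y) (a x * y ^ n)) ∧
        ∀ φ, IsBoxFunction ρ φ →
          Integrable (fun x : ℝ => slabMeasure n (a x) * φ (x, 0)) ∧
          Tendsto (fun ε : ℝ => sublevelIntegral S φ ε / ε ^ (1 / newtonDist S)) (𝓝[>] 0)
            (𝓝 (∫ x : ℝ, slabMeasure n (a x) * φ (x, 0))) := by
  by_cases h : AnalyticAt ℝ S 0 ∧ BisectrixMeetsInterior (horizontalRay S)
  · obtain ⟨n, hn, hle, A, hA, hAn⟩ := exists_of_horizontalRay hd h.2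
    rw [← hn] at hd ⊢
    obtain ⟨a, ρ, hρ, h1, h2, h3⟩ := exists_ray_coefficient hS h.1 (by exact_mod_cast hd) hle hA hAn
    exact ⟨ρ, hρ, fun _ _ => ⟨n, rfl, a, h1,
      fun x hx y => hasSum_edgeTerm_horizontalRay hle hAn (h2 x hx) y, h3⟩⟩
  · exact ⟨1, one_pos, fun h1 h2 => absurd ⟨h1, h2⟩ h⟩

theorem verticalRay_asymptotics (hS : ContDiff ℝ ∞ S) (hd : 1 < newtonDist S) :
    ∃ ρ > 0, AnalyticAt ℝ S 0 → BisectrixMeetsInterior (verticalRay S) →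
      ∃ n : ℕ, (n : ℝ) = newtonDist S ∧ ∃ a : ℝ → ℝ, (∀ y, |y| < ρ → AnalyticAt ℝ a y) ∧
        (∀ y, |y| < ρ → ∀ x : ℝ, HasSum (edgeTerm S (verticalRay S) x y) (a y * x ^ n)) ∧
        ∀ φ, IsBoxFunction ρ φ →
          Integrable (fun y : ℝ => slabMeasure n (a y) * φ (0, y)) ∧
          Tendsto (fun ε : ℝ => sublevelIntegral S φ ε / ε ^ (1 / newtonDist S)) (𝓝[>] 0)
            (𝓝 (∫ y : ℝ, slabMeasure n (a y) * φ (0, y))) := by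
  by_cases h : AnalyticAt ℝ S 0 ∧ BisectrixMeetsInterior (verticalRay S)
  · obtain ⟨n, hn, hle, B, hB, hnB⟩ := exists_of_verticalRay hd h.2
    rw [← hn] at hd ⊢
    have hsw := taylorCoeff_comp_swap hS
    have ha : AnalyticAt ℝ (S ∘ Prod.swap) 0 :=
      h.1.comp (f := Prod.swap) (x := (0 : ℝ × ℝ)) (analyticAt_snd.prod analyticAt_fst)
    obtain ⟨a, ρ, hρ, h1, h2, h3⟩ := exists_ray_coefficient (contDiff_comp_swap hS) ha
      (by exact_mod_cast hd) (fun a b hab => hle b a (by rwa [hsw] at hab)) hB (by rwa [hsw])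
    simp only [hsw] at h2
    refine ⟨ρ, hρ, fun _ _ => ⟨n, rfl, a, h1,
      fun y hy x => hasSum_edgeTerm_verticalRay hle hnB (h2 y hy) x, fun φ hφ => ?_⟩⟩
    have h4 := h3 _ hφ.comp_swap
    simp only [sublevelIntegral_comp_swap] at h4
    exact h4
  · exact ⟨1, one_pos, fun h1 h2 => absurd ⟨h1, h2⟩ h⟩

end Clauses

theorem theorem1p1 (S : ℝ × ℝ → ℝ) (V : Set (ℝ × ℝ)) (hV : V ∈ 𝓝 (0 : ℝ × ℝ))
    (hS : ContDiffOn ℝ ∞ S V) (hsuper : IsSuperadapted S) (hd : 1 < newtonDist S) :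
    -- the leading exponent is `1 / d`
    HasLeadingExponent S (1 / newtonDist S) ∧
    (∀ W r c c' C C', IsSublevelExpansion S W r c c' C C' → r 0 = 1 / newtonDist S) ∧
    ∃ U : Set (ℝ × ℝ), IsOpen U ∧ (0 : ℝ × ℝ) ∈ U ∧
      -- (a) the bisectrix meets the interior of a compact edge
      (∀ (m : ℝ) (e : Set (ℝ × ℝ)), IsCompactEdge S m e → BisectrixMeetsInterior e →
        Integrable (fun y : ℝ => posPow (newtonDist S) (edgeFun S e 1 y)) ∧
        Integrable (fun y : ℝ => posPow (newtonDist S) (edgeFun S e (-1) y)) ∧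
        ∀ φ, IsTestFunction U φ →
          Tendsto (fun ε : ℝ => sublevelIntegral S φ ε / ε ^ (1 / newtonDist S)) (𝓝[>] 0)
            (𝓝 (edgeCoeff S m e φ)) ∧
          ∀ W r c c' C C', IsSublevelExpansion S W r c c' C C' → IsTestFunction W φ →
            c' φ 0 = 0 ∧ c φ 0 = edgeCoeff S m e φ) ∧
      -- (b) the bisectrix meets the Newton polygon at a vertex
      (((newtonDist S, newtonDist S) : ℝ × ℝ) ∈ (newtonPolygon S).extremePoints ℝ →
        ∃ n : ℕ, (n : ℝ) = newtonDist S ∧ taylorCoeff S n n ≠ 0 ∧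
          ∀ (s₁ s₂ : EReal) (e₁ e₂ : Set (ℝ × ℝ)),
            IsEdgeOfSlope S s₁ e₁ → IsEdgeOfSlope S s₂ e₂ → s₂ < s₁ →
            (((n : ℝ), (n : ℝ)) : ℝ × ℝ) ∈ e₁ → (((n : ℝ), (n : ℝ)) : ℝ × ℝ) ∈ e₂ →
            ∀ φ, IsTestFunction U φ →
              Tendsto (fun ε : ℝ => sublevelIntegral S φ ε /
                  (ε ^ (1 / newtonDist S) * Real.log ε)) (𝓝[>] 0)
                (𝓝 (vertexCoeff S n s₁ s₂ φ)) ∧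
              ∀ W r c c' C C', IsSublevelExpansion S W r c c' C C' → IsTestFunction W φ →
                c' φ 0 = vertexCoeff S n s₁ s₂ φ) ∧
      -- (c) real-analytic phase, the bisectrix meets the interior of the horizontal ray
      (AnalyticAt ℝ S 0 → BisectrixMeetsInterior (horizontalRay S) →
        ∃ n : ℕ, (n : ℝ) = newtonDist S ∧ ∃ a : ℝ → ℝ, AnalyticOnNhd ℝ a (Prod.fst '' U) ∧
          (∀ x ∈ Prod.fst '' U, ∀ y : ℝ,
            HasSum (edgeTerm S (horizontalRay S) x y) (a x * y ^ n)) ∧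
          (Odd n → ∀ x, a x ≠ 0 → slabMeasure n (a x) = |a x| ^ (-1 / (n : ℝ))) ∧
          ∀ φ, IsTestFunction U φ →
            Integrable (fun x : ℝ => slabMeasure n (a x) * φ (x, 0)) ∧
            Tendsto (fun ε : ℝ => sublevelIntegral S φ ε / ε ^ (1 / newtonDist S)) (𝓝[>] 0)
              (𝓝 (∫ x : ℝ, slabMeasure n (a x) * φ (x, 0))) ∧
            ∀ W r c c' C C', IsSublevelExpansion S W r c c' C C' → IsTestFunction W φ →
              c' φ 0 = 0 ∧ c φ 0 = ∫ x : ℝ, slabMeasure n (a x) * φ (x, 0)) ∧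
      -- (c) real-analytic phase, the bisectrix meets the interior of the vertical ray
      (AnalyticAt ℝ S 0 → BisectrixMeetsInterior (verticalRay S) →
        ∃ n : ℕ, (n : ℝ) = newtonDist S ∧ ∃ a : ℝ → ℝ, AnalyticOnNhd ℝ a (Prod.snd '' U) ∧
          (∀ y ∈ Prod.snd '' U, ∀ x : ℝ,
            HasSum (edgeTerm S (verticalRay S) x y) (a y * x ^ n)) ∧
          (Odd n → ∀ y, a y ≠ 0 → slabMeasure n (a y) = |a y| ^ (-1 / (n : ℝ))) ∧
          ∀ φ, IsTestFunction U φ →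
            Integrable (fun y : ℝ => slabMeasure n (a y) * φ (0, y)) ∧
            Tendsto (fun ε : ℝ => sublevelIntegral S φ ε / ε ^ (1 / newtonDist S)) (𝓝[>] 0)
              (𝓝 (∫ y : ℝ, slabMeasure n (a y) * φ (0, y))) ∧
            ∀ W r c c' C C', IsSublevelExpansion S W r c c' C C' → IsTestFunction W φ →
              c' φ 0 = 0 ∧ c φ 0 = ∫ y : ℝ, slabMeasure n (a y) * φ (0, y)) := by
  -- Reduction to a globally smooth phase `T` equal to `S` on a box: Taylor coefficients agree, and
  -- so do the integrals of test functions supported in that box.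
  obtain ⟨T, hT, ρ₀, hρ₀, hST⟩ := exists_contDiff_eqOn hV hS
  have hc := taylorCoeff_eq_of_eqOn_box hρ₀ hST
  rw [isSuperadapted_congr hc] at hsuper
  have hdc := newtonDist_congr hc
  rw [hdc] at hd
  have hlead : HasLeadingExponent S (1 / newtonDist T) :=
    hasLeadingExponent_congr hρ₀ hST (hasLeadingExponent hT hsuper hd)
  obtain ⟨ρ₁, hρ₁, hedge⟩ := edge_asymptotics hT hsuper hd
  obtain ⟨ρ₂, hρ₂, hvertex⟩ := vertex_asymptotics hT hsuper hd
  obtain ⟨ρ₃, hρ₃, hhor⟩ := horizontalRay_asymptotics hT hd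
  obtain ⟨ρ₄, hρ₄, hver⟩ := verticalRay_asymptotics hT hd
  -- The limits are taken with the power 1 / d; knowing r 0 = 1 / d lets them determine the leading
  -- coefficients of any expansion.
  have hexp : ∀ W r c c' C C', IsSublevelExpansion S W r c c' C C' → r 0 = 1 / newtonDist T :=
    fun _ _ _ _ _ _ h => hlead.eq_of_isSublevelExpansion h
  have hcoeff : ∀ (φ : ℝ × ℝ → ℝ) (L : ℝ),
      Tendsto (fun ε : ℝ => sublevelIntegral S φ ε / ε ^ (1 / newtonDist T)) (𝓝[>] 0) (𝓝 L) →
      ∀ W r c c' C C', IsSublevelExpansion S W r c c' C C' → IsTestFunction W φ →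
        c' φ 0 = 0 ∧ c φ 0 = L := fun φ L hL _ _ _ _ _ _ h hφ =>
    (h.expansion φ hφ).1.coeff_eq (by rwa [hexp _ _ _ _ _ _ h])
  have han : AnalyticAt ℝ S 0 → AnalyticAt ℝ T 0 := fun h => h.congr (by
    filter_upwards [(isOpen_box ρ₀).mem_nhds (zero_mem_box hρ₀)] with p hp
    exact hST p hp)
  set ρ := min ρ₀ (min (min ρ₁ ρ₂) (min ρ₃ ρ₄)) with hρ
  have hle₀ : ρ ≤ ρ₀ := min_le_left _ _
  have hle₁ : ρ ≤ ρ₁ := (min_le_right _ _).trans ((min_le_left _ _).trans (min_le_left _ _))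
  have hle₂ : ρ ≤ ρ₂ := (min_le_right _ _).trans ((min_le_left _ _).trans (min_le_right _ _))
  have hle₃ : ρ ≤ ρ₃ := (min_le_right _ _).trans ((min_le_right _ _).trans (min_le_left _ _))
  have hle₄ : ρ ≤ ρ₄ := (min_le_right _ _).trans ((min_le_right _ _).trans (min_le_right _ _))
  have hI : ∀ φ, IsTestFunction (box ρ) φ → sublevelIntegral S φ = sublevelIntegral T φ :=
    fun φ hφ => sublevelIntegral_congr hST (hφ.isBoxFunction.mono hle₀)
  simp only [hdc, isCompactEdge_congr hc, edgeFun_congr hc, edgeCoeff_congr hc, vertexCoeff_congr hc,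
    newtonPolygon_congr hc, isEdgeOfSlope_congr hc, horizontalRay_congr hc, verticalRay_congr hc,
    edgeTerm_congr hc, hc]
  refine ⟨hlead, hexp, box ρ, isOpen_box ρ, zero_mem_box (by positivity), fun m e he hb => ?_,
    fun hext => ?_, fun hS0 hb => ?_, fun hS0 hb => ?_⟩
  · obtain ⟨h1, h2, h3⟩ := hedge m e he hb
    refine ⟨h1, h2, fun φ hφ => ?_⟩
    have h4 := h3 φ (hφ.isBoxFunction.mono hle₁)
    rw [← hI φ hφ] at h4
    exact ⟨h4, hcoeff φ _ h4⟩
  · obtain ⟨n, hn, hnn, h⟩ := hvertex hext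
    refine ⟨n, hn, hnn, fun s₁ s₂ e₁ e₂ h₁ h₂ hlt hm₁ hm₂ φ hφ => ?_⟩
    have h4 := h s₁ s₂ e₁ e₂ h₁ h₂ hlt hm₁ hm₂ φ (hφ.isBoxFunction.mono hle₂)
    rw [← hI φ hφ] at h4
    refine ⟨h4, fun W r c c' C C' hW hφW => (hW.expansion φ hφW).1.log_coeff_eq ?_⟩
    rwa [hexp _ _ _ _ _ _ hW]
  · obtain ⟨n, hn, a, h1, h2, h3⟩ := hhor (han hS0) hb
    refine ⟨n, hn, a, ?_, ?_, fun hodd x hx => slabMeasure_of_odd hodd hx, fun φ hφ => ?_⟩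
    · rintro _ ⟨p, hp, rfl⟩
      exact h1 _ (hp.1.trans_le hle₃)
    · rintro _ ⟨p, hp, rfl⟩
      exact h2 _ (hp.1.trans_le hle₃)
    · obtain ⟨h4, h5⟩ := h3 φ (hφ.isBoxFunction.mono hle₃)
      rw [← hI φ hφ] at h5
      exact ⟨h4, h5, hcoeff φ _ h5⟩
  · obtain ⟨n, hn, a, h1, h2, h3⟩ := hver (han hS0) hb
    refine ⟨n, hn, a, ?_, ?_, fun hodd x hx => slabMeasure_of_odd hodd hx, fun φ hφ => ?_⟩
    · rintro _ ⟨p, hp, rfl⟩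
      exact h1 _ (hp.2.trans_le hle₄)
    · rintro _ ⟨p, hp, rfl⟩
      exact h2 _ (hp.2.trans_le hle₄)
    · obtain ⟨h4, h5⟩ := h3 φ (hφ.isBoxFunction.mono hle₄)
      rw [← hI φ hφ] at h5
      exact ⟨h4, h5, hcoeff φ _ h5⟩
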